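/- There are a randomized preprocessing algorithm and a query algorithm, both in the combinatorial machine model described below, that solve the following problem. Let $G=(V,E)$ be an undirected simple graph with $V=\{0,\dots,n-1\}$, $m=|E|\ge 1$ edges and arbitrary non-negative real edge weights, given as a list of its weighted edges in arbitrary order. Let $d(u,v)\in[0,\infty]$ denote the weighted shortest-path distance ($\infty$ if $u$ and $v$ are not connected). Then the following holds. (a) Correctness, for all outcomes of the random choices: whenever the preprocessing halts, the memory content that it leaves is a $2$-approximate distance oracle with constant query time, i.e. for all $u,v\in V$ the query algorithm, run on this memory with input $(u,v)$, halts after at most $T$ steps, leaves the memory unchanged and returns a value $\delta(u,v)$ with $$d(u,v)\le\delta(u,v)\le 2\,d(u,v).$$ Here $T$ is an absolute constant. (b) Preprocessing time and space are $\tilde O(mn^{2/3})$ with high probability: there is an absolute constant $k$ such that for every $c\in\mathbb N$ there is a constant $K$, depending only on $c$, such that with probability at least $1-n^{-c}$ the preprocessing halts after at most $K\,m\,n^{2/3}\log^k n$ steps, and the preprocessing and all subsequent queries together use at most $K\,m\,n^{2/3}\log^k n$ memory cells (memory being counted up to the largest address that is accessed, input included). Machine model: a randomized word RAM, with programs independent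 of the input and of the word length. It has words of $w$ bits for any $w$ with $2^w\ge n^{\kappa}$, where $\kappa$ is an absolute constant, with unit-cost $+,-,\times$ modulo $2^w$, integer division and remainder, comparisons, indirect addressing and uniformly random words; the bounds do not depend on $w$. Edge weights and distance values are kept in separate cells and can only be copied, added and compared, at unit cost; the constants $0$ and $\infty$ are available. -/

import Mathlib

open scoped NNReal ENNReal
open MeasureTheory

namespace DistOracle

/-! ### Weighted graphs and distances -/

/-- An undirected graph on the vertices `0, …, n - 1` with non-negative real edge weights
(the values of `weight` off the edge set are irrelevant). -/
structure WeightedGraph (n : ℕ) where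
  graph : SimpleGraph (Fin n)
  weight : Sym2 (Fin n) → ℝ≥0

namespace WeightedGraph

variable {n : ℕ}

/-- The number `m = |E|` of edges. -/
noncomputable def numEdges (G : WeightedGraph n) : ℕ := G.graph.edgeSet.ncard

/-- The length of a walk: the sum of the weights of its edges. -/
noncomputable def walkLength (G : WeightedGraph n) {u v : Fin n} (p : G.graph.Walk u v) : ℝ≥0 :=
  (p.edges.map G.weight).sum

/-- The distance between two vertices; it is `∞` if they lie in different components. -/
noncomputable def dist (G : WeightedGraph n) (u v : Fin n) : ℝ≥0∞ :=
  ⨅ p : G.graph.Walk u v, (G.walkLength p : ℝ≥0∞)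

/-- `L` lists every edge of `G` exactly once, in some order and in one of its two orientations. -/
def IsEdgeList (G : WeightedGraph n) (L : List (Fin n × Fin n)) : Prop :=
  (L.map fun e => s(e.1, e.2)).Nodup ∧ ∀ e, e ∈ L.map (fun e => s(e.1, e.2)) ↔ e ∈ G.graph.edgeSet

end WeightedGraph

/-! ### The machine

A randomized word RAM with `w`-bit words. Numbers come in two sorts: words (used for vertices,
counters and addresses), with arithmetic modulo `2 ^ w`, and weights, which can only be
copied, added and compared. Each sort has its own registers and its own addressable memory.
A program is a finite piece of code that does not depend on the input or on the word size. -/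

/-- Arithmetic expressions in word registers. -/
inductive WordExpr where
  | const (a : ℕ)
  | reg (x : ℕ)
  | add (a b : WordExpr)
  | sub (a b : WordExpr)
  | mul (a b : WordExpr)
  | div (a b : WordExpr)
  | mod (a b : WordExpr)

/-- Expressions in weight registers. -/
inductive WeightExpr where
  | zero
  | infty
  | reg (x : ℕ)
  | add (a b : WeightExpr)

/-- Tests. -/
inductive Test where
  | wordLT (a b : WordExpr)
  | weightLT (a b : WeightExpr)
  | neg (b : Test)
  | conj (b c : Test)

/-- Programs. -/
inductive Program where
  | skip
  | setWord (x : ℕ) (e : WordExpr)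
  | loadWord (x : ℕ) (addr : WordExpr)
  | storeWord (addr e : WordExpr)
  | setWeight (x : ℕ) (e : WeightExpr)
  | loadWeight (x : ℕ) (addr : WordExpr)
  | storeWeight (addr : WordExpr) (e : WeightExpr)
  | random (x : ℕ)
  | seq (p q : Program)
  | ite (b : Test) (p q : Program)
  | loop (b : Test) (p : Program)

/-- A configuration. `memTop` and `weightMemTop` are one more than the largest address of
the word memory and of the weight memory that is in use or has been accessed so far, and
`tapePos` is the number of random words drawn so far. -/
structure Config where
  reg : ℕ → ℕ
  weightReg : ℕ → ℝ≥0∞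
  mem : ℕ → ℕ
  weightMem : ℕ → ℝ≥0∞
  memTop : ℕ
  weightMemTop : ℕ
  tapePos : ℕ

/-- The space used so far, in cells: memory is paid for up to the largest address accessed. -/
def Config.space (s : Config) : ℕ := s.memTop + s.weightMemTop

/-- The value of a word expression, for `w`-bit words; subtraction wraps around. -/
def WordExpr.eval (w : ℕ) (s : Config) : WordExpr → ℕ
  | const a => a % 2 ^ w
  | reg x => s.reg x
  | add a b => (a.eval w s + b.eval w s) % 2 ^ w
  | sub a b => (a.eval w s + 2 ^ w - b.eval w s) % 2 ^ w
  | mul a b => (a.eval w s * b.eval w s) % 2 ^ w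
  | div a b => a.eval w s / b.eval w s
  | mod a b => a.eval w s % b.eval w s

/-- The value of a weight expression. -/
noncomputable def WeightExpr.eval (s : Config) : WeightExpr → ℝ≥0∞
  | zero => 0
  | infty => ⊤
  | reg x => s.weightReg x
  | add a b => a.eval s + b.eval s

/-- The truth value of a test. -/
def Test.Holds (w : ℕ) (s : Config) : Test → Prop
  | wordLT a b => a.eval w s < b.eval w s
  | weightLT a b => a.eval s < b.eval s
  | neg b => ¬ b.Holds w s
  | conj b c => b.Holds w s ∧ c.Holds w s

/-- `Exec w ω p s t s'`: with `w`-bit words and the sequence `ω` of random words, the program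
`p` started in `s` halts in `s'` after `t` steps. Every elementary instruction and every
evaluated test is one step: the expressions in a program have constant size. -/
inductive Exec (w : ℕ) (ω : ℕ → Fin (2 ^ w)) : Program → Config → ℕ → Config → Prop
  | skip (s : Config) : Exec w ω .skip s 1 s
  | setWord (s : Config) (x : ℕ) (e : WordExpr) :
      Exec w ω (.setWord x e) s 1 { s with reg := Function.update s.reg x (e.eval w s) }
  | loadWord (s : Config) (x : ℕ) (a : WordExpr) :
      Exec w ω (.loadWord x a) s 1
        { s with
          reg := Function.update s.reg x (s.mem (a.eval w s))
          memTop := max s.memTop (a.eval w s + 1) }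
  | storeWord (s : Config) (a e : WordExpr) :
      Exec w ω (.storeWord a e) s 1
        { s with
          mem := Function.update s.mem (a.eval w s) (e.eval w s)
          memTop := max s.memTop (a.eval w s + 1) }
  | setWeight (s : Config) (x : ℕ) (e : WeightExpr) :
      Exec w ω (.setWeight x e) s 1
        { s with weightReg := Function.update s.weightReg x (e.eval s) }
  | loadWeight (s : Config) (x : ℕ) (a : WordExpr) :
      Exec w ω (.loadWeight x a) s 1
        { s with
          weightReg := Function.update s.weightReg x (s.weightMem (a.eval w s))
          weightMemTop := max s.weightMemTop (a.eval w s + 1) }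
  | storeWeight (s : Config) (a : WordExpr) (e : WeightExpr) :
      Exec w ω (.storeWeight a e) s 1
        { s with
          weightMem := Function.update s.weightMem (a.eval w s) (e.eval s)
          weightMemTop := max s.weightMemTop (a.eval w s + 1) }
  | random (s : Config) (x : ℕ) :
      Exec w ω (.random x) s 1
        { s with
          reg := Function.update s.reg x (ω s.tapePos)
          tapePos := s.tapePos + 1 }
  | seq {p q : Program} {s s' s'' : Config} {t t' : ℕ}
      (hp : Exec w ω p s t s') (hq : Exec w ω q s' t' s'') :
      Exec w ω (.seq p q) s (t + t') s''
  | iteTrue {b : Test} {p q : Program} {s s' : Config} {t : ℕ}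
      (hb : b.Holds w s) (hp : Exec w ω p s t s') : Exec w ω (.ite b p q) s (t + 1) s'
  | iteFalse {b : Test} {p q : Program} {s s' : Config} {t : ℕ}
      (hb : ¬ b.Holds w s) (hq : Exec w ω q s t s') : Exec w ω (.ite b p q) s (t + 1) s'
  | loopDone {b : Test} {p : Program} {s : Config}
      (hb : ¬ b.Holds w s) : Exec w ω (.loop b p) s 1 s
  | loopStep {b : Test} {p : Program} {s s' s'' : Config} {t t' : ℕ}
      (hb : b.Holds w s) (hp : Exec w ω p s t s') (hl : Exec w ω (.loop b p) s' t' s'') :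
      Exec w ω (.loop b p) s (t + t' + 1) s''

/-- The law of a sequence of independent, uniformly random `w`-bit words. -/
noncomputable def tapeMeasure (w : ℕ) : Measure (ℕ → Fin (2 ^ w)) :=
  Measure.infinitePi fun _ => (PMF.uniformOfFintype (Fin (2 ^ w))).toMeasure

/-! ### Distance oracles -/

/-- The initial configuration of the preprocessing: `n` and `m` are in the word registers `0`
and `1`, the endpoints of the `i`-th edge are in the cells `2 i` and `2 i + 1` of the word
memory, its weight is in the cell `i` of the weight memory, and everything else is `0`. -/
noncomputable def inputConfig {n : ℕ} (G : WeightedGraph n) (L : List (Fin n × Fin n)) :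
    Config where
  reg x := if x = 0 then n else if x = 1 then L.length else 0
  weightReg _ := 0
  mem a := match L[a / 2]? with
    | some e => if a % 2 = 0 then e.1 else e.2
    | none => 0
  weightMem a := match L[a]? with
    | some e => (G.weight s(e.1, e.2) : ℝ≥0∞)
    | none => 0
  memTop := 2 * L.length
  weightMemTop := L.length
  tapePos := 0

/-- The initial configuration of a query: the memory is the one that the preprocessing left,
the word registers `0` and `1` hold the two vertices, all other registers hold `0`. -/
noncomputable def queryConfig {n : ℕ} (s : Config) (u v : Fin n) : Config where
  reg x := if x = 0 then u else if x = 1 then v else 0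
  weightReg _ := 0
  mem := s.mem
  weightMem := s.weightMem
  memTop := s.memTop
  weightMemTop := s.weightMemTop
  tapePos := 0

/-- On the memory of `s`, the program `query` answers all distance queries of `G` with
approximation factor `2`, in at most `T` steps each and without changing the memory. The
answer is read off from the weight register `0`. -/
def AnswersQueries {n : ℕ} (w : ℕ) (query : Program) (T : ℕ) (G : WeightedGraph n)
    (s : Config) : Prop :=
  ∀ (u v : Fin n) (ω : ℕ → Fin (2 ^ w)), ∃ (t : ℕ) (s' : Config),
    Exec w ω query (queryConfig s u v) t s' ∧ t ≤ T ∧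
    s'.mem = s.mem ∧ s'.weightMem = s.weightMem ∧
    G.dist u v ≤ s'.weightReg 0 ∧ s'.weightReg 0 ≤ 2 * G.dist u v

/-- The preprocessing that ended in `s`, and every query on the memory of `s`, uses at most
`B` cells of memory. -/
def SpaceAtMost (n w : ℕ) (query : Program) (s : Config) (B : ℝ) : Prop :=
  (s.space : ℝ) ≤ B ∧
  ∀ (u v : Fin n) (ω : ℕ → Fin (2 ^ w)) (t : ℕ) (s' : Config),
    Exec w ω query (queryConfig s u v) t s' → (s'.space : ℝ) ≤ B

end DistOracle

set_option linter.constructorNameAsVariable false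
set_option linter.unusedVariables false

/-! The oracle works with centers and clusters. For a set of centers let `r u` be the distance of
`u` from the nearest one, and let the cluster of `w` consist of all `u` with `d(w, u) < r u`.
Suppose that a list of at most `2 * q` vertices covers each cluster, where `q` is about `n ^ (1/3)`,
and that there are about `q ^ 2` centers, up to logarithms. Stored are the distances from all
centers and, for every edge `xy`, every `u` listed for `x` and every `v` listed for `y`, the value
`d(u, x) + weight + d(y, v)` under the key `(u, v)`. Up to logarithms this takes `m * q ^ 2` cells.

A query takes the minimum of the detour through the nearest center of `u`, the detour through that
of `v`, and the dictionary value. By the triangle inequality no candidate is below the distance.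
Conversely, consider a walk of length `l` from `u` to `v`. If `2 * r u ≤ l`, the detour through the
center of `u` costs at most `2 * r u + l ≤ 2 * l`, and likewise for `v`. Otherwise the walk has an
edge `xy` in its middle (`Setup.Path.split`), with `d(u, x) ≤ l / 2 < r u` and `d(y, v) ≤ l / 2 < r
v`; so `u` and `v` lie in the clusters of `x` and `y`, and the dictionary has a value at most `l`.
This is `Oracle.of_clusters` and `wp_queryNet`.

The construction draws no random words. Centers are chosen in `lam` rounds. In a round, `W` is the
set of vertices whose clusters are still too large, and `k = q * |W| / V + 1`. A Dijkstra search
finds the `k` nearest elements of `W` for every vertex (`wp_knn`), and a greedy hitting set of these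
lists is added to the centers (`wp_chooseCenters`). Then a vertex lies in at most `k - 1` clusters
of elements of `W`, these clusters have total size at most `q * |W|`, and at most half of them have
more than `2 * q` elements (`wp_clusterRound`). After `lam` rounds none is left
(`wp_buildClusters`).

The dictionary is deterministic two-level hashing by displacements: the key `(u, v)` goes to the
bucket `u + disp v`, and the bucket is displaced once more in the table. A displacement with at most
the average number of collisions is found bit by bit, by the method of conditional expectations
(`wp_chooseDisp`). The first level leaves few collisions in total (`wp_placeKeys`); this makes the
average on the second level smaller than one, hence zero, if large buckets are placed first
(`Buckets.place_free`).

Since the bounds are in terms of `m`, which may be far below `n`, no array indexed by all vertices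
is affordable. The endpoints of the edges are renumbered through a tree of depth two with fan-out
about `√n` (`wp_compress`); vertices without edges keep the number `0`.

All this is written in a small language with named arrays and counting loops, in which effect, cost
and safety are functions of the state. Weakest preconditions are derived for each piece, and
`Stmt.sim` transfers them to the machine. `preprocessing_spec` assembles the result for every
sequence of random words, so that the probability of failure is zero. -/

namespace DistOracle

/-! ### A structured language on top of the machine

Programs of this language use named registers and named, unbounded arrays, and all their loops
are counting loops, so that they have a denotational semantics. -/

/-- The instances of the counting sort: half-edges by source, candidate pairs by first vertex,
keys by second vertex, keys by bucket; `fin` names the final positions of the keys. -/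
inductive Grp | adj | dup | col | bkt | fin
  deriving DecidableEq

/-- Word registers. -/
inductive Reg
  | a0 | a1 | sq | V | q | cap | pw | lam
  | i | j | x | y | z | acc | blk | h
  | cx | ci | dj | pv | pl | top
  | kk | it | kv | kl | kc | kj | ky | found | ko | kd | kh | kp | ku | kx
  | k | nW | rd | u | w | c | gt | bs | best | gu | gc | gs | gj | gw | gy | ac
  | t | T | d | o | v | cy
  | pg | pa | pbit | pb | pd | po | pj | ps | px | s0 | s1 | th
  | iu | iv | qp | gN | gL
  deriving DecidableEq

/-- Weight registers. -/
inductive WReg | res | wa | wb | key | we | pk | d1 | d2 | rr | rho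
  deriving DecidableEq

/-- Word arrays. -/
inductive Arr
  | inp | root | leaf
  | key (g : Grp) | deg (g : Grp) | off (g : Grp) | slot (g : Grp) | fill (g : Grp)
  | qv | ql | ll (b : Bool) | lc (b : Bool)
  | inW | score | sat | pc | cn | clu | tv | stamp | pos | ku
  | cnt (g : Grp) | disp (g : Grp) | tab | par
  deriving DecidableEq

/-- Weight arrays. -/
inductive WArr
  | inp | tree | ld (b : Bool) | r | dA | cld | tw | kw
  deriving DecidableEq

def Reg.code (x : Reg) : ℕ := x.ctorIdx
def WReg.code (x : WReg) : ℕ := x.ctorIdx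

/-- A parametrized constructor has at most five instances, so `5 * ctorIdx + sub` separates all
arrays. The code of `inp` is `0`; the transfer of the input into arrays relies on this. -/
def Arr.sub : Arr → ℕ
  | key g | deg g | off g | slot g | fill g | cnt g | disp g => g.ctorIdx
  | ll b | lc b => b.toNat
  | _ => 0

def Arr.code (a : Arr) : ℕ := 5 * a.ctorIdx + a.sub

def WArr.code : WArr → ℕ
  | inp => 0 | tree => 1 | ld false => 2 | ld true => 3 | r => 4 | dA => 5 | cld => 6 | tw => 7
  | kw => 8

/-- The number of array codes. -/
def numArr : ℕ := 200

theorem Reg.code_injective : Function.Injective Reg.code := fun x y h => by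
  rw [← Reg.ofNat_ctorIdx x, ← Reg.ofNat_ctorIdx y]; exact congrArg _ h

theorem WReg.code_injective : Function.Injective WReg.code := fun x y h => by
  rw [← WReg.ofNat_ctorIdx x, ← WReg.ofNat_ctorIdx y]; exact congrArg _ h

theorem Grp.ctorIdx_injective : Function.Injective Grp.ctorIdx := fun x y h => by
  rw [← Grp.ofNat_ctorIdx x, ← Grp.ofNat_ctorIdx y]; exact congrArg _ h

theorem Arr.sub_lt (a : Arr) : a.sub < 5 := by
  cases a <;> simp only [Arr.sub] <;> first | omega | (rename_i g; cases g <;> decide)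

theorem Arr.code_injective : Function.Injective Arr.code := fun x y h => by
  have hx := x.sub_lt
  have hy := y.sub_lt
  unfold Arr.code at h
  have h1 : x.ctorIdx = y.ctorIdx := by omega
  have h2 : x.sub = y.sub := by omega
  cases x <;> cases y <;> first
    | rfl
    | (exact absurd h1 (by simp only [Arr.ctorIdx]; decide))
    | (simp only [Arr.sub] at h2; rw [Grp.ctorIdx_injective h2])
    | (simp only [Arr.sub] at h2; rename_i b b'; cases b <;> cases b' <;> first | rfl | exact absurd h2 (by decide))

theorem Arr.code_lt (a : Arr) : a.code < numArr := by
  have h := a.sub_lt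
  have : a.ctorIdx < 38 := by cases a <;> (simp only [Arr.ctorIdx]; decide)
  unfold Arr.code numArr; omega

theorem WArr.code_injective : Function.Injective WArr.code := fun x y h => by
  cases x <;> cases y <;> first
    | rfl
    | (exact absurd h (by simp only [WArr.code]; decide))
    | (rename_i b b'; cases b <;> cases b' <;> first | rfl | exact absurd h (by decide))
    | (rename_i b; cases b <;> exact absurd h (by decide))

theorem WArr.code_lt (a : WArr) : a.code < numArr := by
  cases a <;> first | decide | (rename_i b; cases b <;> decide)

/-- States: contents of registers and arrays. -/
structure State where
  reg : Reg → ℕ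
  wreg : WReg → ℝ≥0∞
  arr : Arr → ℕ → ℕ
  warr : WArr → ℕ → ℝ≥0∞

namespace State

def setR (s : State) (x : Reg) (v : ℕ) : State :=
  { s with reg := fun y => if y = x then v else s.reg y }
noncomputable def setW (s : State) (x : WReg) (v : ℝ≥0∞) : State :=
  { s with wreg := fun y => if y = x then v else s.wreg y }
def setA (s : State) (a : Arr) (i v : ℕ) : State :=
  { s with arr := fun b => if b = a then Function.update (s.arr a) i v else s.arr b }
noncomputable def setWA (s : State) (a : WArr) (i : ℕ) (v : ℝ≥0∞) : State :=
  { s with warr := fun b => if b = a then Function.update (s.warr a) i v else s.warr b }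

variable (s : State) (x y : Reg) (xw yw : WReg) (a b : Arr) (aw bw : WArr) (i v : ℕ) (r : ℝ≥0∞)

@[simp] theorem setR_reg : (s.setR x v).reg y = if y = x then v else s.reg y := rfl
@[simp] theorem setR_wreg : (s.setR x v).wreg = s.wreg := rfl
@[simp] theorem setR_arr : (s.setR x v).arr = s.arr := rfl
@[simp] theorem setR_warr : (s.setR x v).warr = s.warr := rfl
@[simp] theorem setW_reg : (s.setW xw r).reg = s.reg := rfl
@[simp] theorem setW_wreg : (s.setW xw r).wreg yw = if yw = xw then r else s.wreg yw := rfl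
@[simp] theorem setW_arr : (s.setW xw r).arr = s.arr := rfl
@[simp] theorem setW_warr : (s.setW xw r).warr = s.warr := rfl
@[simp] theorem setA_reg : (s.setA a i v).reg = s.reg := rfl
@[simp] theorem setA_wreg : (s.setA a i v).wreg = s.wreg := rfl
@[simp] theorem setA_arr :
    (s.setA a i v).arr b = if b = a then Function.update (s.arr a) i v else s.arr b := rfl
@[simp] theorem setA_warr : (s.setA a i v).warr = s.warr := rfl
@[simp] theorem setWA_reg : (s.setWA aw i r).reg = s.reg := rfl
@[simp] theorem setWA_wreg : (s.setWA aw i r).wreg = s.wreg := rfl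
@[simp] theorem setWA_arr : (s.setWA aw i r).arr = s.arr := rfl
@[simp] theorem setWA_warr :
    (s.setWA aw i r).warr bw = if bw = aw then Function.update (s.warr aw) i r else s.warr bw :=
  rfl

end State

/-- Word expressions. -/
inductive Exp
  | c (n : ℕ)
  | r (x : Reg)
  | add (a b : Exp)
  | sub (a b : Exp)
  | mul (a b : Exp)
  | div (a b : Exp)
  | mod (a b : Exp)

instance : Add Exp := ⟨Exp.add⟩
instance : Sub Exp := ⟨Exp.sub⟩
instance : Mul Exp := ⟨Exp.mul⟩
instance : Div Exp := ⟨Exp.div⟩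
instance : Mod Exp := ⟨Exp.mod⟩
instance (n : ℕ) : OfNat Exp n := ⟨Exp.c n⟩

prefix:max "♯" => Exp.r

namespace Exp

/-- The value of an expression, with natural number arithmetic. -/
def eval (s : State) : Exp → ℕ
  | c n => n
  | r x => s.reg x
  | add a b => a.eval s + b.eval s
  | sub a b => a.eval s - b.eval s
  | mul a b => a.eval s * b.eval s
  | div a b => a.eval s / b.eval s
  | mod a b => a.eval s % b.eval s

/-- The evaluation meets only values below `B`, and no negative ones. -/
def Ok (B : ℕ) (s : State) : Exp → Prop
  | c n => n < B
  | r _ => True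
  | add a b => a.Ok B s ∧ b.Ok B s ∧ a.eval s + b.eval s < B
  | sub a b => a.Ok B s ∧ b.Ok B s ∧ b.eval s ≤ a.eval s ∧ a.eval s < B
  | mul a b => a.Ok B s ∧ b.Ok B s ∧ a.eval s * b.eval s < B
  | div a b => a.Ok B s ∧ b.Ok B s
  | mod a b => a.Ok B s ∧ b.Ok B s

/-- Whether a register occurs in an expression. -/
def uses (y : Reg) : Exp → Bool
  | c _ => false
  | r x => x = y
  | add a b | sub a b | mul a b | div a b | mod a b => a.uses y || b.uses y

variable (s : State) (B : ℕ) (a b : Exp) (n : ℕ) (x : Reg)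

@[simp] theorem eval_c : (c n).eval s = n := rfl
@[simp] theorem eval_zero : (0 : Exp).eval s = 0 := rfl
@[simp] theorem eval_one : (1 : Exp).eval s = 1 := rfl
@[simp] theorem eval_two : (2 : Exp).eval s = 2 := rfl
@[simp] theorem eval_r : (♯x).eval s = s.reg x := rfl
@[simp] theorem eval_add : (a + b).eval s = a.eval s + b.eval s := rfl
@[simp] theorem eval_sub : (a - b).eval s = a.eval s - b.eval s := rfl
@[simp] theorem eval_mul : (a * b).eval s = a.eval s * b.eval s := rfl
@[simp] theorem eval_div : (a / b).eval s = a.eval s / b.eval s := rfl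
@[simp] theorem eval_mod : (a % b).eval s = a.eval s % b.eval s := rfl
@[simp] theorem ok_c : (c n).Ok B s ↔ n < B := Iff.rfl
@[simp] theorem ok_zero : (0 : Exp).Ok B s ↔ 0 < B := Iff.rfl
@[simp] theorem ok_one : (1 : Exp).Ok B s ↔ 1 < B := Iff.rfl
@[simp] theorem ok_two : (2 : Exp).Ok B s ↔ 2 < B := Iff.rfl
@[simp] theorem ok_r : (♯x).Ok B s ↔ True := Iff.rfl
@[simp] theorem ok_add :
    (a + b).Ok B s ↔ a.Ok B s ∧ b.Ok B s ∧ a.eval s + b.eval s < B := Iff.rfl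
@[simp] theorem ok_sub :
    (a - b).Ok B s ↔ a.Ok B s ∧ b.Ok B s ∧ b.eval s ≤ a.eval s ∧ a.eval s < B := Iff.rfl
@[simp] theorem ok_mul :
    (a * b).Ok B s ↔ a.Ok B s ∧ b.Ok B s ∧ a.eval s * b.eval s < B := Iff.rfl
@[simp] theorem ok_div : (a / b).Ok B s ↔ a.Ok B s ∧ b.Ok B s := Iff.rfl
@[simp] theorem ok_mod : (a % b).Ok B s ↔ a.Ok B s ∧ b.Ok B s := Iff.rfl

theorem eval_congr {s s' : State} : ∀ {e : Exp},
    (∀ x, e.uses x = true → s'.reg x = s.reg x) → e.eval s' = e.eval s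
  | c _, _ => rfl
  | r x, h => h x (by simp [uses])
  | add a b, h | sub a b, h | mul a b, h | div a b, h | mod a b, h => by
    simp only [eval]
    rw [eval_congr (e := a) fun x hx => h x (by simp [uses, hx]),
      eval_congr (e := b) fun x hx => h x (by simp [uses, hx])]

theorem ok_congr {B : ℕ} {s s' : State} : ∀ {e : Exp},
    (∀ x, e.uses x = true → s'.reg x = s.reg x) → e.Ok B s → e.Ok B s'
  | c _, _, hk => hk
  | r _, _, _ => trivial
  | add a b, h, hk | sub a b, h, hk | mul a b, h, hk | div a b, h, hk | mod a b, h, hk => by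
    have ha : ∀ x, a.uses x = true → s'.reg x = s.reg x := fun x hx => h x (by simp [uses, hx])
    have hb : ∀ x, b.uses x = true → s'.reg x = s.reg x := fun x hx => h x (by simp [uses, hx])
    simp only [Ok, eval_congr ha, eval_congr hb] at hk ⊢
    have h1 := ok_congr (B := B) ha
    have h2 := ok_congr (B := B) hb
    tauto

/-- Compilation to the machine. -/
def compile : Exp → WordExpr
  | c n => .const n
  | r x => .reg x.code
  | add a b => .add a.compile b.compile
  | sub a b => .sub a.compile b.compile
  | mul a b => .mul a.compile b.compile
  | div a b => .div a.compile b.compile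
  | mod a b => .mod a.compile b.compile

end Exp

/-- Weight expressions. -/
inductive WExp
  | zero
  | infty
  | r (x : WReg)
  | add (a b : WExp)

namespace WExp

noncomputable def eval (s : State) : WExp → ℝ≥0∞
  | zero => 0
  | infty => ⊤
  | r x => s.wreg x
  | add a b => a.eval s + b.eval s

@[simp] theorem eval_zero (s : State) : zero.eval s = 0 := rfl
@[simp] theorem eval_infty (s : State) : infty.eval s = ⊤ := rfl
@[simp] theorem eval_r (s : State) (x : WReg) : (r x).eval s = s.wreg x := rfl
@[simp] theorem eval_add (s : State) (a b : WExp) : (add a b).eval s = a.eval s + b.eval s := rfl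

def compile : WExp → WeightExpr
  | zero => .zero
  | infty => .infty
  | r x => .reg x.code
  | add a b => .add a.compile b.compile

end WExp

/-- Conditions. -/
inductive Cond
  | lt (a b : Exp)
  | wlt (a b : WExp)
  | not (b : Cond)
  | and (a b : Cond)

namespace Cond

def Holds (s : State) : Cond → Prop
  | lt a b => a.eval s < b.eval s
  | wlt a b => a.eval s < b.eval s
  | not b => ¬ b.Holds s
  | and a b => a.Holds s ∧ b.Holds s

def Ok (B : ℕ) (s : State) : Cond → Prop
  | lt a b => a.Ok B s ∧ b.Ok B s
  | wlt _ _ => True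
  | not b => b.Ok B s
  | and a b => a.Ok B s ∧ b.Ok B s

def compile : Cond → Test
  | lt a b => .wordLT a.compile b.compile
  | wlt a b => .weightLT a.compile b.compile
  | not b => .neg b.compile
  | and a b => .conj a.compile b.compile

/-- Equality of words. -/
def eq (a b : Exp) : Cond := .and (.not (.lt a b)) (.not (.lt b a))

section
variable (s : State) (B : ℕ) (a b : Exp) (e f : WExp) (p q : Cond)
@[simp] theorem holds_lt : (lt a b).Holds s ↔ a.eval s < b.eval s := Iff.rfl
@[simp] theorem holds_wlt : (wlt e f).Holds s ↔ e.eval s < f.eval s := Iff.rfl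
@[simp] theorem holds_not : (not p).Holds s ↔ ¬ p.Holds s := Iff.rfl
@[simp] theorem holds_and : (and p q).Holds s ↔ p.Holds s ∧ q.Holds s := Iff.rfl
@[simp] theorem holds_eq : (eq a b).Holds s ↔ a.eval s = b.eval s := by
  simp only [eq, holds_and, holds_not, holds_lt]; omega
@[simp] theorem ok_lt : (lt a b).Ok B s ↔ a.Ok B s ∧ b.Ok B s := Iff.rfl
@[simp] theorem ok_wlt : (wlt e f).Ok B s ↔ True := Iff.rfl
@[simp] theorem ok_not : (not p).Ok B s ↔ p.Ok B s := Iff.rfl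
@[simp] theorem ok_and : (and p q).Ok B s ↔ p.Ok B s ∧ q.Ok B s := Iff.rfl
@[simp] theorem ok_eq : (eq a b).Ok B s ↔ a.Ok B s ∧ b.Ok B s := by
  simp only [eq, ok_and, ok_not, ok_lt]; tauto
end

end Cond

/-- Statements. The loop `loop x e p` runs `p` with `x = 0, …, e - 1`. -/
inductive Stmt
  | skip
  | set (x : Reg) (e : Exp)
  | load (x : Reg) (a : Arr) (e : Exp)
  | store (a : Arr) (e f : Exp)
  | wset (x : WReg) (e : WExp)
  | wload (x : WReg) (a : WArr) (e : Exp)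
  | wstore (a : WArr) (e : Exp) (f : WExp)
  | seq (p q : Stmt)
  | ite (b : Cond) (p q : Stmt)
  | loop (x : Reg) (e : Exp) (p : Stmt)

infixr:60 " ;; " => Stmt.seq

/-- A conditional without alternative. -/
def Stmt.when (b : Cond) (p : Stmt) : Stmt := .ite b p .skip

namespace Stmt

open Classical in
/-- The effect of a statement. -/
noncomputable def run : Stmt → State → State
  | skip, s => s
  | set x e, s => s.setR x (e.eval s)
  | load x a e, s => s.setR x (s.arr a (e.eval s))
  | store a e f, s => s.setA a (e.eval s) (f.eval s)
  | wset x e, s => s.setW x (e.eval s)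
  | wload x a e, s => s.setW x (s.warr a (e.eval s))
  | wstore a e f, s => s.setWA a (e.eval s) (f.eval s)
  | seq p q, s => q.run (p.run s)
  | ite b p q, s => if b.Holds s then p.run s else q.run s
  | loop x e p, s =>
    Nat.rec (s.setR x 0) (fun i s' => (p.run s').setR x (i + 1)) (e.eval s)

/-- The state before the `i`-th iteration of a loop. -/
noncomputable def iter (x : Reg) (p : Stmt) (s : State) (i : ℕ) : State :=
  Nat.rec (s.setR x 0) (fun i s' => (p.run s').setR x (i + 1)) i

open Classical in
/-- The number of machine steps that a statement takes. -/
noncomputable def cost : Stmt → State → ℕ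
  | seq p q, s => p.cost s + q.cost (p.run s)
  | ite b p q, s => (if b.Holds s then p.cost s else q.cost s) + 1
  | loop x e p, s => ∑ i ∈ Finset.range (e.eval s), (p.cost (iter x p s i) + 2) + 2
  | _, _ => 1

/-- All values are below `B`, and all array indices below `M`. -/
def Safe (B M : ℕ) : Stmt → State → Prop
  | skip, _ | wset _ _, _ => True
  | set _ e, s => e.Ok B s
  | load _ _ e, s | wload _ _ e, s | wstore _ e _, s => e.Ok B s ∧ e.eval s < M
  | store _ e f, s => e.Ok B s ∧ e.eval s < M ∧ f.Ok B s
  | seq p q, s => p.Safe B M s ∧ q.Safe B M (p.run s)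
  | ite b p q, s => b.Ok B s ∧ (b.Holds s → p.Safe B M s) ∧ (¬ b.Holds s → q.Safe B M s)
  | loop x e p, s => e.Ok B s ∧ e.eval s < B ∧ ∀ i < e.eval s, p.Safe B M (iter x p s i)

/-- Whether a statement may change a word register. -/
def modR (y : Reg) : Stmt → Bool
  | set x _ | load x _ _ => x = y
  | seq p q | ite _ p q => p.modR y || q.modR y
  | loop x _ p => x = y || p.modR y
  | _ => false

/-- Whether a statement may change a weight register. -/
def modW (y : WReg) : Stmt → Bool
  | wset x _ | wload x _ _ => x = y
  | seq p q | ite _ p q => p.modW y || q.modW y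
  | loop _ _ p => p.modW y
  | _ => false

/-- Whether a statement may change a word array. -/
def modA (b : Arr) : Stmt → Bool
  | store a _ _ => a = b
  | seq p q | ite _ p q => p.modA b || q.modA b
  | loop _ _ p => p.modA b
  | _ => false

/-- Whether a statement may change a weight array. -/
def modWA (b : WArr) : Stmt → Bool
  | wstore a _ _ => a = b
  | seq p q | ite _ p q => p.modWA b || q.modWA b
  | loop _ _ p => p.modWA b
  | _ => false

/-- Whether an expression uses a register that a statement may change. -/
def clobbers (p : Stmt) : Exp → Bool
  | .c _ => false
  | .r x => p.modR x
  | .add a b | .sub a b | .mul a b | .div a b | .mod a b => p.clobbers a || p.clobbers b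

/-- No loop changes its own counter or bound. -/
def wf : Stmt → Bool
  | seq p q | ite _ p q => p.wf && q.wf
  | loop x e p => p.wf && !p.modR x && !p.clobbers e && !e.uses x
  | _ => true

theorem clobbers_spec {p : Stmt} : ∀ {e : Exp}, p.clobbers e = false →
    ∀ x, e.uses x = true → p.modR x = false
  | .c _, _, _, hx => by simp [Exp.uses] at hx
  | .r y, h, x, hx => by simp only [Exp.uses, decide_eq_true_eq] at hx; subst hx; exact h
  | .add a b, h, x, hx | .sub a b, h, x, hx | .mul a b, h, x, hx | .div a b, h, x, hx
  | .mod a b, h, x, hx => by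
    simp only [clobbers, Bool.or_eq_false_iff] at h
    simp only [Exp.uses, Bool.or_eq_true] at hx
    exact hx.elim (clobbers_spec h.1 x) (clobbers_spec h.2 x)

end Stmt

/-- What the statement `p` leaves unchanged. -/
structure Frame (p : Stmt) (s s' : State) : Prop where
  reg : ∀ x, p.modR x = false → s'.reg x = s.reg x
  wreg : ∀ x, p.modW x = false → s'.wreg x = s.wreg x
  arr : ∀ a, p.modA a = false → s'.arr a = s.arr a
  warr : ∀ a, p.modWA a = false → s'.warr a = s.warr a

namespace Frame

theorem refl (p : Stmt) (s : State) : Frame p s s :=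
  ⟨fun _ _ => rfl, fun _ _ => rfl, fun _ _ => rfl, fun _ _ => rfl⟩

theorem trans {p : Stmt} {s s' s'' : State} (h : Frame p s s') (h' : Frame p s' s'') :
    Frame p s s'' :=
  ⟨fun x hx => (h'.reg x hx).trans (h.reg x hx), fun x hx => (h'.wreg x hx).trans (h.wreg x hx),
    fun x hx => (h'.arr x hx).trans (h.arr x hx), fun x hx => (h'.warr x hx).trans (h.warr x hx)⟩

theorem mono {p p' : Stmt} {s s' : State} (h : Frame p s s')
    (hr : ∀ x, p'.modR x = false → p.modR x = false)
    (hw : ∀ x, p'.modW x = false → p.modW x = false)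
    (ha : ∀ x, p'.modA x = false → p.modA x = false)
    (hwa : ∀ x, p'.modWA x = false → p.modWA x = false) : Frame p' s s' :=
  ⟨fun x hx => h.reg x (hr x hx), fun x hx => h.wreg x (hw x hx),
    fun x hx => h.arr x (ha x hx), fun x hx => h.warr x (hwa x hx)⟩

theorem setR {p : Stmt} {x : Reg} (hx : p.modR x = true) (s : State) (v : ℕ) :
    Frame p s (s.setR x v) :=
  ⟨fun y hy => by
    have : y ≠ x := by rintro rfl; simp [hx] at hy
    simp [this], fun _ _ => rfl, fun _ _ => rfl, fun _ _ => rfl⟩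

theorem loopBody {x : Reg} {e : Exp} {p : Stmt} {s s' : State} (h : Frame p s s') :
    Frame (.loop x e p) s s' :=
  h.mono (fun y hy => by simp [Stmt.modR] at hy; exact hy.2) (fun _ h => h) (fun _ h => h)
    (fun _ h => h)

end Frame

theorem Stmt.modR_loop (x : Reg) (e : Exp) (p : Stmt) : (Stmt.loop x e p).modR x = true := by
  simp [Stmt.modR]

theorem Stmt.frame : ∀ (p : Stmt) (s : State), Frame p s (p.run s)
  | skip, s => Frame.refl _ _
  | set x e, s | load x a e, s => Frame.setR (by simp [modR]) _ _
  | store a e f, s => ⟨fun _ _ => rfl, fun _ _ => rfl, fun b hb => by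
      simp only [modA, decide_eq_false_iff_not] at hb
      simp [run, Ne.symm hb], fun _ _ => rfl⟩
  | wset x e, s | wload x a e, s => ⟨fun _ _ => rfl, fun b hb => by
      simp only [modW, decide_eq_false_iff_not] at hb
      simp [run, Ne.symm hb], fun _ _ => rfl, fun _ _ => rfl⟩
  | wstore a e f, s => ⟨fun _ _ => rfl, fun _ _ => rfl, fun _ _ => rfl, fun b hb => by
      simp only [modWA, decide_eq_false_iff_not] at hb
      simp [run, Ne.symm hb]⟩
  | seq p q, s =>
    ((frame p s).mono (by simp +contextual [modR]) (by simp +contextual [modW])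
      (by simp +contextual [modA]) (by simp +contextual [modWA])).trans
    ((frame q _).mono (by simp +contextual [modR]) (by simp +contextual [modW])
      (by simp +contextual [modA]) (by simp +contextual [modWA]))
  | ite b p q, s => by
    by_cases hb : b.Holds s
    · simp only [run, hb, if_true]
      exact (frame p s).mono (by simp +contextual [modR]) (by simp +contextual [modW])
        (by simp +contextual [modA]) (by simp +contextual [modWA])
    · simp only [run, hb, if_false]
      exact (frame q s).mono (by simp +contextual [modR]) (by simp +contextual [modW])
        (by simp +contextual [modA]) (by simp +contextual [modWA])
  | loop x e p, s => by
    have : ∀ i, Frame (.loop x e p) s (iter x p s i) := fun i => by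
      induction i with
      | zero => exact Frame.setR (modR_loop x e p) s 0
      | succ i ih =>
        exact (ih.trans (frame p _).loopBody).trans (Frame.setR (modR_loop x e p) _ _)
    exact this _

/-! ### Weakest preconditions -/

/-- `p` runs safely from `s`, and its final state and cost satisfy `Q`. -/
structure WP (B M : ℕ) (p : Stmt) (s : State) (Q : State → ℕ → Prop) : Prop where
  safe : p.Safe B M s
  post : Q (p.run s) (p.cost s)

section WP

variable {B M : ℕ} {s : State} {Q : State → ℕ → Prop}

/-- The frame is handed to the new postcondition. Specifications therefore state only what changes,
and everything else is recovered from the frame by `rfl`. -/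
theorem WP.mono {p : Stmt} {Q' : State → ℕ → Prop} (h : WP B M p s Q')
    (hQ : ∀ s' t, Frame p s s' → Q' s' t → Q s' t) : WP B M p s Q :=
  ⟨h.safe, hQ _ _ (p.frame s) h.post⟩

theorem wp_iff (p : Stmt) : WP B M p s Q ↔ p.Safe B M s ∧ Q (p.run s) (p.cost s) :=
  ⟨fun h => ⟨h.safe, h.post⟩, fun h => ⟨h.1, h.2⟩⟩

@[simp] theorem wp_skip : WP B M .skip s Q ↔ Q s 1 := by simp [wp_iff, Stmt.Safe, Stmt.run, Stmt.cost]
@[simp] theorem wp_set (x : Reg) (e : Exp) :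
    WP B M (.set x e) s Q ↔ e.Ok B s ∧ Q (s.setR x (e.eval s)) 1 :=
  wp_iff _
@[simp] theorem wp_load (x : Reg) (a : Arr) (e : Exp) : WP B M (.load x a e) s Q ↔
    (e.Ok B s ∧ e.eval s < M) ∧ Q (s.setR x (s.arr a (e.eval s))) 1 :=
  wp_iff _
@[simp] theorem wp_store (a : Arr) (e f : Exp) : WP B M (.store a e f) s Q ↔
    (e.Ok B s ∧ e.eval s < M ∧ f.Ok B s) ∧ Q (s.setA a (e.eval s) (f.eval s)) 1 :=
  wp_iff _
@[simp] theorem wp_wset (x : WReg) (e : WExp) :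
    WP B M (.wset x e) s Q ↔ Q (s.setW x (e.eval s)) 1 := by
  simp [wp_iff, Stmt.Safe, Stmt.run, Stmt.cost]
@[simp] theorem wp_wload (x : WReg) (a : WArr) (e : Exp) : WP B M (.wload x a e) s Q ↔
    (e.Ok B s ∧ e.eval s < M) ∧ Q (s.setW x (s.warr a (e.eval s))) 1 :=
  wp_iff _
@[simp] theorem wp_wstore (a : WArr) (e : Exp) (f : WExp) : WP B M (.wstore a e f) s Q ↔
    (e.Ok B s ∧ e.eval s < M) ∧ Q (s.setWA a (e.eval s) (f.eval s)) 1 :=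
  wp_iff _
@[simp] theorem wp_seq (p q : Stmt) : WP B M (p ;; q) s Q ↔
    WP B M p s fun s' t => WP B M q s' fun s'' t' => Q s'' (t + t') := by
  simp [wp_iff, Stmt.Safe, Stmt.run, Stmt.cost, and_assoc]
@[simp] theorem wp_ite (b : Cond) (p q : Stmt) : WP B M (.ite b p q) s Q ↔
    b.Ok B s ∧ (b.Holds s → WP B M p s fun s' t => Q s' (t + 1)) ∧
      (¬ b.Holds s → WP B M q s fun s' t => Q s' (t + 1)) := by
  by_cases hb : b.Holds s <;> simp [wp_iff, Stmt.Safe, Stmt.run, Stmt.cost, hb, and_assoc]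
@[simp] theorem wp_when (b : Cond) (p : Stmt) : WP B M (.when b p) s Q ↔
    b.Ok B s ∧ (b.Holds s → WP B M p s fun s' t => Q s' (t + 1)) ∧
      (¬ b.Holds s → Q s 2) := by
  rw [Stmt.when, wp_ite, wp_skip]

/-- The second argument of the invariant is the cost so far. Each round adds `2` for the test and
the increment, and the final `2` pays for setting the counter to zero and for the failing test. -/
theorem WP.loop {x : Reg} {e : Exp} {p : Stmt} (n : ℕ) (I : ℕ → ℕ → State → Prop)
    (hn : e.eval s = n) (he : e.Ok B s) (hB : n < B) (h0 : I 0 0 (s.setR x 0))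
    (hstep : ∀ i τ s', i < n → s'.reg x = i → Frame (.loop x e p) s s' → I i τ s' →
      WP B M p s' fun s'' t => I (i + 1) (τ + t + 2) (s''.setR x (i + 1)))
    (hfin : ∀ τ s', s'.reg x = n → Frame (.loop x e p) s s' → I n τ s' → Q s' (τ + 2)) :
    WP B M (.loop x e p) s Q := by
  subst hn
  have key : ∀ i, i ≤ e.eval s → (∀ j < i, p.Safe B M (Stmt.iter x p s j)) ∧
      (Stmt.iter x p s i).reg x = i ∧ Frame (.loop x e p) s (Stmt.iter x p s i) ∧
      I i (∑ j ∈ Finset.range i, (p.cost (Stmt.iter x p s j) + 2)) (Stmt.iter x p s i) := by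
    intro i
    induction i with
    | zero => exact fun _ => ⟨by simp, by simp [Stmt.iter], Frame.setR (Stmt.modR_loop x e p) _ _, h0⟩
    | succ i ih =>
      intro hi
      obtain ⟨h1, h2, h3, h4⟩ := ih (by omega)
      have hw := hstep i _ _ (by omega) h2 h3 h4
      refine ⟨fun j hj => ?_, by simp [Stmt.iter], ?_, ?_⟩
      · rcases Nat.lt_succ_iff_lt_or_eq.1 hj with hj | rfl
        · exact h1 j hj
        · exact hw.safe
      · exact (h3.trans (p.frame _).loopBody).trans (Frame.setR (Stmt.modR_loop x e p) _ _)
      · rw [Finset.sum_range_succ, ← add_assoc]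
        exact hw.post
  obtain ⟨h1, h2, h3, h4⟩ := key _ le_rfl
  exact ⟨⟨he, hB, h1⟩, hfin _ _ h2 h3 h4⟩

end WP

end DistOracle

namespace DistOracle

/-! ### Compilation to the machine -/

/-- The address of a cell of an array: the arrays are interleaved. -/
def addr (code : ℕ) (e : Exp) : WordExpr := .add (.mul (.const numArr) e.compile) (.const code)

namespace Stmt

def compile : Stmt → Program
  | skip => .skip
  | set x e => .setWord x.code e.compile
  | load x a e => .loadWord x.code (addr a.code e)
  | store a e f => .storeWord (addr a.code e) f.compile
  | wset x e => .setWeight x.code e.compile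
  | wload x a e => .loadWeight x.code (addr a.code e)
  | wstore a e f => .storeWeight (addr a.code e) f.compile
  | seq p q => .seq p.compile q.compile
  | ite b p q => .ite b.compile p.compile q.compile
  | loop x e p => .seq (.setWord x.code (.const 0)) (.loop (.wordLT (.reg x.code) e.compile)
      (.seq p.compile (.setWord x.code (.add (.reg x.code) (.const 1)))))

end Stmt

/-- The configuration `σ` represents the state `s`. -/
structure Sim (s : State) (σ : Config) : Prop where
  reg : ∀ x : Reg, σ.reg x.code = s.reg x
  wreg : ∀ x : WReg, σ.weightReg x.code = s.wreg x
  mem : ∀ (a : Arr) i, σ.mem (numArr * i + a.code) = s.arr a i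
  wmem : ∀ (a : WArr) i, σ.weightMem (numArr * i + a.code) = s.warr a i

/-- Interleaving gives every array an unbounded supply of cells without fixing its length in
advance, at the price of a constant factor in space. -/
theorem numArr_mul_add_inj {i j a b : ℕ} (ha : a < numArr) (hb : b < numArr) :
    numArr * i + a = numArr * j + b ↔ i = j ∧ a = b := by
  unfold numArr at *; omega

namespace Sim

variable {s : State} {σ : Config} {w B M : ℕ}

/-- `Exp.Ok` keeps all intermediate values below the word size and all differences non-negative, so
the reductions modulo `2 ^ w` never act. -/
theorem eval (h : Sim s σ) (hB : B ≤ 2 ^ w) : ∀ {e : Exp}, e.Ok B s →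
    e.compile.eval w σ = e.eval s
  | .c n, hk => Nat.mod_eq_of_lt (lt_of_lt_of_le hk hB)
  | .r x, _ => h.reg x
  | .add a b, hk => by
    simp only [Exp.compile, WordExpr.eval, Exp.eval, h.eval hB hk.1, h.eval hB hk.2.1]
    exact Nat.mod_eq_of_lt (lt_of_lt_of_le hk.2.2 hB)
  | .sub a b, hk => by
    obtain ⟨h1, h2, h3, h4⟩ := hk
    simp only [Exp.compile, WordExpr.eval, Exp.eval, h.eval hB h1, h.eval hB h2]
    rw [show a.eval s + 2 ^ w - b.eval s = (a.eval s - b.eval s) + 2 ^ w by omega,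
      Nat.add_mod_right]
    exact Nat.mod_eq_of_lt (by omega)
  | .mul a b, hk => by
    simp only [Exp.compile, WordExpr.eval, Exp.eval, h.eval hB hk.1, h.eval hB hk.2.1]
    exact Nat.mod_eq_of_lt (lt_of_lt_of_le hk.2.2 hB)
  | .div a b, hk => by
    simp only [Exp.compile, WordExpr.eval, Exp.eval, h.eval hB hk.1, h.eval hB hk.2]
  | .mod a b, hk => by
    simp only [Exp.compile, WordExpr.eval, Exp.eval, h.eval hB hk.1, h.eval hB hk.2]

theorem weval (h : Sim s σ) : ∀ e : WExp, e.compile.eval σ = e.eval s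
  | .zero => rfl
  | .infty => rfl
  | .r x => h.wreg x
  | .add a b => by simp only [WExp.compile, WeightExpr.eval, WExp.eval, h.weval]

theorem holds (h : Sim s σ) (hB : B ≤ 2 ^ w) : ∀ {b : Cond}, b.Ok B s →
    (b.compile.Holds w σ ↔ b.Holds s)
  | .lt a b, hk => by
    simp only [Cond.compile, Test.Holds, Cond.Holds, h.eval hB hk.1, h.eval hB hk.2]
  | .wlt a b, _ => by simp only [Cond.compile, Test.Holds, Cond.Holds, h.weval]
  | .not b, hk => by
    have : b.Ok B s := hk
    simp only [Cond.compile, Test.Holds, Cond.Holds, h.holds hB this]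
  | .and a b, hk => by
    simp only [Cond.compile, Test.Holds, Cond.Holds, h.holds hB hk.1, h.holds hB hk.2]

/-- An index below `M` leads to an address below `numArr * M`; this is also what bounds the memory
in use. -/
theorem addr (h : Sim s σ) (hB : B ≤ 2 ^ w) (hM : numArr * M < 2 ^ w) {e : Exp} (hk : e.Ok B s)
    (he : e.eval s < M) {code : ℕ} (hc : code < numArr) :
    (addr code e).eval w σ = numArr * e.eval s + code := by
  have h1 : numArr * e.eval s + code < numArr * M := by unfold numArr at *; omega
  have hM0 : numArr ≤ numArr * M := Nat.le_mul_of_pos_right _ (by omega)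
  simp only [DistOracle.addr, WordExpr.eval, h.eval hB hk]
  rw [Nat.mod_eq_of_lt (a := numArr) (by omega), Nat.mod_eq_of_lt (a := code) (by omega),
    Nat.mod_eq_of_lt (a := numArr * _) (by omega), Nat.mod_eq_of_lt (by omega)]

theorem setR (h : Sim s σ) (x : Reg) (v N : ℕ) : Sim (s.setR x v)
    { σ with reg := Function.update σ.reg x.code v, memTop := N } :=
  ⟨fun y => by
    by_cases hy : y = x
    · simp [hy]
    · simp [hy, Function.update_of_ne (fun e => hy (Reg.code_injective e)), h.reg],
    h.wreg, h.mem, h.wmem⟩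

theorem setW (h : Sim s σ) (x : WReg) (v : ℝ≥0∞) (N : ℕ) : Sim (s.setW x v)
    { σ with weightReg := Function.update σ.weightReg x.code v, weightMemTop := N } :=
  ⟨h.reg, fun y => by
    by_cases hy : y = x
    · simp [hy]
    · simp [hy, Function.update_of_ne (fun e => hy (WReg.code_injective e)), h.wreg],
    h.mem, h.wmem⟩

theorem setA (h : Sim s σ) (a : Arr) (i v N : ℕ) : Sim (s.setA a i v)
    { σ with mem := Function.update σ.mem (numArr * i + a.code) v, memTop := N } :=
  ⟨h.reg, h.wreg, fun b j => by
    by_cases hb : b = a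
    · by_cases hj : j = i
      · simp [hb, hj]
      · subst hb; simpa [hj, numArr] using h.mem b j
    · have : numArr * j + b.code ≠ numArr * i + a.code := fun e =>
        hb (Arr.code_injective ((numArr_mul_add_inj b.code_lt a.code_lt).1 e).2)
      simp [hb, Function.update_of_ne this, h.mem], h.wmem⟩

theorem setWA (h : Sim s σ) (a : WArr) (i : ℕ) (v : ℝ≥0∞) (N : ℕ) : Sim (s.setWA a i v)
    { σ with weightMem := Function.update σ.weightMem (numArr * i + a.code) v,
             weightMemTop := N } :=
  ⟨h.reg, h.wreg, h.mem, fun b j => by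
    by_cases hb : b = a
    · by_cases hj : j = i
      · simp [hb, hj]
      · subst hb; simpa [hj, numArr] using h.wmem b j
    · have : numArr * j + b.code ≠ numArr * i + a.code := fun e =>
        hb (WArr.code_injective ((numArr_mul_add_inj b.code_lt a.code_lt).1 e).2)
      simp [hb, Function.update_of_ne this, h.wmem]⟩

end Sim

/-- The memory in use in `σ'` is the one in use in `σ`, and at most `N` cells of each sort. -/
def Config.Within (N : ℕ) (σ σ' : Config) : Prop :=
  σ'.memTop ≤ max σ.memTop N ∧ σ'.weightMemTop ≤ max σ.weightMemTop N

theorem Config.Within.trans {N : ℕ} {σ σ' σ'' : Config} (h : σ.Within N σ')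
    (h' : σ'.Within N σ'') : σ.Within N σ'' := by
  unfold Config.Within at *; omega

theorem Config.Within.refl {N : ℕ} (σ : Config) : σ.Within N σ := by
  unfold Config.Within; omega

theorem numArr_mul_add_lt {i M code : ℕ} (hi : i < M) (hc : code < numArr) :
    numArr * i + code + 1 ≤ numArr * M := by
  unfold numArr at *; omega

/-- The machine simulates the structured language. -/
theorem Stmt.sim {w B M : ℕ} (ω : ℕ → Fin (2 ^ w)) (hB : B ≤ 2 ^ w) (hM : numArr * M < 2 ^ w) :
    ∀ (p : Stmt), p.wf = true → ∀ (s : State) (σ : Config), Sim s σ → p.Safe B M s →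
      ∃ σ', Exec w ω p.compile σ (p.cost s) σ' ∧ Sim (p.run s) σ' ∧ σ.Within (numArr * M) σ'
  | .skip, _, s, σ, h, _ => ⟨σ, .skip σ, h, .refl σ⟩
  | .set x e, _, s, σ, h, hs => ⟨_, .setWord σ x.code e.compile, by
      rw [h.eval hB hs]; exact h.setR x _ _, .refl σ⟩
  | .load x a e, _, s, σ, h, hs => ⟨_, .loadWord σ x.code _, by
      rw [h.addr hB hM hs.1 hs.2 a.code_lt, h.mem]; exact h.setR x _ _, by
      rw [h.addr hB hM hs.1 hs.2 a.code_lt]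
      exact ⟨max_le_max le_rfl (numArr_mul_add_lt hs.2 a.code_lt), le_max_left _ _⟩⟩
  | .store a e f, _, s, σ, h, hs => ⟨_, .storeWord σ _ f.compile, by
      rw [h.addr hB hM hs.1 hs.2.1 a.code_lt, h.eval hB hs.2.2]; exact h.setA a _ _ _, by
      rw [h.addr hB hM hs.1 hs.2.1 a.code_lt]
      exact ⟨max_le_max le_rfl (numArr_mul_add_lt hs.2.1 a.code_lt), le_max_left _ _⟩⟩
  | .wset x e, _, s, σ, h, _ => ⟨_, .setWeight σ x.code e.compile, by
      rw [h.weval]; exact h.setW x _ _, .refl σ⟩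
  | .wload x a e, _, s, σ, h, hs => ⟨_, .loadWeight σ x.code _, by
      rw [h.addr hB hM hs.1 hs.2 a.code_lt, h.wmem]; exact h.setW x _ _, by
      rw [h.addr hB hM hs.1 hs.2 a.code_lt]
      exact ⟨le_max_left _ _, max_le_max le_rfl (numArr_mul_add_lt hs.2 a.code_lt)⟩⟩
  | .wstore a e f, _, s, σ, h, hs => ⟨_, .storeWeight σ _ f.compile, by
      rw [h.addr hB hM hs.1 hs.2 a.code_lt, h.weval]; exact h.setWA a _ _ _, by
      rw [h.addr hB hM hs.1 hs.2 a.code_lt]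
      exact ⟨le_max_left _ _, max_le_max le_rfl (numArr_mul_add_lt hs.2 a.code_lt)⟩⟩
  | .seq p q, hwf, s, σ, h, hs => by
    simp only [wf, Bool.and_eq_true] at hwf
    obtain ⟨σ₁, e₁, h₁, w₁⟩ := sim ω hB hM p hwf.1 s σ h hs.1
    obtain ⟨σ₂, e₂, h₂, w₂⟩ := sim ω hB hM q hwf.2 _ σ₁ h₁ hs.2
    exact ⟨σ₂, .seq e₁ e₂, h₂, w₁.trans w₂⟩
  | .ite b p q, hwf, s, σ, h, hs => by
    simp only [wf, Bool.and_eq_true] at hwf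
    by_cases hb : b.Holds s
    · obtain ⟨σ₁, e₁, h₁, w₁⟩ := sim ω hB hM p hwf.1 s σ h (hs.2.1 hb)
      refine ⟨σ₁, ?_, ?_, w₁⟩
      · simpa only [cost, compile, hb, if_true] using Exec.iteTrue ((h.holds hB hs.1).2 hb) e₁
      · simpa only [run, hb, if_true] using h₁
    · obtain ⟨σ₁, e₁, h₁, w₁⟩ := sim ω hB hM q hwf.2 s σ h (hs.2.2 hb)
      refine ⟨σ₁, ?_, ?_, w₁⟩
      · simpa only [cost, compile, hb, if_false] using
          Exec.iteFalse (fun hb' => hb ((h.holds hB hs.1).1 hb')) e₁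
      · simpa only [run, hb, if_false] using h₁
  | .loop x e p, hwf, s, σ, h, hs => by
    simp only [wf, Bool.and_eq_true, Bool.not_eq_true'] at hwf
    obtain ⟨⟨⟨hwp, hx⟩, hcl⟩, hux⟩ := hwf
    obtain ⟨he, heB, hbody⟩ := hs
    -- The machine evaluates the bound of the loop before every round, the language only once. They
    -- agree because a well-formed body changes neither the counter nor a register of the bound.
    have hiter : ∀ i, (∀ y, e.uses y = true → (iter x p s i).reg y = s.reg y) ∧
        (iter x p s i).reg x = i := by
      intro i
      refine ⟨fun y hy => ?_, ?_⟩
      · have hyx : y ≠ x := by rintro rfl; simp [hux] at hy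
        induction i with
        | zero => simp [iter, hyx]
        | succ i ih =>
          refine Eq.trans ?_ ih
          simp only [iter, State.setR_reg, hyx, if_false]
          exact (p.frame _).reg y (clobbers_spec hcl y hy)
      · cases i <;> simp [iter]
    have key : ∀ d i, i + d = e.eval s → ∀ σ₁, Sim (iter x p s i) σ₁ →
        ∃ σ₂, Exec w ω (.loop (.wordLT (.reg x.code) e.compile)
            (.seq p.compile (.setWord x.code (.add (.reg x.code) (.const 1))))) σ₁
            (∑ j ∈ Finset.Ico i (e.eval s), (p.cost (iter x p s j) + 2) + 1) σ₂ ∧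
          Sim (iter x p s (e.eval s)) σ₂ ∧ σ₁.Within (numArr * M) σ₂ := by
      intro d
      induction d with
      | zero =>
        intro i hi σ₁ h₁
        obtain rfl : i = e.eval s := hi
        refine ⟨σ₁, ?_, h₁, .refl σ₁⟩
        simp only [Finset.Ico_self, Finset.sum_empty, zero_add]
        refine .loopDone ?_
        simp only [Test.Holds, h₁.eval hB (Exp.ok_congr (hiter _).1 he)]
        rw [Exp.eval_congr (hiter _).1]
        simp only [WordExpr.eval, h₁.reg, (hiter _).2, lt_irrefl, not_false_eq_true]
      | succ d ih =>
        intro i hi σ₁ h₁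
        obtain ⟨σ₂, e₂, h₂, w₂⟩ := sim ω hB hM p hwp _ σ₁ h₁ (hbody i (by omega))
        have hx2 : σ₂.reg x.code = i := by
          rw [h₂.reg, (p.frame _).reg x hx, (hiter i).2]
        have h₃ := h₂.setR x (i + 1) σ₂.memTop
        obtain ⟨σ₃, e₃, h₄, w₃⟩ := ih (i + 1) (by omega) _ h₃
        refine ⟨σ₃, ?_, h₄, w₂.trans w₃⟩
        rw [Finset.sum_eq_sum_Ico_succ_bot (by omega)]
        have := Exec.loopStep (w := w) (ω := ω) (b := .wordLT (.reg x.code) e.compile) (s := σ₁)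
          (by
            simp only [Test.Holds, h₁.eval hB (Exp.ok_congr (hiter _).1 he)]
            rw [Exp.eval_congr (hiter _).1]
            simp only [WordExpr.eval, h₁.reg, (hiter _).2]; omega)
          (Exec.seq e₂ (Exec.setWord σ₂ x.code (.add (.reg x.code) (.const 1)))) (by
            have hv : (WordExpr.add (.reg x.code) (.const 1)).eval w σ₂ = i + 1 := by
              simp only [WordExpr.eval, hx2]
              rw [Nat.mod_eq_of_lt (a := 1) (by omega), Nat.mod_eq_of_lt (by omega)]
            rw [hv]; exact e₃)
        convert this using 1
        ring
    obtain ⟨σ₂, e₂, h₂, w₂⟩ := key _ 0 (zero_add _) _ (h.setR x 0 σ.memTop)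
    refine ⟨σ₂, ?_, h₂, ?_⟩
    · have h0 : (WordExpr.const 0).eval w σ = 0 := by simp [WordExpr.eval]
      have := Exec.seq (Exec.setWord (w := w) (ω := ω) σ x.code (.const 0)) (by rw [h0]; exact e₂)
      have hc : (Stmt.loop x e p).cost s =
          1 + (∑ j ∈ Finset.Ico 0 (e.eval s), (p.cost (iter x p s j) + 2) + 1) := by
        rw [add_comm, add_assoc, ← Finset.range_eq_Ico]; rfl
      rw [hc]
      exact this
    · exact w₂

/-- The machine is deterministic once the random words are fixed. -/
theorem Exec.det {w : ℕ} {ω : ℕ → Fin (2 ^ w)} {p : Program} {s s₁ s₂ : Config} {t₁ t₂ : ℕ}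
    (h₁ : Exec w ω p s t₁ s₁) (h₂ : Exec w ω p s t₂ s₂) : t₁ = t₂ ∧ s₁ = s₂ := by
  induction h₁ generalizing t₂ s₂ with
  | seq _ _ ih₁ ih₂ =>
    cases h₂ with
    | seq hp hq =>
      obtain ⟨rfl, rfl⟩ := ih₁ hp
      obtain ⟨rfl, rfl⟩ := ih₂ hq
      exact ⟨rfl, rfl⟩
  | iteTrue hb _ ih =>
    cases h₂ with
    | iteTrue _ hp => obtain ⟨rfl, rfl⟩ := ih hp; exact ⟨rfl, rfl⟩
    | iteFalse hb' _ => exact absurd hb hb'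
  | iteFalse hb _ ih =>
    cases h₂ with
    | iteTrue hb' _ => exact absurd hb' hb
    | iteFalse _ hp => obtain ⟨rfl, rfl⟩ := ih hp; exact ⟨rfl, rfl⟩
  | loopDone hb =>
    cases h₂ with
    | loopDone _ => exact ⟨rfl, rfl⟩
    | loopStep hb' _ _ => exact absurd hb' hb
  | loopStep hb _ _ ih₁ ih₂ =>
    cases h₂ with
    | loopDone hb' => exact absurd hb hb'
    | loopStep _ hp hl =>
      obtain ⟨rfl, rfl⟩ := ih₁ hp
      obtain ⟨rfl, rfl⟩ := ih₂ hl
      exact ⟨rfl, rfl⟩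
  | _ => cases h₂; exact ⟨rfl, rfl⟩

/-- Whether a program writes to memory. -/
def Program.stores : Program → Bool
  | storeWord _ _ | storeWeight _ _ => true
  | seq p q | ite _ p q => p.stores || q.stores
  | loop _ p => p.stores
  | _ => false

/-- This makes it decidable, by inspection of the code, that a query leaves the memory unchanged. -/
theorem Exec.mem_eq {w : ℕ} {ω : ℕ → Fin (2 ^ w)} {p : Program} {s s' : Config} {t : ℕ}
    (h : Exec w ω p s t s') (hp : p.stores = false) :
    s'.mem = s.mem ∧ s'.weightMem = s.weightMem := by
  induction h with
  | seq _ _ ih₁ ih₂ =>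
    simp only [Program.stores, Bool.or_eq_false_iff] at hp
    exact ⟨(ih₂ hp.2).1.trans (ih₁ hp.1).1, (ih₂ hp.2).2.trans (ih₁ hp.1).2⟩
  | iteTrue _ _ ih => simp only [Program.stores, Bool.or_eq_false_iff] at hp; exact ih hp.1
  | iteFalse _ _ ih => simp only [Program.stores, Bool.or_eq_false_iff] at hp; exact ih hp.2
  | loopStep _ _ _ ih₁ ih₂ =>
    exact ⟨(ih₂ hp).1.trans (ih₁ hp).1, (ih₂ hp).2.trans (ih₁ hp).2⟩
  | storeWord | storeWeight => simp [Program.stores] at hp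
  | _ => exact ⟨rfl, rfl⟩

end DistOracle

namespace DistOracle

/-! ### Counting sort -/

/-- Groups the items `0, …, gL - 1` by their keys, which are below `gN`. -/
def csr (g : Grp) : Stmt :=
  .loop .i ♯.gL (.load .x (.key g) ♯.i ;; .load .y (.deg g) ♯.x ;;
    .store (.deg g) ♯.x (♯.y + 1)) ;;
  .set .acc 0 ;;
  .loop .i ♯.gN (.store (.off g) ♯.i ♯.acc ;; .load .y (.deg g) ♯.i ;;
    .set .acc (♯.acc + ♯.y)) ;;
  .loop .i ♯.gL (.load .x (.key g) ♯.i ;; .load .y (.off g) ♯.x ;; .load .z (.fill g) ♯.x ;;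
    .store (.slot g) (♯.y + ♯.z) ♯.i ;; .store (.fill g) ♯.x (♯.z + 1))

/-- The items below `n` with key `x`. -/
def group (key : ℕ → ℕ) (n x : ℕ) : List ℕ := (List.range n).filter fun i => key i = x

theorem mem_group {key : ℕ → ℕ} {n x i : ℕ} : i ∈ group key n x ↔ i < n ∧ key i = x := by
  simp [group]

theorem nodup_group (key : ℕ → ℕ) (n x : ℕ) : (group key n x).Nodup :=
  List.nodup_range.filter _

theorem group_succ (key : ℕ → ℕ) (n x : ℕ) :
    group key (n + 1) x = group key n x ++ if key n = x then [n] else [] := by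
  rw [group, List.range_succ, List.filter_append]
  by_cases h : key n = x <;> simp [group, h]

theorem group_length_le {key : ℕ → ℕ} {n n' : ℕ} (h : n ≤ n') (x : ℕ) :
    (group key n x).length ≤ (group key n' x).length :=
  ((List.range_sublist.2 h).filter _).length_le

theorem sum_group_length {key : ℕ → ℕ} {n nk : ℕ} (hk : ∀ i < n, key i < nk) :
    ∑ x ∈ Finset.range nk, (group key n x).length = n := by
  induction n with
  | zero => simp [group]
  | succ n ih =>
    have : ∀ x, (group key (n + 1) x).length =
        (group key n x).length + if key n = x then 1 else 0 := fun x => by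
      rw [group_succ]; split <;> simp
    simp only [this, Finset.sum_add_distrib, ih fun i hi => hk i (by omega),
      Finset.sum_ite_eq, Finset.mem_range, hk n (by omega), if_true]

/-- The arrays `deg`, `off`, `slot` describe the items `0, …, len - 1`, grouped by key: the items
with key `x` are `slot (off x + j)` for `j < deg x`. -/
structure Grouped (key deg off slot : ℕ → ℕ) (nk len : ℕ) : Prop where
  key_lt : ∀ i < len, key i < nk
  deg_eq : ∀ x < nk, deg x = (group key len x).length
  off_add_deg : ∀ x < nk, off x + deg x ≤ len
  slot_eq : ∀ x < nk, ∀ j (hj : j < (group key len x).length), slot (off x + j) = (group key len x)[j]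

namespace Grouped

variable {key deg off slot : ℕ → ℕ} {nk len : ℕ} (h : Grouped key deg off slot nk len)
include h

theorem slot_mem {x j : ℕ} (hx : x < nk) (hj : j < deg x) :
    slot (off x + j) < len ∧ key (slot (off x + j)) = x := by
  rw [h.deg_eq x hx] at hj
  rw [h.slot_eq x hx j hj]
  exact mem_group.1 (List.getElem_mem hj)

theorem exists_slot {i : ℕ} (hi : i < len) : ∃ j < deg (key i), slot (off (key i) + j) = i := by
  obtain ⟨j, hj, e⟩ := List.mem_iff_getElem.1 (mem_group.2 ⟨hi, rfl⟩ : i ∈ group key len (key i))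
  have hk := h.key_lt i hi
  exact ⟨j, by rwa [h.deg_eq _ hk], by rw [h.slot_eq _ hk j hj, e]⟩

theorem slot_inj {x j j' : ℕ} (hx : x < nk) (hj : j < deg x) (hj' : j' < deg x)
    (e : slot (off x + j) = slot (off x + j')) : j = j' := by
  rw [h.deg_eq x hx] at hj hj'
  rw [h.slot_eq x hx j hj, h.slot_eq x hx j' hj'] at e
  exact (List.Nodup.getElem_inj_iff (nodup_group key len x)).1 e

theorem sum_deg : ∑ x ∈ Finset.range nk, deg x = len := by
  rw [← sum_group_length h.key_lt]
  exact Finset.sum_congr rfl fun x hx => h.deg_eq x (Finset.mem_range.1 hx)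

theorem deg_le {x : ℕ} (hx : x < nk) : deg x ≤ len := by
  have := h.off_add_deg x hx; omega

end Grouped

/-- Three passes: the sizes of the groups, their prefix sums as offsets, and the distribution of the
items. The counters `deg` and `fill` have to start from zero, which is why each use of the sort has
its own arrays. -/
theorem wp_csr {B M : ℕ} {g : Grp} {s : State} {K : ℕ → ℕ} {n N : ℕ}
    (hK : s.arr (.key g) = K) (hn : s.reg .gL = n) (hN : s.reg .gN = N)
    (hMB : M < B) (hNM : N ≤ M) (hnM : n ≤ M)
    (hdeg : ∀ x, s.arr (.deg g) x = 0) (hfill : ∀ x, s.arr (.fill g) x = 0)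
    (hkey : ∀ i < n, K i < N) :
    WP B M (csr g) s fun s' t => t ≤ 12 * n + 5 * N + 7 ∧
      Grouped K (s'.arr (.deg g)) (s'.arr (.off g)) (s'.arr (.slot g)) N n := by
  rw [csr, wp_seq]
  refine WP.loop n (fun i τ s' => τ ≤ 5 * i ∧ ∀ x, s'.arr (.deg g) x = (group K i x).length)
    hn (by simp) (by omega) (by simp [hdeg, group]) ?_ ?_
  · rintro i τ s' hi hx hf ⟨h1, h3⟩
    have hk : s'.arr (.key g) = K := by rw [← hK]; exact hf.arr _ rfl
    have h4 := hkey i hi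
    have h5 : (group K i (K i)).length ≤ i := by
      simpa [group] using List.length_filter_le (fun j => decide (K j = K i)) (List.range i)
    simp [hx, hk, h3]
    and_intros <;> try omega
    intro x
    rw [group_succ, Function.update_apply]
    by_cases hxi : x = K i
    · simp [hxi]
    · simp [hxi, Ne.symm hxi, h3]
  rintro τ₁ s₁ - hf₁ ⟨h1, h3⟩
  have hk₁ : s₁.arr (.key g) = K := by rw [← hK]; exact hf₁.arr _ rfl
  have hF₁ : s₁.arr (.fill g) = s.arr (.fill g) := hf₁.arr _ rfl
  have hn₁ : s₁.reg .gL = n := by rw [← hn]; exact hf₁.reg _ rfl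
  have hN₁ : s₁.reg .gN = N := by rw [← hN]; exact hf₁.reg _ rfl
  set D := fun x => (group K n x).length with hD
  have hD₁ : s₁.arr (.deg g) = D := funext h3
  have hS := sum_group_length (key := K) (n := n) (nk := N) hkey
  have hle : ∀ i, i < N → (∑ x ∈ Finset.range i, D x) + D i ≤ n := fun i hi => by
    rw [← Finset.sum_range_succ]
    calc _ ≤ ∑ x ∈ Finset.range N, D x :=
          Finset.sum_le_sum_of_subset (Finset.range_mono (by omega))
      _ = n := hS
  simp only [wp_seq, wp_set]
  refine ⟨by simp; omega, ?_⟩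
  refine WP.loop N (fun i τ s' => τ ≤ 5 * i ∧ s'.reg .acc = ∑ x ∈ Finset.range i, D x ∧
      ∀ x < i, s'.arr (.off g) x = ∑ y ∈ Finset.range x, D y) (by simp [hN₁]) (by simp)
      (by omega) (by simp) ?_ ?_
  · rintro i τ s' hi hx hf ⟨h1, h4, h5⟩
    have hk : s'.arr (.deg g) = D := by rw [← hD₁]; exact hf.arr _ rfl
    have := hle i hi
    simp [hx, hk, h4]
    and_intros <;> try omega
    · rw [Finset.sum_range_succ]
    · intro x hx
      rw [Function.update_apply]
      split
      · next h => rw [h]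
      · exact h5 x (by omega)
  rintro τ₂ s₂ - hf₂ ⟨h4, -, h5⟩
  have hk₂ : s₂.arr (.key g) = K := by rw [← hk₁]; exact hf₂.arr _ rfl
  have hD₂ : s₂.arr (.deg g) = D := by rw [← hD₁]; exact hf₂.arr _ rfl
  have hF₂ : s₂.arr (.fill g) = s.arr (.fill g) := by rw [← hF₁]; exact hf₂.arr _ rfl
  have hn₂ : s₂.reg .gL = n := by rw [← hn₁]; exact hf₂.reg _ rfl
  set O := fun x => ∑ y ∈ Finset.range x, D y with hO
  -- The segments of different keys are disjoint, so writing a slot of one group does not damage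
  -- another group.
  have hOle : ∀ x y, x < y → O x + D x ≤ O y := fun x y hxy => by
    simp only [hO]
    rw [← Finset.sum_range_succ]
    exact Finset.sum_le_sum_of_subset (Finset.range_mono (by omega))
  refine WP.loop n (fun i τ s' => τ ≤ 7 * i ∧
      (∀ x, s'.arr (.fill g) x = (group K i x).length) ∧
      ∀ x < N, ∀ j (hj : j < (group K i x).length), s'.arr (.slot g) (O x + j) = (group K i x)[j])
    hn₂ (by simp) (by omega) (by simp [group, hF₂, hfill]) ?_ ?_
  · rintro i τ s' hi hx hf ⟨h6, h7, h8⟩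
    have hk : s'.arr (.key g) = K := by rw [← hk₂]; exact hf.arr _ rfl
    have ho : ∀ x < N, s'.arr (.off g) x = O x := fun x hx =>
      (congrFun (hf.arr _ rfl) x).trans (h5 x hx)
    have h9 := hkey i hi
    have h10 := hle _ h9
    have h12 : ∀ x, (group K (i + 1) x).length ≤ D x := fun x => group_length_le hi x
    have h11 : (group K i (K i)).length + 1 ≤ D (K i) := by simpa [group_succ] using h12 (K i)
    change O (K i) + D (K i) ≤ n at h10
    simp [hx, hk, h7, ho _ h9]
    and_intros <;> try omega
    · intro x
      rw [group_succ, Function.update_apply]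
      by_cases hxi : x = K i
      · simp [hxi]
      · simp [hxi, Ne.symm hxi, h7]
    · intro x hx j hj
      have hjD : j < D x := lt_of_lt_of_le hj (h12 x)
      rw [Function.update_apply]
      by_cases hxi : x = K i
      · subst hxi
        simp only [group_succ, if_true, List.length_append, List.length_singleton] at hj
        by_cases hj' : j = (group K i (K i)).length
        · subst hj'; simp [group_succ]
        · rw [if_neg (by omega), h8 _ hx j (by omega)]
          simp [group_succ, List.getElem_append_left (show j < (group K i (K i)).length by omega)]
      · have hne : O x + j ≠ O (K i) + (group K i (K i)).length := by
          rcases Nat.lt_or_gt_of_ne hxi with h | h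
          · have := hOle _ _ h; omega
          · have := hOle _ _ h; omega
        have hg : group K (i + 1) x = group K i x := by simp [group_succ, Ne.symm hxi]
        rw [if_neg hne, h8 x hx j (by rwa [hg] at hj)]
        simp [hg]
  rintro τ₃ s₃ - hf₃ ⟨h6, -, h8⟩
  have ho : ∀ x < N, s₃.arr (.off g) x = O x := fun x hx =>
    (congrFun (hf₃.arr _ rfl) x).trans (h5 x hx)
  have hD₃ : s₃.arr (.deg g) = D := by rw [← hD₂]; exact hf₃.arr _ rfl
  refine ⟨by omega, hkey, fun x _ => by rw [hD₃], fun x hx => ?_, fun x hx j hj => ?_⟩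
  · rw [hD₃, ho x hx]; exact hle x hx
  · rw [ho x hx]; exact h8 x hx j hj

end DistOracle

namespace DistOracle

/-! ### A priority queue

The keys are at the leaves `pw, …, 2 * pw - 1` of a complete binary tree, with `pw = 2 ^ lam`;
an inner node holds the minimum of its children. -/

/-- Restores the tree after a change of the leaf `cx`. -/
def climb : Stmt :=
  .loop .ci ♯.lam (.set .cx (♯.cx / 2) ;; .wload .wa .tree (2 * ♯.cx) ;;
    .wload .wb .tree (2 * ♯.cx + 1) ;;
    .ite (.wlt (.r .wb) (.r .wa)) (.wstore .tree ♯.cx (.r .wb)) (.wstore .tree ♯.cx (.r .wa)))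

/-- Moves `cx` to a leaf with the smallest key. -/
def descend : Stmt :=
  .set .cx 1 ;;
  .loop .dj ♯.lam (.wload .wa .tree (2 * ♯.cx) ;; .wload .wb .tree (2 * ♯.cx + 1) ;;
    .ite (.wlt (.r .wb) (.r .wa)) (.set .cx (2 * ♯.cx + 1)) (.set .cx (2 * ♯.cx)))

/-- Inserts the pair `(pv, pl)` with key `pk`. -/
def push : Stmt :=
  .store .qv ♯.top ♯.pv ;; .store .ql ♯.top ♯.pl ;; .set .cx (♯.pw + ♯.top) ;;
  .wstore .tree ♯.cx (.r .pk) ;; climb ;; .set .top (♯.top + 1)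

/-- Extracts a pair `(kv, kl)` with the smallest key. -/
def pop : Stmt :=
  descend ;; .load .kv .qv (♯.cx - ♯.pw) ;; .load .kl .ql (♯.cx - ♯.pw) ;;
  .wstore .tree ♯.cx .infty ;; climb

/-- Every inner node holds the minimum of its children. -/
def HeapOK (t : ℕ → ℝ≥0∞) (pw : ℕ) : Prop :=
  ∀ x, 1 ≤ x → x < pw → t x = min (t (2 * x)) (t (2 * x + 1))

/-- The nodes of level `i` are those between `2 ^ i` and `2 ^ (i + 1)`. Halving moves to the parent,
whose value is not larger. -/
theorem HeapOK.root_le {t : ℕ → ℝ≥0∞} {lam : ℕ} (h : HeapOK t (2 ^ lam)) :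
    ∀ i x, 2 ^ i ≤ x → x < 2 ^ (i + 1) → i ≤ lam → t 1 ≤ t x := by
  intro i
  induction i with
  | zero => intro x h1 h2 _; obtain rfl : x = 1 := by simp at h1 h2; omega
            exact le_rfl
  | succ i ih =>
    intro x h1 h2 hi
    have h3 : 2 ^ (i + 1) = 2 * 2 ^ i := by ring
    have h4 : 2 ^ (i + 1 + 1) = 2 * 2 ^ (i + 1) := by ring
    have h5 : 2 ^ (i + 1) ≤ 2 ^ lam := Nat.pow_le_pow_right (by norm_num) hi
    have hp : 0 < 2 ^ i := by positivity
    refine (ih (x / 2) (by omega) (by omega) (by omega)).trans ?_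
    rw [h (x / 2) (by omega) (by omega)]
    rcases Nat.mod_two_eq_zero_or_one x with hx | hx
    · exact (min_le_left _ _).trans (le_of_eq (congrArg t (by omega)))
    · exact (min_le_right _ _).trans (le_of_eq (congrArg t (by omega)))

section

variable {B M lam pw : ℕ} {s : State}

/-- After a change at the leaf `l`, the equation of the heap can fail only at the proper ancestors
`l / 2 ^ j`. They are repaired from the bottom up, and after `i` rounds only those with `j ≥ i + 1`
remain exceptional. -/
theorem wp_climb {l : ℕ} (hlam : s.reg .lam = lam) (hpw : pw = 2 ^ lam) (hM : 2 * pw ≤ M)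
    (hB : M < B) (hl : pw ≤ l) (hl' : l < 2 * pw) (hx : s.reg .cx = l)
    (ht : ∀ x, 1 ≤ x → x < pw → (∀ j ≥ 1, x ≠ l / 2 ^ j) →
      s.warr .tree x = min (s.warr .tree (2 * x)) (s.warr .tree (2 * x + 1))) :
    WP B M climb s fun s' t => t = 7 * lam + 2 ∧ HeapOK (s'.warr .tree) pw ∧
      ∀ x ≥ pw, s'.warr .tree x = s.warr .tree x := by
  have hlp : lam < pw := hpw ▸ Nat.lt_two_pow_self
  rw [climb]
  refine WP.loop lam (fun i τ s' => τ = 7 * i ∧ s'.reg .cx = l / 2 ^ i ∧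
      (∀ x ≥ pw, s'.warr .tree x = s.warr .tree x) ∧
      ∀ x, 1 ≤ x → x < pw → (∀ j ≥ i + 1, x ≠ l / 2 ^ j) →
      s'.warr .tree x = min (s'.warr .tree (2 * x)) (s'.warr .tree (2 * x + 1)))
    hlam (by simp) (by omega) (by simpa [hx] using ht) ?_ ?_
  · rintro i τ s' hi - hf ⟨h1, h2, h3, h4⟩
    have e : l / 2 ^ i / 2 = l / 2 ^ (i + 1) := by rw [Nat.div_div_eq_div_mul, pow_succ]
    have e2 : l / 2 ^ (i + 1) / 2 = l / 2 ^ (i + 2) := by rw [Nat.div_div_eq_div_mul, pow_succ _ (i + 1)]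
    have hle : l / 2 ^ (i + 1) < pw := by
      rw [← e]; have := Nat.div_le_self l (2 ^ i); omega
    set c := l / 2 ^ (i + 1) with hc
    have hmin : ∀ a b : ℝ≥0∞, (if b < a then b else a) = min a b := fun a b => by
      rw [min_def]; split_ifs with h h' h' <;> first | rfl | exact absurd h (not_lt.2 h') |
        exact absurd (not_lt.1 h) h'
    have key : ∀ v, v = min (s'.warr .tree (2 * c)) (s'.warr .tree (2 * c + 1)) →
        (∀ x ≥ pw, Function.update (s'.warr .tree) c v x = s.warr .tree x) ∧
        ∀ x, 1 ≤ x → x < pw → (∀ j, i + 1 + 1 ≤ j → x ≠ l / 2 ^ j) →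
        Function.update (s'.warr .tree) c v x = min (Function.update (s'.warr .tree) c v (2 * x))
          (Function.update (s'.warr .tree) c v (2 * x + 1)) := by
      intro v hv
      refine ⟨fun x hx => by rw [Function.update_of_ne (by omega)]; exact h3 x hx, ?_⟩
      intro x hx hx' hj
      -- The parent of the node just rewritten is the next exceptional ancestor; every other node
      -- has unchanged children.
      have hxc : x ≠ c / 2 := by rw [e2]; exact hj _ (by omega)
      rw [Function.update_of_ne (show 2 * x ≠ c by omega),
        Function.update_of_ne (show 2 * x + 1 ≠ c by omega)]
      by_cases hxc' : x = c
      · rw [hxc', Function.update_self, hv]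
      · rw [Function.update_of_ne hxc']
        refine h4 x hx hx' fun j hj' => ?_
        rcases Nat.lt_or_ge j (i + 2) with h | h
        · obtain rfl : j = i + 1 := by omega
          exact hxc'
        · exact hj j h
    simp only [wp_seq, wp_set, wp_wload, wp_ite, wp_wstore]
    simp [h2, e]
    and_intros <;> try omega
    · intro hlt
      and_intros <;> first | omega | exact (key _ (min_eq_right hlt.le).symm).1 |
        exact (key _ (min_eq_right hlt.le).symm).2
    · intro hlt
      and_intros <;> first | omega | exact (key _ (min_eq_left hlt).symm).1 |
        exact (key _ (min_eq_left hlt).symm).2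
  · rintro τ s' - hf ⟨h1, -, h3, h4⟩
    refine ⟨by omega, fun x hx hx' => h4 x hx hx' fun j hj => ?_, h3⟩
    -- Beyond the root the ancestors are `0`, which is no node, so no exception is left.
    have : l / 2 ^ j = 0 := Nat.div_eq_of_lt (lt_of_lt_of_le (b := 2 ^ (lam + 1))
      (by rw [pow_succ, ← hpw]; omega) (Nat.pow_le_pow_right (by norm_num) hj))
    omega

/-- The value of the root is the value of one of its children, and so on: going to the smaller child
keeps the key equal to that of the root. -/
theorem wp_descend (hlam : s.reg .lam = lam) (hpw : pw = 2 ^ lam) (hM : 2 * pw ≤ M)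
    (hB : M < B) (ht : HeapOK (s.warr .tree) pw) :
    WP B M descend s fun s' t => t = 6 * lam + 3 ∧ pw ≤ s'.reg .cx ∧ s'.reg .cx < 2 * pw ∧
      s.warr .tree (s'.reg .cx) = s.warr .tree 1 := by
  have hlp : lam < pw := hpw ▸ Nat.lt_two_pow_self
  simp only [descend, wp_seq, wp_set]
  refine ⟨by simp; omega, ?_⟩
  refine WP.loop lam (fun i τ s' => τ = 6 * i ∧ 2 ^ i ≤ s'.reg .cx ∧ s'.reg .cx < 2 ^ (i + 1) ∧
      s.warr .tree (s'.reg .cx) = s.warr .tree 1) (by simpa using hlam) (by simp) (by omega)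
      (by simp) ?_ ?_
  · rintro i τ s' hi - hf ⟨h1, h2, h3, h4⟩
    have htr : s'.warr .tree = s.warr .tree := hf.warr _ rfl
    have e3 : 2 ^ (i + 1) = 2 * 2 ^ i := by ring
    have e4 : 2 ^ (i + 1 + 1) = 2 * 2 ^ (i + 1) := by ring
    have h5 : 2 ^ (i + 1) ≤ pw := hpw ▸ Nat.pow_le_pow_right (by norm_num) hi
    have hp : 0 < 2 ^ i := by positivity
    have hm := ht (s'.reg .cx) (by omega) (by omega)
    simp [htr]
    and_intros <;> try omega
    · intro hlt
      rw [h4, min_eq_right hlt.le] at hm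
      and_intros <;> first | omega | exact hm.symm
    · intro hlt
      rw [h4, min_eq_left hlt] at hm
      and_intros <;> first | omega | exact hm.symm
  · rintro τ s' - hf ⟨h1, h2, h3, h4⟩
    rw [pow_succ] at h3
    exact ⟨by omega, by omega, by omega, h4⟩

/-- Leaves are not reused within a search: `top` counts all insertions. The tree thus needs as many
leaves as there are insertions, and `top` can serve as a measure of the work done. -/
theorem wp_push {q : ℕ} (hlam : s.reg .lam = lam) (hpw : pw = 2 ^ lam) (hM : 2 * pw ≤ M)
    (hB : M < B) (hp : s.reg .pw = pw) (hq : s.reg .top = q) (hqp : q < pw)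
    (ht : HeapOK (s.warr .tree) pw) :
    WP B M push s fun s' t => t = 7 * lam + 7 ∧ HeapOK (s'.warr .tree) pw ∧
      (∀ p, s'.warr .tree (pw + p) = if p = q then s.wreg .pk else s.warr .tree (pw + p)) ∧
      s'.arr .qv = Function.update (s.arr .qv) q (s.reg .pv) ∧
      s'.arr .ql = Function.update (s.arr .ql) q (s.reg .pl) ∧ s'.reg .top = q + 1 := by
  simp only [push, wp_seq, wp_store, wp_set, wp_wstore]
  simp [hp, hq]
  and_intros <;> try omega
  refine (wp_climb (l := pw + q) (lam := lam) (pw := pw) (by simpa using hlam) hpw hM hB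
    (by omega) (by omega) (by simp) ?_).mono ?_
  · intro x hx hx' hj
    have h1 : x ≠ pw + q := by omega
    have h2 := hj 1 le_rfl
    rw [pow_one] at h2
    simp only [State.setWA_warr, if_true, State.setR_warr, State.setA_warr]
    rw [Function.update_of_ne h1, Function.update_of_ne (by omega),
      Function.update_of_ne (by omega)]
    exact ht x hx hx'
  · rintro s' t hf ⟨h1, h2, h3⟩
    have h4 : s'.reg .top = q := by rw [hf.reg _ rfl]; simpa using hq
    have h5 := hf.arr .qv rfl
    have h6 := hf.arr .ql rfl
    simp at h5 h6
    simp [h4, h5, h6, h2]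
    and_intros <;> try omega
    · intro p
      rw [h3 _ (by omega)]
      simp [Function.update_apply]

/-- An empty leaf is one with key `⊤`. If the root is `⊤` the extracted pair is meaningless, so
callers test the root beforehand. -/
theorem wp_pop (hlam : s.reg .lam = lam) (hpw : pw = 2 ^ lam) (hM : 2 * pw ≤ M)
    (hB : M < B) (hp : s.reg .pw = pw) (ht : HeapOK (s.warr .tree) pw) :
    WP B M pop s fun s' t => t = 13 * lam + 8 ∧ HeapOK (s'.warr .tree) pw ∧
      ∃ q < pw, s.warr .tree (pw + q) = s.warr .tree 1 ∧
      (∀ p, s'.warr .tree (pw + p) = if p = q then ⊤ else s.warr .tree (pw + p)) ∧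
      s'.reg .kv = s.arr .qv q ∧ s'.reg .kl = s.arr .ql q := by
  simp only [pop, wp_seq]
  refine (wp_descend hlam hpw hM hB ht).mono ?_
  rintro s₁ t₁ hf ⟨h1, h2, h3, h4⟩
  have e1 : s₁.reg .pw = pw := by rw [← hp]; exact hf.reg _ rfl
  have e2 : s₁.arr .qv = s.arr .qv := hf.arr _ rfl
  have e3 : s₁.arr .ql = s.arr .ql := hf.arr _ rfl
  have e4 : s₁.warr .tree = s.warr .tree := hf.warr _ rfl
  have e5 : s₁.reg .lam = lam := by rw [← hlam]; exact hf.reg _ rfl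
  obtain ⟨q, hq⟩ : ∃ q, s₁.reg .cx = pw + q := ⟨_, (Nat.add_sub_cancel' h2).symm⟩
  simp [e1, e2, e3, hq]
  and_intros <;> try omega
  refine (wp_climb (l := pw + q) (lam := lam) (pw := pw) (by simpa using e5) hpw hM hB
    (by omega) (by omega) (by simpa using hq) ?_).mono ?_
  · intro x hx hx' hj
    have h1 : x ≠ pw + q := by omega
    have h2 := hj 1 le_rfl
    rw [pow_one] at h2
    simp only [State.setWA_warr, if_true, State.setR_warr, e4]
    rw [Function.update_of_ne h1, Function.update_of_ne (by omega),
      Function.update_of_ne (by omega)]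
    exact ht x hx hx'
  · rintro s' t hf' ⟨h6, h7, h8⟩
    refine ⟨by omega, h7, q, by omega, by rw [← hq]; exact h4, fun p => ?_, ?_, ?_⟩
    · rw [h8 _ (by omega)]
      simp [Function.update_apply, e4]
    · rw [hf'.reg _ rfl]; simp
    · rw [hf'.reg _ rfl]; simp

end

end DistOracle

namespace DistOracle

/-! ### Networks

After the compression of the vertices, the graph is given by its `2 * m` half-edges; the
half-edges `2 * e` and `2 * e + 1` belong to the edge `e`. -/

/-- The other half of the edge. -/
def twin (h : ℕ) : ℕ := h + 1 - 2 * (h % 2)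

theorem twin_lt {h m : ℕ} (hh : h < 2 * m) : twin h < 2 * m := by unfold twin; omega
theorem twin_twin (h : ℕ) : twin (twin h) = h := by unfold twin; omega
theorem twin_div (h : ℕ) : twin h / 2 = h / 2 := by unfold twin; omega

/-- A network, together with the parameters of the algorithm and the bounds `B` for values and `M`
for addresses. -/
structure Setup where
  V : ℕ
  m : ℕ
  q : ℕ
  lam : ℕ
  pw : ℕ
  B : ℕ
  M : ℕ
  src : ℕ → ℕ
  ew : ℕ → ℝ≥0∞
  m_pos : 1 ≤ m
  V_pos : 1 ≤ V
  q_pos : 1 ≤ q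
  src_lt : ∀ h < 2 * m, src h < V
  ew_lt : ∀ e < m, ew e < ⊤
  pw_eq : pw = 2 ^ lam
  le_pw : 64 * (m * (q + 1) ^ 2) ≤ pw
  V_le : V ≤ 2 * m + 1
  V_le_q : V ≤ q ^ 3
  pw_le_M : 4 * pw ≤ M
  table_le_M : (q ^ 2 * lam ^ 2 + 1) * V ≤ M
  M_lt_B : M < B
  pw_sq_lt_B : pw * pw < B

namespace Setup

variable (P : Setup)

/-- There is a walk of length `l` from `a`. -/
inductive Path (a : ℕ) : ℕ → ℝ≥0∞ → Prop
  | nil : Path a a 0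
  | cons {u : ℕ} {l : ℝ≥0∞} {h : ℕ} (p : Path a u l) (hh : h < 2 * P.m) (hu : P.src h = u) :
      Path a (P.src (twin h)) (l + P.ew (h / 2))

variable {P}

theorem Path.lt {a u : ℕ} {l : ℝ≥0∞} (p : P.Path a u l) (ha : a < P.V) : u < P.V := by
  cases p with
  | nil => exact ha
  | cons p hh hu => exact P.src_lt _ (twin_lt hh)

theorem Path.trans {a b c : ℕ} {l l' : ℝ≥0∞} (p : P.Path a b l) (p' : P.Path b c l') :
    P.Path a c (l + l') := by
  induction p' with
  | nil => simpa using p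
  | cons p' hh hu ih => rw [← add_assoc]; exact .cons ih hh hu

theorem Path.edge {h : ℕ} (hh : h < 2 * P.m) :
    P.Path (P.src h) (P.src (twin h)) (P.ew (h / 2)) := by
  simpa using Path.cons (.nil (P := P)) hh rfl

theorem Path.symm {a b : ℕ} {l : ℝ≥0∞} (p : P.Path a b l) : P.Path b a l := by
  induction p with
  | nil => exact .nil
  | cons p hh hu ih =>
    have h := Path.edge (P := P) (twin_lt hh)
    rw [twin_twin, twin_div, hu] at h
    rw [add_comm]
    exact h.trans ih

theorem lam_lt : P.lam < P.pw := P.pw_eq ▸ Nat.lt_two_pow_self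

theorem mul_le_pw : 64 * P.m * (P.q + 1) * (P.q + 1) ≤ P.pw := by
  have := P.le_pw; nlinarith

/-- The left side bounds the insertions of a search for `k` nearest sources: one for each source,
and one for each of at most `k` explorations of a half-edge. -/
theorem size_le {k : ℕ} (hk : k ≤ P.q + 1) : P.V + 2 * P.m * k ≤ P.pw := by
  have h1 := P.mul_le_pw
  have h2 := P.V_le
  have h3 := P.m_pos
  have h4 : 2 * P.m * k ≤ 2 * P.m * (P.q + 1) := Nat.mul_le_mul_left _ hk
  nlinarith [Nat.zero_le (P.m * P.q), Nat.zero_le (P.m * P.q * P.q)]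

/-- Room for tables with `k` rows of length `V`: the lists of sources and the clusters. -/
theorem mul_V_le {k : ℕ} (hk : k ≤ 2 * P.q + 2) : k * P.V ≤ P.pw := by
  have h1 := P.mul_le_pw
  have h2 := P.V_le
  have h3 := P.m_pos
  have h4 : k * P.V ≤ (2 * P.q + 2) * P.V := Nat.mul_le_mul_right _ hk
  have h5 : (2 * P.q + 2) * P.V ≤ (2 * P.q + 2) * (3 * P.m) := Nat.mul_le_mul_left _ (by omega)
  nlinarith [Nat.zero_le (P.m * P.q), Nat.zero_le (P.m * P.q * P.q)]

end Setup

/-- Two-dimensional tables are stored by rows of length `V`; different entries have different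
indices. -/
theorem mul_add_inj {V j u j' u' : ℕ} (hu : u < V) (hu' : u' < V) :
    j * V + u = j' * V + u' ↔ j = j' ∧ u = u' := by
  constructor
  · intro h
    have h1 : (j * V + u) / V = (j' * V + u') / V := by rw [h]
    have h2 : (j * V + u) % V = (j' * V + u') % V := by rw [h]
    rw [mul_comm j, mul_comm j', Nat.mul_add_div (by omega), Nat.mul_add_div (by omega),
      Nat.div_eq_of_lt hu, Nat.div_eq_of_lt hu'] at h1
    rw [mul_comm j, mul_comm j', Nat.mul_add_mod, Nat.mul_add_mod, Nat.mod_eq_of_lt hu,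
      Nat.mod_eq_of_lt hu'] at h2
    exact ⟨by omega, h2⟩
  · rintro ⟨rfl, rfl⟩; rfl

theorem mul_add_lt {V j u k : ℕ} (hj : j < k) (hu : u < V) : j * V + u < k * V := by
  have : (j + 1) * V ≤ k * V := Nat.mul_le_mul_right _ hj
  nlinarith

/-- The parameters and the network are in their places. -/
structure Env (P : Setup) (s : State) : Prop where
  V : s.reg .V = P.V
  m : s.reg .a1 = P.m
  q : s.reg .q = P.q
  cap : s.reg .cap = 2 * P.q
  lam : s.reg .lam = P.lam
  pw : s.reg .pw = P.pw
  src : ∀ h < 2 * P.m, s.arr (.key .adj) h = P.src h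
  grp : Grouped P.src (s.arr (.deg .adj)) (s.arr (.off .adj)) (s.arr (.slot .adj)) P.V (2 * P.m)
  inp : ∀ e < P.m, s.warr .inp (P.m + e) = P.ew e

/-- A check that a statement keeps the environment. -/
def Stmt.keeps (p : Stmt) : Bool :=
  !p.modR .V && !p.modR .a1 && !p.modR .q && !p.modR .cap && !p.modR .lam && !p.modR .pw &&
  !p.modA (.key .adj) && !p.modA (.deg .adj) && !p.modA (.off .adj) && !p.modA (.slot .adj) &&
  !p.modWA .inp

theorem Env.frame {P : Setup} {s s' : State} {p : Stmt} (h : Env P s) (hf : Frame p s s')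
    (hp : p.keeps = true) : Env P s' := by
  simp only [Stmt.keeps, Bool.and_eq_true, Bool.not_eq_true'] at hp
  obtain ⟨⟨⟨⟨⟨⟨⟨⟨⟨⟨h1, h2⟩, h3⟩, h4⟩, h5⟩, h6⟩, h7⟩, h8⟩, h9⟩, h10⟩, h11⟩ := hp
  refine ⟨?_, ?_, ?_, ?_, ?_, ?_, ?_, ?_, ?_⟩
  · rw [hf.reg _ h1, h.V]
  · rw [hf.reg _ h2, h.m]
  · rw [hf.reg _ h3, h.q]
  · rw [hf.reg _ h4, h.cap]
  · rw [hf.reg _ h5, h.lam]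
  · rw [hf.reg _ h6, h.pw]
  · rw [hf.arr _ h7]; exact h.src
  · rw [hf.arr _ h8, hf.arr _ h9, hf.arr _ h10]; exact h.grp
  · rw [hf.warr _ h11]; exact h.inp

/-! ### Nearest sources -/

/-- The data of a search: for every vertex `u` a list of `cnt u` sources `lab u j` with distances
`dist u j`, and a queue whose items `p` are pairs of a vertex and a source. -/
structure Search where
  cnt : ℕ → ℕ
  lab : ℕ → ℕ → ℕ
  dist : ℕ → ℕ → ℝ≥0∞
  leaf : ℕ → ℝ≥0∞
  qv : ℕ → ℕ
  ql : ℕ → ℕ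

namespace Search

variable (P : Setup) (k : ℕ) (D : Search)

/-- The source `w` at distance `l` is not missing from the list of `v`. -/
def Done (v w : ℕ) (l : ℝ≥0∞) : Prop :=
  (∃ j < D.cnt v, D.lab v j = w ∧ D.dist v j ≤ l) ∨
    (D.cnt v = k ∧ ∀ j < k, D.dist v j ≤ l)

/-- The source `w` at distance `l` of `v` is in the queue or done. -/
def Covered (v w : ℕ) (l : ℝ≥0∞) : Prop :=
  (∃ p < P.pw, D.leaf p < ⊤ ∧ D.leaf p ≤ l ∧ D.qv p = v ∧ D.ql p = w) ∨ D.Done k v w l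

/-- The lists contain at most `k` different sources, with lengths of walks to them, sorted. -/
structure Sound (W : Finset ℕ) : Prop where
  cnt_le : ∀ u < P.V, D.cnt u ≤ k
  mem : ∀ u < P.V, ∀ j < D.cnt u, D.lab u j ∈ W
  path : ∀ u < P.V, ∀ j < D.cnt u, P.Path (D.lab u j) u (D.dist u j)
  inj : ∀ u < P.V, ∀ j < D.cnt u, ∀ j' < D.cnt u, D.lab u j = D.lab u j' → j = j'
  mono : ∀ u < P.V, ∀ j j', j ≤ j' → j' < D.cnt u → D.dist u j ≤ D.dist u j'

/-- The lists contain the `k` nearest sources. -/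
structure Nearest (W : Finset ℕ) : Prop extends D.Sound P k W where
  done : ∀ w ∈ W, ∀ u l, P.Path w u l → D.Done k u w l

/-- The invariant of the search; the edges in `ex` are still to be explored. -/
structure Inv (W : Finset ℕ) (top : ℕ) (ex : ℕ → ℕ → ℕ → Prop) : Prop extends
    D.Sound P k W where
  le_leaf : ∀ u < P.V, ∀ j < D.cnt u, ∀ p < P.pw, D.dist u j ≤ D.leaf p
  lt_top : ∀ p < P.pw, D.leaf p < ⊤ → p < top
  qv_lt : ∀ p < P.pw, D.leaf p < ⊤ → D.qv p < P.V
  ql_mem : ∀ p < P.pw, D.leaf p < ⊤ → D.ql p ∈ W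
  item : ∀ p < P.pw, D.leaf p < ⊤ → P.Path (D.ql p) (D.qv p) (D.leaf p)
  source : ∀ w ∈ W, D.Covered P k w w 0
  edge : ∀ u < P.V, ∀ j < D.cnt u, ∀ h < 2 * P.m, P.src h = u → ¬ ex u j h →
    D.Covered P k (P.src (twin h)) (D.lab u j) (D.dist u j + P.ew (h / 2))

/-- The number of items in the queue. -/
noncomputable def live : ℕ := {p ∈ Finset.range P.pw | D.leaf p < ⊤}.card

variable {P k D} {W : Finset ℕ} {top : ℕ} {ex : ℕ → ℕ → ℕ → Prop}

theorem Sound.eq_of_done (h : D.Sound P k W) {u j : ℕ} (hu : u < P.V) (hj : j < D.cnt u)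
    {l : ℝ≥0∞} (hd : D.Done k u (D.lab u j) l) : D.dist u j ≤ l := by
  rcases hd with ⟨j', hj', e, hl⟩ | ⟨e, hl⟩
  · rwa [← h.inj u hu j' hj' j hj e]
  · exact hl j (e ▸ hj)

/-- With an empty queue, covered means done, and the claim follows by induction along the walk. If
`w` is in the list of the previous vertex, the explored edge passes it on. If that list is full of
`k` sources at least as near, all of them were offered to the next vertex, and they exclude `w`
there as well. -/
theorem Inv.nearest (h : D.Inv P k W top fun _ _ _ => False) (hW : ∀ w ∈ W, w < P.V)
    (hq : ∀ p < P.pw, D.leaf p = ⊤) : D.Nearest P k W := by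
  refine ⟨h.toSound, fun w hw u l p => ?_⟩
  have hcov : ∀ v w l, D.Covered P k v w l → D.Done k v w l := by
    rintro v w l (⟨p, hp, h1, -⟩ | h1)
    · exact absurd (hq p hp) h1.ne
    · exact h1
  induction p with
  | nil => exact hcov _ _ _ (h.source w hw)
  | @cons u l e p hh hu ih =>
    have huV := p.lt (hW w hw)
    have hedge := fun j hj => hcov _ _ _ (h.edge u huV j hj e hh hu not_false)
    have hvV : P.src (twin e) < P.V := P.src_lt _ (twin_lt hh)
    rcases ih with ⟨j, hj, e1, hl⟩ | ⟨e1, hl⟩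
    · have h1 := hedge j hj
      rw [e1] at h1
      have h2 : D.dist u j + P.ew (e / 2) ≤ l + P.ew (e / 2) := by gcongr
      rcases h1 with ⟨i, hi, e2, hl2⟩ | ⟨e2, hl2⟩
      · exact .inl ⟨i, hi, e2, hl2.trans h2⟩
      · exact .inr ⟨e2, fun i hi => (hl2 i hi).trans h2⟩
    · have hle : ∀ j < k, D.dist u j + P.ew (e / 2) ≤ l + P.ew (e / 2) := fun j hj => by
        gcongr; exact hl j hj
      -- Either one of the offered sources was rejected by a full list of nearer ones, which settles
      -- the claim at once, or all `k` of them are in the list.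
      by_cases hfull : ∃ j < k, D.cnt (P.src (twin e)) = k ∧
          ∀ i < k, D.dist (P.src (twin e)) i ≤ D.dist u j + P.ew (e / 2)
      · obtain ⟨j, hj, e2, hl2⟩ := hfull
        exact .inr ⟨e2, fun i hi => (hl2 i hi).trans (hle j hj)⟩
      push Not at hfull
      have hex : ∀ j : Fin k, ∃ i : Fin (D.cnt (P.src (twin e))),
          D.lab (P.src (twin e)) i = D.lab u j ∧
          D.dist (P.src (twin e)) i ≤ D.dist u j + P.ew (e / 2) := by
        intro j
        rcases hedge j (e1.symm ▸ j.2) with ⟨i, hi, e2, hl2⟩ | ⟨e2, hl2⟩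
        · exact ⟨⟨i, hi⟩, e2, hl2⟩
        · obtain ⟨i, hi, h3⟩ := hfull j j.2 e2
          exact absurd (hl2 i hi) (not_le.2 h3)
      choose f hf hf' using hex
      -- Different sources occupy different places, so `k` accepted sources fill the list, and every
      -- entry of it is one of them.
      have hfi : Function.Injective f := fun a b hab => by
        have := (hf a).symm.trans ((congrArg (fun i : Fin _ => D.lab (P.src (twin e)) i) hab).trans
          (hf b))
        exact Fin.ext (h.inj u huV a (e1.symm ▸ a.2) b (e1.symm ▸ b.2) this)
      have hcard := Fintype.card_le_of_injective f hfi
      simp only [Fintype.card_fin] at hcard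
      have hk := le_antisymm (h.cnt_le _ hvV) hcard
      have hsurj : Function.Surjective f :=
        ((Fintype.bijective_iff_injective_and_card f).2 ⟨hfi, by simp [hk]⟩).2
      refine .inr ⟨hk, fun i hi => ?_⟩
      obtain ⟨j, hj⟩ := hsurj ⟨i, hk.symm ▸ hi⟩
      have h3 := hf' j
      rw [hj] at h3
      exact h3.trans (hle j j.2)

variable {D' : Search}

theorem Done.mono {v w : ℕ} {l l' : ℝ≥0∞} (h : D.Done k v w l) (hl : l ≤ l') :
    D.Done k v w l' := by
  rcases h with ⟨j, hj, e, h⟩ | ⟨e, h⟩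
  · exact .inl ⟨j, hj, e, h.trans hl⟩
  · exact .inr ⟨e, fun j hj => (h j hj).trans hl⟩

/-- Extraction of an item that is done. -/
theorem Inv.pop (h : D.Inv P k W top ex) {q : ℕ} (hq : q < P.pw)
    (hdone : D.Done k (D.qv q) (D.ql q) (D.leaf q)) (hcnt : D'.cnt = D.cnt) (hlab : D'.lab = D.lab)
    (hdist : D'.dist = D.dist) (hqv : D'.qv = D.qv) (hql : D'.ql = D.ql)
    (hleaf : ∀ p, D'.leaf p = if p = q then ⊤ else D.leaf p) : D'.Inv P k W top ex := by
  obtain ⟨cnt, lab, dist, leaf, qv, ql⟩ := D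
  obtain ⟨cnt', lab', dist', leaf', qv', ql'⟩ := D'
  dsimp only at hcnt hlab hdist hqv hql hleaf hdone
  subst hcnt hlab hdist hqv hql
  have hlt : ∀ p, leaf' p < ⊤ → leaf' p = leaf p ∧ leaf p < ⊤ := fun p hp => by
    have := hleaf p
    by_cases hpq : p = q
    · rw [if_pos hpq] at this; exact absurd this hp.ne
    · rw [if_neg hpq] at this; exact ⟨this, this ▸ hp⟩
  have hcov : ∀ v w l, Covered P k ⟨cnt', lab', dist', leaf, qv', ql'⟩ v w l →
      Covered P k ⟨cnt', lab', dist', leaf', qv', ql'⟩ v w l := by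
    rintro v w l (⟨p, hp, h1, h2, h3, h4⟩ | h1)
    · by_cases hpq : p = q
      · subst hpq
        dsimp only at h2 h3 h4
        rw [h3, h4] at hdone
        exact .inr (hdone.mono h2)
      · have := hleaf p
        rw [if_neg hpq] at this
        exact .inl ⟨p, hp, by dsimp only; rw [this]; exact h1,
          by dsimp only; rw [this]; exact h2, h3, h4⟩
    · exact .inr h1
  refine ⟨⟨h.cnt_le, h.mem, h.path, h.inj, h.mono⟩, fun u hu j hj p hp => ?_,
    fun p hp hl => h.lt_top p hp (hlt p hl).2, fun p hp hl => h.qv_lt p hp (hlt p hl).2,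
    fun p hp hl => h.ql_mem p hp (hlt p hl).2, fun p hp hl => ?_,
    fun w hw => hcov _ _ _ (h.source w hw),
    fun u hu j hj e he hs hn => hcov _ _ _ (h.edge u hu j hj e he hs hn)⟩
  · dsimp only
    rw [hleaf]
    split
    · exact le_top
    · exact h.le_leaf u hu j hj p hp
  · have := h.item p hp (hlt p hl).2
    dsimp only at this ⊢
    rwa [← (hlt p hl).1] at this

/-- Appending an item to a list. -/
theorem Inv.append (h : D.Inv P k W top fun _ _ _ => False) {v w : ℕ} {δ : ℝ≥0∞}
    (hW : ∀ w ∈ W, w < P.V) (hv : v < P.V)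
    (hw : w ∈ W) (hpath : P.Path w v δ) (hnot : ∀ j < D.cnt v, D.lab v j ≠ w)
    (hk : D.cnt v < k) (hmin : ∀ p < P.pw, δ ≤ D.leaf p)
    (hmax : ∀ u < P.V, ∀ j < D.cnt u, D.dist u j ≤ δ)
    (hcnt : ∀ u < P.V, D'.cnt u = if u = v then D.cnt u + 1 else D.cnt u)
    (hlab : ∀ u < P.V, ∀ j, D'.lab u j = if u = v ∧ j = D.cnt v then w else D.lab u j)
    (hdist : ∀ u < P.V, ∀ j, D'.dist u j = if u = v ∧ j = D.cnt v then δ else D.dist u j)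
    (hqv : D'.qv = D.qv) (hql : D'.ql = D.ql) (hleaf : D'.leaf = D.leaf) :
    D'.Inv P k W top fun u j _ => u = v ∧ j = D.cnt v := by
  have hold : ∀ u < P.V, ∀ j < D.cnt u, D'.lab u j = D.lab u j ∧ D'.dist u j = D.dist u j :=
    fun u hu j hj => by
      have : ¬ (u = v ∧ j = D.cnt v) := by rintro ⟨rfl, rfl⟩; omega
      exact ⟨by rw [hlab u hu, if_neg this], by rw [hdist u hu, if_neg this]⟩
  have hnew : D'.lab v (D.cnt v) = w ∧ D'.dist v (D.cnt v) = δ := by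
    simp [hlab v hv, hdist v hv]
  have hcases : ∀ u < P.V, ∀ j < D'.cnt u, j < D.cnt u ∨ (u = v ∧ j = D.cnt v) :=
    fun u hu j hj => by
      rw [hcnt u hu] at hj
      split at hj
      · next e => subst e; rcases Nat.lt_succ_iff_lt_or_eq.1 hj with h | h
                  · exact .inl h
                  · exact .inr ⟨rfl, h⟩
      · exact .inl hj
  have hge : ∀ u < P.V, D.cnt u ≤ D'.cnt u := fun u hu => by rw [hcnt u hu]; split <;> omega
  have hdone : ∀ u < P.V, ∀ w l, D.Done k u w l → D'.Done k u w l := by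
    rintro u hu w l (⟨j, hj, e, hl⟩ | ⟨e, hl⟩)
    · exact .inl ⟨j, lt_of_lt_of_le hj (hge u hu), by rw [(hold u hu j hj).1, e],
        by rw [(hold u hu j hj).2]; exact hl⟩
    · have huv : u ≠ v := by rintro rfl; omega
      exact .inr ⟨by rw [hcnt u hu, if_neg huv, e], fun j hj => by
        rw [(hold u hu j (e ▸ hj)).2]; exact hl j hj⟩
  have hcov : ∀ u < P.V, ∀ w l, D.Covered P k u w l → D'.Covered P k u w l := by
    rintro u hu w l (⟨p, hp, h1⟩ | h1)
    · exact .inl ⟨p, hp, by rw [hleaf, hqv, hql]; exact h1⟩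
    · exact .inr (hdone u hu w l h1)
  have hmax' : ∀ u < P.V, ∀ j < D'.cnt u, D'.dist u j ≤ δ := fun u hu j hj => by
    rcases hcases u hu j hj with hj | ⟨rfl, rfl⟩
    · rw [(hold u hu j hj).2]; exact hmax u hu j hj
    · rw [hnew.2]
  refine ⟨⟨fun u hu => ?_, fun u hu j hj => ?_, fun u hu j hj => ?_, fun u hu j hj j' hj' e => ?_,
    fun u hu j j' hjj hj' => ?_⟩, fun u hu j hj p hp => ?_, ?_, ?_, ?_, ?_, fun w' hw' => ?_,
    fun u hu j hj e he hs hn => ?_⟩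
  · rw [hcnt u hu]
    split
    · next e => subst e; omega
    · exact h.cnt_le u hu
  · rcases hcases u hu j hj with hj | ⟨rfl, rfl⟩
    · rw [(hold u hu j hj).1]; exact h.mem u hu j hj
    · rw [hnew.1]; exact hw
  · rcases hcases u hu j hj with hj | ⟨rfl, rfl⟩
    · rw [(hold u hu j hj).1, (hold u hu j hj).2]; exact h.path u hu j hj
    · rw [hnew.1, hnew.2]; exact hpath
  · rcases hcases u hu j hj with hj | ⟨rfl, rfl⟩
    · rcases hcases u hu j' hj' with hj' | ⟨rfl, rfl⟩
      · rw [(hold u hu j hj).1, (hold u hu j' hj').1] at e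
        exact h.inj u hu j hj j' hj' e
      · rw [(hold u hu j hj).1, hnew.1] at e
        exact absurd e (hnot j hj)
    · rcases hcases u hu j' hj' with hj' | ⟨-, rfl⟩
      · rw [(hold u hu j' hj').1, hnew.1] at e
        exact absurd e.symm (hnot j' hj')
      · rfl
  · rcases hcases u hu j' hj' with hj' | ⟨rfl, rfl⟩
    · rw [(hold u hu j (by omega)).2, (hold u hu j' hj').2]
      exact h.mono u hu j j' hjj hj'
    · rw [hnew.2]; exact hmax' u hu j (by omega)
  · rw [hleaf]; exact (hmax' u hu j hj).trans (hmin p hp)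
  · rw [hleaf]; exact h.lt_top
  · rw [hleaf, hqv]; exact h.qv_lt
  · rw [hleaf, hql]; exact h.ql_mem
  · rw [hleaf, hql, hqv]; exact h.item
  · exact hcov w' (hW w' hw') _ _ (h.source w' hw')
  · rcases hcases u hu j hj with hj | h1
    · rw [(hold u hu j hj).1, (hold u hu j hj).2]
      exact hcov _ (P.src_lt _ (twin_lt he)) _ _ (h.edge u hu j hj e he hs not_false)
    · exact absurd h1 hn

/-- Insertion of an item. -/
theorem Inv.push (h : D.Inv P k W top ex) {v w : ℕ} {δ : ℝ≥0∞} (hv : v < P.V) (hw : w ∈ W)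
    (hpath : P.Path w v δ) (htop : top < P.pw) (hδ : δ < ⊤)
    (hmax : ∀ u < P.V, ∀ j < D.cnt u, D.dist u j ≤ δ)
    (hcnt : D'.cnt = D.cnt) (hlab : D'.lab = D.lab)
    (hdist : D'.dist = D.dist) (hqv : D'.qv = Function.update D.qv top v)
    (hql : D'.ql = Function.update D.ql top w)
    (hleaf : ∀ p, D'.leaf p = if p = top then δ else D.leaf p) {ex' : ℕ → ℕ → ℕ → Prop}
    (hex : ∀ u < P.V, ∀ j < D.cnt u, ∀ h < 2 * P.m, P.src h = u → ¬ ex' u j h → ¬ ex u j h ∨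
      (P.src (twin h) = v ∧ D.lab u j = w ∧ D.dist u j + P.ew (h / 2) = δ)) :
    D'.Inv P k W (top + 1) ex' := by
  obtain ⟨cnt, lab, dist, leaf, qv, ql⟩ := D
  obtain ⟨cnt', lab', dist', leaf', qv', ql'⟩ := D'
  dsimp only at hcnt hlab hdist hqv hql hleaf hmax hex
  subst hcnt hlab hdist hqv hql
  have hne : ∀ p < P.pw, leaf p < ⊤ → p ≠ top := fun p hp hl e => by
    have := h.lt_top p hp hl; omega
  have hcov : ∀ v' w' l, Covered P k ⟨cnt', lab', dist', leaf, qv, ql⟩ v' w' l →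
      Covered P k ⟨cnt', lab', dist', leaf', Function.update qv top v,
        Function.update ql top w⟩ v' w' l := by
    rintro v' w' l (⟨p, hp, h1, h2, h3, h4⟩ | h1)
    · have := hne p hp h1
      refine .inl ⟨p, hp, ?_⟩
      simp only [hleaf, if_neg this, Function.update_of_ne this]
      exact ⟨h1, h2, h3, h4⟩
    · exact .inr h1
  have hall : ∀ p < P.pw, leaf' p < ⊤ → p = top ∨ (p ≠ top ∧ leaf p < ⊤) := fun p hp hl => by
    by_cases hpt : p = top
    · exact .inl hpt
    · rw [hleaf, if_neg hpt] at hl; exact .inr ⟨hpt, hl⟩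
  refine ⟨⟨h.cnt_le, h.mem, h.path, h.inj, h.mono⟩, fun u hu j hj p hp => ?_,
    fun p hp hl => ?_, fun p hp hl => ?_, fun p hp hl => ?_, fun p hp hl => ?_,
    fun w hw => hcov _ _ _ (h.source w hw), fun u hu j hj e he hs hn => ?_⟩
  · dsimp only
    rw [hleaf]
    split
    · exact hmax u hu j hj
    · exact h.le_leaf u hu j hj p hp
  · rcases hall p hp hl with rfl | ⟨h1, h2⟩
    · exact Nat.lt_succ_self _
    · exact (h.lt_top p hp h2).trans (Nat.lt_succ_self _)
  · rcases hall p hp hl with rfl | ⟨h1, h2⟩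
    · simpa using hv
    · simpa [h1] using h.qv_lt p hp h2
  · rcases hall p hp hl with rfl | ⟨h1, h2⟩
    · simpa using hw
    · simpa [h1] using h.ql_mem p hp h2
  · rcases hall p hp hl with rfl | ⟨h1, h2⟩
    · simpa [hleaf] using hpath
    · simpa [h1, hleaf] using h.item p hp h2
  · rcases hex u hu j hj e he hs hn with h1 | ⟨h1, h2, h3⟩
    · exact hcov _ _ _ (h.edge u hu j hj e he hs h1)
    · exact .inl ⟨top, htop, by simp [hleaf, hδ], by simp [hleaf, h3], by simp [h1], by simp [h2]⟩

theorem live_pop {q : ℕ} (hq : q < P.pw) (hl : D.leaf q < ⊤)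
    (hleaf : ∀ p, D'.leaf p = if p = q then ⊤ else D.leaf p) :
    D'.live P + 1 = D.live P := by
  have : {p ∈ Finset.range P.pw | D'.leaf p < ⊤} =
      {p ∈ Finset.range P.pw | D.leaf p < ⊤}.erase q := by
    ext p
    simp only [Finset.mem_filter, Finset.mem_erase, hleaf]
    by_cases h : p = q <;> simp [h]
  rw [live, live, this]
  exact Finset.card_erase_add_one (by simp [hq, hl])

theorem live_push {q : ℕ} {δ : ℝ≥0∞} (hleaf : ∀ p, D'.leaf p = if p = q then δ else D.leaf p) :
    D'.live P ≤ D.live P + 1 := by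
  refine (Finset.card_le_card (t := insert q {p ∈ Finset.range P.pw | D.leaf p < ⊤}) ?_).trans
    (Finset.card_insert_le _ _)
  intro p
  simp only [Finset.mem_filter, Finset.mem_insert, hleaf]
  by_cases h : p = q <;> simp [h]

end Search

end DistOracle

/-! ### Dijkstra's algorithm with many sources and several labels per vertex -/

namespace DistOracle

/-- Decides whether `kl` is in the list of `kv`, which has length `kc`. -/
def findLabel (b : Bool) : Stmt :=
  .set .found 0 ;;
  .loop .kj ♯.kc (.load .ky (.ll b) (♯.kj * ♯.V + ♯.kv) ;;
    .when (.eq ♯.ky ♯.kl) (.set .found 1))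

/-- Inserts the neighbours of `kv`. -/
def explore : Stmt :=
  .load .ko (.off .adj) ♯.kv ;; .load .kd (.deg .adj) ♯.kv ;;
  .loop .kh ♯.kd (.load .kp (.slot .adj) (♯.ko + ♯.kh) ;;
    .load .pv (.key .adj) (♯.kp + 1 - 2 * (♯.kp % 2)) ;;
    .wload .we .inp (♯.a1 + ♯.kp / 2) ;;
    .set .pl ♯.kl ;; .wset .pk (.add (.r .key) (.r .we)) ;; push)

/-- Appends `kl` to the list of `kv`. -/
def appendLabel (b : Bool) : Stmt :=
  .store (.ll b) (♯.kc * ♯.V + ♯.kv) ♯.kl ;;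
  .wstore (.ld b) (♯.kc * ♯.V + ♯.kv) (.r .key) ;;
  .store (.lc b) ♯.kv (♯.kc + 1)

/-- Processes an item of the queue. -/
def searchStep (b : Bool) : Stmt :=
  .wload .key .tree 1 ;;
  .when (.wlt (.r .key) .infty) (
    pop ;;
    .load .kc (.lc b) ♯.kv ;;
    findLabel b ;;
    .when (.and (.lt ♯.found 1) (.lt ♯.kc ♯.kk)) (appendLabel b ;; explore))

/-- Finds for every vertex the `kk` nearest of the sources in the queue. -/
def knn (b : Bool) : Stmt :=
  .loop .kx ♯.V (.store (.lc b) ♯.kx 0) ;;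
  .loop .it (♯.V + 2 * ♯.a1 * ♯.kk) (searchStep b)

/-- The data of a search that a state holds. -/
def State.search (s : State) (P : Setup) (b : Bool) : Search where
  cnt := s.arr (.lc b)
  lab u j := s.arr (.ll b) (j * P.V + u)
  dist u j := s.warr (.ld b) (j * P.V + u)
  leaf p := s.warr .tree (P.pw + p)
  qv := s.arr .qv
  ql := s.arr .ql

/-- The queue holds exactly the pairs `(w, w)` with `w ∈ W`, at distance `0`. -/
structure Loaded (P : Setup) (W : Finset ℕ) (s : State) : Prop where
  heap : HeapOK (s.warr .tree) P.pw
  top : s.reg .top = W.card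
  item : ∀ p < P.pw, s.warr .tree (P.pw + p) < ⊤ → p < W.card ∧ s.arr .qv p = s.arr .ql p ∧
    s.arr .ql p ∈ W ∧ s.warr .tree (P.pw + p) = 0
  source : ∀ w ∈ W, ∃ p < P.pw, s.warr .tree (P.pw + p) = 0 ∧ s.arr .qv p = w ∧ s.arr .ql p = w

/-- The queue is empty. -/
structure EmptyQueue (P : Setup) (s : State) : Prop where
  heap : HeapOK (s.warr .tree) P.pw
  leaf : ∀ p < P.pw, s.warr .tree (P.pw + p) = ⊤

/-- The number of edges explored. -/
def Setup.work (P : Setup) (cnt deg : ℕ → ℕ) : ℕ := ∑ u ∈ Finset.range P.V, cnt u * deg u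

section

variable {P : Setup} {s : State} {b : Bool} {k : ℕ} {W : Finset ℕ}

theorem Env.work_le (he : Env P s) {cnt : ℕ → ℕ} (hc : ∀ u < P.V, cnt u ≤ k) :
    P.work cnt (s.arr (.deg .adj)) ≤ 2 * P.m * k := by
  calc P.work cnt (s.arr (.deg .adj)) ≤ ∑ u ∈ Finset.range P.V, k * s.arr (.deg .adj) u :=
        Finset.sum_le_sum fun u hu => Nat.mul_le_mul_right _ (hc u (Finset.mem_range.1 hu))
    _ = 2 * P.m * k := by rw [← Finset.mul_sum, he.grp.sum_deg, mul_comm]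

theorem Setup.work_succ {cnt cnt' deg : ℕ → ℕ} {v : ℕ} (hv : v < P.V)
    (h : ∀ u < P.V, cnt' u = if u = v then cnt u + 1 else cnt u) :
    P.work cnt' deg = P.work cnt deg + deg v := by
  have : ∀ u ∈ Finset.range P.V, cnt' u * deg u = cnt u * deg u + if u = v then deg u else 0 := by
    intro u hu
    rw [h u (Finset.mem_range.1 hu)]
    split <;> ring
  rw [Setup.work, Finset.sum_congr rfl this, Finset.sum_add_distrib, Finset.sum_ite_eq',
    if_pos (Finset.mem_range.2 hv)]
  rfl

theorem wp_findLabel {v c w : ℕ} (he : Env P s) (hc : s.reg .kc = c) (hv : s.reg .kv = v)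
    (hw : s.reg .kl = w) (hcq : c ≤ P.q + 1) (hvV : v < P.V) :
    WP P.B P.M (findLabel b) s fun s' t => t ≤ 5 * c + 3 ∧
      (s'.reg .found < 1 ↔ ∀ j < c, s.arr (.ll b) (j * P.V + v) ≠ w) := by
  have hB := P.M_lt_B
  have hM := P.pw_le_M
  have hcV : c * P.V ≤ P.pw := P.mul_V_le (by omega)
  have hV1 := P.V_pos
  have hcp : c ≤ P.pw := (Nat.le_mul_of_pos_right c hV1).trans hcV
  simp only [findLabel, wp_seq, wp_set]
  refine ⟨by simp; omega, ?_⟩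
  refine WP.loop c (fun i τ s' => τ ≤ 5 * i ∧
      (s'.reg .found < 1 ↔ ∀ j < i, s.arr (.ll b) (j * P.V + v) ≠ w)) (by simpa using hc)
      (by simp) (by omega) (by simp) ?_ ?_
  · rintro i τ s' hi hx hf ⟨h1, h2⟩
    have e1 : s'.reg .V = P.V := by rw [hf.reg _ rfl]; exact he.V
    have e2 : s'.reg .kv = v := by rw [hf.reg _ rfl]; exact hv
    have e3 : s'.reg .kl = w := by rw [hf.reg _ rfl]; exact hw
    have e4 : s'.arr (.ll b) = s.arr (.ll b) := hf.arr _ rfl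
    have := mul_add_lt hi hvV
    simp [hx, e1, e2, e3, e4]
    and_intros <;> try omega
    · intro h
      exact ⟨by omega, by omega, i, le_rfl, h⟩
    · intro h
      refine ⟨by omega, ?_⟩
      simp only [Nat.lt_one_iff] at h2
      rw [h2]
      refine ⟨fun h3 j hj => ?_, fun h3 j hj => h3 j (by omega)⟩
      rcases (show j ≤ i from hj).lt_or_eq with hj | rfl
      · exact h3 j hj
      · exact h
  · rintro τ s' - hf ⟨h1, h2⟩
    exact ⟨by omega, h2⟩

/-- The new entry `c` of `v` is exempt from the edge condition at first. Each insertion removes one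
half-edge from the exceptions, in the order of the slots of `v`. -/
theorem wp_explore {v c w top : ℕ} {δ : ℝ≥0∞} (he : Env P s) (hv : s.reg .kv = v)
    (hw : s.reg .kl = w) (hδ : s.wreg .key = δ) (hvV : v < P.V) (hδt : δ < ⊤)
    (htop : s.reg .top = top) (hsize : top + s.arr (.deg .adj) v ≤ P.pw)
    (hheap : HeapOK (s.warr .tree) P.pw) (hwW : w ∈ W) (hp : P.Path w v δ)
    (hlab : (s.search P b).lab v c = w) (hdist : (s.search P b).dist v c = δ)
    (hmax : ∀ u < P.V, ∀ j < (s.search P b).cnt u, (s.search P b).dist u j ≤ δ)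
    (hinv : (s.search P b).Inv P k W top fun u j _ => u = v ∧ j = c) :
    WP P.B P.M explore s fun s' t =>
      t ≤ (7 * P.lam + 14) * s.arr (.deg .adj) v + 4 ∧ HeapOK (s'.warr .tree) P.pw ∧
      s'.reg .top = top + s.arr (.deg .adj) v ∧
      (s'.search P b).live P ≤ (s.search P b).live P + s.arr (.deg .adj) v ∧
      (s'.search P b).Inv P k W (top + s.arr (.deg .adj) v) fun _ _ _ => False := by
  have hB := P.M_lt_B
  have hM := P.pw_le_M
  have hV1 := P.V_pos
  have hsz := P.size_le (k := 1) (by omega)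
  set d := s.arr (.deg .adj) v with hd
  set o := s.arr (.off .adj) v with ho
  have hod : o + d ≤ 2 * P.m := he.grp.off_add_deg v hvV
  simp only [explore, wp_seq, wp_load]
  simp [hv]
  and_intros <;> try omega
  refine WP.loop d (fun i τ s' => τ = (7 * P.lam + 14) * i ∧ HeapOK (s'.warr .tree) P.pw ∧
      s'.reg .top = top + i ∧ (s'.search P b).live P ≤ (s.search P b).live P + i ∧
      (s'.search P b).Inv P k W (top + i) fun u j h => (u = v ∧ j = c) ∧
        ∀ i' < i, h ≠ s.arr (.slot .adj) (o + i')) (by simp [hd]) (by simp) (by omega) ?_ ?_ ?_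
  · refine ⟨by simp, hheap, by simpa using htop, le_rfl, ?_⟩
    simp only [not_lt_zero, false_imp_iff, imp_true_iff, and_true]
    exact hinv
  · rintro i τ s' hi hx hf ⟨h1, h2, h3, h4, h5⟩
    obtain ⟨hpl, hps⟩ := he.grp.slot_mem hvV hi
    set p := s.arr (.slot .adj) (o + i) with hpd
    have hpl' : p < 2 * P.m := hpl
    have e1 : s'.reg .a1 = P.m := by rw [hf.reg _ rfl]; exact he.m
    have e2 : s'.reg .ko = o := by rw [hf.reg _ rfl]; simp [ho]
    have e3 : s'.reg .kl = w := by rw [hf.reg _ rfl]; exact hw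
    have e4 : s'.arr (.slot .adj) = s.arr (.slot .adj) := hf.arr _ rfl
    have e5 : s'.arr (.key .adj) (twin p) = P.src (twin p) := by
      rw [hf.arr _ rfl]; exact he.src _ (twin_lt hpl)
    have e6 : s'.warr .inp (P.m + p / 2) = P.ew (p / 2) := by
      rw [hf.warr _ rfl]; exact he.inp _ (by omega)
    have e7 : s'.wreg .key = δ := by rw [hf.wreg _ rfl]; exact hδ
    have e8 : s'.reg .lam = P.lam := by rw [hf.reg _ rfl]; exact he.lam
    have e9 : s'.reg .pw = P.pw := by rw [hf.reg _ rfl]; exact he.pw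
    have htw : p + 1 - 2 * (p % 2) = twin p := rfl
    have htwl := twin_lt hpl'
    have hew := P.ew_lt (p / 2) (by omega)
    simp only [wp_seq, wp_load, wp_wload, wp_set, wp_wset]
    simp [hx, e1, e2, e3, e4, e7, ← hpd, htw, e5, e6]
    and_intros <;> try omega
    refine (wp_push (q := top + i) (lam := P.lam) (pw := P.pw) (by simpa using e8) P.pw_eq
      (by omega) hB (by simpa using e9) (by simpa using h3) (by omega) (by simpa using h2)).mono ?_
    rintro s'' t hf' ⟨g1, g2, g3, g4, g5, g6⟩
    have hcnt : (s''.search P b).cnt = (s'.search P b).cnt := hf'.arr (.lc b) rfl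
    have hll : s''.arr (.ll b) = s'.arr (.ll b) := hf'.arr (.ll b) rfl
    have hld : s''.warr (.ld b) = s'.warr (.ld b) := hf'.warr (.ld b) rfl
    have hcnt0 : (s'.search P b).cnt = (s.search P b).cnt := hf.arr (.lc b) rfl
    have hll0 : s'.arr (.ll b) = s.arr (.ll b) := hf.arr (.ll b) rfl
    have hld0 : s'.warr (.ld b) = s.warr (.ld b) := hf.warr (.ld b) rfl
    have hlab0 : (s'.search P b).lab = (s.search P b).lab := by
      funext u j; exact congrFun hll0 _
    have hdist0 : (s'.search P b).dist = (s.search P b).dist := by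
      funext u j; exact congrFun hld0 _
    have hleaf : ∀ p', (s''.search P b).leaf p' = if p' = top + i then δ + P.ew (p / 2) else
      (s'.search P b).leaf p' := fun p' => by
        have := g3 p'
        simp at this
        exact this
    refine ⟨by rw [g1, h1]; ring, g2, by rw [g6, add_assoc], ?_, ?_⟩
    · have := Search.live_push (P := P) hleaf
      exact this.trans (by omega)
    · have hps' : P.src p = v := hps
      refine Search.Inv.push (P := P) (top := top + i) h5 (v := P.src (twin p)) (w := w)
        (δ := δ + P.ew (p / 2)) (P.src_lt _ htwl) hwW (hp.cons hpl' hps') (by omega)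
        (ENNReal.add_lt_top.2 ⟨hδt, hew⟩) ?_ hcnt (by funext u j; exact congrFun hll _)
        (by funext u j; exact congrFun hld _) (by simp at g4; exact g4)
        (by simp at g5; exact g5) hleaf ?_
      · intro u hu j hj
        rw [hcnt0] at hj
        rw [hdist0]
        exact (hmax u hu j hj).trans le_self_add
      · intro u hu j hj h hh hs hn
        by_cases hex : (u = v ∧ j = c) ∧ ∀ i' < i, h ≠ s.arr (.slot .adj) (o + i')
        · obtain ⟨⟨rfl, rfl⟩, h6⟩ := hex
          have : h = p := by
            by_contra hne
            refine hn ⟨⟨rfl, rfl⟩, fun i' hi' => ?_⟩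
            rcases (show i' ≤ i from hi').lt_or_eq with hi' | rfl
            · exact h6 i' hi'
            · exact hne
          subst this
          exact .inr ⟨rfl, by rw [hlab0, hlab], by rw [hdist0, hdist]⟩
        · exact .inl hex
  · rintro τ s' - hf ⟨h1, h2, h3, h4, h5⟩
    refine ⟨by omega, h2, h3, h4, ?_⟩
    -- Every half-edge that starts in `v` has a slot there, so no exception survives.
    refine { h5 with edge := fun u hu j hj h hh hs _ => h5.edge u hu j hj h hh hs ?_ }
    rintro ⟨⟨rfl, rfl⟩, h6⟩
    obtain ⟨i, hi, e⟩ := he.grp.exists_slot hh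
    rw [hs] at hi e
    exact h6 i hi e.symm

/-- The state of a search after some steps. -/
structure Searching (P : Setup) (b : Bool) (k : ℕ) (W : Finset ℕ) (steps : ℕ) (deg : ℕ → ℕ)
    (s : State) : Prop where
  heap : HeapOK (s.warr .tree) P.pw
  inv : (s.search P b).Inv P k W (s.reg .top) fun _ _ _ => False
  top : s.reg .top = W.card + P.work (s.search P b).cnt deg
  live : (s.search P b).live P + steps ≤ s.reg .top ∨ (s.search P b).live P = 0

theorem Search.live_eq_zero {D : Search} (h : ∀ p < P.pw, D.leaf p = ⊤) : D.live P = 0 := by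
  rw [Search.live, Finset.card_eq_zero, Finset.filter_eq_empty_iff]
  intro p hp
  simp [h p (Finset.mem_range.1 hp)]

theorem Search.leaf_eq_top {D : Search} (h : D.live P = 0) : ∀ p < P.pw, D.leaf p = ⊤ := by
  rw [Search.live, Finset.card_eq_zero, Finset.filter_eq_empty_iff] at h
  intro p hp
  simpa using h (Finset.mem_range.2 hp)

theorem HeapOK.root_le_leaf {t : ℕ → ℝ≥0∞} (h : HeapOK t P.pw) {p : ℕ} (hp : p < P.pw) :
    t 1 ≤ t (P.pw + p) := by
  rw [P.pw_eq] at h hp ⊢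
  exact h.root_le P.lam _ (by omega) (by rw [pow_succ]; omega) le_rfl

/-- The cost is amortized: an exploration is charged to the growth of `work`, so that the bound for
all steps together depends on the explored edges and not on the maximal degree. -/
theorem wp_searchStep (he : Env P s) (hkk : s.reg .kk = k) (hkq : k ≤ P.q + 1)
    (hW : W ⊆ Finset.range P.V) {i : ℕ} (hs : Searching P b k W i (s.arr (.deg .adj)) s) :
    WP P.B P.M (searchStep b) s fun s' t =>
      Searching P b k W (i + 1) (s.arr (.deg .adj)) s' ∧
      t + (7 * P.lam + 14) * P.work (s.search P b).cnt (s.arr (.deg .adj)) ≤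
        13 * P.lam + 5 * k + 40 +
          (7 * P.lam + 14) * P.work (s'.search P b).cnt (s.arr (.deg .adj)) := by
  have hB := P.M_lt_B
  have hM := P.pw_le_M
  have hV1 := P.V_pos
  have hsz := P.size_le hkq
  have hkV := P.mul_V_le (k := k) (by omega)
  have hkp : k ≤ P.pw := (Nat.le_mul_of_pos_right k hV1).trans hkV
  have hWc : W.card ≤ P.V := by simpa using Finset.card_le_card hW
  have hWl : ∀ w ∈ W, w < P.V := fun w hw => Finset.mem_range.1 (hW hw)
  have hlam := P.lam_lt
  simp only [searchStep, wp_seq, wp_wload, wp_when]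
  simp
  and_intros <;> try omega
  swap
  · intro htop
    -- A root with value `⊤` means that the queue is empty; the remaining steps then do nothing.
    have hall : ∀ p < P.pw, (s.search P b).leaf p = ⊤ := fun p hp =>
      top_le_iff.1 (htop ▸ hs.heap.root_le_leaf hp)
    refine ⟨⟨hs.heap, hs.inv, hs.top, .inr (Search.live_eq_zero hall)⟩, ?_⟩
    have : ((s.setW .key (s.warr .tree 1)).search P b).cnt = (s.search P b).cnt := rfl
    rw [this]; omega
  intro hlt
  refine (wp_pop (lam := P.lam) (pw := P.pw) (s := s.setW .key (s.warr .tree 1)) he.lam P.pw_eq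
    (by omega) hB he.pw hs.heap).mono ?_
  rintro s₁ t₁ hf₁ ⟨h1, h2, q, hq, h3, h4, h5, h6⟩
  have hroot : ∀ p < P.pw, s.warr .tree 1 ≤ (s.search P b).leaf p := fun p hp =>
    hs.heap.root_le_leaf hp
  simp only [State.setW_arr, State.setW_warr] at h3 h4 h5 h6
  set δ := s.warr .tree 1 with hδ
  have hleafq : (s.search P b).leaf q = δ := h3
  have hltq : (s.search P b).leaf q < ⊤ := by rw [hleafq]; exact hlt
  have e1 : (s₁.search P b).cnt = (s.search P b).cnt := hf₁.arr (.lc b) rfl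
  have e2' : s₁.arr (.ll b) = s.arr (.ll b) := hf₁.arr (.ll b) rfl
  have e2 : (s₁.search P b).lab = (s.search P b).lab := by funext u j; exact congrFun e2' _
  have e3' : s₁.warr (.ld b) = s.warr (.ld b) := hf₁.warr (.ld b) rfl
  have e3 : (s₁.search P b).dist = (s.search P b).dist := by funext u j; exact congrFun e3' _
  have e4 : (s₁.search P b).qv = (s.search P b).qv := hf₁.arr .qv rfl
  have e5 : (s₁.search P b).ql = (s.search P b).ql := hf₁.arr .ql rfl
  have e6 : s₁.reg .top = s.reg .top := hf₁.reg _ rfl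
  have e7 : s₁.wreg .key = δ := by rw [hf₁.wreg _ rfl]; simp
  have e8 : s₁.reg .kk = k := by rw [hf₁.reg _ rfl]; exact hkk
  have he₁ : Env P s₁ := Env.frame (s := s.setW .key δ) (p := pop) ⟨he.1, he.2, he.3, he.4, he.5,
    he.6, he.7, he.8, he.9⟩ hf₁ rfl
  set v := s.arr .qv q with hv
  set w := s.arr .ql q with hw
  have hvV : v < P.V := hs.inv.qv_lt q hq hltq
  have hwW : w ∈ W := hs.inv.ql_mem q hq hltq
  have hpath : P.Path w v δ := by rw [← hleafq]; exact hs.inv.item q hq hltq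
  have hmax : ∀ u < P.V, ∀ j < (s.search P b).cnt u, (s.search P b).dist u j ≤ δ :=
    fun u hu j hj => by rw [← hleafq]; exact hs.inv.le_leaf u hu j hj q hq
  have hlive : (s₁.search P b).live P + 1 = (s.search P b).live P :=
    Search.live_pop hq hltq h4
  -- An item was extracted, so the queue was not empty and the first alternative of `hs.live`
  -- applies.
  have hlive' : (s₁.search P b).live P + (i + 1) ≤ s₁.reg .top := by
    rcases hs.live with h | h <;> omega
  set c := (s.search P b).cnt v with hc
  have hck : c ≤ k := hs.inv.cnt_le v hvV
  have hc₁ : s₁.arr (.lc b) v = c := congrFun e1 v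
  simp [h5, hc₁]
  and_intros <;> try omega
  refine (wp_findLabel (P := P) (s := s₁.setR .kc c) (v := v) (c := c) (w := w) (b := b)
    ⟨he₁.1, he₁.2, he₁.3, he₁.4, he₁.5, he₁.6, he₁.7, he₁.8, he₁.9⟩
    (by simp) (by simpa using h5) (by simpa using h6) (by omega) hvV).mono ?_
  rintro s₂ t₂ hf₂ ⟨h7, h8⟩
  simp only [State.setR_arr] at h8
  have f1 : (s₂.search P b) = (s₁.search P b) := by
    have a1 := hf₂.arr (.lc b) rfl
    have a2 := hf₂.arr (.ll b) rfl
    have a3 := hf₂.warr (.ld b) rfl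
    have a4 := hf₂.warr .tree rfl
    have a5 := hf₂.arr .qv rfl
    have a6 := hf₂.arr .ql rfl
    simp only [State.setR_arr, State.setR_warr] at a1 a2 a3 a4 a5 a6
    simp only [State.search, a1, a2, a3, a4, a5, a6]
  have f2 : s₂.warr .tree = s₁.warr .tree := hf₂.warr _ rfl
  have f3 : s₂.reg .top = s.reg .top := by rw [hf₂.reg _ rfl]; simpa using e6
  have f4 : s₂.reg .kk = k := by rw [hf₂.reg _ rfl]; simpa using e8
  have f5 : s₂.reg .kc = c := by rw [hf₂.reg _ rfl]; simp
  have f6 : s₂.reg .kv = v := by rw [hf₂.reg _ rfl]; simpa using h5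
  have f7 : s₂.reg .kl = w := by rw [hf₂.reg _ rfl]; simpa using h6
  have f8 : s₂.wreg .key = δ := by rw [hf₂.wreg _ rfl]; simpa using e7
  have he₂ : Env P s₂ := Env.frame (s := s₁.setR .kc c) (p := findLabel b)
    ⟨he₁.1, he₁.2, he₁.3, he₁.4, he₁.5, he₁.6, he₁.7, he₁.8, he₁.9⟩ hf₂ (by cases b <;> rfl)
  have hdeg₂ : s₂.arr (.deg .adj) = s.arr (.deg .adj) := by
    rw [hf₂.arr _ rfl]; exact hf₁.arr _ rfl
  simp [f4, f5]
  refine ⟨by omega, ?_, ?_⟩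
  swap
  · -- nothing is appended
    intro hno
    have hdone : (s.search P b).Done k ((s.search P b).qv q) ((s.search P b).ql q)
        ((s.search P b).leaf q) := by
      rw [hleafq]
      -- The source is either new, and then the list is full, or already listed. In both cases the
      -- entries are at distance at most `δ`, as keys are extracted in increasing order.
      by_cases hfd : s₂.reg .found = 0
      · refine .inr ⟨le_antisymm hck (hno hfd), fun j hj => hmax v hvV j ?_⟩
        have := hno hfd
        omega
      · have hfd' : ¬ s₂.reg .found < 1 := by omega
        rw [h8] at hfd'
        push Not at hfd'
        obtain ⟨j, hj, e⟩ := hfd'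
        rw [e2'] at e
        exact .inl ⟨j, hj, e, hmax v hvV j hj⟩
    have hinv := hs.inv.pop (D' := s₁.search P b) hq hdone e1 e2 e3 e4 e5 h4
    refine ⟨⟨f2 ▸ h2, ?_, ?_, ?_⟩, ?_⟩
    · rw [f1, f3]; exact hinv
    · rw [f3, f1, e1]; exact hs.top
    · rw [f1, f3, ← e6]; exact .inl hlive'
    · rw [f1, e1]; omega
  · intro hfd hck'
    have h9 : ∀ j < c, (s.search P b).lab v j ≠ w := fun j hj => by
      have := h8.1 (by omega) j hj
      rwa [e2'] at this
    have hcv := mul_add_lt hck' hvV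
    simp only [appendLabel, wp_seq, wp_store, wp_wstore]
    simp [he₂.V, f5, f6, f7, f8]
    and_intros <;> try omega
    set s₃ := ((s₂.setA (.ll b) (c * P.V + v) w).setWA (.ld b) (c * P.V + v) δ).setA (.lc b) v
      (c + 1) with hs₃
    have he₃ : Env P s₃ := ⟨he₂.1, he₂.2, he₂.3, he₂.4, he₂.5, he₂.6, by simpa [s₃] using he₂.7,
      by simpa [s₃] using he₂.8, by simpa [s₃] using he₂.9⟩
    have hcnt₃ : ∀ u, (s₃.search P b).cnt u =
        if u = v then (s.search P b).cnt u + 1 else (s.search P b).cnt u := fun u => by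
      have a1 : s₂.arr (.lc b) u = (s.search P b).cnt u := by
        rw [← e1]; exact congrArg (fun D : Search => D.cnt u) f1
      by_cases hu : u = v
      · subst hu; simp [s₃, State.search, Function.update_apply]; exact hc
      · simp [s₃, State.search, Function.update_apply, hu]; exact a1
    have hlab₃ : ∀ u < P.V, ∀ j, (s₃.search P b).lab u j =
        if u = v ∧ j = c then w else (s.search P b).lab u j := fun u hu j => by
      have a1 : s₂.arr (.ll b) (j * P.V + u) = (s.search P b).lab u j := by
        rw [← e2]; exact congrArg (fun D : Search => D.lab u j) f1
      have a2 := mul_add_inj (j := j) (j' := c) hu hvV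
      simp only [s₃, State.search, State.setA_arr, State.setWA_arr, Function.update_apply, a2,
        reduceCtorEq, if_true, if_false, and_comm, a1]
    have hdist₃ : ∀ u < P.V, ∀ j, (s₃.search P b).dist u j =
        if u = v ∧ j = c then δ else (s.search P b).dist u j := fun u hu j => by
      have a1 : s₂.warr (.ld b) (j * P.V + u) = (s.search P b).dist u j := by
        rw [← e3]; exact congrArg (fun D : Search => D.dist u j) f1
      have a2 := mul_add_inj (j := j) (j' := c) hu hvV
      simp only [s₃, State.search, State.setA_warr, State.setWA_warr, Function.update_apply, a2,
        reduceCtorEq, if_true, if_false, and_comm, a1]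
    have hleaf₂ : (s₃.search P b).leaf = (s₁.search P b).leaf := by
      funext p; simp [State.search, s₃, f2]
    have hleaf₃ : ∀ p, (s₃.search P b).leaf p =
        if p = q then ⊤ else (s.search P b).leaf p := fun p => by
      rw [hleaf₂]; exact h4 p
    have hqv₃ : (s₃.search P b).qv = (s.search P b).qv := by
      rw [← e4]
      exact (show (s₃.search P b).qv = (s₂.search P b).qv by simp [State.search, s₃]).trans
        (congrArg Search.qv f1)
    have hql₃ : (s₃.search P b).ql = (s.search P b).ql := by
      rw [← e5]
      exact (show (s₃.search P b).ql = (s₂.search P b).ql by simp [State.search, s₃]).trans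
        (congrArg Search.ql f1)
    have hlive₃ : (s₃.search P b).live P = (s₁.search P b).live P := by
      rw [Search.live, hleaf₂]; rfl
    have hwork : P.work (s₃.search P b).cnt (s.arr (.deg .adj)) =
        P.work (s.search P b).cnt (s.arr (.deg .adj)) + s.arr (.deg .adj) v :=
      Setup.work_succ hvV fun u _ => hcnt₃ u
    -- appending first and extracting afterwards
    have hinv : (s₃.search P b).Inv P k W (s.reg .top) fun u j _ => u = v ∧ j = c := by
      have hA := hs.inv.append (D' := { (s₃.search P b) with leaf := (s.search P b).leaf })
        hWl hvV hwW hpath h9 hck' hroot hmax (fun u _ => hcnt₃ u) hlab₃ hdist₃ hqv₃ hql₃ rfl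
      refine hA.pop (q := q) hq (.inl ⟨c, ?_, ?_, ?_⟩) rfl rfl rfl rfl rfl hleaf₃
      · have := hcnt₃ v
        rw [if_pos rfl] at this
        show c < (s₃.search P b).cnt ((s₃.search P b).qv q)
        rw [hqv₃]
        show c < (s₃.search P b).cnt v
        omega
      · show (s₃.search P b).lab ((s₃.search P b).qv q) c = (s₃.search P b).ql q
        rw [hqv₃, hql₃]
        show (s₃.search P b).lab v c = w
        rw [hlab₃ v hvV]; simp
      · show (s₃.search P b).dist ((s₃.search P b).qv q) c ≤ (s.search P b).leaf q
        rw [hqv₃, hleafq]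
        show (s₃.search P b).dist v c ≤ δ
        rw [hdist₃ v hvV]; simp
    have hcle : ∀ u < P.V, (s₃.search P b).cnt u ≤ k := hinv.cnt_le
    have hwle : P.work (s₃.search P b).cnt (s.arr (.deg .adj)) ≤ 2 * P.m * k := he.work_le hcle
    have hdeg₃ : s₃.arr (.deg .adj) = s.arr (.deg .adj) := by
      rw [← hdeg₂]; simp [s₃]
    have htop := hs.top
    refine (wp_explore (P := P) (s := s₃) (b := b) (k := k) (W := W) (v := v) (c := c) (w := w)
      (top := s.reg .top) (δ := δ) he₃ f6 f7 f8 hvV hlt f3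
      (by rw [hdeg₃]; omega) (by rw [show s₃.warr .tree = s₁.warr .tree from f2]; exact h2) hwW
      hpath (by rw [hlab₃ v hvV]; simp) (by rw [hdist₃ v hvV]; simp) ?_ hinv).mono ?_
    · intro u hu j hj
      rw [hdist₃ u hu]
      split
      · exact le_rfl
      · next h =>
        refine hmax u hu j ?_
        rw [hcnt₃] at hj
        split at hj
        · next e => subst e; have : j ≠ c := fun e => h ⟨rfl, e⟩
                    omega
        · exact hj
    · rintro s₄ t₄ hf₄ ⟨g1, g2, g3, g4, g5⟩
      rw [hdeg₃] at g1 g3 g4 g5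
      have hcnt₄ : (s₄.search P b).cnt = (s₃.search P b).cnt := hf₄.arr (.lc b) rfl
      refine ⟨⟨g2, g3 ▸ g5, ?_, ?_⟩, ?_⟩
      · rw [hcnt₄, hwork, g3]; omega
      · left
        rw [hlive₃] at g4
        omega
      · rw [hcnt₄, hwork, mul_add]; omega

/-- The language has counting loops only, so the number of steps is fixed in advance. There are at
most `V + 2 * m * k` insertions, and a step on a non-empty queue removes an item; hence this many
steps empty the queue. -/
theorem wp_knn (he : Env P s) (hkk : s.reg .kk = k) (hkq : k ≤ P.q + 1)
    (hW : W ⊆ Finset.range P.V) (hl : Loaded P W s) :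
    WP P.B P.M (knn b) s fun s' t =>
      t ≤ (P.V + 2 * P.m * k) * (20 * P.lam + 5 * k + 70) ∧
      EmptyQueue P s' ∧ (s'.search P b).Nearest P k W := by
  have hB := P.M_lt_B
  have hM := P.pw_le_M
  have hV1 := P.V_pos
  have hsz := P.size_le hkq
  have hWc : W.card ≤ P.V := by simpa using Finset.card_le_card hW
  have hWl : ∀ w ∈ W, w < P.V := fun w hw => Finset.mem_range.1 (hW hw)
  have hsz1 := P.size_le (k := 1) (by omega)
  simp only [knn, wp_seq]
  refine WP.loop P.V (fun i τ s' => τ ≤ 3 * i ∧ ∀ u < i, s'.arr (.lc b) u = 0) he.V (by simp)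
    (by omega) (by simp) ?_ ?_
  · rintro i τ s' hi hx hf ⟨h1, h2⟩
    simp [hx]
    and_intros <;> try omega
    intro u hu
    rw [Function.update_apply]
    split
    · rfl
    · exact h2 u (by omega)
  rintro τ₁ s₁ - hf₁ ⟨h1, h2⟩
  have he₁ := he.frame hf₁ rfl
  have e1 : s₁.warr .tree = s.warr .tree := hf₁.warr _ rfl
  have e2 : s₁.arr .qv = s.arr .qv := hf₁.arr _ rfl
  have e3 : s₁.arr .ql = s.arr .ql := hf₁.arr _ rfl
  have e4 : s₁.reg .top = W.card := by rw [hf₁.reg _ rfl]; exact hl.top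
  have e5 : s₁.reg .kk = k := by rw [hf₁.reg _ rfl]; exact hkk
  have hdeg₁ : s₁.arr (.deg .adj) = s.arr (.deg .adj) := hf₁.arr _ rfl
  have hwork : P.work (s₁.search P b).cnt (s.arr (.deg .adj)) = 0 :=
    Finset.sum_eq_zero fun u hu => by
      show s₁.arr (.lc b) u * _ = 0
      rw [h2 u (Finset.mem_range.1 hu), zero_mul]
  have hno : ∀ u < P.V, ∀ j, ¬ j < (s₁.search P b).cnt u := fun u hu j => by
    show ¬ j < s₁.arr (.lc b) u
    rw [h2 u hu]; omega
  have hs₁ : Searching P b k W 0 (s.arr (.deg .adj)) s₁ := by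
    refine ⟨e1 ▸ hl.heap, ⟨⟨fun u hu => ?_, fun u hu j hj => absurd hj (hno u hu j),
      fun u hu j hj => absurd hj (hno u hu j), fun u hu j hj => absurd hj (hno u hu j),
      fun u hu j j' _ hj => absurd hj (hno u hu j')⟩, fun u hu j hj => absurd hj (hno u hu j),
      fun p hp hlt => ?_, fun p hp hlt => ?_, fun p hp hlt => ?_, fun p hp hlt => ?_,
      fun w hw => ?_, fun u hu j hj => absurd hj (hno u hu j)⟩, ?_, ?_⟩
    · show s₁.arr (.lc b) u ≤ k
      rw [h2 u hu]; omega
    all_goals try simp only [State.search, e1, e2, e3] at hlt ⊢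
    · rw [e4]; exact (hl.item p hp hlt).1
    · rw [(hl.item p hp hlt).2.1]; exact hWl _ (hl.item p hp hlt).2.2.1
    · exact (hl.item p hp hlt).2.2.1
    · rw [(hl.item p hp hlt).2.1, (hl.item p hp hlt).2.2.2]; exact .nil
    · obtain ⟨p, hp, a1, a2, a3⟩ := hl.source w hw
      refine .inl ⟨p, hp, ?_⟩
      simp [State.search, e1, e2, e3, a1, a2, a3]
    · rw [hwork, e4]; rfl
    · left
      rw [e4, add_zero]
      refine (Finset.card_le_card (t := Finset.range W.card) fun p hp => ?_).trans (by simp)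
      simp only [Finset.mem_filter, Finset.mem_range, State.search, e1] at hp ⊢
      exact (hl.item p hp.1 hp.2).1
  refine WP.loop (P.V + 2 * P.m * k) (fun i τ s' =>
      Searching P b k W i (s.arr (.deg .adj)) s' ∧ τ ≤ (13 * P.lam + 5 * k + 42) * i +
        (7 * P.lam + 14) * P.work (s'.search P b).cnt (s.arr (.deg .adj)))
    (by simp [he₁.V, he₁.m, e5]) (by simp [he₁.V, he₁.m, e5]; and_intros <;> omega) (by omega)
    ⟨⟨hs₁.heap, hs₁.inv, hs₁.top, hs₁.live⟩, by simp⟩ ?_ ?_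
  · rintro i τ s' hi hx hf ⟨h3, h4⟩
    have he' : Env P s' := he₁.frame hf (by cases b <;> rfl)
    have hdeg' : s'.arr (.deg .adj) = s.arr (.deg .adj) := by
      rw [← hdeg₁]; exact hf.arr _ (by cases b <;> rfl)
    have hkk' : s'.reg .kk = k := by rw [← e5]; exact hf.reg _ (by cases b <;> rfl)
    rw [← hdeg'] at h3
    refine (wp_searchStep (P := P) he' hkk' hkq hW h3).mono ?_
    rintro s'' t - ⟨g1, g2⟩
    rw [hdeg'] at g1 g2
    refine ⟨⟨g1.heap, g1.inv, g1.top, g1.live⟩, ?_⟩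
    have : ((s''.setR .it (i + 1)).search P b).cnt = (s''.search P b).cnt := rfl
    rw [this]
    ring_nf at h4 g2 ⊢
    omega
  · rintro τ s' - hf ⟨h3, h4⟩
    have hw := he.work_le h3.inv.cnt_le
    -- Now the number of steps is at least `top`, the number of insertions.
    have hlive : (s'.search P b).live P = 0 := by
      rcases h3.live with h | h
      · have := h3.top; omega
      · exact h
    have hleaf := Search.leaf_eq_top hlive
    refine ⟨?_, ⟨h3.heap, hleaf⟩, h3.inv.nearest hWl hleaf⟩
    have h5 : (7 * P.lam + 14) * P.work (s'.search P b).cnt (s.arr (.deg .adj)) ≤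
      (7 * P.lam + 14) * (P.V + 2 * P.m * k) := Nat.mul_le_mul_left _ (by omega)
    nlinarith

end

end DistOracle

namespace DistOracle

/-- The distance in the network. -/
noncomputable def Setup.dist (P : Setup) (a u : ℕ) : ℝ≥0∞ := ⨅ (l : ℝ≥0∞) (_ : P.Path a u l), l

section

variable {P : Setup} {s : State} {b : Bool} {k : ℕ} {W : Finset ℕ}

theorem Setup.dist_le {a u : ℕ} {l : ℝ≥0∞} (p : P.Path a u l) : P.dist a u ≤ l := iInf₂_le l p

theorem Setup.dist_comm (a u : ℕ) : P.dist a u = P.dist u a :=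
  le_antisymm (le_iInf₂ fun _ p => Setup.dist_le p.symm) (le_iInf₂ fun _ p => Setup.dist_le p.symm)

/-- A recorded value is the length of some walk, and completeness applied to a listed source shows
that no walk is shorter. -/
theorem Search.Nearest.dist_eq {D : Search} (h : D.Nearest P k W) {u j : ℕ} (hu : u < P.V)
    (hj : j < D.cnt u) : D.dist u j = P.dist (D.lab u j) u :=
  le_antisymm (le_iInf₂ fun l p => h.eq_of_done hu hj (h.done _ (h.mem u hu j hj) u l p))
    (Setup.dist_le (h.path u hu j hj))

/-- With a single source the search computes distances; an empty list means that `u` is not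
reachable. -/
theorem Search.Nearest.dist_one {D : Search} {a u : ℕ} (h : D.Nearest P 1 {a}) (hu : u < P.V) :
    P.dist a u = if D.cnt u < 1 then ⊤ else D.dist u 0 := by
  split
  · next hc =>
    refine iInf₂_eq_top.2 fun l p => ?_
    rcases h.done a (Finset.mem_singleton_self a) u l p with ⟨j, hj, -⟩ | ⟨e, -⟩ <;> omega
  · next hc =>
    rw [h.dist_eq hu (by omega), Finset.mem_singleton.1 (h.mem u hu 0 (by omega))]

/-! ### Loading the sources -/

/-- Makes the vertex in the register `x` a source. -/
def pushSource (x : Reg) : Stmt := .set .pv ♯x ;; .set .pl ♯x ;; .wset .pk .zero ;; push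

theorem wp_pushSource {x : Reg} {w : ℕ} (he : Env P s) (hl : Loaded P W s) (hx : s.reg x = w)
    (hxpl : x ≠ .pv) (hw : w ∉ W) (hV : W.card < P.V) :
    WP P.B P.M (pushSource x) s fun s' t => t = 7 * P.lam + 10 ∧ Loaded P (insert w W) s' := by
  have hB := P.M_lt_B
  have hM := P.pw_le_M
  have hsz := P.size_le (k := 1) (by omega)
  have hV1 := P.V_pos
  simp only [pushSource, wp_seq, wp_set, wp_wset]
  simp [hxpl, hx]
  refine (wp_push (q := W.card) (lam := P.lam) (pw := P.pw) (by simpa using he.lam) P.pw_eq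
    (by omega) hB (by simpa using he.pw) (by simpa using hl.top) (by omega)
    (by simpa using hl.heap)).mono ?_
  rintro s' t hf ⟨h1, h2, h3, h4, h5, h6⟩
  simp at h3 h4 h5
  refine ⟨by omega, h2, ?_, fun p hp hlt => ?_, fun v hv => ?_⟩
  · rw [h6, Finset.card_insert_of_notMem hw]
  · rw [h3] at hlt ⊢
    rw [h4, h5, Finset.card_insert_of_notMem hw]
    by_cases hpc : p = W.card
    · simp [hpc]
    · rw [if_neg hpc] at hlt
      obtain ⟨g1, g2, g3, g4⟩ := hl.item p hp hlt
      simp only [if_neg hpc, Function.update_of_ne hpc]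
      exact ⟨by omega, g2, Finset.mem_insert_of_mem g3, g4⟩
  · rcases Finset.mem_insert.1 hv with rfl | hv
    · exact ⟨W.card, by omega, by simp [h3], by simp [h4], by simp [h5]⟩
    · obtain ⟨p, hp, g1, g2, g3⟩ := hl.source v hv
      have hpc : p ≠ W.card := by
        have := (hl.item p hp (by rw [g1]; exact ENNReal.zero_lt_top)).1
        omega
      exact ⟨p, hp, by simp [h3, hpc, g1], by simp [h4, hpc, g2], by simp [h5, hpc, g3]⟩

/-- A finished search leaves only leaves with key `⊤`. Setting `top` to zero is all that is needed
to use the tree again. -/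
theorem EmptyQueue.loaded (h : EmptyQueue P s) : Loaded P ∅ (s.setR .top 0) :=
  ⟨h.heap, by simp, fun p hp hl => absurd (h.leaf p hp) (by simpa using hl.ne), by simp⟩

/-- Makes the vertices of `inW` the sources, and resets `score` and `cn`. -/
def loadSources : Stmt :=
  .set .top 0 ;;
  .loop .u ♯.V (.load .w .inW ♯.u ;; .store .score ♯.u 0 ;;
    .when (.lt 0 ♯.w) (.store .cn ♯.u 0 ;; pushSource .u))

theorem wp_loadSources (he : Env P s) (hq : EmptyQueue P s) (hW : W ⊆ Finset.range P.V)
    (hin : ∀ u < P.V, 0 < s.arr .inW u ↔ u ∈ W) :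
    WP P.B P.M loadSources s fun s' t => t ≤ P.V * (7 * P.lam + 20) + 3 ∧ Loaded P W s' ∧
      (∀ u < P.V, s'.arr .score u = 0) ∧
      ∀ u < P.V, s'.arr .cn u = if u ∈ W then 0 else s.arr .cn u := by
  have hB := P.M_lt_B
  have hM := P.pw_le_M
  have hsz := P.size_le (k := 1) (by omega)
  have hV1 := P.V_pos
  simp only [loadSources, wp_seq, wp_set]
  refine ⟨by simp; omega, ?_⟩
  refine WP.loop P.V (fun i τ s' => τ ≤ i * (7 * P.lam + 20) ∧ Loaded P (W.filter (· < i)) s' ∧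
      (∀ u < i, s'.arr .score u = 0) ∧
      ∀ u < P.V, s'.arr .cn u = if u ∈ W ∧ u < i then 0 else s.arr .cn u)
    he.V (by simp) (by omega) ?_ ?_ ?_
  · refine ⟨by simp, ?_, by simp, by simp⟩
    have := hq.loaded
    simpa using ⟨this.heap, this.top, this.item, this.source⟩
  · rintro i τ s' hi hx hf ⟨h1, h2, h3, h4⟩
    have e1 : s'.arr .inW = s.arr .inW := hf.arr _ rfl
    have he' : Env P s' := Env.frame (s := s.setR .top 0)
      ⟨he.1, he.2, he.3, he.4, he.5, he.6, he.7, he.8, he.9⟩ hf rfl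
    have hcost : τ + (7 * P.lam + 20) ≤ (i + 1) * (7 * P.lam + 20) := by rw [add_mul]; omega
    have hsc : ∀ u, u ≤ i → Function.update (s'.arr .score) i 0 u = 0 := fun u hu => by
      rw [Function.update_apply]; split
      · rfl
      · exact h3 u (by omega)
    simp only [wp_seq, wp_load, wp_store, wp_when]
    simp [hx, e1, hin i hi]
    and_intros <;> try omega
    · intro hiW
      and_intros <;> try omega
      have hni : i ∉ W.filter (· < i) := by simp
      have hcard : (W.filter (· < i)).card < P.V := by
        have h5 : W.filter (· < i) ⊆ Finset.range i := fun u hu => by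
          simpa using (Finset.mem_filter.1 hu).2
        have := Finset.card_le_card h5
        simp at this; omega
      refine (wp_pushSource (P := P) (W := W.filter (· < i)) (x := .u) (w := i)
        (s := ((s'.setR .w (s.arr .inW i)).setA .score i 0).setA .cn i 0)
        ⟨he'.1, he'.2, he'.3, he'.4, he'.5, he'.6, by simpa using he'.7, by simpa using he'.8,
          by simpa using he'.9⟩ ?_ (by simpa using hx) (by decide) hni hcard).mono ?_
      · refine ⟨by simpa using h2.heap, by simpa using h2.top, ?_, ?_⟩
        · simpa using h2.item
        · simpa using h2.source
      · rintro s'' t hf' ⟨g1, g2⟩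
        have e2 : s''.arr .score = Function.update (s'.arr .score) i 0 := by
          rw [hf'.arr _ rfl]; simp
        have e3 : s''.arr .cn = Function.update (s'.arr .cn) i 0 := by
          rw [hf'.arr _ rfl]; simp
        refine ⟨by omega, ?_, ?_, ?_⟩
        · have : W.filter (· ≤ i) = insert i (W.filter (· < i)) := by
            ext u
            simp only [Finset.mem_filter, Finset.mem_insert]
            constructor
            · rintro ⟨h6, h7⟩
              by_cases hui : u = i
              · exact .inl hui
              · exact .inr ⟨h6, by omega⟩
            · rintro (rfl | ⟨h6, h7⟩)
              · exact ⟨hiW, by omega⟩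
              · exact ⟨h6, by omega⟩
          rw [this]
          exact ⟨g2.heap, g2.top, g2.item, g2.source⟩
        · intro u hu
          simp only [e2]
          exact hsc u (by omega)
        · intro u hu
          simp only [e3, Function.update_apply]
          by_cases hui : u = i
          · subst hui; simp [hiW]
          · rw [if_neg hui, h4 u hu]
            have : u ≤ i ↔ u < i := by omega
            simp [this]
    · intro hiW
      refine ⟨by omega, ?_, fun u hu => hsc u (by omega), fun u hu => ?_⟩
      · have : W.filter (· ≤ i) = W.filter (· < i) := by
          refine Finset.filter_congr fun u hu => ?_
          have : u ≠ i := fun e => hiW (e ▸ hu)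
          omega
        rw [this]
        refine ⟨by simpa using h2.heap, by simpa using h2.top, ?_, ?_⟩
        · simpa using h2.item
        · simpa using h2.source
      · rw [h4 u hu]
        by_cases hui : u = i
        · subst hui; simp [hiW]
        · have : u ≤ i ↔ u < i := by omega
          simp [this]
  · rintro τ s' - hf ⟨h1, h2, h3, h4⟩
    have hWf : W.filter (· < P.V) = W :=
      Finset.filter_true_of_mem fun u hu => Finset.mem_range.1 (hW hu)
    rw [hWf] at h2
    refine ⟨by omega, h2, h3, fun u hu => ?_⟩
    rw [h4 u hu]; simp [hu]

/-! ### Hitting the lists -/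

/-- The number of vertices in `U` that have `w` among their first `k` sources. -/
def scoreOf (U : Finset ℕ) (k : ℕ) (lab : ℕ → ℕ → ℕ) (w : ℕ) : ℕ :=
  {u ∈ U | ∃ j < k, lab u j = w}.card

theorem scoreOf_insert {U : Finset ℕ} {lab : ℕ → ℕ → ℕ} {u : ℕ} (hu : u ∉ U) (w : ℕ) :
    scoreOf (insert u U) k lab w =
      scoreOf U k lab w + if ∃ j < k, lab u j = w then 1 else 0 := by
  rw [scoreOf, Finset.filter_insert]
  split
  · rw [Finset.card_insert_of_notMem (by simp [hu])]; rfl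
  · rfl

theorem scoreOf_le (U : Finset ℕ) (lab : ℕ → ℕ → ℕ) (w : ℕ) : scoreOf U k lab w ≤ U.card :=
  Finset.card_filter_le _ _

/-- Double counting: each vertex of `U` contributes to exactly `k` different sources. Averaging over
`W` then yields a source with a high score. -/
theorem sum_scoreOf {U : Finset ℕ} {lab : ℕ → ℕ → ℕ} (hW : ∀ u ∈ U, ∀ j < k, lab u j ∈ W)
    (hinj : ∀ u ∈ U, ∀ j < k, ∀ j' < k, lab u j = lab u j' → j = j') :
    ∑ w ∈ W, scoreOf U k lab w = k * U.card := by
  have h1 : ∀ w, scoreOf U k lab w = ∑ u ∈ U, if ∃ j < k, lab u j = w then 1 else 0 := fun w => by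
    rw [scoreOf, Finset.card_filter]
  simp only [h1]
  rw [Finset.sum_comm, mul_comm, ← smul_eq_mul, ← Finset.sum_const]
  refine Finset.sum_congr rfl fun u hu => ?_
  rw [← Finset.card_filter]
  have : {w ∈ W | ∃ j < k, lab u j = w} = (Finset.range k).image (lab u) := by
    ext w
    simp only [Finset.mem_filter, Finset.mem_image, Finset.mem_range]
    constructor
    · rintro ⟨-, h⟩; exact h
    · rintro ⟨j, hj, rfl⟩; exact ⟨hW u hu j hj, j, hj, rfl⟩
  rw [this, Finset.card_image_of_injOn, Finset.card_range]
  intro j hj j' hj' e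
  exact hinj u hu j (by simpa using hj) j' (by simpa using hj') e

/-- Increments or decrements the scores of the list of `gu`. -/
def bump (e : Exp) : Stmt :=
  .loop .gj ♯.k (.load .gw (.ll false) (♯.gj * ♯.V + ♯.gu) ;; .load .gy .score ♯.gw ;;
    .store .score ♯.gw e)

/-- The entries of a list are different, so every score changes by at most one. The decrement is
stated additively, to avoid truncated subtraction. -/
theorem wp_bump {u : ℕ} (up : Bool) (he : Env P s) (hk : s.reg .k = k) (hkq : k ≤ P.q + 1)
    (hu : s.reg .gu = u) (huV : u < P.V)
    (hlab : ∀ j < k, (s.search P false).lab u j < P.V)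
    (hinj : ∀ j < k, ∀ j' < k, (s.search P false).lab u j = (s.search P false).lab u j' → j = j')
    (hle : ∀ w < P.V, s.arr .score w ≤ P.V)
    (hpos : up = false → ∀ j < k, 0 < s.arr .score ((s.search P false).lab u j)) :
    WP P.B P.M (bump (if up then ♯.gy + 1 else ♯.gy - 1)) s fun s' t => t ≤ 5 * k + 2 ∧
      ∀ w, (up = true → s'.arr .score w = s.arr .score w +
        if ∃ j < k, (s.search P false).lab u j = w then 1 else 0) ∧
        (up = false → s'.arr .score w + (if ∃ j < k, (s.search P false).lab u j = w then 1 else 0) =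
          s.arr .score w) := by
  have hB := P.M_lt_B
  have hM := P.pw_le_M
  have hsz := P.size_le (k := 1) (by omega)
  have hV1 := P.V_pos
  have hkV := P.mul_V_le (k := k) (by omega)
  have hkp : k ≤ P.pw := (Nat.le_mul_of_pos_right k hV1).trans hkV
  rw [bump]
  refine WP.loop k (fun i τ s' => τ ≤ 5 * i ∧
      ∀ w, (up = true → s'.arr .score w = s.arr .score w +
        if ∃ j < i, (s.search P false).lab u j = w then 1 else 0) ∧
        (up = false → s'.arr .score w + (if ∃ j < i, (s.search P false).lab u j = w then 1 else 0) =
          s.arr .score w)) hk (by simp) (by omega) (by simp) ?_ ?_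
  · rintro i τ s' hi hx hf ⟨h1, h2⟩
    have e1 : s'.reg .V = P.V := by rw [hf.reg _ (by cases up <;> rfl)]; exact he.V
    have e2 : s'.reg .gu = u := by rw [hf.reg _ (by cases up <;> rfl)]; exact hu
    obtain ⟨w, hw⟩ : ∃ w, (s.search P false).lab u i = w := ⟨_, rfl⟩
    have e3 : s'.arr (.ll false) (i * P.V + u) = w :=
      (congrFun (hf.arr (.ll false) (by cases up <;> rfl)) _).trans hw
    have hiu := mul_add_lt hi huV
    have hwV : w < P.V := hw ▸ hlab i hi
    have hsc := hle w hwV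
    have hnot : ¬ ∃ j < i, (s.search P false).lab u j = w := by
      rintro ⟨j, hj, e⟩
      have := hinj j (by omega) i hi (e.trans hw.symm)
      omega
    have hcur := h2 w
    simp only [if_neg hnot, add_zero] at hcur
    have hcur' : s'.arr .score w = s.arr .score w := by
      cases up
      · exact hcur.2 rfl
      · exact hcur.1 rfl
    have hex : ∀ w', (∃ j < i + 1, (s.search P false).lab u j = w') ↔
        (∃ j < i, (s.search P false).lab u j = w') ∨ w' = w := fun w' => by
      constructor
      · rintro ⟨j, hj, e⟩
        rcases (show j ≤ i by omega).lt_or_eq with h | rfl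
        · exact .inl ⟨j, h, e⟩
        · exact .inr (e.symm.trans hw)
      · rintro (⟨j, hj, e⟩ | rfl)
        · exact ⟨j, by omega, e⟩
        · exact ⟨i, by omega, hw⟩
    have hp := hpos
    cases up
    · have := hp rfl i hi
      rw [hw] at this
      simp [hx, e1, e2, e3, hcur']
      and_intros <;> try omega
      intro w'
      rw [Function.update_apply]
      have h4 := (h2 w').2 rfl
      have h5 := hex w'
      simp only [← Nat.lt_succ_iff, Nat.succ_eq_add_one] at h5 ⊢
      by_cases hww : w' = w
      · subst hww
        rw [if_pos rfl, if_pos (h5.2 (.inr rfl))]; omega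
      · rw [if_neg hww, ← h4]
        congr 1
        simp only [h5, hww, or_false]
    · simp [hx, e1, e2, e3, hcur']
      and_intros <;> try omega
      intro w'
      rw [Function.update_apply]
      have h4 := (h2 w').1 rfl
      have h5 := hex w'
      simp only [← Nat.lt_succ_iff, Nat.succ_eq_add_one] at h5 ⊢
      by_cases hww : w' = w
      · subst hww
        rw [if_pos rfl, if_pos (h5.2 (.inr rfl))]
      · rw [if_neg hww, h4]
        congr 1
        simp only [h5, hww, or_false]
  · rintro τ s' - hf ⟨h1, h2⟩
    exact ⟨by omega, h2⟩

end

end DistOracle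

namespace DistOracle

/-! ### Choosing the centers -/

/-- The vertices with `k` sources, all of them nearer than the centers. -/
noncomputable def unsat (P : Setup) (D : Search) (k : ℕ) (r : ℕ → ℝ≥0∞) : Finset ℕ :=
  {u ∈ Finset.range P.V | D.cnt u = k ∧ D.dist u (k - 1) < r u}

/-- The state holds the lists of `D`. -/
structure Lists (P : Setup) (D : Search) (s : State) : Prop where
  cnt : s.arr (.lc false) = D.cnt
  lab : ∀ u j, s.arr (.ll false) (j * P.V + u) = D.lab u j
  dist : ∀ u j, s.warr (.ld false) (j * P.V + u) = D.dist u j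

/-- The scores of the sources, with respect to the set `U` of unsatisfied vertices. -/
structure Scored (P : Setup) (D : Search) (k : ℕ) (U : Finset ℕ) (s : State) : Prop where
  sat : ∀ u < P.V, 0 < s.arr .sat u ↔ u ∉ U
  score : ∀ w < P.V, s.arr .score w = scoreOf U k D.lab w

/-- The centers chosen so far, with their distances. -/
structure Centers (P : Setup) (s : State) : Prop where
  dist : ∃ C : ℕ → ℕ, ∀ c < s.reg .ac, ∀ u < P.V, s.warr .dA (c * P.V + u) = P.dist (C c) u
  le : ∀ c < s.reg .ac, ∀ u < P.V, s.warr .r u ≤ s.warr .dA (c * P.V + u)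
  pc : ∀ u < P.V, s.warr .r u = ⊤ ∨
    s.arr .pc u < s.reg .ac ∧ s.warr .r u = s.warr .dA (s.arr .pc u * P.V + u)
  pc_le : ∀ u < P.V, s.arr .pc u ≤ s.reg .ac

/-- Selects a source with the highest score. -/
def selectBest : Stmt :=
  .set .bs 0 ;; .loop .gs ♯.V (.load .gt .score ♯.gs ;;
    .when (.lt ♯.bs ♯.gt) (.set .bs ♯.gt ;; .set .best ♯.gs))

/-- Loads the distance of `gu` from the current center. -/
def fetchDist : Stmt :=
  .load .c (.lc true) ♯.gu ;;
  .ite (.lt ♯.c 1) (.wset .d1 .infty) (.wload .d1 (.ld true) ♯.gu)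

/-- Updates the nearest center of `gu`. -/
def relaxCenter : Stmt :=
  .wstore .dA (♯.ac * ♯.V + ♯.gu) (.r .d1) ;;
  .wload .rr .r ♯.gu ;;
  .when (.wlt (.r .d1) (.r .rr)) (.wstore .r ♯.gu (.r .d1) ;; .store .pc ♯.gu ♯.ac)

/-- Updates the scores if `gu` has become satisfied. -/
def settle : Stmt :=
  .load .gt .sat ♯.gu ;;
  .when (.lt ♯.gt 1) (.wload .rho (.ld false) ((♯.k - 1) * ♯.V + ♯.gu) ;;
    .when (.not (.wlt (.r .rho) (.r .d1))) (.store .sat ♯.gu 1 ;; bump (♯.gy - 1)))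

/-- Stores the distances from the current center. -/
def centerUpdate : Stmt :=
  .loop .gu ♯.V (fetchDist ;; relaxCenter ;; settle) ;; .set .ac (♯.ac + 1)

/-- Adds a center. -/
def greedyStep : Stmt :=
  selectBest ;; .when (.lt 0 ♯.bs)
    (.set .top 0 ;; pushSource .best ;; .set .kk 1 ;; knn true ;; centerUpdate)

/-- Determines the unsatisfied vertices and their scores. -/
def initScores : Stmt :=
  .loop .gu ♯.V (
    .load .c (.lc false) ♯.gu ;; .store .sat ♯.gu 1 ;;
    .when (.not (.lt ♯.c ♯.k)) (
      .wload .rho (.ld false) ((♯.k - 1) * ♯.V + ♯.gu) ;;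
      .wload .rr .r ♯.gu ;;
      .when (.wlt (.r .rho) (.r .rr)) (.store .sat ♯.gu 0 ;; bump (♯.gy + 1))))

section

variable {P : Setup} {D : Search} {s : State} {k : ℕ} {W U : Finset ℕ}

theorem unsat_update_of {r : ℕ → ℝ≥0∞} {u : ℕ} {x : ℝ≥0∞}
    (h : u ∈ unsat P D k r → D.dist u (k - 1) < x) (hx : x ≤ r u) :
    unsat P D k (Function.update r u x) = unsat P D k r := by
  ext v
  simp only [unsat, Finset.mem_filter, Finset.mem_range, Function.update_apply] at h ⊢
  by_cases hv : v = u
  · subst hv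
    rw [if_pos rfl]
    constructor
    · rintro ⟨a, b, c⟩; exact ⟨a, b, c.trans_le hx⟩
    · rintro ⟨a, b, c⟩; exact ⟨a, b, h ⟨a, b, c⟩⟩
  · rw [if_neg hv]

theorem unsat_update_erase {r : ℕ → ℝ≥0∞} {u : ℕ} {x : ℝ≥0∞} (h : ¬ D.dist u (k - 1) < x) :
    unsat P D k (Function.update r u x) = (unsat P D k r).erase u := by
  ext v
  simp only [unsat, Finset.mem_filter, Finset.mem_range, Function.update_apply, Finset.mem_erase]
  by_cases hv : v = u
  · subst hv; simp [h]
  · simp [hv]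

theorem wp_selectBest (he : Env P s) :
    WP P.B P.M selectBest s fun s' t => t ≤ 6 * P.V + 3 ∧
      (∀ w < P.V, s.arr .score w ≤ s'.reg .bs) ∧
      (0 < s'.reg .bs → s'.reg .best < P.V ∧ s.arr .score (s'.reg .best) = s'.reg .bs) := by
  have hB := P.M_lt_B
  have hM := P.pw_le_M
  have hsz := P.size_le (k := 1) (by omega)
  have hV1 := P.V_pos
  simp only [selectBest, wp_seq, wp_set]
  refine ⟨by simp; omega, ?_⟩
  refine WP.loop P.V (fun i τ s' => τ ≤ 6 * i ∧ (∀ w < i, s.arr .score w ≤ s'.reg .bs) ∧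
      (0 < s'.reg .bs → s'.reg .best < P.V ∧ s.arr .score (s'.reg .best) = s'.reg .bs))
    he.V (by simp) (by omega) (by simp) ?_ ?_
  · rintro i τ s' hi hx hf ⟨h1, h2, h3⟩
    have e1 : s'.arr .score = s.arr .score := hf.arr _ rfl
    simp [hx, e1]
    and_intros <;> try omega
    · intro hlt
      refine ⟨by omega, fun w hw => ?_, fun _ => hi⟩
      rcases hw.lt_or_eq with h | rfl
      · exact (h2 w h).trans hlt.le
      · exact le_rfl
    · intro hle
      refine ⟨by omega, fun w hw => ?_, h3⟩
      rcases hw.lt_or_eq with h | rfl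
      · exact h2 w h
      · exact hle
  · rintro τ s' - hf ⟨h1, h2, h3⟩
    exact ⟨by omega, h2, h3⟩

theorem wp_fetchDist {a u : ℕ} (hn : (s.search P true).Nearest P 1 {a}) (hu : u < P.V)
    (hgu : s.reg .gu = u) :
    WP P.B P.M fetchDist s fun s' t => t ≤ 3 ∧ s'.wreg .d1 = P.dist a u := by
  have hB := P.M_lt_B
  have hM := P.pw_le_M
  have hsz := P.size_le (k := 1) (by omega)
  have := hn.dist_one hu
  simp only [State.search, zero_mul, zero_add] at this
  simp [fetchDist, hgu]
  and_intros <;> try omega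
  · intro h; simp [this, h]
  · intro h; rw [this, if_neg (by omega)]; and_intros <;> first | omega | rfl

theorem wp_relaxCenter {u c : ℕ} {d : ℝ≥0∞} (hV : s.reg .V = P.V) (hu : u < P.V)
    (hgu : s.reg .gu = u) (hd : s.wreg .d1 = d) (hc : s.reg .ac = c) (hcM : (c + 1) * P.V ≤ P.M) :
    WP P.B P.M relaxCenter s fun s' t => t ≤ 5 ∧
      s'.warr .dA = Function.update (s.warr .dA) (c * P.V + u) d ∧
      s'.warr .r = Function.update (s.warr .r) u (min (s.warr .r u) d) ∧
      s'.arr .pc = Function.update (s.arr .pc) u (if d < s.warr .r u then c else s.arr .pc u) := by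
  have hB := P.M_lt_B
  have hM := P.pw_le_M
  have hsz := P.size_le (k := 1) (by omega)
  rw [add_mul] at hcM
  simp [relaxCenter, hgu, hd, hc, hV]
  and_intros <;> try omega
  · intro h; simp [h, min_eq_right h.le]; omega
  · intro h; simp [not_lt.2 h]; exact h

theorem Search.Nearest.lab_lt (hn : D.Nearest P k W) (hW : W ⊆ Finset.range P.V) {u j : ℕ}
    (hu : u < P.V) (hj : j < D.cnt u) : D.lab u j < P.V :=
  Finset.mem_range.1 (hW (hn.mem u hu j hj))

/-- Adjusting the scores costs about `5 * k`, but it happens only when `u` leaves the set of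
unsatisfied vertices, to which it never returns. This set therefore serves as potential, with `5 * k
+ 4` units per vertex. -/
theorem wp_settle {u : ℕ} {d : ℝ≥0∞} {r : ℕ → ℝ≥0∞} (he : Env P s) (hk : s.reg .k = k)
    (hk1 : 1 ≤ k) (hkq : k ≤ P.q + 1) (hl : Lists P D s) (hn : D.Nearest P k W)
    (hW : W ⊆ Finset.range P.V) (hu : u < P.V) (hgu : s.reg .gu = u) (hd : s.wreg .d1 = d)
    (hs : Scored P D k (unsat P D k r) s) :
    WP P.B P.M settle s fun s' t =>
      t + (5 * k + 4) * (unsat P D k (Function.update r u (min (r u) d))).card ≤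
        12 + (5 * k + 4) * (unsat P D k r).card ∧
      Scored P D k (unsat P D k (Function.update r u (min (r u) d))) s' := by
  have hB := P.M_lt_B
  have hM := P.pw_le_M
  have hsz := P.size_le (k := 1) (by omega)
  have hkV := P.mul_V_le (k := k) (by omega)
  have hku := mul_add_lt (show k - 1 < k by omega) hu
  have hkp : k ≤ P.pw := (Nat.le_mul_of_pos_right k P.V_pos).trans hkV
  have hsu := hs.sat u hu
  simp only [settle, wp_seq, wp_load, wp_when]
  simp [hgu, hk, he.V, hl.dist, hd]
  and_intros <;> try omega
  swap
  · intro h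
    have hnu := hsu.1 (by omega)
    rw [unsat_update_of (fun h' => absurd h' hnu) (min_le_left _ _)]
    exact ⟨by omega, ⟨hs.sat, hs.score⟩⟩
  intro h0
  have hmem : u ∈ unsat P D k r := by by_contra h; have := hsu.2 h; omega
  have hmem' := hmem
  simp only [unsat, Finset.mem_filter, Finset.mem_range] at hmem'
  obtain ⟨-, hcu, hru⟩ := hmem'
  and_intros <;> try omega
  swap
  · intro h
    rw [unsat_update_of (fun _ => lt_min hru h) (min_le_left _ _)]
    exact ⟨by omega, ⟨hs.sat, hs.score⟩⟩
  intro hle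
  have hnlt : ¬ D.dist u (k - 1) < min (r u) d := fun h => absurd (h.trans_le (min_le_right _ _))
    (not_lt.2 hle)
  rw [unsat_update_erase hnlt]
  have hUV : unsat P D k r ⊆ Finset.range P.V := Finset.filter_subset _ _
  have hUc : (unsat P D k r).card ≤ P.V := by simpa using Finset.card_le_card hUV
  have hins : unsat P D k r = insert u ((unsat P D k r).erase u) := (Finset.insert_erase hmem).symm
  have hcard := Finset.card_erase_add_one hmem
  have hscore : ∀ w < P.V, s.arr .score w = scoreOf ((unsat P D k r).erase u) k D.lab w +
      if ∃ j < k, D.lab u j = w then 1 else 0 := fun w hw => by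
    rw [hs.score w hw]
    conv_lhs => rw [hins]
    exact scoreOf_insert (by simp) w
  refine ⟨by omega, ?_⟩
  have hlab : ∀ u' j, s.arr (.ll false) (j * P.V + u') = D.lab u' j := hl.lab
  refine (wp_bump (P := P) (k := k) (u := u) (up := false)
    (s := ((s.setR .gt (s.arr .sat u)).setW .rho (D.dist u (k - 1))).setA .sat u 1)
    ⟨he.1, he.2, he.3, he.4, he.5, he.6, by simpa using he.7, by simpa using he.8, he.9⟩
    (by simpa using hk) hkq (by simpa using hgu) hu ?_ ?_ ?_ ?_).mono ?_
  · intro j hj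
    simpa [State.search, hlab] using hn.lab_lt hW hu (hcu.symm ▸ hj)
  · intro j hj j' hj'
    simpa [State.search, hlab] using hn.inj u hu j (hcu.symm ▸ hj) j' (hcu.symm ▸ hj')
  · intro w hw
    simpa [hs.score w hw] using (scoreOf_le (k := k) _ _ _).trans hUc
  · intro _ j hj
    simp [State.search, hlab]
    rw [hscore _ (hn.lab_lt hW hu (hcu.symm ▸ hj)), if_pos ⟨j, hj, rfl⟩]
    omega
  · rintro s' t hf ⟨h1, h2⟩
    simp [State.search, hlab] at h2
    refine ⟨?_, ⟨fun v hv => ?_, fun w hw => ?_⟩⟩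
    · rw [← hcard, mul_add]; omega
    · rw [hf.arr _ rfl]
      simp only [State.setA_arr, State.setW_arr, State.setR_arr, if_true, Function.update_apply,
        Finset.mem_erase]
      by_cases hvu : v = u
      · simp [hvu]
      · simp [hvu]
        exact hs.sat v hv
    · have h3 := h2 w
      have h4 := hscore w hw
      omega

/-- The vertex `a` becomes the center with number `ac`, and its distances fill the row `ac` of the
table. Along the way `r` takes minima, and the scores follow the shrinking set of unsatisfied
vertices. -/
theorem wp_centerUpdate {a : ℕ} (he : Env P s) (hk : s.reg .k = k)
    (hk1 : 1 ≤ k) (hkq : k ≤ P.q + 1) (hl : Lists P D s) (hn : D.Nearest P k W)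
    (hW : W ⊆ Finset.range P.V) (ha : (s.search P true).Nearest P 1 {a})
    (hs : Scored P D k (unsat P D k (s.warr .r)) s) (hc : Centers P s)
    (hcM : (s.reg .ac + 1) * P.V ≤ P.M) :
    WP P.B P.M centerUpdate s fun s' t =>
      t + (5 * k + 4) * (unsat P D k (s'.warr .r)).card ≤
        22 * P.V + 3 + (5 * k + 4) * (unsat P D k (s.warr .r)).card ∧
      Scored P D k (unsat P D k (s'.warr .r)) s' ∧ Centers P s' ∧ s'.reg .ac = s.reg .ac + 1 ∧
      (∀ u < P.V, s'.warr .r u = min (s.warr .r u) (P.dist a u)) := by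
  have hB := P.M_lt_B
  have hM := P.pw_le_M
  have hsz := P.size_le (k := 1) (by omega)
  have hV1 := P.V_pos
  simp only [centerUpdate, wp_seq]
  obtain ⟨c, hac⟩ : ∃ c, s.reg .ac = c := ⟨_, rfl⟩
  rw [hac] at hcM
  have hcB : c + 1 < P.B := lt_of_le_of_lt (Nat.le_mul_of_pos_right _ hV1) (lt_of_le_of_lt hcM hB)
  refine WP.loop P.V (fun i τ s' => τ + (5 * k + 4) * (unsat P D k (s'.warr .r)).card ≤
        22 * i + (5 * k + 4) * (unsat P D k (s.warr .r)).card ∧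
      Scored P D k (unsat P D k (s'.warr .r)) s' ∧
      (∀ u < P.V, s'.warr .r u =
        if u < i then min (s.warr .r u) (P.dist a u) else s.warr .r u) ∧
      (∀ u < P.V, s'.arr .pc u =
        if u < i ∧ P.dist a u < s.warr .r u then c else s.arr .pc u) ∧
      (∀ j, ∀ u < P.V, s'.warr .dA (j * P.V + u) =
        if j = c ∧ u < i then P.dist a u else s.warr .dA (j * P.V + u)))
    he.V (by simp) (by omega) ?_ ?_ ?_
  · exact ⟨by simp, ⟨hs.sat, hs.score⟩, by simp, by simp, by simp⟩
  · rintro i τ s' hi hx hf ⟨h1, h2, h3, h4, h5⟩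
    have he' := he.frame hf rfl
    have e1 : s'.arr (.lc true) = s.arr (.lc true) := hf.arr _ rfl
    have e2 : s'.warr (.ld true) = s.warr (.ld true) := hf.warr _ rfl
    have e3 : s'.reg .ac = c := by rw [hf.reg _ rfl]; exact hac
    have e4 : s'.reg .k = k := by rw [hf.reg _ rfl]; exact hk
    have e5 : s'.arr (.lc false) = s.arr (.lc false) := hf.arr _ rfl
    have e6 : s'.arr (.ll false) = s.arr (.ll false) := hf.arr _ rfl
    have e7 : s'.warr (.ld false) = s.warr (.ld false) := hf.warr _ rfl
    have e8 : s'.arr (.ll true) = s.arr (.ll true) := hf.arr _ rfl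
    -- `Nearest` concerns only the lists; the queue components of the search data are irrelevant.
    have ha' : (s'.search P true).Nearest P 1 {a} := by
      have : (s'.search P true) = { s.search P true with
          leaf := (s'.search P true).leaf, qv := (s'.search P true).qv,
          ql := (s'.search P true).ql } := by
        simp only [State.search, e1, e2, e8]
      rw [this]
      exact ⟨⟨ha.cnt_le, ha.mem, ha.path, ha.inj, ha.mono⟩, ha.done⟩
    simp only [wp_seq]
    refine (wp_fetchDist (P := P) ha' hi hx).mono ?_
    rintro s₁ t₁ hf₁ ⟨g1, g2⟩
    refine (wp_relaxCenter (P := P) (u := i) (c := c) ((hf₁.reg _ rfl).trans he'.V) hi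
      ((hf₁.reg _ rfl).trans hx) g2 ((hf₁.reg _ rfl).trans e3) hcM).mono ?_
    rintro s₂ t₂ hf₂ ⟨g3, g4, g5, g6⟩
    have he₂ : Env P s₂ := (he'.frame hf₁ rfl).frame hf₂ rfl
    have hl₂ : Lists P D s₂ := by
      refine ⟨?_, ?_, ?_⟩
      · rw [hf₂.arr _ rfl, hf₁.arr _ rfl, e5]; exact hl.cnt
      · rw [hf₂.arr _ rfl, hf₁.arr _ rfl, e6]; exact hl.lab
      · rw [hf₂.warr _ rfl, hf₁.warr _ rfl, e7]; exact hl.dist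
    rw [hf₁.warr _ rfl] at g4 g5
    rw [hf₁.arr .pc rfl, hf₁.warr .r rfl] at g6
    refine (wp_settle (P := P) (D := D) (W := W) (u := i) (r := s'.warr .r) he₂
      ((hf₂.reg _ rfl).trans ((hf₁.reg _ rfl).trans e4)) hk1 hkq hl₂ hn hW hi
      ((hf₂.reg _ rfl).trans ((hf₁.reg _ rfl).trans hx)) ((hf₂.wreg _ rfl).trans g2) ?_).mono ?_
    · refine ⟨?_, ?_⟩
      · rw [hf₂.arr _ rfl, hf₁.arr _ rfl]; exact h2.sat
      · rw [hf₂.arr _ rfl, hf₁.arr _ rfl]; exact h2.score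
    rintro s₃ t₃ hf₃ ⟨g7, g8⟩
    have k1 : s₃.warr .r = _ := (hf₃.warr _ rfl).trans g5
    have k2 : s₃.arr .pc = _ := (hf₃.arr _ rfl).trans g6
    have k3 : s₃.warr .dA = _ := (hf₃.warr _ rfl).trans g4
    refine ⟨?_, ⟨?_, ?_⟩, ?_, ?_, ?_⟩
    · simp only [State.setR_warr, k1]; omega
    · simp only [State.setR_warr, k1]; exact g8.sat
    · simp only [State.setR_warr, k1]; exact g8.score
    · intro u hu
      simp only [State.setR_warr, k1, Function.update_apply, h3 _ hi, h3 _ hu]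
      by_cases hui : u = i
      · subst hui; simp
      · have : u < i + 1 ↔ u < i := by omega
        simp [hui, this]
    · intro u hu
      simp only [State.setR_arr, k2, Function.update_apply, h3 _ hi, h4 _ hi, h4 _ hu]
      by_cases hui : u = i
      · subst hui; simp
      · have : u < i + 1 ↔ u < i := by omega
        simp [hui, this]
    · intro j u hu
      have := mul_add_inj (j := j) (j' := c) hu hi
      simp only [State.setR_warr, k3, Function.update_apply, this, h5 j u hu]
      by_cases hj : j = c
      · by_cases hui : u = i
        · subst hui; simp [hj]
        · have : u < i + 1 ↔ u < i := by omega
          simp [hui, this]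
      · simp [hj]
  · rintro τ s' - hf ⟨h1, h2, h3, h4, h5⟩
    have e3 : s'.reg .ac = c := by rw [hf.reg _ rfl]; exact hac
    have hr : ∀ u < P.V, s'.warr .r u = min (s.warr .r u) (P.dist a u) := fun u hu => by
      rw [h3 u hu, if_pos hu]
    simp only [wp_set]
    simp [e3]
    refine ⟨by omega, by omega, ⟨h2.sat, h2.score⟩, ?_, by omega, hr⟩
    obtain ⟨C, hC⟩ := hc.dist
    rw [hac] at hC
    have hcle := hc.le
    have hcpc := hc.pc
    have hpl := hc.pc_le
    rw [hac] at hcle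
    simp only [hac] at hcpc hpl
    have hdA : ∀ j, ∀ u < P.V, j < c + 1 → s'.warr .dA (j * P.V + u) =
        P.dist (if j = c then a else C j) u := fun j u hu hj => by
      rw [h5 j u hu]
      by_cases hjc : j = c
      · simp [hjc, hu]
      · simp [hjc]; exact hC j (by omega) u hu
    refine ⟨⟨fun j => if j = c then a else C j, fun j hj u hu => hdA j u hu (by simpa using hj)⟩,
      fun j hj u hu => ?_, fun u hu => ?_, fun u hu => ?_⟩
    · have hj : j < c + 1 := by simpa using hj
      simp only [State.setR_warr]
      rw [hr u hu, h5 j u hu]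
      by_cases hjc : j = c
      · simp [hjc, hu]
      · simp [hjc]
        exact .inl (hcle j (by omega) u hu)
    · simp only [State.setR_warr, State.setR_arr, State.setR_reg, if_true]
      rw [hr u hu, h4 u hu]
      by_cases hlt : P.dist a u < s.warr .r u
      · right
        simp [hu, hlt, hlt.le, h5 c u hu]
      · rw [not_lt] at hlt
        rw [if_neg (fun h => absurd h.2 (not_lt.2 hlt)), min_eq_left hlt]
        rcases hcpc u hu with h | ⟨h, h'⟩
        · exact .inl h
        · right
          refine ⟨by omega, ?_⟩
          rw [h5 _ u hu, if_neg (by omega)]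
          exact h'
    · simp only [State.setR_arr, State.setR_reg, if_true]
      have := hpl u hu
      rw [h4 u hu]; split <;> omega

theorem wp_initScores (he : Env P s) (hk : s.reg .k = k)
    (hk1 : 1 ≤ k) (hkq : k ≤ P.q + 1) (hl : Lists P D s) (hn : D.Nearest P k W)
    (hW : W ⊆ Finset.range P.V) (hs : ∀ w < P.V, s.arr .score w = 0) :
    WP P.B P.M initScores s fun s' t => t ≤ P.V * (5 * k + 14) + 2 ∧
      Scored P D k (unsat P D k (s.warr .r)) s' := by
  have hB := P.M_lt_B
  have hM := P.pw_le_M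
  have hsz := P.size_le (k := 1) (by omega)
  have hV1 := P.V_pos
  have hkV := P.mul_V_le (k := k) (by omega)
  have hkp : k ≤ P.pw := (Nat.le_mul_of_pos_right k P.V_pos).trans hkV
  set U := unsat P D k (s.warr .r) with hU
  have hUV : U ⊆ Finset.range P.V := Finset.filter_subset _ _
  have hUc : U.card ≤ P.V := by simpa using Finset.card_le_card hUV
  rw [initScores]
  refine WP.loop P.V (fun i τ s' => τ ≤ i * (5 * k + 14) ∧
      (∀ u < i, 0 < s'.arr .sat u ↔ u ∉ U) ∧
      ∀ w < P.V, s'.arr .score w = scoreOf (U.filter (· < i)) k D.lab w)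
    he.V (by simp) (by omega) ?_ ?_ ?_
  · refine ⟨by simp, by simp, fun w hw => ?_⟩
    simp [scoreOf, hs w hw]
  · rintro i τ s' hi hx hf ⟨h1, h2, h3⟩
    have he' := he.frame hf rfl
    have e4 : s'.reg .k = k := by rw [hf.reg _ rfl]; exact hk
    have e5 : s'.arr (.lc false) = D.cnt := (hf.arr _ rfl).trans hl.cnt
    have e6 : s'.warr .r = s.warr .r := hf.warr _ rfl
    have e7 : ∀ u j, s'.warr (.ld false) (j * P.V + u) = D.dist u j := fun u j => by
      rw [hf.warr _ rfl]; exact hl.dist u j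
    have e8 : ∀ u j, s'.arr (.ll false) (j * P.V + u) = D.lab u j := fun u j => by
      rw [hf.arr _ rfl]; exact hl.lab u j
    have hku := mul_add_lt (show k - 1 < k by omega) hi
    have hcost : (i + 1) * (5 * k + 14) = i * (5 * k + 14) + (5 * k + 14) := by ring
    have hck := hn.cnt_le i hi
    have hUi : i ∉ U.filter (· < i) := by simp
    have hUs : U.filter (· ≤ i) = if i ∈ U then insert i (U.filter (· < i))
        else U.filter (· < i) := by
      ext v
      simp only [Finset.mem_filter]
      split
      · next h =>
        simp only [Finset.mem_insert, Finset.mem_filter]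
        by_cases hv : v = i
        · subst hv; simp [h]
        · simp only [hv, false_or, and_congr_right_iff]; omega
      · next h =>
        by_cases hv : v = i
        · subst hv; simp [h]
        · simp only [Finset.mem_filter, and_congr_right_iff]; omega
    have hsat : ∀ x : ℕ, (0 < x ↔ i ∉ U) → ∀ u ≤ i,
        (0 < Function.update (s'.arr .sat) i x u ↔ u ∉ U) := fun x hx u hu => by
      rw [Function.update_apply]
      by_cases hui : u = i
      · subst hui; simpa using hx
      · rw [if_neg hui]; exact h2 u (by omega)
    have hiU : i ∈ U ↔ D.cnt i = k ∧ D.dist i (k - 1) < s.warr .r i := by simp [U, unsat, hi]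
    simp [hx, e5, e4, he'.V, e7, e6]
    and_intros <;> try omega
    swap
    · intro hlt
      have : i ∉ U := fun h => by have := (hiU.1 h).1; omega
      rw [if_neg this] at hUs
      rw [hUs]
      exact ⟨by omega, hsat 1 (by simp [this]), h3⟩
    intro hkc
    and_intros <;> try omega
    swap
    · intro hle
      have : i ∉ U := fun h => absurd (hiU.1 h).2 (not_lt.2 hle)
      rw [if_neg this] at hUs
      rw [hUs]
      exact ⟨by omega, hsat 1 (by simp [this]), h3⟩
    intro hlt
    have hmem : i ∈ U := hiU.2 ⟨by omega, hlt⟩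
    rw [if_pos hmem] at hUs
    refine ⟨by omega, ?_⟩
    refine (wp_bump (P := P) (k := k) (u := i) (up := true)
      (s := ((((s'.setR .c (D.cnt i)).setA .sat i 1).setW .rho (D.dist i (k - 1))).setW .rr
        (s.warr .r i)).setA .sat i 0)
      ⟨he'.1, he'.2, he'.3, he'.4, he'.5, he'.6, by simpa using he'.7, by simpa using he'.8,
        he'.9⟩ (by simpa using e4) hkq (by simpa using hx) hi ?_ ?_ ?_ (by simp)).mono ?_
    · intro j hj
      simpa [State.search, e8] using hn.lab_lt hW hi (show j < D.cnt i by omega)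
    · intro j hj j' hj'
      simpa [State.search, e8] using hn.inj i hi j (show j < D.cnt i by omega) j'
        (show j' < D.cnt i by omega)
    · intro w hw
      simp only [State.setA_arr, State.setW_arr, State.setR_arr, reduceCtorEq, if_false, h3 w hw]
      exact (scoreOf_le (k := k) _ _ _).trans
        ((Finset.card_le_card (Finset.filter_subset _ _)).trans hUc)
    · rintro s'' t hf' ⟨g1, g2⟩
      simp [State.search, e8] at g2
      refine ⟨by omega, ?_, fun w hw => ?_⟩
      · simp only [State.setR_arr, hf'.arr .sat rfl, State.setA_arr, State.setW_arr, if_true,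
          Function.update_idem]
        exact hsat 0 (by simp [hmem])
      · simp only [g2 w, h3 w hw]
        rw [hUs, scoreOf_insert hUi]
  · rintro τ s' - hf ⟨h1, h2, h3⟩
    have : U.filter (· < P.V) = U :=
      Finset.filter_true_of_mem fun u hu => Finset.mem_range.1 (hUV hu)
    rw [this] at h3
    exact ⟨by omega, h2, h3⟩

/-- The state during the choice of the centers. -/
structure Greedy (P : Setup) (D : Search) (k : ℕ) (s : State) : Prop where
  env : Env P s
  kreg : s.reg .k = k
  lists : Lists P D s
  queue : EmptyQueue P s
  scored : Scored P D k (unsat P D k (s.warr .r)) s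
  centers : Centers P s

/-- If `b` is among the first `k` sources of `u`, then as a center it is no farther from `u` than
the last of them, so `u` becomes satisfied. Hence all vertices counted by the score of `b` leave the
set. -/
theorem unsat_card_le (hn : D.Nearest P k W) {r r' : ℕ → ℝ≥0∞} {b : ℕ}
    (hr : ∀ u < P.V, r' u = min (r u) (P.dist b u)) :
    (unsat P D k r').card + scoreOf (unsat P D k r) k D.lab b ≤ (unsat P D k r).card := by
  rw [scoreOf, ← Finset.card_union_of_disjoint]
  · refine Finset.card_le_card fun u hu => ?_
    rcases Finset.mem_union.1 hu with hu | hu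
    · simp only [unsat, Finset.mem_filter, Finset.mem_range] at hu ⊢
      rw [hr u hu.1] at hu
      exact ⟨hu.1, hu.2.1, hu.2.2.trans_le (min_le_left _ _)⟩
    · exact (Finset.mem_filter.1 hu).1
  · refine Finset.disjoint_left.2 fun u hu hu' => ?_
    simp only [unsat, Finset.mem_filter, Finset.mem_range] at hu hu'
    obtain ⟨⟨hV, hc, -⟩, j, hj, rfl⟩ := hu'
    have h1 := hu.2.2
    rw [hr u hV] at h1
    have h2 := Setup.dist_le (hn.path u hV j (by omega))
    have h3 := hn.mono u hV j (k - 1) (by omega) (by omega)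
    exact absurd (h1.trans_le ((min_le_right _ _).trans h2)) (not_lt.2 h3)

/-- The scores add up to `k * |U|` over `W`, so the best source satisfies at least the fraction `k /
|W|` of the unsatisfied vertices `U`. The third conclusion says this without division. -/
theorem wp_greedyStep (hg : Greedy P D k s) (hk1 : 1 ≤ k) (hkq : k ≤ P.q + 1)
    (hn : D.Nearest P k W) (hW : W ⊆ Finset.range P.V) (hcM : (s.reg .ac + 1) * P.V ≤ P.M) :
    WP P.B P.M greedyStep s fun s' t => Greedy P D k s' ∧
      t + (5 * k + 4) * (unsat P D k (s'.warr .r)).card ≤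
        (P.V + 2 * P.m) * (27 * P.lam + 130) + (5 * k + 4) * (unsat P D k (s.warr .r)).card ∧
      W.card * (unsat P D k (s'.warr .r)).card + k * (unsat P D k (s.warr .r)).card ≤
        W.card * (unsat P D k (s.warr .r)).card ∧
      s'.reg .ac ≤ s.reg .ac + 1 ∧ ∀ u < P.V, s'.warr .r u ≤ s.warr .r u := by
  have hB := P.M_lt_B
  have hM := P.pw_le_M
  have hsz := P.size_le (k := 1) (by omega)
  have hV1 := P.V_pos
  have hm1 := P.m_pos
  have hq1 := P.q_pos
  set U := unsat P D k (s.warr .r) with hU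
  have hsum : ∑ w ∈ W, scoreOf U k D.lab w = k * U.card := by
    refine sum_scoreOf (fun u hu j hj => ?_) fun u hu j hj j' hj' => ?_ <;>
      simp only [U, unsat, Finset.mem_filter, Finset.mem_range] at hu
    · exact hn.mem u hu.1 j (by omega)
    · exact hn.inj u hu.1 j (by omega) j' (by omega)
  have hbound : 30 * P.V + 7 * P.lam + 30 + (P.V + 2 * P.m) * (20 * P.lam + 75) ≤
      (P.V + 2 * P.m) * (27 * P.lam + 130) := by
    -- `V + 2 * m ≥ 3` absorbs the terms of the cost that are not multiples of the size of the
    -- network.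
    have h1 : 3 * P.lam ≤ (P.V + 2 * P.m) * P.lam := Nat.mul_le_mul_right _ (by omega)
    have h2 : (P.V + 2 * P.m) * (27 * P.lam + 130) =
      27 * ((P.V + 2 * P.m) * P.lam) + 130 * P.V + 260 * P.m := by ring
    have h3 : (P.V + 2 * P.m) * (20 * P.lam + 75) =
      20 * ((P.V + 2 * P.m) * P.lam) + 75 * P.V + 150 * P.m := by ring
    omega
  simp only [greedyStep, wp_seq]
  refine (wp_selectBest (P := P) hg.env).mono ?_
  rintro s₁ t₁ hf₁ ⟨h1, h2, h3⟩
  have he₁ := hg.env.frame hf₁ rfl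
  have hl₁ : Lists P D s₁ := by
    refine ⟨?_, ?_, ?_⟩
    · rw [hf₁.arr _ rfl]; exact hg.lists.cnt
    · rw [hf₁.arr _ rfl]; exact hg.lists.lab
    · rw [hf₁.warr _ rfl]; exact hg.lists.dist
  have hq₁ : EmptyQueue P s₁ := by
    have := hf₁.warr .tree rfl
    exact ⟨this ▸ hg.queue.heap, this ▸ hg.queue.leaf⟩
  have hs₁ : Scored P D k U s₁ := by
    refine ⟨?_, ?_⟩
    · rw [hf₁.arr _ rfl]; exact hg.scored.sat
    · rw [hf₁.arr _ rfl]; exact hg.scored.score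
  have e1 : s₁.reg .ac = s.reg .ac := hf₁.reg _ rfl
  have e2 : s₁.warr .dA = s.warr .dA := hf₁.warr _ rfl
  have e3 : s₁.warr .r = s.warr .r := hf₁.warr _ rfl
  have e4 : s₁.arr .pc = s.arr .pc := hf₁.arr _ rfl
  have e5 : s₁.reg .k = k := (hf₁.reg _ rfl).trans hg.kreg
  have hc₁ : Centers P s₁ := by
    have := hg.centers
    refine ⟨?_, ?_, ?_, ?_⟩ <;> simp only [e1, e2, e3, e4]
    exacts [this.dist, this.le, this.pc, this.pc_le]
  have hle : k * U.card ≤ W.card * s₁.reg .bs := by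
    rw [← hsum, ← smul_eq_mul, ← Finset.sum_const]
    refine Finset.sum_le_sum fun w hw => ?_
    have hwV := Finset.mem_range.1 (hW hw)
    rw [← hg.scored.score w hwV]
    exact h2 w hwV
  simp only [wp_when]
  simp only [Cond.ok_lt, Cond.holds_lt, Exp.ok_zero, Exp.ok_r, Exp.eval_zero, Exp.eval_r, wp_seq,
    wp_set, not_lt, nonpos_iff_eq_zero]
  refine ⟨⟨by omega, trivial⟩, fun hbs => ⟨by omega, ?_⟩, fun hbs => ?_⟩
  swap
  -- If all scores vanish, nothing is left to satisfy; idle steps are harmless.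
  · have hU0 : k * U.card = 0 := by rw [hbs, mul_zero] at hle; omega
    refine ⟨⟨he₁, e5, hl₁, hq₁, by rw [e3]; exact hs₁, hc₁⟩, ?_, ?_, by omega, fun u hu => ?_⟩
    · rw [e3, ← hU]; omega
    · rw [e3, ← hU, hU0]; omega
    · rw [e3]
  obtain ⟨hbV, hbs'⟩ := h3 hbs
  obtain ⟨b, hb⟩ : ∃ b, s₁.reg .best = b := ⟨_, rfl⟩
  rw [hb] at hbV hbs'
  have hl0 : Loaded P ∅ (s₁.setR .top 0) := hq₁.loaded
  refine (wp_pushSource (P := P) (W := ∅) (x := .best) (w := b) (s := s₁.setR .top 0)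
    ⟨he₁.1, he₁.2, he₁.3, he₁.4, he₁.5, he₁.6, he₁.7, he₁.8, he₁.9⟩ hl0 (by simpa using hb)
    (by decide) (by simp) (by simp; omega)).mono ?_
  rintro s₂ t₂ hf₂ ⟨h4, h5⟩
  have he₂ : Env P s₂ := Env.frame (s := s₁.setR .top 0)
    ⟨he₁.1, he₁.2, he₁.3, he₁.4, he₁.5, he₁.6, he₁.7, he₁.8, he₁.9⟩ hf₂ rfl
  refine ⟨by simp; omega, ?_⟩
  refine (wp_knn (P := P) (b := true) (k := 1) (W := {b}) (s := s₂.setR .kk 1)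
    ⟨he₂.1, he₂.2, he₂.3, he₂.4, he₂.5, he₂.6, he₂.7, he₂.8, he₂.9⟩ (by simp) (by omega)
    (by simpa using hbV) ?_).mono ?_
  · rw [LawfulSingleton.insert_empty_eq] at h5
    exact ⟨h5.heap, h5.top, h5.item, h5.source⟩
  rintro s₃ t₃ hf₃ ⟨h6, h7, h8⟩
  have he₃ : Env P s₃ := Env.frame (s := s₂.setR .kk 1)
    ⟨he₂.1, he₂.2, he₂.3, he₂.4, he₂.5, he₂.6, he₂.7, he₂.8, he₂.9⟩ hf₃ rfl
  have hA : ∀ a, (pushSource .best).modA a = false → (knn true).modA a = false →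
      s₃.arr a = s₁.arr a := fun a ha ha' => (hf₃.arr a ha').trans (hf₂.arr a ha)
  have hWA : ∀ a, (pushSource .best).modWA a = false → (knn true).modWA a = false →
      s₃.warr a = s₁.warr a := fun a ha ha' => (hf₃.warr a ha').trans (hf₂.warr a ha)
  have hR : ∀ x, (pushSource .best).modR x = false → (knn true).modR x = false → x ≠ .kk →
      x ≠ .top → s₃.reg x = s₁.reg x := fun x hx hx' h h' => by
    rw [hf₃.reg x hx', State.setR_reg, if_neg h, hf₂.reg x hx, State.setR_reg, if_neg h']
  have f1 : s₃.warr .r = s₁.warr .r := hWA _ rfl rfl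
  have f2 : s₃.reg .ac = s₁.reg .ac := hR _ rfl rfl (by decide) (by decide)
  have f3 : s₃.warr .dA = s₁.warr .dA := hWA _ rfl rfl
  have f4 : s₃.arr .pc = s₁.arr .pc := hA _ rfl rfl
  have hl₃ : Lists P D s₃ := by
    refine ⟨?_, ?_, ?_⟩
    · rw [hA _ rfl rfl]; exact hl₁.cnt
    · rw [hA _ rfl rfl]; exact hl₁.lab
    · rw [hWA _ rfl rfl]; exact hl₁.dist
  refine (wp_centerUpdate (P := P) (D := D) (k := k) (W := W) (a := b) he₃
    ((hR _ rfl rfl (by decide) (by decide)).trans e5) hk1 hkq hl₃ hn hW h8 ?_ ?_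
    (by rw [f2, e1]; exact hcM)).mono ?_
  · rw [f1, e3]
    refine ⟨?_, ?_⟩
    · rw [hA _ rfl rfl]; exact hs₁.sat
    · rw [hA _ rfl rfl]; exact hs₁.score
  · refine ⟨?_, ?_, ?_, ?_⟩ <;> simp only [f1, f2, f3, f4]
    exacts [hc₁.dist, hc₁.le, hc₁.pc, hc₁.pc_le]
  rintro s₄ t₄ hf₄ ⟨h9, h10, h11, h12, h13⟩
  rw [f1, e3] at h13 h9
  have hdec := unsat_card_le (r := s.warr .r) (r' := s₄.warr .r) hn h13
  rw [← hU] at hdec h9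
  have hbsc : scoreOf U k D.lab b = s₁.reg .bs := by
    rw [← hg.scored.score b hbV]; exact hbs'
  refine ⟨⟨he₃.frame hf₄ rfl, ?_, ?_, ?_, h10, h11⟩, ?_, ?_, ?_, fun u hu => ?_⟩
  · rw [hf₄.reg _ rfl, hR _ rfl rfl (by decide) (by decide)]; exact e5
  · refine ⟨?_, ?_, ?_⟩
    · rw [hf₄.arr _ rfl]; exact hl₃.cnt
    · rw [hf₄.arr _ rfl]; exact hl₃.lab
    · rw [hf₄.warr _ rfl]; exact hl₃.dist
  · have := hf₄.warr .tree rfl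
    exact ⟨this ▸ h7.heap, this ▸ h7.leaf⟩
  · simp only [mul_one] at h6
    have : (P.V + 2 * P.m) * (20 * P.lam + 5 + 70) = (P.V + 2 * P.m) * (20 * P.lam + 75) := by ring
    omega
  · have h14 : W.card * ((unsat P D k (s₄.warr .r)).card + s₁.reg .bs) ≤ W.card * U.card :=
      Nat.mul_le_mul_left _ (hbsc ▸ hdec)
    rw [mul_add] at h14
    omega
  · rw [h12, f2, e1]
  · rw [h13 u hu]; exact min_le_left _ _

end

end DistOracle

/-! ### Hitting all lists, and recording the clusters -/

namespace DistOracle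

/-- Adds enough centers to satisfy all vertices. -/
def chooseCenters : Stmt := .loop .gc ((♯.nW / ♯.k + 1) * ♯.lam) greedyStep

/-- Enters `gu` into the cluster of its `gj`-th source. -/
def recordEntry : Stmt :=
  .wload .d1 (.ld false) (♯.gj * ♯.V + ♯.gu) ;;
  .when (.wlt (.r .d1) (.r .rr)) (
    .load .gw (.ll false) (♯.gj * ♯.V + ♯.gu) ;;
    .load .gy .cn ♯.gw ;;
    .when (.lt ♯.gy ♯.cap) (
      .store .clu (♯.gy * ♯.V + ♯.gw) ♯.gu ;;
      .wstore .cld (♯.gy * ♯.V + ♯.gw) (.r .d1)) ;;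
    .store .cn ♯.gw (♯.gy + 1))

/-- Enters all vertices into the clusters. -/
def recordClusters : Stmt :=
  .loop .gu ♯.V (.load .c (.lc false) ♯.gu ;; .wload .rr .r ♯.gu ;; .loop .gj ♯.c recordEntry)

/-- Keeps the sources whose clusters are too large. -/
def filterSources : Stmt :=
  .set .nW 0 ;;
  .loop .gu ♯.V (.load .gw .inW ♯.gu ;; .when (.lt 0 ♯.gw) (.load .gy .cn ♯.gu ;;
    .ite (.lt ♯.cap ♯.gy) (.set .nW (♯.nW + 1)) (.store .inW ♯.gu 0)))

/-- Halves the number of vertices with large clusters. -/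
def clusterRound : Stmt :=
  .set .k (♯.q * ♯.nW / ♯.V + 1) ;; .set .kk ♯.k ;; loadSources ;; knn false ;; initScores ;;
  chooseCenters ;; recordClusters ;; filterSources

/-- Chooses centers such that all clusters are small, and determines the clusters. -/
def buildClusters : Stmt := .loop .rd ♯.lam clusterRound

section

variable {P : Setup} {D : Search} {s : State} {k : ℕ} {W U : Finset ℕ}

/-- The usual analysis of the greedy hitting set: after `i` steps at most `V * exp (-k * i / |W|)`
vertices are unsatisfied. For `i = J` the exponent is at most `-lam`, and `V < 2 ^ lam`, so fewer
than one is left. -/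
theorem wp_chooseCenters {J : ℕ} (hg : Greedy P D k s) (hk1 : 1 ≤ k) (hkq : k ≤ P.q + 1)
    (hn : D.Nearest P k W) (hW : W ⊆ Finset.range P.V) (hnW : s.reg .nW = W.card)
    (hJ : J = (W.card / k + 1) * P.lam) (hcM : (s.reg .ac + J) * P.V ≤ P.M) :
    WP P.B P.M chooseCenters s fun s' t => Greedy P D k s' ∧ unsat P D k (s'.warr .r) = ∅ ∧
      t ≤ J * ((P.V + 2 * P.m) * (27 * P.lam + 130) + 2) + (5 * k + 4) * P.V + 2 ∧
      s'.reg .ac ≤ s.reg .ac + J ∧ ∀ u < P.V, s'.warr .r u ≤ s.warr .r u := by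
  have hB := P.M_lt_B
  have hM := P.pw_le_M
  have hsz := P.size_le (k := 1) (by omega)
  have hV1 := P.V_pos
  have hWc : W.card ≤ P.V := by simpa using Finset.card_le_card hW
  have hJM : s.reg .ac + J ≤ P.M := (Nat.le_mul_of_pos_right _ hV1).trans hcM
  have hdiv : W.card / k ≤ W.card := Nat.div_le_self _ _
  have hUc : ∀ r, (unsat P D k r).card ≤ P.V := fun r => by
    simpa using Finset.card_le_card (show unsat P D k r ⊆ Finset.range P.V from
      Finset.filter_subset _ _)
  rw [chooseCenters]
  refine WP.loop J (fun i τ s' => Greedy P D k s' ∧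
      τ + (5 * k + 4) * (unsat P D k (s'.warr .r)).card ≤
        i * ((P.V + 2 * P.m) * (27 * P.lam + 130) + 2) +
          (5 * k + 4) * (unsat P D k (s.warr .r)).card ∧
      ((unsat P D k (s'.warr .r)).card : ℝ) ≤ P.V * Real.exp (-(k * i / W.card)) ∧
      s'.reg .ac ≤ s.reg .ac + i ∧ ∀ u < P.V, s'.warr .r u ≤ s.warr .r u)
    ?_ ?_ (by omega) ?_ ?_ ?_
  · simp [hnW, hg.kreg, hg.env.lam, hJ]
  · simp [hnW, hg.kreg, hg.env.lam, ← hJ]; omega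
  · refine ⟨⟨⟨hg.env.1, hg.env.2, hg.env.3, hg.env.4, hg.env.5, hg.env.6, hg.env.7, hg.env.8,
      hg.env.9⟩, hg.kreg, ⟨hg.lists.1, hg.lists.2, hg.lists.3⟩, ⟨hg.queue.1, hg.queue.2⟩,
      ⟨hg.scored.1, hg.scored.2⟩, ⟨hg.centers.1, hg.centers.2, hg.centers.3, hg.centers.4⟩⟩,
      by simp, ?_, by simp, by simp⟩
    simpa using hUc _
  · rintro i τ s' hi hx hf ⟨h1, h2, h3, h4, h5⟩
    have h6 : (s'.reg .ac + 1) * P.V ≤ P.M := (Nat.mul_le_mul_right _ (by omega)).trans hcM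
    refine (wp_greedyStep (P := P) h1 hk1 hkq hn hW h6).mono ?_
    rintro s'' t hf' ⟨g1, g2, g3, g4, g5⟩
    refine ⟨⟨⟨g1.env.1, g1.env.2, g1.env.3, g1.env.4, g1.env.5, g1.env.6, g1.env.7, g1.env.8,
      g1.env.9⟩, g1.kreg, ⟨g1.lists.1, g1.lists.2, g1.lists.3⟩, ⟨g1.queue.1, g1.queue.2⟩,
      ⟨g1.scored.1, g1.scored.2⟩, ⟨g1.centers.1, g1.centers.2, g1.centers.3, g1.centers.4⟩⟩,
      ?_, ?_, ?_, fun u hu => ?_⟩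
    · simp only [State.setR_warr]
      have : ∀ S, (i + 1) * S = i * S + S := fun S => by ring
      rw [this]; omega
    · simp only [State.setR_warr]
      rcases Nat.eq_zero_or_pos W.card with hw | hw
      · rw [hw]; simpa using hUc _
      · have hw' : (0 : ℝ) < W.card := by exact_mod_cast hw
        have g3' : (W.card : ℝ) * (unsat P D k (s''.warr .r)).card +
            k * (unsat P D k (s'.warr .r)).card ≤ W.card * (unsat P D k (s'.warr .r)).card := by
          exact_mod_cast g3
        have h7 : ((unsat P D k (s''.warr .r)).card : ℝ) ≤
            (unsat P D k (s'.warr .r)).card * (1 - k / W.card) := by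
          have : ((unsat P D k (s'.warr .r)).card : ℝ) * (1 - k / W.card) =
              (W.card * (unsat P D k (s'.warr .r)).card - k * (unsat P D k (s'.warr .r)).card) /
                W.card := by field_simp
          rw [this, le_div_iff₀ hw']
          linarith
        -- The step multiplies the number of unsatisfied vertices by at most `1 - k / |W|`.
        have h8 : (1 - k / W.card : ℝ) ≤ Real.exp (-(k / W.card)) := by
          have := Real.add_one_le_exp (-(k / W.card : ℝ)); linarith
        calc ((unsat P D k (s''.warr .r)).card : ℝ) ≤
              (unsat P D k (s'.warr .r)).card * Real.exp (-(k / W.card)) :=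
              h7.trans (mul_le_mul_of_nonneg_left h8 (by positivity))
          _ ≤ P.V * Real.exp (-(k * i / W.card)) * Real.exp (-(k / W.card)) :=
              mul_le_mul_of_nonneg_right h3 (Real.exp_pos _).le
          _ = P.V * Real.exp (-(k * (i + 1 : ℕ) / W.card)) := by
              rw [mul_assoc, ← Real.exp_add]; push_cast; ring_nf
    · simp; omega
    · exact (g5 u hu).trans (h5 u hu)
  · rintro τ s' - hf ⟨h1, h2, h3, h4, h5⟩
    refine ⟨h1, ?_, ?_, h4, h5⟩
    -- Without sources the exponential bound is void, but then no list can be full, since `k ≥ 1`.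
    · rcases Nat.eq_zero_or_pos W.card with hw | hw
      · rw [Finset.card_eq_zero] at hw
        refine Finset.eq_empty_of_forall_notMem fun u hu => ?_
        simp only [unsat, Finset.mem_filter, Finset.mem_range] at hu
        have := hn.mem u hu.1 0 (by omega)
        simp [hw] at this
      · have hw' : (0 : ℝ) < W.card := by exact_mod_cast hw
        -- The summand `1` in `J` makes up for the rounding in `|W| / k`.
        have h6 : (P.lam : ℝ) ≤ k * J / W.card := by
          rw [le_div_iff₀ hw']
          have : W.card ≤ k * (W.card / k + 1) := (Nat.lt_mul_div_succ _ hk1).le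
          have : P.lam * W.card ≤ k * J := by
            rw [hJ]
            calc P.lam * W.card ≤ P.lam * (k * (W.card / k + 1)) := Nat.mul_le_mul_left _ this
              _ = _ := by ring
          exact_mod_cast this
        have h7 : (P.V : ℝ) < 2 ^ P.lam := by
          have : P.V < 2 ^ P.lam := by have := P.pw_eq; have := P.m_pos; omega
          exact_mod_cast this
        have h8 : (2 : ℝ) ^ P.lam ≤ Real.exp P.lam := by
          have : (2 : ℝ) ≤ Real.exp 1 := by have := Real.add_one_le_exp (1 : ℝ); linarith
          calc (2 : ℝ) ^ P.lam ≤ Real.exp 1 ^ P.lam := pow_le_pow_left₀ (by norm_num) this _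
            _ = Real.exp P.lam := by rw [← Real.exp_nat_mul]; simp
        have h9 : ((unsat P D k (s'.warr .r)).card : ℝ) < 1 := by
          refine h3.trans_lt ?_
          calc P.V * Real.exp (-(k * J / W.card)) ≤ P.V * Real.exp (-P.lam) := by gcongr
            _ < Real.exp P.lam * Real.exp (-P.lam) := by
                gcongr; exact h7.trans_le h8
            _ = 1 := by rw [← Real.exp_add]; simp
        have : (unsat P D k (s'.warr .r)).card < 1 := by exact_mod_cast h9
        exact Finset.card_eq_zero.1 (by omega)
    · have := Nat.mul_le_mul_left (5 * k + 4) (hUc (s.warr .r))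
      omega

/-! ### Clusters -/

/-- The cluster of `w` is complete. -/
structure ClusterOK (P : Setup) (s : State) (w : ℕ) : Prop where
  card_le : s.arr .cn w ≤ 2 * P.q
  mem : ∀ j < s.arr .cn w, s.arr .clu (j * P.V + w) < P.V ∧
    s.warr .cld (j * P.V + w) = P.dist w (s.arr .clu (j * P.V + w))
  exists_mem : ∀ u < P.V, P.dist w u < s.warr .r u →
    ∃ j < s.arr .cn w, s.arr .clu (j * P.V + w) = u

/-- The clusters recorded so far. -/
structure Recorded (P : Setup) (D : Search) (W : Finset ℕ) (s₀ : State) (done : ℕ → ℕ → Prop)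
    (s : State) : Prop where
  cn : ∀ w < P.V, w ∉ W → s.arr .cn w = s₀.arr .cn w
  clu : ∀ w < P.V, w ∉ W → ∀ y, s.arr .clu (y * P.V + w) = s₀.arr .clu (y * P.V + w)
  cld : ∀ w < P.V, w ∉ W → ∀ y, s.warr .cld (y * P.V + w) = s₀.warr .cld (y * P.V + w)
  mem : ∀ w ∈ W, ∀ y < s.arr .cn w, y < 2 * P.q → s.arr .clu (y * P.V + w) < P.V ∧
    s.warr .cld (y * P.V + w) = P.dist w (s.arr .clu (y * P.V + w))
  exists_mem : ∀ u < P.V, ∀ j < D.cnt u, done u j → D.dist u j < s₀.warr .r u →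
    s.arr .cn (D.lab u j) ≤ 2 * P.q →
    ∃ y < s.arr .cn (D.lab u j), s.arr .clu (y * P.V + D.lab u j) = u

theorem Recorded.setR {s₀ : State} {done : ℕ → ℕ → Prop} (h : Recorded P D W s₀ done s) (x : Reg)
    (v : ℕ) : Recorded P D W s₀ done (s.setR x v) :=
  ⟨h.cn, h.clu, h.cld, h.mem, h.exists_mem⟩

theorem Recorded.done_mono {s₀ : State} {done done' : ℕ → ℕ → Prop} (h : Recorded P D W s₀ done s)
    (hd : ∀ u < P.V, ∀ j < D.cnt u, done' u j → done u j) : Recorded P D W s₀ done' s :=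
  ⟨h.cn, h.clu, h.cld, h.mem, fun u hu j hj hdn => h.exists_mem u hu j hj (hd u hu j hj hdn)⟩

/-- `cn` counts all members, but only the first `2 * q` are stored. Clusters that are too large are
thus recognized without exceeding the table, and completeness is claimed only for those that fit. -/
theorem wp_recordEntry {s₀ : State} {done : ℕ → ℕ → Prop} {u j N : ℕ} (he : Env P s)
    (hkq : k ≤ P.q + 1) (hl : Lists P D s) (hn : D.Nearest P k W)
    (hW : W ⊆ Finset.range P.V) (hu : u < P.V) (hj : j < D.cnt u) (hgu : s.reg .gu = u)
    (hgj : s.reg .gj = j) (hrr : s.wreg .rr = s₀.warr .r u)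
    (hs : Recorded P D W s₀ done s) (hN : ∑ w ∈ W, s.arr .cn w ≤ N) (hNp : N ≤ P.pw) :
    WP P.B P.M recordEntry s fun s' t => t ≤ 10 ∧
      Recorded P D W s₀ (fun u' j' => done u' j' ∨ (u' = u ∧ j' = j)) s' ∧
      ∑ w ∈ W, s'.arr .cn w ≤ N + if D.dist u j < s₀.warr .r u then 1 else 0 := by
  have hB := P.M_lt_B
  have hM := P.pw_le_M
  have hsz := P.size_le (k := 1) (by omega)
  have hV1 := P.V_pos
  have hck := hn.cnt_le u hu
  have hjV := mul_add_lt (show j < k by omega) hu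
  have hkV := P.mul_V_le (k := k) (by omega)
  have hkp : k ≤ P.pw := (Nat.le_mul_of_pos_right k P.V_pos).trans hkV
  have hcapV := P.mul_V_le (k := 2 * P.q) (by omega)
  have hcapp : 2 * P.q ≤ P.pw := (Nat.le_mul_of_pos_right _ P.V_pos).trans hcapV
  obtain ⟨w, hw⟩ : ∃ w, D.lab u j = w := ⟨_, rfl⟩
  have hwW : w ∈ W := hw ▸ hn.mem u hu j hj
  have hwV : w < P.V := Finset.mem_range.1 (hW hwW)
  have hdist : D.dist u j = P.dist w u := hw ▸ hn.dist_eq hu hj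
  obtain ⟨c, hc⟩ : ∃ c, s.arr .cn w = c := ⟨_, rfl⟩
  have hcN : c ≤ N := by
    rw [← hc]
    exact (Finset.single_le_sum (f := fun w => s.arr .cn w) (fun _ _ => Nat.zero_le _) hwW).trans hN
  have hsum : ∑ x ∈ W, Function.update (s.arr .cn) w (c + 1) x = ∑ x ∈ W, s.arr .cn x + 1 := by
    rw [← Finset.add_sum_erase _ _ hwW, ← Finset.add_sum_erase W (s.arr .cn) hwW]
    rw [Function.update_self, hc, Finset.sum_congr rfl fun x hx => Function.update_of_ne
      (Finset.ne_of_mem_erase hx) _ _]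
    omega
  -- Completeness is shown for both branches at once: in case of an overflow the premise `cn ≤ 2 *
  -- q` is false for `w`.
  have hexm : ∀ s' : State, s'.arr .cn = Function.update (s.arr .cn) w (c + 1) →
      (∀ y, y < 2 * P.q → ∀ x < P.V, s'.arr .clu (y * P.V + x) =
        if y = c ∧ x = w then u else s.arr .clu (y * P.V + x)) →
      ∀ u' < P.V, ∀ j' < D.cnt u', (done u' j' ∨ (u' = u ∧ j' = j)) →
      D.dist u' j' < s₀.warr .r u' → s'.arr .cn (D.lab u' j') ≤ 2 * P.q →
      ∃ y < s'.arr .cn (D.lab u' j'), s'.arr .clu (y * P.V + D.lab u' j') = u' := by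
    intro s' e1 e2 u' hu' j' hj' hd hlt hle
    have hlV := hn.lab_lt hW hu' hj'
    rw [e1, Function.update_apply] at hle ⊢
    rcases hd with hd | ⟨rfl, rfl⟩
    · have hle' : s.arr .cn (D.lab u' j') ≤ 2 * P.q := by
        split at hle
        · next h => rw [h]; omega
        · exact hle
      obtain ⟨y, hy, hyu⟩ := hs.exists_mem u' hu' j' hj' hd hlt hle'
      refine ⟨y, ?_, ?_⟩
      · split
        · next h => rw [h] at hy; omega
        · exact hy
      · rw [e2 y (by omega) _ hlV, if_neg, hyu]
        rintro ⟨rfl, h⟩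
        rw [h, hc] at hy; omega
    · rw [hw, if_pos rfl] at hle ⊢
      refine ⟨c, by omega, ?_⟩
      rw [e2 c (by omega) w hwV]; simp
  simp only [recordEntry, wp_seq, wp_wload, wp_when]
  simp [hgu, hgj, he.V, hrr, hl.dist]
  refine ⟨by omega, ?_, ?_⟩
  swap
  · intro hle
    refine ⟨⟨hs.cn, hs.clu, hs.cld, hs.mem, ?_⟩, ?_⟩
    · rintro u' hu' j' hj' (hd | ⟨rfl, rfl⟩) hlt hc'
      · exact hs.exists_mem u' hu' j' hj' hd hlt hc'
      · exact absurd hlt (not_lt.2 hle)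
    · rw [if_neg (not_lt.2 hle)]; exact hN
  intro hlt
  simp [hl.lab, hw, hc, he.cap, hlt]
  and_intros <;> try omega
  · intro hcq
    have hcV := mul_add_lt hcq hwV
    have hold : ∀ x < P.V, x ∉ W → x ≠ w := fun x _ hx e => hx (e ▸ hwW)
    refine ⟨by and_intros <;> omega, by and_intros <;> omega,
      ⟨fun x hx hxW => ?_, fun x hx hxW y => ?_, fun x hx hxW y => ?_, fun x hx y hy hyq => ?_,
        hexm _ (by simp) (fun y _ x hx => ?_)⟩, by simpa [hsum] using hN⟩
    · simp [hold x hx hxW]; exact hs.cn x hx hxW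
    · have := mul_add_inj (j := y) (j' := c) hx hwV
      simp [this, hold x hx hxW]
      exact hs.clu x hx hxW y
    · have := mul_add_inj (j := y) (j' := c) hx hwV
      simp [this, hold x hx hxW]
      exact hs.cld x hx hxW y
    · have := mul_add_inj (j := y) (j' := c) (Finset.mem_range.1 (hW hx)) hwV
      simp [Function.update_apply] at hy
      simp [Function.update_apply, this]
      by_cases hyx : y = c ∧ x = w
      · simp [hyx, hu, hdist]
      · simp only [if_neg hyx]
        refine hs.mem x hx y ?_ hyq
        split at hy
        · next h => subst h; have : y ≠ c := fun e => hyx ⟨e, rfl⟩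
                    omega
        · exact hy
    · have := mul_add_inj (j := y) (j' := c) hx hwV
      simp [Function.update_apply, this]
  · intro hcq
    have hold : ∀ x < P.V, x ∉ W → x ≠ w := fun x _ hx e => hx (e ▸ hwW)
    refine ⟨by omega,
      ⟨fun x hx hxW => ?_, hs.clu, hs.cld, fun x hx y hy hyq => ?_,
        hexm _ (by simp) (fun y hy x hx => ?_)⟩, by simpa [hsum] using hN⟩
    · simp [hold x hx hxW]; exact hs.cn x hx hxW
    · simp [Function.update_apply] at hy
      refine hs.mem x hx y ?_ hyq
      split at hy
      · next h => subst h; omega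
      · exact hy
    · rw [if_neg (by omega)]; rfl

/-- When all vertices are satisfied, the last entry of a full list is not closer than the nearest
center. So every `w` in `W` whose cluster contains `u` is found in the list of `u`, and there are at
most `k - 1` of them. This bounds the total size of the clusters. -/
theorem wp_recordClusters (he : Env P s) (hk1 : 1 ≤ k) (hkq : k ≤ P.q + 1)
    (hl : Lists P D s) (hn : D.Nearest P k W) (hW : W ⊆ Finset.range P.V)
    (hsat : unsat P D k (s.warr .r) = ∅) (hcn : ∀ w ∈ W, s.arr .cn w = 0) :
    WP P.B P.M recordClusters s fun s' t => t ≤ P.V * (12 * k + 6) + 2 ∧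
      ∑ w ∈ W, s'.arr .cn w ≤ P.V * (k - 1) ∧
      (∀ w < P.V, w ∉ W → ClusterOK P s w → ClusterOK P s' w) ∧
      ∀ w ∈ W, s'.arr .cn w ≤ 2 * P.q → ClusterOK P s' w := by
  have hB := P.M_lt_B
  have hM := P.pw_le_M
  have hsz := P.size_le (k := 1) (by omega)
  have hV1 := P.V_pos
  have hkV := P.mul_V_le (k := k) (by omega)
  have hkp : k ≤ P.pw := (Nat.le_mul_of_pos_right k P.V_pos).trans hkV
  have hlast : ∀ u < P.V, D.cnt u = k → s.warr .r u ≤ D.dist u (k - 1) := fun u hu hc => by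
    by_contra h
    have : u ∈ unsat P D k (s.warr .r) := by simp [unsat, hu, hc, not_le.1 h]
    simp [hsat] at this
  rw [recordClusters]
  refine WP.loop P.V (fun i τ s' => τ ≤ i * (12 * k + 6) ∧
      ∑ w ∈ W, s'.arr .cn w ≤ i * (k - 1) ∧ Recorded P D W s (fun u _ => u < i) s')
    he.V (by simp) (by omega) ?_ ?_ ?_
  · refine ⟨by simp, ?_, fun _ _ _ => rfl, fun _ _ _ _ => rfl, fun _ _ _ _ => rfl,
      fun w hw y hy => ?_, fun _ _ _ _ h => absurd h (by omega)⟩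
    · simpa using hcn
    · simp [hcn w hw] at hy
  · rintro i τ s' hi hx hf ⟨h1, h2, h3⟩
    have he' := he.frame hf rfl
    have hl' : Lists P D s' := by
      refine ⟨?_, ?_, ?_⟩
      · rw [hf.arr _ rfl]; exact hl.cnt
      · rw [hf.arr _ rfl]; exact hl.lab
      · rw [hf.warr _ rfl]; exact hl.dist
    have e6 : s'.warr .r = s.warr .r := hf.warr _ rfl
    have hck := hn.cnt_le i hi
    have hik : i * (k - 1) + (k - 1) ≤ P.pw := by
      have : (i + 1) * (k - 1) ≤ P.V * k := Nat.mul_le_mul (by omega) (by omega)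
      rw [add_mul, mul_comm P.V] at this
      omega
    simp only [wp_seq, wp_load, wp_wload]
    simp [hx, hl'.cnt, e6]
    and_intros <;> try omega
    refine WP.loop (D.cnt i) (fun j τ' s'' => τ' ≤ 12 * j ∧
        ∑ w ∈ W, s''.arr .cn w ≤ i * (k - 1) + min j (k - 1) ∧
        Recorded P D W s (fun u j' => u < i ∨ u = i ∧ j' < j) s'') (by simp) (by simp) (by omega)
      ?_ ?_ ?_
    · refine ⟨by simp, by simpa using h2, ?_⟩
      refine Recorded.done_mono (done := fun u _ => u < i) ?_ (by simp)
      exact ⟨h3.cn, h3.clu, h3.cld, h3.mem, h3.exists_mem⟩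
    · rintro j τ' s'' hj hx' hf' ⟨g1, g2, g3⟩
      have he'' : Env P s'' := Env.frame (s := (s'.setR .c (D.cnt i)).setW .rr (s.warr .r i))
        ⟨he'.1, he'.2, he'.3, he'.4, he'.5, he'.6, he'.7, he'.8, he'.9⟩ hf' rfl
      have hl'' : Lists P D s'' := by
        refine ⟨?_, ?_, ?_⟩
        · rw [hf'.arr _ rfl]; exact hl'.cnt
        · rw [hf'.arr _ rfl]; exact hl'.lab
        · rw [hf'.warr _ rfl]; exact hl'.dist
      refine (wp_recordEntry (P := P) (D := D) (W := W) (k := k) (u := i) (j := j) (s₀ := s)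
        (N := i * (k - 1) + min j (k - 1)) he''
        hkq hl'' hn hW hi hj (by rw [hf'.reg _ rfl]; simpa using hx) hx'
        (by rw [hf'.wreg _ rfl]; simp) g3 g2 (by omega)).mono ?_
      rintro s₃ t₃ - ⟨k1, k2, k3⟩
      refine ⟨by omega, ?_, ?_⟩
      · simp only [State.setR_arr]
        refine k3.trans ?_
        split
        · next h =>
          -- The last of `k` entries never enters a cluster; this is the gain that allows `min j (k
          -- - 1)` in the invariant.
          have : j ≠ k - 1 := by
            rintro rfl
            exact absurd h (not_lt.2 (hlast i hi (by omega)))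
          omega
        · omega
      · refine Recorded.setR (Recorded.done_mono k2 fun u hu j' _ => ?_) _ _
        rintro (h | ⟨h, h'⟩)
        · exact .inl (.inl h)
        · rcases Nat.lt_succ_iff_lt_or_eq.1 h' with h' | h'
          · exact .inl (.inr ⟨h, h'⟩)
          · exact .inr ⟨h, h'⟩
    · rintro τ' s'' - - ⟨g1, g2, g3⟩
      refine ⟨?_, ?_, ?_⟩
      · rw [add_mul]; omega
      · refine g2.trans ?_
        rw [add_mul]; omega
      · refine Recorded.setR (Recorded.done_mono g3 fun u hu j' hj' h => ?_) _ _
        rcases h.lt_or_eq with h | h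
        · exact .inl h
        · subst h; exact .inr ⟨rfl, hj'⟩
  · rintro τ s' - hf ⟨h1, h2, h3⟩
    have e6 : s'.warr .r = s.warr .r := hf.warr _ rfl
    refine ⟨by omega, h2, fun w hw hwW hok => ⟨?_, fun j hj => ?_, fun u hu hd => ?_⟩,
      fun w hw hle => ⟨hle, fun j hj => h3.mem w hw j hj (by omega), fun u hu hd => ?_⟩⟩
    · rw [h3.cn w hw hwW]; exact hok.card_le
    · rw [h3.cn w hw hwW] at hj
      rw [h3.clu w hw hwW, h3.cld w hw hwW]; exact hok.mem j hj
    · rw [e6] at hd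
      obtain ⟨j, hj, e⟩ := hok.exists_mem u hu hd
      exact ⟨j, by rw [h3.cn w hw hwW]; exact hj, by rw [h3.clu w hw hwW]; exact e⟩
    · rw [e6] at hd
      simp only [Setup.dist, iInf_lt_iff] at hd
      obtain ⟨l, p, hlt⟩ := hd
      -- If `w` were missing from the list of `u`, the list would be full with entries at distance
      -- at most `l < r u`, against `hlast`.
      rcases hn.done w hw u l p with ⟨j, hj, e, hl'⟩ | ⟨e, hl'⟩
      · obtain ⟨y, hy, e'⟩ := h3.exists_mem u hu j hj hu (hl'.trans_lt hlt) (e.symm ▸ hle)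
        rw [e] at hy e'
        exact ⟨y, hy, e'⟩
      · exact absurd hlt (not_lt.2 ((hlast u hu e).trans (hl' _ (by omega))))

theorem wp_filterSources (he : Env P s) (hW : W ⊆ Finset.range P.V)
    (hin : ∀ u < P.V, 0 < s.arr .inW u ↔ u ∈ W) :
    WP P.B P.M filterSources s fun s' t => t ≤ 8 * P.V + 3 ∧
      s'.reg .nW = (W.filter fun w => 2 * P.q < s.arr .cn w).card ∧
      ∀ u < P.V, 0 < s'.arr .inW u ↔ u ∈ W.filter fun w => 2 * P.q < s.arr .cn w := by
  have hB := P.M_lt_B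
  have hM := P.pw_le_M
  have hsz := P.size_le (k := 1) (by omega)
  have hV1 := P.V_pos
  set W' := W.filter fun w => 2 * P.q < s.arr .cn w with hW'
  have hW'V : W' ⊆ Finset.range P.V := (Finset.filter_subset _ _).trans hW
  have hmem : ∀ u, u ∈ W' ↔ u ∈ W ∧ 2 * P.q < s.arr .cn u := fun u => Finset.mem_filter
  have hcard : ∀ i, (W'.filter (· < i)).card ≤ P.V := fun i => by
    simpa using Finset.card_le_card ((Finset.filter_subset (· < i) W').trans hW'V)
  have hstep : ∀ i, (W'.filter (· ≤ i)).card =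
      (W'.filter (· < i)).card + if i ∈ W' then 1 else 0 := fun i => by
    have : W'.filter (· ≤ i) = if i ∈ W' then insert i (W'.filter (· < i))
        else W'.filter (· < i) := by
      ext v
      split
      · next h =>
        simp only [Finset.mem_insert, Finset.mem_filter]
        by_cases hv : v = i
        · subst hv; simp [h]
        · simp only [hv, false_or, and_congr_right_iff]; omega
      · next h =>
        by_cases hv : v = i
        · subst hv; simp [h]
        · simp only [Finset.mem_filter, and_congr_right_iff]; omega
    rw [this]
    split
    · rw [Finset.card_insert_of_notMem (by simp)]
    · rfl
  simp only [filterSources, wp_seq, wp_set]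
  refine ⟨by simp; omega, ?_⟩
  refine WP.loop P.V (fun i τ s' => τ ≤ 8 * i ∧
      s'.reg .nW = (W'.filter (· < i)).card ∧
      ∀ u < P.V, 0 < s'.arr .inW u ↔ if u < i then u ∈ W' else u ∈ W)
    he.V (by simp) (by omega) ?_ ?_ ?_
  · simpa using hin
  · rintro i τ s' hi hx hf ⟨h1, h2, h3⟩
    have e1 : s'.arr .cn = s.arr .cn := hf.arr _ rfl
    have e2 : s'.reg .cap = 2 * P.q := (hf.reg _ rfl).trans he.cap
    have h4 := h3 i hi
    rw [if_neg (by omega)] at h4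
    have hci := hcard i
    have hne : ∀ u, u ≠ i → (u ≤ i ↔ u < i) := fun u hu => by omega
    simp [hx, e1, e2]
    simp only [h4]
    and_intros <;> try omega
    · intro hiW
      and_intros <;> try omega
      · intro hlt
        have hi' : i ∈ W' := (hmem i).2 ⟨hiW, hlt⟩
        refine ⟨by omega, by omega, by rw [hstep, if_pos hi', h2], fun u hu => ?_⟩
        by_cases hui : u = i
        · subst hui; simp [hi', h4, hiW]
        · simp only [hne u hui]; exact h3 u hu
      · intro hle
        have hi' : i ∉ W' := fun h => by have := ((hmem i).1 h).2; omega
        refine ⟨by omega, by omega, by rw [hstep, if_neg hi', h2]; rfl, fun u hu => ?_⟩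
        rw [Function.update_apply]
        by_cases hui : u = i
        · subst hui; simp [hi']
        · simp only [hne u hui, if_neg hui]; exact h3 u hu
    · intro hiW
      have hiW : i ∉ W := fun h => by have := h4.2 h; omega
      have hi' : i ∉ W' := fun h => hiW ((hmem i).1 h).1
      refine ⟨by omega, by rw [hstep, if_neg hi', h2]; rfl, fun u hu => ?_⟩
      by_cases hui : u = i
      · subst hui; simp [hi', h4, hiW]
      · simp only [hne u hui]; exact h3 u hu
  · rintro τ s' - hf ⟨h1, h2, h3⟩
    have : W'.filter (· < P.V) = W' :=
      Finset.filter_true_of_mem fun u hu => Finset.mem_range.1 (hW'V hu)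
    rw [this] at h2
    refine ⟨by omega, h2, fun u hu => ?_⟩
    rw [h3 u hu, if_pos hu]

end

end DistOracle

/-! ### The rounds that halve the set of vertices with large clusters -/

namespace DistOracle

section

variable {P : Setup} {D : Search} {s s' : State} {k : ℕ} {W U : Finset ℕ}

/-- New centers only decrease `r`, so clusters shrink and a complete list stays complete. It may
then contain vertices outside the cluster, which `ClusterOK` allows since their distances are still
correct. -/
theorem ClusterOK.of_eq {w : ℕ} (h : ClusterOK P s w) (hcn : s'.arr .cn w = s.arr .cn w)
    (hclu : s'.arr .clu = s.arr .clu) (hcld : s'.warr .cld = s.warr .cld)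
    (hr : ∀ u < P.V, s'.warr .r u ≤ s.warr .r u) : ClusterOK P s' w :=
  ⟨hcn ▸ h.card_le, by rw [hcn, hclu, hcld]; exact h.mem, fun u hu hd => by
    rw [hcn, hclu]; exact h.exists_mem u hu (hd.trans_le (hr u hu))⟩

theorem Env.congr (he : Env P s) (hr : ∀ x ∈ [Reg.V, .a1, .q, .cap, .lam, .pw], s'.reg x = s.reg x)
    (ha : s'.arr = s.arr) (hw : s'.warr = s.warr) : Env P s' := by
  simp only [List.mem_cons, List.not_mem_nil, or_false, forall_eq_or_imp, forall_eq] at hr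
  obtain ⟨h1, h2, h3, h4, h5, h6⟩ := hr
  exact ⟨h1 ▸ he.1, h2 ▸ he.2, h3 ▸ he.3, h4 ▸ he.4, h5 ▸ he.5, h6 ▸ he.6, ha ▸ he.7, ha ▸ he.8,
    hw ▸ he.9⟩

/-- The state between the rounds: `W` is the set of vertices without a complete cluster. -/
structure Rounds (P : Setup) (W : Finset ℕ) (s : State) : Prop where
  env : Env P s
  queue : EmptyQueue P s
  sub : W ⊆ Finset.range P.V
  inW : ∀ u < P.V, 0 < s.arr .inW u ↔ u ∈ W
  nW : s.reg .nW = W.card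
  centers : Centers P s
  cluster : ∀ w < P.V, w ∉ W → ClusterOK P s w

theorem Rounds.setR (h : Rounds P W s) {x : Reg} (v : ℕ)
    (hx : x ∉ [Reg.V, .a1, .q, .cap, .lam, .pw, .nW, .ac]) : Rounds P W (s.setR x v) := by
  simp only [List.mem_cons, List.not_mem_nil, or_false, not_or] at hx
  obtain ⟨h1, h2, h3, h4, h5, h6, h7, h8⟩ := hx
  refine ⟨h.env.congr ?_ rfl rfl, ⟨h.queue.1, h.queue.2⟩, h.sub, h.inW, ?_, ⟨?_, ?_, ?_, ?_⟩,
    fun w hw hwW => (h.cluster w hw hwW).of_eq rfl rfl rfl fun _ _ => le_rfl⟩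
  · simp [Ne.symm h1, Ne.symm h2, Ne.symm h3, Ne.symm h4, Ne.symm h5, Ne.symm h6]
  · simpa [Ne.symm h7] using h.nW
  · simpa [Ne.symm h8] using h.centers.dist
  · simpa [Ne.symm h8] using h.centers.le
  · simpa [Ne.symm h8] using h.centers.pc
  · simpa [Ne.symm h8] using h.centers.pc_le

/-- The divisor is the `k` of a round with `n` sources. From `q * n < V * k ≤ q ^ 3 * k` one gets `n
< q ^ 2 * k`; so a round needs at most `q ^ 2 * lam` centers. -/
theorem card_div_lt {n : ℕ} (hn : n ≤ P.V) : n / (P.q * n / P.V + 1) + 1 ≤ P.q ^ 2 := by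
  have hV := P.V_pos
  have hq := P.V_le_q
  have hq1 := P.q_pos
  have h1 : P.q * n < P.V * (P.q * n / P.V + 1) := Nat.lt_mul_div_succ _ hV
  refine Nat.div_lt_of_lt_mul ?_
  have h2 : P.q * n < P.q * ((P.q * n / P.V + 1) * P.q ^ 2) := by
    calc P.q * n < P.V * (P.q * n / P.V + 1) := h1
      _ ≤ P.q ^ 3 * (P.q * n / P.V + 1) := Nat.mul_le_mul_right _ hq
      _ = _ := by ring
  exact Nat.lt_of_mul_lt_mul_left h2

theorem Setup.lam_pos (P : Setup) : 6 ≤ P.lam := by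
  have h1 := P.le_pw
  have h2 : 1 ≤ P.m * (P.q + 1) ^ 2 := Nat.mul_pos P.m_pos (by positivity)
  have h3 : 2 ^ 6 ≤ 2 ^ P.lam := by rw [← P.pw_eq]; omega
  exact (Nat.pow_le_pow_iff_right (by norm_num)).1 h3

/-- The dominant term comes from `J` searches with a single source, each of cost about `m * lam`.
The summands on the left are the costs of the pieces of a round. -/
theorem Setup.round_cost (P : Setup) {k J : ℕ} (hk : k ≤ P.q + 1) (hJ : J ≤ P.q ^ 2 * P.lam) :
    (P.V * (7 * P.lam + 20) + 3) + (P.V + 2 * P.m * k) * (20 * P.lam + 5 * k + 70) +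
      (P.V * (5 * k + 14) + 2) +
      (J * ((P.V + 2 * P.m) * (27 * P.lam + 130) + 2) + (5 * k + 4) * P.V + 2) +
      (P.V * (12 * k + 6) + 2) + (8 * P.V + 3) + 4 ≤ 1500 * (P.m * (P.q + 1) ^ 2 * P.lam ^ 2) := by
  have hV : P.V ≤ 3 * P.m := by have := P.V_le; have := P.m_pos; omega
  have hl := P.lam_pos
  have hq := P.q_pos
  have hm := P.m_pos
  generalize P.V = V at *
  generalize P.lam = l at *
  generalize P.m = m at *
  obtain ⟨Q, hQ⟩ : ∃ Q, P.q + 1 = Q := ⟨_, rfl⟩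
  have hJ' : J ≤ Q ^ 2 * l := hJ.trans (Nat.mul_le_mul_right _ (Nat.pow_le_pow_left (by omega) 2))
  have hQ2 : 2 ≤ Q := by omega
  rw [hQ] at hk ⊢
  have h1 : (V * (7 * l + 20) + 3) + (V + 2 * m * k) * (20 * l + 5 * k + 70) +
      (V * (5 * k + 14) + 2) +
      (J * ((V + 2 * m) * (27 * l + 130) + 2) + (5 * k + 4) * V + 2) +
      (V * (12 * k + 6) + 2) + (8 * V + 3) + 4 ≤
      (3 * m * (7 * l + 20) + 3) + (3 * m + 2 * m * Q) * (20 * l + 5 * Q + 70) +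
      (3 * m * (5 * Q + 14) + 2) +
      (Q ^ 2 * l * ((3 * m + 2 * m) * (27 * l + 130) + 2) + (5 * Q + 4) * (3 * m) + 2) +
      (3 * m * (12 * Q + 6) + 2) + (8 * (3 * m) + 3) + 4 := by gcongr
  refine h1.trans ?_
  set A := m * Q ^ 2 with hA
  have hmQ : 2 * m ≤ m * Q := by nlinarith
  have hmQQ : 2 * (m * Q) ≤ A := by rw [hA]; nlinarith
  have hQA : Q ^ 2 ≤ A := Nat.le_mul_of_pos_left _ hm
  have hAl : 6 * A ≤ A * l := by rw [mul_comm]; exact Nat.mul_le_mul_left _ hl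
  have hAll : 6 * (A * l) ≤ A * l ^ 2 := by
    calc 6 * (A * l) = A * l * 6 := mul_comm _ _
      _ ≤ A * l * l := Nat.mul_le_mul_left _ hl
      _ = _ := by ring
  have h2 : Q ^ 2 * l ≤ A * l := Nat.mul_le_mul_right _ hQA
  have h3 : 2 * m * l ≤ m * Q * l := Nat.mul_le_mul_right _ hmQ
  have h4 : 2 * (m * Q) * l ≤ A * l := Nat.mul_le_mul_right _ hmQQ
  have h5 : (3 * m * (7 * l + 20) + 3) + (3 * m + 2 * m * Q) * (20 * l + 5 * Q + 70) +
      (3 * m * (5 * Q + 14) + 2) +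
      (Q ^ 2 * l * ((3 * m + 2 * m) * (27 * l + 130) + 2) + (5 * Q + 4) * (3 * m) + 2) +
      (3 * m * (12 * Q + 6) + 2) + (8 * (3 * m) + 3) + 4 =
      81 * (m * l) + 366 * m + 16 + 221 * (m * Q) + 40 * (m * Q * l) + 10 * A + 135 * (A * l ^ 2) +
        650 * (A * l) + 2 * (Q ^ 2 * l) := by
    rw [hA]; ring
  rw [h5]
  nlinarith

/-- The choice `k = q * |W| / V + 1` balances two demands: `k - 1` is small enough for the clusters
of `W` to have total size at most `q * |W|`, and `k` is large enough for a small hitting set. -/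
theorem wp_clusterRound (hr : Rounds P W s)
    (hcM : (s.reg .ac + P.q ^ 2 * P.lam) * P.V ≤ P.M) :
    WP P.B P.M clusterRound s fun s' t => t ≤ 1500 * (P.m * (P.q + 1) ^ 2 * P.lam ^ 2) ∧
      s'.reg .ac ≤ s.reg .ac + P.q ^ 2 * P.lam ∧
      ∃ W', 2 * W'.card ≤ W.card ∧ Rounds P W' s' := by
  have hB := P.M_lt_B
  have hM := P.pw_le_M
  have hsz := P.size_le (k := 1) (by omega)
  have hV1 := P.V_pos
  have hm1 := P.m_pos
  have hW := hr.sub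
  have hWc : W.card ≤ P.V := by simpa using Finset.card_le_card hW
  obtain ⟨k, hk⟩ : ∃ k, P.q * W.card / P.V + 1 = k := ⟨_, rfl⟩
  have hqV := P.mul_V_le (k := P.q) (by omega)
  have hqW : P.q * W.card ≤ P.q * P.V := Nat.mul_le_mul_left _ hWc
  have hkq : k ≤ P.q + 1 := by
    rw [← hk]
    have : P.q * W.card / P.V ≤ P.q := Nat.div_le_of_le_mul (by rw [mul_comm P.V]; exact hqW)
    omega
  have hk1 : 1 ≤ k := hk ▸ Nat.le_add_left _ _
  have hkV := P.mul_V_le (k := k) (by omega)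
  have hkp : k ≤ P.pw := (Nat.le_mul_of_pos_right k P.V_pos).trans hkV
  obtain ⟨J, hJ⟩ : ∃ J, (W.card / k + 1) * P.lam = J := ⟨_, rfl⟩
  have hJq : J ≤ P.q ^ 2 * P.lam := by
    rw [← hJ, ← hk]; exact Nat.mul_le_mul_right _ (card_div_lt hWc)
  have hcost := P.round_cost hkq hJq
  simp only [clusterRound, wp_seq, wp_set]
  refine ⟨?_, ?_, ?_⟩
  · simp [hr.env.q, hr.env.V, hr.nW, hk]; omega
  · simp
  simp only [Exp.eval_add, Exp.eval_div, Exp.eval_mul, Exp.eval_r, Exp.eval_one, hr.env.q, hr.nW,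
    hr.env.V, hk, State.setR_reg, if_true]
  have hr₀ : Rounds P W ((s.setR .k k).setR .kk k) := (hr.setR k (by decide)).setR k (by decide)
  set s₀ := (s.setR .k k).setR .kk k with hs₀
  have hac₀ : s₀.reg .ac = s.reg .ac := rfl
  have hk₀ : s₀.reg .k = k := by simp [s₀]
  have hkk₀ : s₀.reg .kk = k := by simp [s₀]
  clear_value s₀
  refine (wp_loadSources (P := P) hr₀.env hr₀.queue hW hr₀.inW).mono ?_
  rintro s₁ t₁ hf₁ ⟨h1, h2, h3, h4⟩
  have he₁ := hr₀.env.frame hf₁ rfl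
  refine (wp_knn (P := P) (b := false) he₁ ((hf₁.reg _ rfl).trans hkk₀) hkq hW h2).mono ?_
  rintro s₂ t₂ hf₂ ⟨h5, h6, h7⟩
  have he₂ := he₁.frame hf₂ rfl
  set D := s₂.search P false with hD
  have hl₂ : Lists P D s₂ := ⟨rfl, fun _ _ => rfl, fun _ _ => rfl⟩
  have hk₂ : s₂.reg .k = k := (hf₂.reg _ rfl).trans ((hf₁.reg _ rfl).trans hk₀)
  refine (wp_initScores (P := P) (D := D) he₂ hk₂ hk1 hkq hl₂ h7 hW
    (by rw [hf₂.arr _ rfl]; exact h3)).mono ?_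
  rintro s₃ t₃ hf₃ ⟨h8, h9⟩
  have hA : ∀ a, loadSources.modA a = false → (knn false).modA a = false →
      initScores.modA a = false → s₃.arr a = s₀.arr a := fun a h h' h'' =>
    (hf₃.arr a h'').trans ((hf₂.arr a h').trans (hf₁.arr a h))
  have hWA : ∀ a, loadSources.modWA a = false → (knn false).modWA a = false →
      initScores.modWA a = false → s₃.warr a = s₀.warr a := fun a h h' h'' =>
    (hf₃.warr a h'').trans ((hf₂.warr a h').trans (hf₁.warr a h))
  have hR : ∀ x, loadSources.modR x = false → (knn false).modR x = false →
      initScores.modR x = false → s₃.reg x = s₀.reg x := fun x h h' h'' =>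
    (hf₃.reg x h'').trans ((hf₂.reg x h').trans (hf₁.reg x h))
  have hac₃ : s₃.reg .ac = s.reg .ac := (hR _ rfl rfl rfl).trans hac₀
  have hg₃ : Greedy P D k s₃ := by
    refine ⟨he₂.frame hf₃ rfl, (hf₃.reg _ rfl).trans hk₂, ⟨?_, ?_, ?_⟩, ?_, ?_, ⟨?_, ?_, ?_, ?_⟩⟩
    · rw [hf₃.arr _ rfl]; exact hl₂.cnt
    · rw [hf₃.arr _ rfl]; exact hl₂.lab
    · rw [hf₃.warr _ rfl]; exact hl₂.dist
    · have := hf₃.warr .tree rfl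
      exact ⟨this ▸ h6.heap, this ▸ h6.leaf⟩
    · rw [hf₃.warr .r rfl]; exact h9
    · rw [hR .ac rfl rfl rfl, hWA .dA rfl rfl rfl]; exact hr₀.centers.dist
    · rw [hR .ac rfl rfl rfl, hWA .dA rfl rfl rfl, hWA .r rfl rfl rfl]; exact hr₀.centers.le
    · rw [hR .ac rfl rfl rfl, hWA .dA rfl rfl rfl, hWA .r rfl rfl rfl, hA .pc rfl rfl rfl]
      exact hr₀.centers.pc
    · rw [hR .ac rfl rfl rfl, hA .pc rfl rfl rfl]; exact hr₀.centers.pc_le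
  refine (wp_chooseCenters (P := P) (D := D) hg₃ hk1 hkq h7 hW ((hR _ rfl rfl rfl).trans hr₀.nW)
    hJ.symm ?_).mono ?_
  · rw [hac₃]; exact (Nat.mul_le_mul_right _ (by omega)).trans hcM
  rintro s₄ t₄ hf₄ ⟨h10, h11, h12, h13, h14⟩
  have hcn₄ : ∀ u < P.V, s₄.arr .cn u = if u ∈ W then 0 else s₀.arr .cn u := by
    rw [hf₄.arr .cn rfl, hf₃.arr .cn rfl, hf₂.arr .cn rfl]; exact h4
  have hok₄ : ∀ w < P.V, w ∉ W → ClusterOK P s₄ w := fun w hw hwW => by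
    refine (hr₀.cluster w hw hwW).of_eq (by rw [hcn₄ w hw, if_neg hwW])
      ((hf₄.arr _ rfl).trans (hA _ rfl rfl rfl)) ((hf₄.warr _ rfl).trans (hWA _ rfl rfl rfl))
      fun u hu => ?_
    rw [← hWA .r rfl rfl rfl]
    exact h14 u hu
  refine (wp_recordClusters (P := P) (D := D) h10.env hk1 hkq h10.lists h7 hW h11
    fun w hw => ?_).mono ?_
  · rw [hcn₄ w (Finset.mem_range.1 (hW hw)), if_pos hw]
  rintro s₅ t₅ hf₅ ⟨h15, h16, h17, h18⟩
  have he₅ := h10.env.frame hf₅ rfl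
  refine (wp_filterSources (P := P) (W := W) he₅ hW ?_).mono ?_
  · rw [hf₅.arr _ rfl, hf₄.arr _ rfl, hA .inW rfl rfl rfl]; exact hr₀.inW
  rintro s₆ t₆ hf₆ ⟨h19, h20, h21⟩
  set W' := W.filter fun w => 2 * P.q < s₅.arr .cn w with hW'
  refine ⟨by omega, ?_, W', ?_, he₅.frame hf₆ rfl, ?_, (Finset.filter_subset _ _).trans hW, h21,
    h20, ⟨?_, ?_, ?_, ?_⟩, fun w hw hwW => ?_⟩
  · rw [hf₆.reg _ rfl, hf₅.reg _ rfl]; omega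
  -- Markov's inequality: each remaining vertex has a cluster of more than `2 * q` elements, and the
  -- total is at most `q * |W|`.
  · have h22 : (2 * P.q + 1) * W'.card ≤ ∑ w ∈ W, s₅.arr .cn w := by
      calc (2 * P.q + 1) * W'.card = ∑ w ∈ W', (2 * P.q + 1) := by simp [mul_comm]
        _ ≤ ∑ w ∈ W', s₅.arr .cn w := Finset.sum_le_sum fun w hw => (Finset.mem_filter.1 hw).2
        _ ≤ _ := Finset.sum_le_sum_of_subset (Finset.filter_subset _ _)
    have h23 : P.V * (k - 1) ≤ P.q * W.card := by
      rw [← hk, Nat.add_sub_cancel]; exact Nat.mul_div_le _ _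
    have h24 : P.q * (2 * W'.card) ≤ P.q * W.card := by
      calc P.q * (2 * W'.card) ≤ (2 * P.q + 1) * W'.card := by
            rw [add_mul, ← mul_assoc, mul_comm P.q 2]; omega
        _ ≤ _ := (h22.trans h16).trans h23
    exact Nat.le_of_mul_le_mul_left h24 P.q_pos
  · have := (hf₆.warr .tree rfl).trans (hf₅.warr .tree rfl)
    exact ⟨this ▸ h10.queue.heap, this ▸ h10.queue.leaf⟩
  · rw [hf₆.reg _ rfl, hf₅.reg _ rfl, hf₆.warr _ rfl, hf₅.warr _ rfl]; exact h10.centers.dist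
  · rw [hf₆.reg _ rfl, hf₅.reg _ rfl, hf₆.warr .dA rfl, hf₅.warr .dA rfl, hf₆.warr .r rfl,
      hf₅.warr .r rfl]
    exact h10.centers.le
  · rw [hf₆.reg _ rfl, hf₅.reg _ rfl, hf₆.warr .dA rfl, hf₅.warr .dA rfl, hf₆.warr .r rfl,
      hf₅.warr .r rfl, hf₆.arr _ rfl, hf₅.arr _ rfl]
    exact h10.centers.pc
  · rw [hf₆.reg _ rfl, hf₅.reg _ rfl, hf₆.arr _ rfl, hf₅.arr _ rfl]; exact h10.centers.pc_le
  · have h25 : ClusterOK P s₅ w := by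
      by_cases hw' : w ∈ W
      · refine h18 w hw' ?_
        by_contra h
        exact hwW (Finset.mem_filter.2 ⟨hw', by omega⟩)
      · exact h17 w hw hw' (hok₄ w hw hw')
    refine h25.of_eq (by rw [hf₆.arr _ rfl]) (hf₆.arr _ rfl) (hf₆.warr _ rfl) fun u _ => ?_
    rw [hf₆.warr _ rfl]

/-- After `lam` rounds fewer than one vertex is left, as `V < 2 ^ lam`, and at most `q ^ 2 * lam ^
2` centers have been used. The spare row in the last bound is needed because `pc` is only known to
be at most `ac`: a vertex without a center must also have a legal address. -/
theorem wp_buildClusters (hr : Rounds P (Finset.range P.V) s) (hac : s.reg .ac = 0) :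
    WP P.B P.M buildClusters s fun s' t =>
      t ≤ P.lam * (1500 * (P.m * (P.q + 1) ^ 2 * P.lam ^ 2) + 2) + 2 ∧ Rounds P ∅ s' ∧
      (s'.reg .ac + 1) * P.V ≤ P.M := by
  have hB := P.M_lt_B
  have hM := P.pw_le_M
  have hlam := P.lam_lt
  have hac' : ∀ i ≤ P.lam, i * (P.q ^ 2 * P.lam) ≤ P.q ^ 2 * P.lam ^ 2 := fun i hi => by
    calc i * (P.q ^ 2 * P.lam) ≤ P.lam * (P.q ^ 2 * P.lam) := Nat.mul_le_mul_right _ hi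
      _ = _ := by ring
  rw [buildClusters]
  refine WP.loop P.lam (fun i τ s' => τ ≤ i * (1500 * (P.m * (P.q + 1) ^ 2 * P.lam ^ 2) + 2) ∧
      s'.reg .ac ≤ i * (P.q ^ 2 * P.lam) ∧ ∃ W, 2 ^ i * W.card ≤ P.V ∧ Rounds P W s')
    hr.env.lam (by simp) (by omega) ?_ ?_ ?_
  · exact ⟨by simp, by simp [hac], _, by simp, hr.setR 0 (by decide)⟩
  · rintro i τ s' hi hx hf ⟨h1, h2, W, h3, h4⟩
    have h5 := hac' (i + 1) hi
    rw [add_mul, one_mul] at h5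
    refine (wp_clusterRound (P := P) h4 ?_).mono ?_
    · exact (Nat.mul_le_mul_right _ (by omega)).trans P.table_le_M
    · rintro s'' t - ⟨g1, g2, W', g3, g4⟩
      refine ⟨?_, ?_, W', ?_, g4.setR _ (by decide)⟩
      · have : ∀ S, (i + 1) * (S + 2) = i * (S + 2) + S + 2 := fun S => by ring
        rw [this]; omega
      · simp [add_mul]; omega
      · calc 2 ^ (i + 1) * W'.card = 2 ^ i * (2 * W'.card) := by ring
          _ ≤ 2 ^ i * W.card := Nat.mul_le_mul_left _ g3
          _ ≤ _ := h3
  · rintro τ s' - hf ⟨h1, h2, W, h3, h4⟩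
    have hsz := P.size_le (k := 1) (by omega)
    have hm1 := P.m_pos
    have hW : W.card = 0 := by
      rw [← P.pw_eq] at h3
      by_contra h
      have := Nat.le_mul_of_pos_right P.pw (Nat.pos_of_ne_zero h)
      omega
    rw [Finset.card_eq_zero] at hW
    subst hW
    refine ⟨by omega, h4, (Nat.mul_le_mul_right _ ?_).trans P.table_le_M⟩
    have := hac' P.lam le_rfl
    omega

end

end DistOracle

namespace DistOracle

/-! ### Pairs of vertices with clusters that are joined by an edge -/

/-- Stores a pair. -/
def storePair : Stmt :=
  .load .v .clu (♯.dj * ♯.V + ♯.y) ;; .wload .d2 .cld (♯.dj * ♯.V + ♯.y) ;;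
  .store (.key .dup) ♯.t ♯.u ;; .store .tv ♯.t ♯.v ;;
  .wstore .tw ♯.t (.add (.r .d1) (.r .d2)) ;; .set .t (♯.t + 1)

/-- Stores all pairs of the half-edge `h`. -/
def edgePairs : Stmt :=
  .load .x (.key .adj) ♯.h ;; .load .y (.key .adj) (♯.h + 1 - 2 * (♯.h % 2)) ;;
  .wload .we .inp (♯.a1 + ♯.h / 2) ;; .load .cx .cn ♯.x ;; .load .c .cn ♯.y ;;
  .loop .ci ♯.cx (
    .load .u .clu (♯.ci * ♯.V + ♯.x) ;; .wload .d1 .cld (♯.ci * ♯.V + ♯.x) ;;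
    .wset .d1 (.add (.r .d1) (.r .we)) ;;
    .loop .dj ♯.c storePair)

/-- Stores all pairs of elements of the clusters of the ends of an edge. -/
def genPairs : Stmt := .set .t 0 ;; .loop .h (2 * ♯.a1) edgePairs

/-- Enters a pair into the table of keys. -/
def dedupEntry : Stmt :=
  .load .t (.slot .dup) (♯.o + ♯.dj) ;; .load .v .tv ♯.t ;; .wload .d1 .tw ♯.t ;;
  .load .gt .stamp ♯.v ;;
  .ite (.lt ♯.gt (♯.u + 1))
    (.store .stamp ♯.v (♯.u + 1) ;; .store .pos ♯.v ♯.T ;; .store .ku ♯.T ♯.u ;;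
      .store (.key .col) ♯.T ♯.v ;; .wstore .kw ♯.T (.r .d1) ;; .set .T (♯.T + 1))
    (.load .x .pos ♯.v ;; .wload .d2 .kw ♯.x ;;
      .when (.wlt (.r .d1) (.r .d2)) (.wstore .kw ♯.x (.r .d1)))

/-- Removes duplicate pairs. -/
def dedup : Stmt :=
  .set .gN ♯.V ;; .set .gL ♯.t ;; csr .dup ;; .set .T 0 ;;
  .loop .u ♯.V (.load .o (.off .dup) ♯.u ;; .load .d (.deg .dup) ♯.u ;; .loop .dj ♯.d dedupEntry)

section

variable {P : Setup} {s : State}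

theorem Setup.dist_triangle (a b c : ℕ) : P.dist a c ≤ P.dist a b + P.dist b c := by
  simp only [Setup.dist, ENNReal.iInf_add, ENNReal.add_iInf]
  exact le_iInf fun l => le_iInf fun p => le_iInf fun l' => le_iInf fun p' =>
    Setup.dist_le (p'.trans p)

/-- The pairs stored so far contain those in `R`. -/
structure Pairs (P : Setup) (R : ℕ → ℕ → ℝ≥0∞ → Prop) (s : State) : Prop where
  lt : ∀ i < s.reg .t, s.arr (.key .dup) i < P.V ∧ s.arr .tv i < P.V
  sound : ∀ i < s.reg .t, P.dist (s.arr (.key .dup) i) (s.arr .tv i) ≤ s.warr .tw i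
  complete : ∀ u v l, R u v l →
    ∃ i < s.reg .t, s.arr (.key .dup) i = u ∧ s.arr .tv i = v ∧ s.warr .tw i = l

theorem Pairs.setR {R : ℕ → ℕ → ℝ≥0∞ → Prop} (h : Pairs P R s) {x : Reg} (hx : x ≠ .t) (v : ℕ) :
    Pairs P R (s.setR x v) := by
  refine ⟨?_, ?_, ?_⟩ <;> simp only [State.setR_reg, if_neg hx.symm, State.setR_arr, State.setR_warr]
  exacts [h.lt, h.sound, h.complete]

theorem Pairs.mono {R R' : ℕ → ℕ → ℝ≥0∞ → Prop} (h : Pairs P R s)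
    (hR : ∀ u v l, R' u v l → R u v l) : Pairs P R' s :=
  ⟨h.lt, h.sound, fun u v l h' => h.complete u v l (hR u v l h')⟩

/-- The element `j` of the cluster of `x`, with its distance. -/
def IsEntry (P : Setup) (s : State) (x j u : ℕ) (l : ℝ≥0∞) : Prop :=
  s.arr .clu (j * P.V + x) = u ∧ s.warr .cld (j * P.V + x) = l

theorem wp_storePair {R : ℕ → ℕ → ℝ≥0∞ → Prop} {u y j : ℕ} {d : ℝ≥0∞} (he : Env P s)
    (hu : s.reg .u = u) (huV : u < P.V) (hy : s.reg .y = y) (hyV : y < P.V) (hj : s.reg .dj = j)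
    (hjq : j < 2 * P.q) (hd : s.wreg .d1 = d) (hv : s.arr .clu (j * P.V + y) < P.V)
    (hdist : P.dist u (s.arr .clu (j * P.V + y)) ≤ d + s.warr .cld (j * P.V + y))
    (hp : Pairs P R s) (ht : s.reg .t < P.pw) :
    WP P.B P.M storePair s fun s' t => t = 6 ∧ s'.reg .t = s.reg .t + 1 ∧
      Pairs P (fun u' v l => R u' v l ∨ u' = u ∧ v = s.arr .clu (j * P.V + y) ∧
        l = d + s.warr .cld (j * P.V + y)) s' := by
  have hB := P.M_lt_B
  have hM := P.pw_le_M
  have hjV := mul_add_lt hjq hyV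
  have hqV := P.mul_V_le (k := 2 * P.q) (by omega)
  simp [storePair, hu, hy, hj, he.V, hd]
  and_intros <;> try omega
  refine ⟨fun i hi => ?_, fun i hi => ?_, fun u' v l h => ?_⟩
  · simp at hi
    simp [Function.update_apply]
    by_cases hit : i = s.reg .t
    · simp [hit, huV, hv]
    · simp [hit]; exact hp.lt i (by omega)
  · simp at hi
    simp [Function.update_apply]
    by_cases hit : i = s.reg .t
    · simp [hit, hdist]
    · simp [hit]; exact hp.sound i (by omega)
  · simp [Function.update_apply]
    rcases h with h | ⟨rfl, rfl, rfl⟩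
    · obtain ⟨i, hi, h1⟩ := hp.complete u' v l h
      refine ⟨i, by omega, ?_⟩
      have : i ≠ s.reg .t := by omega
      simpa [this] using h1
    · exact ⟨s.reg .t, le_rfl, by simp⟩

/-- The state has complete clusters. -/
structure Clustered (P : Setup) (s : State) : Prop where
  env : Env P s
  ok : ∀ w < P.V, ClusterOK P s w

theorem Clustered.frame {p : Stmt} {s' : State} (h : Clustered P s) (hf : Frame p s s')
    (hp : p.keeps = true) (h1 : p.modA .cn = false) (h2 : p.modA .clu = false)
    (h3 : p.modWA .cld = false) (h4 : p.modWA .r = false) : Clustered P s' :=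
  ⟨h.env.frame hf hp, fun w hw => (h.ok w hw).of_eq (by rw [hf.arr _ h1]) (hf.arr _ h2)
    (hf.warr _ h3) fun u _ => by rw [hf.warr _ h4]⟩

/-- The pairs that the half-edge `h` contributes. -/
def EdgePair (P : Setup) (s : State) (h u v : ℕ) (l : ℝ≥0∞) : Prop :=
  ∃ i < s.arr .cn (P.src h), ∃ j < s.arr .cn (P.src (twin h)), ∃ d d',
    IsEntry P s (P.src h) i u d ∧ IsEntry P s (P.src (twin h)) j v d' ∧ l = d + P.ew (h / 2) + d'

/-- Two lists of at most `2 * q` elements give at most `4 * q ^ 2` pairs. Since the bound on `t` is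
a multiple of `h`, it can be summed over the half-edges. -/
theorem wp_edgePairs {R : ℕ → ℕ → ℝ≥0∞ → Prop} {h : ℕ} (hc : Clustered P s)
    (hh : s.reg .h = h) (hhm : h < 2 * P.m) (hp : Pairs P R s)
    (ht : s.reg .t ≤ h * (4 * P.q ^ 2)) :
    WP P.B P.M edgePairs s fun s' t => t ≤ 48 * P.q ^ 2 + 8 ∧
      s'.reg .t ≤ (h + 1) * (4 * P.q ^ 2) ∧
      Pairs P (fun u v l => R u v l ∨ EdgePair P s h u v l) s' := by
  have hB := P.M_lt_B
  have hM := P.pw_le_M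
  have he := hc.env
  have hsz := P.size_le (k := 1) (by omega)
  have hV1 := P.V_pos
  have hq1 := P.q_pos
  have hqV := P.mul_V_le (k := 2 * P.q) (by omega)
  have hqp : 2 * P.q ≤ P.pw := (Nat.le_mul_of_pos_right _ P.V_pos).trans hqV
  have ht' : twin h < 2 * P.m := twin_lt hhm
  have htw : h + 1 - 2 * (h % 2) = twin h := rfl
  obtain ⟨x, hx⟩ : ∃ x, P.src h = x := ⟨_, rfl⟩
  obtain ⟨y, hy⟩ : ∃ y, P.src (twin h) = y := ⟨_, rfl⟩
  have hxV : x < P.V := hx ▸ P.src_lt h hhm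
  have hyV : y < P.V := hy ▸ P.src_lt _ ht'
  have hx₀ : s.arr (.key .adj) h = x := (he.src h hhm).trans hx
  have hy₀ : s.arr (.key .adj) (twin h) = y := (he.src _ ht').trans hy
  have hw₀ : s.warr .inp (P.m + h / 2) = P.ew (h / 2) := he.inp _ (by omega)
  have hcx := (hc.ok x hxV).card_le
  have hcy := (hc.ok y hyV).card_le
  have hxy : P.dist x y ≤ P.ew (h / 2) := by rw [← hx, ← hy]; exact Setup.dist_le (.edge hhm)
  have hpq : 2 * P.m * (4 * P.q ^ 2) ≤ P.pw := by
    have := P.mul_le_pw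
    nlinarith [Nat.zero_le (P.m * P.q), Nat.zero_le (P.m * P.q * P.q)]
  have hpq' : h * (4 * P.q ^ 2) + 4 * P.q ^ 2 ≤ P.pw := by
    have : (h + 1) * (4 * P.q ^ 2) ≤ 2 * P.m * (4 * P.q ^ 2) := Nat.mul_le_mul_right _ hhm
    rw [add_mul, one_mul] at this
    omega
  simp only [edgePairs, wp_seq, wp_load, wp_wload]
  simp [hh, htw, hx₀, hy₀, he.m, hw₀]
  and_intros <;> try omega
  obtain ⟨a, ha⟩ : ∃ a, s.arr .cn x = a := ⟨_, rfl⟩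
  obtain ⟨b, hb⟩ : ∃ b, s.arr .cn y = b := ⟨_, rfl⟩
  simp only [ha, hb]
  obtain ⟨s₀, hs₀⟩ : ∃ s₀, ((((s.setR .x x).setR .y y).setW .we (P.ew (h / 2))).setR .cx a).setR .c b
    = s₀ := ⟨_, rfl⟩
  rw [hs₀]
  have hc₀ : Clustered P s₀ := by
    rw [← hs₀]
    exact ⟨⟨he.1, he.2, he.3, he.4, he.5, he.6, he.7, he.8, he.9⟩, fun w hw =>
      (hc.ok w hw).of_eq rfl rfl rfl fun _ _ => le_rfl⟩
  have hab : ∀ i ≤ a, i * b ≤ 4 * P.q ^ 2 := fun i hi => by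
    calc i * b ≤ 2 * P.q * (2 * P.q) := Nat.mul_le_mul (by omega) (by omega)
      _ = _ := by ring
  refine WP.loop a (fun i τ s' => τ ≤ i * (8 * b + 7) ∧
      s'.reg .t ≤ h * (4 * P.q ^ 2) + i * b ∧
      Pairs P (fun u v l => R u v l ∨ ∃ i' < i, ∃ j < b, ∃ d d',
        IsEntry P s x i' u d ∧ IsEntry P s y j v d' ∧ l = d + P.ew (h / 2) + d') s')
    (by simp [← hs₀]) (by simp) (by omega) ?_ ?_ ?_
  · refine ⟨by simp, by simpa [← hs₀] using ht, ?_⟩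
    have : Pairs P R (s₀.setR .ci 0) := by
      rw [← hs₀]
      exact ⟨by simpa using hp.lt, by simpa using hp.sound, by simpa using hp.complete⟩
    exact this.mono (by simp)
  · rintro i τ s' hi hix hf ⟨h1, h2, h3⟩
    have hc' := hc₀.frame hf rfl rfl rfl rfl rfl
    have e1 : s'.reg .x = x := by rw [hf.reg _ rfl]; simp [← hs₀]
    have e2 : s'.reg .y = y := by rw [hf.reg _ rfl]; simp [← hs₀]
    have e3 : s'.reg .c = b := by rw [hf.reg _ rfl]; simp [← hs₀]
    have e4 : s'.wreg .we = P.ew (h / 2) := by rw [hf.wreg _ rfl]; simp [← hs₀]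
    have e5 : s'.arr .clu = s.arr .clu := by rw [hf.arr _ rfl]; simp [← hs₀]
    have e6 : s'.warr .cld = s.warr .cld := by rw [hf.warr _ rfl]; simp [← hs₀]
    have hix' : i * P.V + x < 2 * P.q * P.V := mul_add_lt (by omega) hxV
    obtain ⟨hu, hud⟩ := (hc.ok x hxV).mem i (by omega)
    obtain ⟨u, hue⟩ : ∃ u, s.arr .clu (i * P.V + x) = u := ⟨_, rfl⟩
    rw [hue] at hu hud
    simp only [wp_seq, wp_load, wp_wload, wp_wset]
    simp [hix, e1, e5, e6, e4, hc'.env.V, hue, hud]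
    and_intros <;> try omega
    obtain ⟨s₁, hs₁⟩ : ∃ s₁, ((s'.setR .u u).setW .d1 (P.dist x u)).setW .d1
      (P.dist x u + P.ew (h / 2)) = s₁ := ⟨_, rfl⟩
    rw [hs₁]
    have he₁ : Env P s₁ := by
      rw [← hs₁]; exact hc'.env.congr (by simp) rfl rfl
    have hib := hab (i + 1) hi
    refine WP.loop b (fun j τ s'' => τ ≤ 8 * j ∧ s''.reg .t ≤ h * (4 * P.q ^ 2) + i * b + j ∧
        Pairs P (fun u' v l => (R u' v l ∨ ∃ i' < i, ∃ j < b, ∃ d d',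
          IsEntry P s x i' u' d ∧ IsEntry P s y j v d' ∧ l = d + P.ew (h / 2) + d') ∨
          ∃ j' < j, u' = u ∧ ∃ d', IsEntry P s y j' v d' ∧
            l = P.dist x u + P.ew (h / 2) + d') s'')
      (by simp [← hs₁, e3]) (by simp) (by omega) ?_ ?_ ?_
    · refine ⟨by simp, by simpa [← hs₁] using h2, ?_⟩
      refine Pairs.mono (R := fun u v l => R u v l ∨ ∃ i' < i, ∃ j < b, ∃ d d',
        IsEntry P s x i' u d ∧ IsEntry P s y j v d' ∧ l = d + P.ew (h / 2) + d') ?_ (by simp)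
      rw [← hs₁]
      exact ⟨by simpa using h3.lt, by simpa using h3.sound, by simpa using h3.complete⟩
    · rintro j τ' s'' hj hjx hf' ⟨g1, g2, g3⟩
      have he'' := he₁.frame hf' rfl
      have k1 : s''.reg .u = u := by rw [hf'.reg _ rfl]; simp [← hs₁]
      have k2 : s''.reg .y = y := by rw [hf'.reg _ rfl]; simp [← hs₁, e2]
      have k4 : s''.wreg .d1 = P.dist x u + P.ew (h / 2) := by rw [hf'.wreg _ rfl]; simp [← hs₁]
      have k5 : s''.arr .clu = s.arr .clu := by rw [hf'.arr _ rfl]; simp [← hs₁, e5]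
      have k6 : s''.warr .cld = s.warr .cld := by rw [hf'.warr _ rfl]; simp [← hs₁, e6]
      obtain ⟨hv, hvd⟩ := (hc.ok y hyV).mem j (by omega)
      -- The triangle inequality along `u`, `x`, `y` and the stored vertex.
      have hdist : P.dist u (s''.arr .clu (j * P.V + y)) ≤
          P.dist x u + P.ew (h / 2) + s''.warr .cld (j * P.V + y) := by
        rw [k5, k6, hvd]
        calc P.dist u _ ≤ P.dist u x + P.dist x _ := Setup.dist_triangle _ _ _
          _ ≤ P.dist u x + (P.dist x y + P.dist y _) := by gcongr; exact Setup.dist_triangle _ _ _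
          _ ≤ P.dist x u + (P.ew (h / 2) + P.dist y _) := by rw [Setup.dist_comm u x]; gcongr
          _ = _ := by rw [add_assoc]
      have hib' : i * b + b ≤ 4 * P.q ^ 2 := by rw [add_mul, one_mul] at hib; exact hib
      refine (wp_storePair (P := P) (u := u) (y := y) (j := j) he'' k1 hu k2 hyV hjx (by omega) k4
        (by rw [k5]; exact hv) hdist g3 (by omega)).mono ?_
      rintro s₃ t₃ - ⟨a1, a2, a3⟩
      refine ⟨by omega, by simp; omega, ?_⟩
      refine (a3.setR (by decide) _).mono fun u' v l h4 => ?_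
      rcases h4 with h4 | ⟨j', hj', rfl, d', h5, rfl⟩
      · exact .inl (.inl h4)
      · rcases Nat.lt_succ_iff_lt_or_eq.1 hj' with hj' | rfl
        · exact .inl (.inr ⟨j', hj', rfl, d', h5, rfl⟩)
        · exact .inr ⟨rfl, by rw [k5]; exact h5.1.symm, by rw [k6]; rw [h5.2]⟩
    · rintro τ' s'' - - ⟨g1, g2, g3⟩
      refine ⟨?_, ?_, ?_⟩
      · rw [add_mul]; omega
      · rw [add_mul]; omega
      · refine (g3.setR (by decide) _).mono fun u' v l h4 => ?_
        rcases h4 with h4 | ⟨i', hi', j, hj, d, h5, d', h6, rfl⟩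
        · exact .inl (.inl h4)
        · rcases (show i' ≤ i by omega).lt_or_eq with hi' | rfl
          · exact .inl (.inr ⟨i', hi', j, hj, d, d', h5, h6, rfl⟩)
          · refine .inr ⟨j, hj, h5.1.symm.trans hue, d', h6, ?_⟩
            rw [← h5.2, hud]
  · rintro τ s' - hf ⟨h1, h2, h3⟩
    have hab' := hab a le_rfl
    have : a * (8 * b + 7) = 8 * (a * b) + 7 * a := by ring
    have hq2 : P.q ≤ P.q ^ 2 := Nat.le_self_pow (by norm_num) _
    refine ⟨by omega, by rw [add_mul]; omega, h3.mono fun u v l h4 => ?_⟩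
    rcases h4 with h4 | ⟨i, hi, j, hj, h5⟩
    · exact .inl h4
    · rw [hx, ha] at hi
      rw [hy, hb] at hj
      exact .inr ⟨i, hi, j, hj, hx ▸ hy ▸ h5⟩

theorem wp_genPairs (hc : Clustered P s) :
    WP P.B P.M genPairs s fun s' t => t ≤ 2 * P.m * (48 * P.q ^ 2 + 10) + 3 ∧
      s'.reg .t ≤ 8 * P.m * P.q ^ 2 ∧
      Pairs P (fun u v l => ∃ h < 2 * P.m, EdgePair P s h u v l) s' := by
  have hB := P.M_lt_B
  have hM := P.pw_le_M
  have hsz := P.size_le (k := 1) (by omega)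
  have hm := P.m_pos
  simp only [genPairs, wp_seq, wp_set]
  refine ⟨by simp; omega, ?_⟩
  have hc₀ : Clustered P (s.setR .t 0) := ⟨hc.env.congr (by simp) rfl rfl, fun w hw =>
    (hc.ok w hw).of_eq rfl rfl rfl fun _ _ => le_rfl⟩
  refine WP.loop (2 * P.m) (fun i τ s' => τ ≤ i * (48 * P.q ^ 2 + 10) ∧
      s'.reg .t ≤ i * (4 * P.q ^ 2) ∧ Pairs P (fun u v l => ∃ h < i, EdgePair P s h u v l) s')
    (by simp [hc.env.m]) (by simp [hc.env.m]; omega) (by omega) ?_ ?_ ?_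
  · exact ⟨by simp, by simp, ⟨by simp, by simp, by simp⟩⟩
  · rintro i τ s' hi hx hf ⟨h1, h2, h3⟩
    have e1 : s'.arr .cn = s.arr .cn := by rw [hf.arr _ rfl]; rfl
    have e2 : s'.arr .clu = s.arr .clu := by rw [hf.arr _ rfl]; rfl
    have e3 : s'.warr .cld = s.warr .cld := by rw [hf.warr _ rfl]; rfl
    refine (wp_edgePairs (P := P) (hc₀.frame hf rfl rfl rfl rfl rfl) hx hi h3 h2).mono ?_
    rintro s'' t - ⟨g1, g2, g3⟩
    refine ⟨by rw [add_mul]; omega, g2, (g3.setR (by decide) _).mono fun u v l h => ?_⟩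
    obtain ⟨h', hlt, h4⟩ := h
    rcases Nat.lt_succ_iff_lt_or_eq.1 hlt with hlt | rfl
    · exact .inl ⟨h', hlt, h4⟩
    · right
      unfold EdgePair IsEntry at h4 ⊢
      rw [e1, e2, e3]; exact h4
  · rintro τ s' - hf ⟨h1, h2, h3⟩
    refine ⟨by omega, ?_, h3⟩
    calc s'.reg .t ≤ _ := h2
      _ = _ := by ring

end

end DistOracle

/-! ### Correctness of the removal of duplicate pairs -/

namespace DistOracle

section

variable {P : Setup} {s s₀ : State}

/-- The table of keys contains the pairs in `done`, without duplicates. -/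
structure Keyed (P : Setup) (s₀ : State) (len : ℕ) (done : ℕ → Prop) (s : State) : Prop where
  lt : ∀ i < s.reg .T, s.arr .ku i < P.V ∧ s.arr (.key .col) i < P.V
  inj : ∀ i < s.reg .T, ∀ j < s.reg .T, s.arr .ku i = s.arr .ku j →
    s.arr (.key .col) i = s.arr (.key .col) j → i = j
  sound : ∀ i < s.reg .T, ∃ t < len, s₀.arr (.key .dup) t = s.arr .ku i ∧
    s₀.arr .tv t = s.arr (.key .col) i ∧ s.warr .kw i = s₀.warr .tw t
  complete : ∀ t < len, done t → ∃ i < s.reg .T, s.arr .ku i = s₀.arr (.key .dup) t ∧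
    s.arr (.key .col) i = s₀.arr .tv t ∧ s.warr .kw i ≤ s₀.warr .tw t

/-- The stamps of the vertices that are in a pair with `u`. -/
structure Stamped (P : Setup) (u : ℕ) (s : State) : Prop where
  le : ∀ v < P.V, s.arr .stamp v ≤ u + 1
  pos : ∀ v < P.V, s.arr .stamp v = u + 1 → s.arr .pos v < s.reg .T ∧
    s.arr .ku (s.arr .pos v) = u ∧ s.arr (.key .col) (s.arr .pos v) = v
  key : ∀ i < s.reg .T, s.arr .ku i ≤ u ∧ (s.arr .ku i = u →
    s.arr .stamp (s.arr (.key .col) i) = u + 1 ∧ s.arr .pos (s.arr (.key .col) i) = i)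

theorem Keyed.setR {len : ℕ} {done : ℕ → Prop} (h : Keyed P s₀ len done s) {x : Reg} (hx : x ≠ .T)
    (v : ℕ) : Keyed P s₀ len done (s.setR x v) := by
  refine ⟨?_, ?_, ?_, ?_⟩ <;>
    simp only [State.setR_reg, if_neg hx.symm, State.setR_arr, State.setR_warr]
  exacts [h.lt, h.inj, h.sound, h.complete]

theorem Stamped.setR {u : ℕ} (h : Stamped P u s) {x : Reg} (hx : x ≠ .T) (v : ℕ) :
    Stamped P u (s.setR x v) := by
  refine ⟨?_, ?_, ?_⟩ <;> simp only [State.setR_reg, if_neg hx.symm, State.setR_arr]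
  exacts [h.le, h.pos, h.key]

theorem Keyed.mono {len : ℕ} {done done' : ℕ → Prop} (h : Keyed P s₀ len done s)
    (hd : ∀ t < len, done' t → done t) : Keyed P s₀ len done' s :=
  ⟨h.lt, h.inj, h.sound, fun t ht h' => h.complete t ht (hd t ht h')⟩

/-- While the pairs with first vertex `u` are processed, the stamp `u + 1` marks the second vertices
met so far, and `pos` gives their places. For a repeated pair only the smaller value is kept. -/
theorem wp_dedupEntry {len u o j t : ℕ} {done : ℕ → Prop} (hu : s.reg .u = u) (huV : u < P.V)
    (ho : s.reg .o = o) (hj : s.reg .dj = j) (hslot : s.arr (.slot .dup) (o + j) = t)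
    (ht : t < len) (hoj : o + j < len) (hlen : len ≤ P.pw)
    (hkey : s₀.arr (.key .dup) t = u) (htv : s₀.arr .tv t < P.V)
    (etv : s.arr .tv = s₀.arr .tv) (etw : s.warr .tw = s₀.warr .tw) (hT : s.reg .T < P.pw)
    (hk : Keyed P s₀ len done s) (hs : Stamped P u s) :
    WP P.B P.M dedupEntry s fun s' c => c ≤ 11 ∧ s'.reg .T ≤ s.reg .T + 1 ∧
      Keyed P s₀ len (fun t' => done t' ∨ t' = t) s' ∧ Stamped P u s' := by
  have hB := P.M_lt_B
  have hM := P.pw_le_M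
  have hsz := P.size_le (k := 1) (by omega)
  obtain ⟨v, hv⟩ : ∃ v, s₀.arr .tv t = v := ⟨_, rfl⟩
  rw [hv] at htv
  have hst := hs.le v htv
  have hpos := hs.pos v htv
  simp [dedupEntry, ho, hj, hslot, etv, etw, hv, hu]
  and_intros <;> try omega
  · intro hlt
    -- An old stamp on `v` means that the key `(u, v)` is not yet in the table.
    have hnew : ∀ i < s.reg .T, s.arr .ku i = u → s.arr (.key .col) i ≠ v := fun i hi h h' => by
      have := ((hs.key i hi).2 h).1
      rw [h'] at this
      omega
    and_intros <;> try omega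
    · refine ⟨fun i hi => ?_, fun i hi i' hi' => ?_, fun i hi => ?_, fun t' ht' hd => ?_⟩
      · simp at hi
        simp [Function.update_apply]
        by_cases hiT : i = s.reg .T
        · simp [hiT, huV, htv]
        · simp [hiT]; exact hk.lt i (by omega)
      · simp at hi hi'
        simp [Function.update_apply]
        by_cases hiT : i = s.reg .T <;> by_cases hiT' : i' = s.reg .T
        · simp [hiT, hiT']
        · simp only [hiT, hiT', if_true, if_false]
          exact fun h h' => absurd h'.symm (hnew i' (by omega) h.symm)
        · simp only [hiT, hiT', if_true, if_false]
          exact fun h h' => absurd h' (hnew i (by omega) h)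
        · simp only [hiT, hiT', if_false]
          exact hk.inj i (by omega) i' (by omega)
      · simp at hi
        simp [Function.update_apply]
        by_cases hiT : i = s.reg .T
        · simp only [hiT, if_true]; exact ⟨t, ht, hkey, hv, rfl⟩
        · simp only [hiT, if_false]; exact hk.sound i (by omega)
      · simp [Function.update_apply]
        rcases hd with hd | rfl
        · obtain ⟨i, hi, h⟩ := hk.complete t' ht' hd
          refine ⟨i, by omega, ?_⟩
          have : i ≠ s.reg .T := by omega
          simpa only [this, if_false] using h
        · exact ⟨s.reg .T, le_rfl, by simp [hkey, hv]⟩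
    · refine ⟨fun x hx => ?_, fun x hx => ?_, fun i hi => ?_⟩
      · simp [Function.update_apply]
        have := hs.le x hx
        split <;> omega
      · simp [Function.update_apply]
        by_cases hxv : x = v
        · simp [hxv]
        · simp only [hxv, if_false, not_false_eq_true, forall_const]
          intro h
          obtain ⟨h1, h2, h3⟩ := hs.pos x hx h
          have : s.arr .pos x ≠ s.reg .T := by omega
          simp only [this, if_false, not_false_eq_true, forall_const]
          exact ⟨by omega, h2, h3⟩
      · simp at hi
        simp [Function.update_apply]
        by_cases hiT : i = s.reg .T
        · simp [hiT]
        · simp only [hiT, if_false]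
          obtain ⟨h1, h2⟩ := hs.key i (by omega)
          simp only [not_false_eq_true, forall_const]
          refine ⟨h1, fun h => ?_⟩
          have := hnew i (by omega) h
          simp only [this, if_false, not_false_eq_true, forall_const]
          exact h2 h
  · intro hle
    obtain ⟨h1, h2, h3⟩ := hpos (by omega)
    obtain ⟨p, hp⟩ : ∃ p, s.arr .pos v = p := ⟨_, rfl⟩
    rw [hp] at h1 h2 h3
    simp only [hp]
    and_intros <;> try omega
    · intro hlt
      and_intros <;> try omega
      swap
      · exact ⟨hs.le, hs.pos, hs.key⟩
      refine ⟨hk.lt, hk.inj, fun i hi => ?_, fun t' ht' hd => ?_⟩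
      · simp at hi
        simp [Function.update_apply]
        by_cases hip : i = p
        · simp only [hip, if_true, h2, h3]; exact ⟨t, ht, hkey, hv, rfl⟩
        · simp only [hip, if_false]; exact hk.sound i hi
      · simp [Function.update_apply]
        rcases hd with hd | rfl
        · obtain ⟨i, hi, g1, g2, g3⟩ := hk.complete t' ht' hd
          refine ⟨i, hi, g1, g2, ?_⟩
          split
          · next h => subst h; exact hlt.le.trans g3
          · exact g3
        · exact ⟨p, h1, by rw [h2, hkey], by rw [h3, hv], by simp⟩
    · intro hle
      refine ⟨⟨hk.lt, hk.inj, hk.sound, fun t' ht' hd => ?_⟩, ⟨hs.le, hs.pos, hs.key⟩⟩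
      simp
      rcases hd with hd | rfl
      · exact hk.complete t' ht' hd
      · exact ⟨p, h1, by rw [h2, hkey], by rw [h3, hv], hle⟩

/-- The first vertices are processed in increasing order, so the stamps of previous groups are
smaller than the current one and need not be erased. Initially they are zero, hence the shift by
one. -/
theorem wp_dedup {R : ℕ → ℕ → ℝ≥0∞ → Prop} {len : ℕ} (hV : s.reg .V = P.V) (hp : Pairs P R s)
    (ht : s.reg .t = len) (hlen : len ≤ P.pw) (hstamp : ∀ v < P.V, s.arr .stamp v = 0)
    (hdeg : ∀ x, s.arr (.deg .dup) x = 0) (hfill : ∀ x, s.arr (.fill .dup) x = 0) :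
    WP P.B P.M dedup s fun s' t => t ≤ 26 * len + 12 * P.V + 15 ∧ s'.reg .T ≤ len ∧
      Keyed P s len (fun _ => True) s' := by
  have hB := P.M_lt_B
  have hM := P.pw_le_M
  have hsz := P.size_le (k := 1) (by omega)
  have hV1 := P.V_pos
  simp only [dedup, wp_seq, wp_set]
  refine ⟨by simp, by simp, ?_⟩
  refine (wp_csr (B := P.B) (M := P.M) (n := len) (N := P.V) (K := s.arr (.key .dup)) (by simp)
    (by simp [ht]) (by simp [hV]) hB (by omega) (by omega) (by simpa using hdeg)
    (by simpa using hfill) fun i hi => (hp.lt i (by omega)).1).mono ?_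
  rintro s₁ t₁ hf₁ ⟨h1, h2⟩
  refine ⟨by simp; omega, ?_⟩
  obtain ⟨s₂, hs₂⟩ : ∃ s₂, s₁.setR .T 0 = s₂ := ⟨_, rfl⟩
  have e1 : s₂.reg .V = P.V := by rw [← hs₂]; exact (hf₁.reg _ rfl).trans hV
  have e2 : s₂.arr .tv = s.arr .tv := by rw [← hs₂]; exact hf₁.arr _ rfl
  have e3 : s₂.warr .tw = s.warr .tw := by rw [← hs₂]; exact hf₁.warr _ rfl
  have e4 : s₂.arr .stamp = s.arr .stamp := by rw [← hs₂]; exact hf₁.arr _ rfl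
  have hg : Grouped (s.arr (.key .dup)) (s₂.arr (.deg .dup)) (s₂.arr (.off .dup))
      (s₂.arr (.slot .dup)) P.V len := by rw [← hs₂]; exact h2
  have e5 : s₂.reg .T = 0 := by simp [← hs₂]
  show WP P.B P.M _ (s₁.setR .T 0) _
  rw [hs₂]
  obtain ⟨dg, hdg⟩ : ∃ dg, s₂.arr (.deg .dup) = dg := ⟨_, rfl⟩
  obtain ⟨of, hof⟩ : ∃ of, s₂.arr (.off .dup) = of := ⟨_, rfl⟩
  obtain ⟨sl, hsl⟩ : ∃ sl, s₂.arr (.slot .dup) = sl := ⟨_, rfl⟩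
  rw [hdg, hof, hsl] at hg
  refine WP.loop P.V (fun i τ s' => τ ≤ 6 * i + 13 * ∑ u ∈ Finset.range i, dg u ∧
      s'.reg .T ≤ ∑ u ∈ Finset.range i, dg u ∧
      Keyed P s len (fun t => s.arr (.key .dup) t < i) s' ∧ (∀ v < P.V, s'.arr .stamp v ≤ i) ∧
      ∀ j < s'.reg .T, s'.arr .ku j < i) (by simp [e1]) (by simp) (by omega) ?_ ?_ ?_
  · refine ⟨by simp, by simp [e5], ⟨?_, ?_, ?_, ?_⟩, ?_, ?_⟩ <;> simp [e5, e4]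
    exact hstamp
  · rintro i τ s' hi hx hf ⟨g1, g2, g3, g4, g5⟩
    have k1 : s'.arr (.deg .dup) = dg := (hf.arr _ rfl).trans hdg
    have k2 : s'.arr (.off .dup) = of := (hf.arr _ rfl).trans hof
    have k3 : s'.arr (.slot .dup) = sl := (hf.arr _ rfl).trans hsl
    have k4 : s'.arr .tv = s.arr .tv := (hf.arr _ rfl).trans e2
    have k5 : s'.warr .tw = s.warr .tw := (hf.warr _ rfl).trans e3
    have hsum : ∑ u ∈ Finset.range i, dg u + dg i ≤ len := by
      rw [← Finset.sum_range_succ, ← hg.sum_deg]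
      exact Finset.sum_le_sum_of_subset (Finset.range_subset_range.2 hi)
    have hod := hg.off_add_deg i hi
    simp only [wp_seq, wp_load]
    simp [hx, k1, k2]
    and_intros <;> try omega
    obtain ⟨s₃, hs₃⟩ : ∃ s₃, (s'.setR .o (of i)).setR .d (dg i) = s₃ := ⟨_, rfl⟩
    rw [hs₃]
    refine WP.loop (dg i) (fun j τ' s'' => τ' ≤ 13 * j ∧
        s''.reg .T ≤ ∑ u ∈ Finset.range i, dg u + j ∧
        Keyed P s len (fun t => s.arr (.key .dup) t < i ∨ ∃ j' < j, t = sl (of i + j')) s'' ∧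
        Stamped P i s'') (by simp [← hs₃]) (by simp) (by omega) ?_ ?_ ?_
    · refine ⟨by simp, by simpa [← hs₃] using g2, Keyed.setR ?_ (by decide) _,
        Stamped.setR ?_ (by decide) _⟩ <;> rw [← hs₃]
      · exact (g3.mono (by simp)).setR (by decide) _ |>.setR (by decide) _
      · refine Stamped.setR (Stamped.setR ⟨fun v hv => ?_, fun v hv h => ?_, fun j hj => ?_⟩
          (by decide) _) (by decide) _
        · have := g4 v hv; omega
        · have := g4 v hv; omega
        · have := g5 j hj
          exact ⟨this.le, fun h => absurd h this.ne⟩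
    · rintro j τ' s'' hj hjx hf' ⟨a1, a2, a3, a4⟩
      obtain ⟨b1, b2⟩ := hg.slot_mem hi hj
      refine (wp_dedupEntry (P := P) (s₀ := s) (len := len) (u := i) (o := of i) (j := j)
        (t := sl (of i + j)) ?_ hi ?_ hjx ?_ b1 (by omega) hlen b2 (hp.lt _ (by omega)).2 ?_ ?_
        (by omega) a3 a4).mono ?_
      · rw [hf'.reg _ rfl, ← hs₃]; simpa using hx
      · rw [hf'.reg _ rfl, ← hs₃]; simp
      · rw [hf'.arr _ rfl, ← hs₃]; simp [k3]
      · rw [hf'.arr _ rfl, ← hs₃]; simp [k4]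
      · rw [hf'.warr _ rfl, ← hs₃]; simp [k5]
      · rintro s₄ t₄ - ⟨c1, c2, c3, c4⟩
        refine ⟨by omega, by simp; omega, (c3.mono fun t _ h => ?_).setR (by decide) _,
          c4.setR (by decide) _⟩
        rcases h with h | ⟨j', hj', h⟩
        · exact .inl (.inl h)
        · rcases Nat.lt_succ_iff_lt_or_eq.1 hj' with hj' | rfl
          · exact .inl (.inr ⟨j', hj', h⟩)
          · exact .inr h
    · rintro τ' s'' - - ⟨a1, a2, a3, a4⟩
      rw [Finset.sum_range_succ]
      refine ⟨by omega, by omega, (a3.mono fun t htl h => ?_).setR (by decide) _, ?_, ?_⟩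
      · rcases (show s.arr (.key .dup) t ≤ i by omega).lt_or_eq with h | h
        · exact .inl h
        · obtain ⟨j, hj, e⟩ := hg.exists_slot htl
          rw [h] at hj e
          exact .inr ⟨j, hj, e.symm⟩
      · exact a4.le
      · intro j hj
        exact (a4.key j hj).1
  · rintro τ s' - hf ⟨g1, g2, g3, g4, g5⟩
    rw [hg.sum_deg] at g1 g2
    exact ⟨by simp only [ht] at *; omega, g2, g3.mono fun t ht' _ => (hp.lt t (by omega)).1⟩

end

end DistOracle

namespace DistOracle

/-! ### Placing groups of items by displacement

There are two levels: on the level `false` the keys, grouped by their second vertex, are placed into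
buckets; on the level `true` the buckets are placed into the table. -/

/-- The grouping of the items on a level. -/
def srcGrp : Bool → Grp | false => .col | true => .bkt
/-- The grouping for which a level computes the keys. -/
def dstGrp : Bool → Grp | false => .bkt | true => .fin
/-- The values that are displaced. -/
def valArr : Bool → Arr | false => .ku | true => .key .col

/-- Chooses a displacement with few collisions, bit by bit. -/
def chooseDisp (b : Bool) : Stmt :=
  .set .pa 0 ;; .set .pbit 1 ;;
  .loop .pb ♯.lam (
    .set .s0 0 ;; .set .s1 0 ;;
    .loop .pj ♯.pd (
      .load .px (.slot (srcGrp b)) (♯.po + ♯.pj) ;; .load .ps (valArr b) ♯.px ;;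
      .load .z (.cnt (dstGrp b)) (2 * ♯.pbit + (♯.ps + ♯.pa) % (2 * ♯.pbit)) ;;
      .set .s0 (♯.s0 + ♯.z) ;;
      .load .z (.cnt (dstGrp b)) (2 * ♯.pbit + (♯.ps + ♯.pa + ♯.pbit) % (2 * ♯.pbit)) ;;
      .set .s1 (♯.s1 + ♯.z)) ;;
    .when (.lt ♯.s1 ♯.s0) (.set .pa (♯.pa + ♯.pbit)) ;; .set .pbit (2 * ♯.pbit))

/-- Counts an item at the position `z`. -/
def countItem (b : Bool) : Stmt :=
  .set .pbit 1 ;;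
  .loop .pb (♯.lam + 1) (
    .load .y (.cnt (dstGrp b)) (♯.pbit + ♯.z % ♯.pbit) ;;
    .store (.cnt (dstGrp b)) (♯.pbit + ♯.z % ♯.pbit) (♯.y + 1) ;; .set .pbit (2 * ♯.pbit))

/-- Places the items of the group `pg`. -/
def commitDisp (b : Bool) : Stmt :=
  .store (.disp (dstGrp b)) ♯.pg ♯.pa ;;
  .loop .pj ♯.pd (
    .load .px (.slot (srcGrp b)) (♯.po + ♯.pj) ;; .load .ps (valArr b) ♯.px ;;
    .set .z ((♯.ps + ♯.pa) % ♯.pw) ;; .store (.key (dstGrp b)) ♯.px ♯.z ;; countItem b)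

/-- Chooses a displacement for the group `pg`, and places its items. -/
def place (b : Bool) : Stmt := chooseDisp b ;; commitDisp b

section

variable {P : Setup} {s : State} {b : Bool}

/-- The number of collisions modulo `p`. -/
def clash (c X : ℕ → ℕ) (d p a : ℕ) : ℕ := ∑ j ∈ Finset.range d, c (p + (X j + a) % p)

/-- The counters for residues are consistent. -/
def TreeSum (c : ℕ → ℕ) (lam : ℕ) : Prop :=
  ∀ j < lam, ∀ z < 2 ^ j, c (2 ^ j + z) = c (2 ^ (j + 1) + z) + c (2 ^ (j + 1) + (z + 2 ^ j))

/-- A residue modulo `p` has two lifts modulo `2 * p`, and adding `p` exchanges them. -/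
theorem mod_two_mul (n p : ℕ) :
    n % (2 * p) = n % p ∧ (n + p) % (2 * p) = n % p + p ∨
    n % (2 * p) = n % p + p ∧ (n + p) % (2 * p) = n % p := by
  rcases Nat.eq_zero_or_pos p with rfl | hp
  · simp
  have h1 := Nat.mod_mul (x := n) (a := p) (b := 2)
  have h2 := Nat.mod_mul (x := n + p) (a := p) (b := 2)
  rw [mul_comm p 2] at h1 h2
  rw [Nat.add_mod_right, Nat.add_div_right _ hp] at h2
  rcases Nat.mod_two_eq_zero_or_one (n / p) with h | h
  · left
    have h' : (n / p).succ % 2 = 1 := by omega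
    rw [h1, h2, h, h']; omega
  · right
    have h' : (n / p).succ % 2 = 0 := by omega
    rw [h1, h2, h, h']; omega

/-- For every item the two possible next bits of the displacement lead to the two lifts of its
present residue, in some order. So the two extended displacements share the present collisions
between them. -/
theorem TreeSum.clash {c : ℕ → ℕ} {lam : ℕ} (h : TreeSum c lam) (X : ℕ → ℕ) (d a : ℕ) {j : ℕ}
    (hj : j < lam) : clash c X d (2 ^ j) a =
      clash c X d (2 * 2 ^ j) a + clash c X d (2 * 2 ^ j) (a + 2 ^ j) := by
  rw [DistOracle.clash, DistOracle.clash, DistOracle.clash, ← Finset.sum_add_distrib]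
  refine Finset.sum_congr rfl fun i _ => ?_
  have h1 := h j hj ((X i + a) % 2 ^ j) (Nat.mod_lt _ (by positivity))
  rw [pow_succ, mul_comm _ 2] at h1
  rw [h1, show X i + (a + 2 ^ j) = X i + a + 2 ^ j by omega]
  rcases mod_two_mul (X i + a) (2 ^ j) with ⟨e1, e2⟩ | ⟨e1, e2⟩
  · rw [e1, e2]
  · rw [e1, e2]; exact Nat.add_comm _ _

theorem TreeSum.le {c : ℕ → ℕ} {lam : ℕ} (h : TreeSum c lam) : ∀ {j : ℕ}, j ≤ lam → ∀ {z : ℕ},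
    z < 2 ^ j → c (2 ^ j + z) ≤ c 1
  | 0, _, z, hz => by
    have : z = 0 := by simpa using hz
    simp [this]
  | j + 1, hj, z, hz => by
    rw [pow_succ] at hz
    by_cases hzj : z < 2 ^ j
    · have h1 := h j (by omega) z hzj
      have h2 := h.le (j := j) (by omega) hzj
      omega
    · have h1 := h j (by omega) (z - 2 ^ j) (by omega)
      have h2 := h.le (j := j) (by omega) (z := z - 2 ^ j) (by omega)
      rw [Nat.sub_add_cancel (by omega)] at h1
      omega

/-- The bits of the displacement are fixed from the lowest on. The better of two extensions has at
most half of the collisions, so `2 ^ i` times their number does not increase. It starts as `d * c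
1`, all pairs of an item and a placed item; in the end the collisions are at most the average over
all displacements. -/
theorem wp_chooseDisp {o d : ℕ} {X c : ℕ → ℕ} (he : Env P s) (ho : s.reg .po = o)
    (hd : s.reg .pd = d) (hdp : d ≤ P.pw) (hod : o + d ≤ P.pw)
    (hslot : ∀ j < d, s.arr (.slot (srcGrp b)) (o + j) < P.pw ∧
      s.arr (valArr b) (s.arr (.slot (srcGrp b)) (o + j)) = X j) (hX : ∀ j < d, X j < P.pw)
    (hc : s.arr (.cnt (dstGrp b)) = c) (htree : TreeSum c P.lam) (hc1 : c 1 ≤ P.pw) :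
    WP P.B P.M (chooseDisp b) s fun s' t => t ≤ P.lam * (8 * d + 10) + 4 ∧ s'.reg .pa < P.pw ∧
      P.pw * clash c X d P.pw (s'.reg .pa) ≤ d * c 1 := by
  have hB := P.M_lt_B
  have hM := P.pw_le_M
  have hsz := P.size_le (k := 1) (by omega)
  have hV1 := P.V_pos
  have hlam := P.lam_lt
  have hpp := P.pw_sq_lt_B
  simp only [chooseDisp, wp_seq, wp_set]
  refine ⟨by simp; omega, by simp; omega, ?_⟩
  refine WP.loop P.lam (fun i τ s' => τ ≤ i * (8 * d + 10) ∧ s'.reg .pbit = 2 ^ i ∧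
      s'.reg .pa < 2 ^ i ∧ 2 ^ i * clash c X d (2 ^ i) (s'.reg .pa) ≤ d * c 1)
    he.lam (by simp) (by omega) ?_ ?_ ?_
  · refine ⟨by simp, by simp, by simp, ?_⟩
    simp [clash, Nat.mod_one]
  · rintro i τ s' hi hx hf ⟨h1, h2, h3, h4⟩
    obtain ⟨p, hp⟩ : ∃ p, 2 ^ i = p := ⟨_, rfl⟩
    have hp0 : 0 < p := by rw [← hp]; positivity
    have hpp' : 2 * p ≤ P.pw := by
      rw [← hp, P.pw_eq, mul_comm, ← pow_succ]; exact Nat.pow_le_pow_right (by norm_num) hi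
    obtain ⟨a, ha⟩ : ∃ a, s'.reg .pa = a := ⟨_, rfl⟩
    rw [ha] at h3 h4
    rw [hp] at h2 h3 h4
    have hcl := htree.clash X d a hi
    rw [hp] at hcl
    have e1 : s'.arr (.slot (srcGrp b)) = s.arr (.slot (srcGrp b)) := hf.arr _ rfl
    have e2 : s'.arr (valArr b) = s.arr (valArr b) := hf.arr _ rfl
    have e3 : s'.arr (.cnt (dstGrp b)) = c := (hf.arr _ rfl).trans hc
    have e4 : s'.reg .po = o := (hf.reg _ rfl).trans ho
    have e5 : s'.reg .pd = d := (hf.reg _ rfl).trans hd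
    have hle : ∀ n, c (2 * p + n % (2 * p)) ≤ P.pw := fun n => by
      have : 2 * p = 2 ^ (i + 1) := by rw [← hp]; ring
      rw [this]
      exact (htree.le hi (Nat.mod_lt _ (by positivity))).trans hc1
    simp only [wp_seq, wp_set]
    refine ⟨by simp; omega, by simp; omega, ?_⟩
    refine WP.loop d (fun j τ' s'' => τ' ≤ 8 * j ∧ s''.reg .s0 = clash c X j (2 * p) a ∧
      s''.reg .s1 = clash c X j (2 * p) (a + p) ∧ s''.reg .s0 ≤ j * P.pw ∧
      s''.reg .s1 ≤ j * P.pw) (by simp [e5]) (by simp) (by omega) (by simp [clash]) ?_ ?_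
    · rintro j τ' s'' hj hjx hf' ⟨g1, g2, g3, g4, g5⟩
      have k1 : s''.arr (.slot (srcGrp b)) = s.arr (.slot (srcGrp b)) := (hf'.arr _ rfl).trans e1
      have k2 : s''.arr (valArr b) = s.arr (valArr b) := (hf'.arr _ rfl).trans e2
      have k3 : s''.arr (.cnt (dstGrp b)) = c := (hf'.arr _ rfl).trans e3
      have k4 : s''.reg .po = o := (hf'.reg _ rfl).trans (by simp [e4])
      have k5 : s''.reg .pbit = p := (hf'.reg _ rfl).trans (by simp [h2])
      have k6 : s''.reg .pa = a := (hf'.reg _ rfl).trans (by simp [ha])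
      obtain ⟨t, ht⟩ : ∃ t, s.arr (.slot (srcGrp b)) (o + j) = t := ⟨_, rfl⟩
      obtain ⟨htp, hval⟩ := hslot j hj
      rw [ht] at htp hval
      have hXj := hX j hj
      have hj' : (j + 1) * P.pw ≤ P.pw * P.pw := Nat.mul_le_mul_right _ (by omega)
      have hj'' : (j + 1) * P.pw = j * P.pw + P.pw := by ring
      have l1 := hle (X j + a)
      have l2 := hle (X j + a + p)
      have m1 := Nat.mod_lt (X j + a) (show 2 * p > 0 by omega)
      have m2 := Nat.mod_lt (X j + a + p) (show 2 * p > 0 by omega)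
      simp [hjx, k1, k2, k3, k4, k5, k6, ht, hval]
      rw [hj'']
      and_intros <;> try omega
      · rw [clash, Finset.sum_range_succ, g2]; rfl
      · rw [clash, Finset.sum_range_succ, g3, ← add_assoc]; rfl
    · rintro τ' s'' - hf' ⟨g1, g2, g3, g4, g5⟩
      have k5 : s''.reg .pbit = p := (hf'.reg _ rfl).trans (by simp [h2])
      have k6 : s''.reg .pa = a := (hf'.reg _ rfl).trans (by simp [ha])
      have hpow : 2 ^ (i + 1) = 2 * p := by rw [← hp]; ring
      have hcost : (i + 1) * (8 * d + 10) = i * (8 * d + 10) + (8 * d + 10) := by ring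
      simp [k5, k6, hpow, g2, g3]
      refine ⟨fun hlt => ?_, fun hge => ?_⟩
      · and_intros <;> try omega
        have : p * (2 * clash c X d (2 * p) (a + p)) ≤ p * clash c X d p a :=
          Nat.mul_le_mul_left _ (by omega)
        exact (le_of_eq (by ring)).trans (this.trans h4)
      · and_intros <;> try omega
        have : p * (2 * clash c X d (2 * p) a) ≤ p * clash c X d p a :=
          Nat.mul_le_mul_left _ (by omega)
        exact (le_of_eq (by ring)).trans (this.trans h4)
  · rintro τ s' - hf ⟨h1, h2, h3, h4⟩
    rw [← P.pw_eq] at h3 h4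
    exact ⟨by omega, h3, h4⟩

/-- The counters for the items in `D`, at the positions `pos`. -/
structure Counted (P : Setup) (c pos : ℕ → ℕ) (D : Finset ℕ) : Prop where
  cnt : ∀ j ≤ P.lam, ∀ z < 2 ^ j, c (2 ^ j + z) = (D.filter fun t => pos t % 2 ^ j = z).card
  pos_lt : ∀ t ∈ D, pos t < P.pw

/-- The counter of the residue `z` modulo `2 ^ j` is at the index `2 ^ j + z`; the leading bit
separates the levels. -/
theorem two_pow_add_inj {i j z z' : ℕ} (hz : z < 2 ^ i) (hz' : z' < 2 ^ j) :
    2 ^ i + z = 2 ^ j + z' ↔ i = j ∧ z = z' := by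
  constructor
  · intro h
    have h1 : Nat.log 2 (2 ^ i + z) = i := by
      rw [Nat.log_eq_iff (by right; constructor <;> [norm_num; positivity])]
      rw [pow_succ]; omega
    have h2 : Nat.log 2 (2 ^ j + z') = j := by
      rw [Nat.log_eq_iff (by right; constructor <;> [norm_num; positivity])]
      rw [pow_succ]; omega
    have : i = j := by rw [← h1, ← h2, h]
    subst this
    exact ⟨rfl, by omega⟩
  · rintro ⟨rfl, rfl⟩; rfl

namespace Counted

variable {c pos : ℕ → ℕ} {D : Finset ℕ} (h : Counted P c pos D)
include h

theorem one : c 1 = D.card := by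
  have := h.cnt 0 (by omega) 0 (by norm_num)
  simpa [Nat.mod_one] using this

theorem leaf {y : ℕ} (hy : y < P.pw) : c (P.pw + y) = (D.filter fun t => pos t = y).card := by
  have hpw := P.pw_eq
  have := h.cnt P.lam le_rfl y (by omega)
  rw [hpw, this]
  congr 1
  refine Finset.filter_congr fun t ht => ?_
  rw [Nat.mod_eq_of_lt (hpw ▸ h.pos_lt t ht)]

theorem tree : TreeSum c P.lam := fun j hj z hz => by
  have h2 : 2 ^ (j + 1) = 2 * 2 ^ j := by ring
  rw [h.cnt j hj.le z hz, h.cnt (j + 1) hj z (by omega), h.cnt (j + 1) hj _ (by omega),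
    ← Finset.card_union_of_disjoint]
  · congr 1
    ext t
    simp only [Finset.mem_filter, Finset.mem_union, h2, ← and_or_left]
    refine and_congr_right fun _ => ?_
    have hm := Nat.mod_lt (pos t) (show 2 ^ j > 0 by positivity)
    rcases mod_two_mul (pos t) (2 ^ j) with ⟨e, -⟩ | ⟨e, -⟩ <;> rw [e] <;> omega
  · refine Finset.disjoint_left.2 fun t h1 h2 => ?_
    simp only [Finset.mem_filter] at h1 h2
    have : 0 < 2 ^ j := by positivity
    omega

end Counted

/-- A placed item belongs to one residue class on each of the `lam + 1` levels, and exactly these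
counters grow. -/
theorem wp_countItem {z : ℕ} {c pos : ℕ → ℕ} {D : Finset ℕ} {t : ℕ} (he : Env P s)
    (hz : s.reg .z = z) (hzp : z < P.pw) (hc : s.arr (.cnt (dstGrp b)) = c)
    (h : Counted P c pos D) (ht : t ∉ D) (hD : D.card < P.pw) :
    WP P.B P.M (countItem b) s fun s' cost => cost ≤ 5 * P.lam + 8 ∧
      Counted P (s'.arr (.cnt (dstGrp b))) (Function.update pos t z) (insert t D) := by
  have hB := P.M_lt_B
  have hM := P.pw_le_M
  have hsz := P.size_le (k := 1) (by omega)
  have hV1 := P.V_pos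
  have hlam := P.lam_lt
  have hle : ∀ j ≤ P.lam, ∀ z < 2 ^ j, c (2 ^ j + z) < P.pw := fun j hj z hz => by
    have := h.tree.le hj hz
    have := h.one
    omega
  simp only [countItem, wp_seq, wp_set]
  refine ⟨by simp; omega, ?_⟩
  refine WP.loop (P.lam + 1) (fun i τ s' => τ ≤ 5 * i ∧ s'.reg .pbit = 2 ^ i ∧
      ∀ j ≤ P.lam, ∀ y < 2 ^ j, s'.arr (.cnt (dstGrp b)) (2 ^ j + y) =
        c (2 ^ j + y) + if j < i ∧ y = z % 2 ^ j then 1 else 0)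
    (by simp [he.lam]) (by simp [he.lam]; omega) (by omega) (by simp [hc]) ?_ ?_
  · rintro i τ s' hi hx hf ⟨h1, h2, h3⟩
    have e1 : s'.reg .z = z := by rw [hf.reg _ rfl]; simpa using hz
    have hp2 : 2 ^ i ≤ P.pw := by rw [P.pw_eq]; exact Nat.pow_le_pow_right (by norm_num) (by omega)
    have hm := Nat.mod_lt z (show 2 ^ i > 0 by positivity)
    have hcur := h3 i (by omega) _ hm
    rw [if_neg (by omega)] at hcur
    have hcl := hle i (by omega) _ hm
    simp [e1, h2, hcur]
    and_intros <;> try omega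
    · intro j hj y hy
      rw [Function.update_apply]
      have := two_pow_add_inj hy hm
      by_cases hji : j = i
      · subst hji
        by_cases hyz : y = z % 2 ^ j
        · simp [hyz]
        · rw [if_neg (by simp [hyz]), h3 j hj y hy]; simp [hyz]
      · rw [if_neg (by simp [this, hji]), h3 j hj y hy]
        have : j ≤ i ↔ j < i := by omega
        simp [this]
  · rintro τ s' - hf ⟨h1, h2, h3⟩
    refine ⟨by omega, ⟨fun j hj y hy => ?_, fun x hx => ?_⟩⟩
    · rw [h3 j hj y hy, h.cnt j hj y hy, Finset.filter_insert, Function.update_self]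
      have hD' : (D.filter fun x => Function.update pos t z x % 2 ^ j = y) =
          D.filter fun x => pos x % 2 ^ j = y :=
        Finset.filter_congr fun x hx => by rw [Function.update_of_ne (ne_of_mem_of_not_mem hx ht)]
      rw [hD']
      by_cases hyz : z % 2 ^ j = y
      · rw [if_pos ⟨by omega, hyz.symm⟩, if_pos hyz, Finset.card_insert_of_notMem (by simp [ht])]
      · rw [if_neg (fun h => hyz h.2.symm), if_neg hyz]; rfl
    · rcases Finset.mem_insert.1 hx with rfl | hx
      · simpa using hzp
      · rw [Function.update_of_ne (ne_of_mem_of_not_mem hx ht)]; exact h.pos_lt x hx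

end

end DistOracle

/-! ### Placing a group, and the first level of the dictionary -/

namespace DistOracle

section

variable {P : Setup} {s : State} {b : Bool}

theorem wp_commitDisp {o d a x T : ℕ} {sl val : ℕ → ℕ} {D : Finset ℕ} (he : Env P s)
    (hx : s.reg .pg = x) (hxp : x < P.pw)
    (ho : s.reg .po = o) (hd : s.reg .pd = d) (hod : o + d ≤ P.pw) (ha : s.reg .pa = a)
    (hap : a < P.pw) (hsl : s.arr (.slot (srcGrp b)) = sl) (hval : s.arr (valArr b) = val)
    (hT : T < P.pw) (hslot : ∀ j < d, sl (o + j) < T ∧ sl (o + j) ∉ D ∧ val (sl (o + j)) < P.pw)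
    (hinj : ∀ j < d, ∀ j' < d, sl (o + j) = sl (o + j') → j = j')
    (hc : Counted P (s.arr (.cnt (dstGrp b))) (s.arr (.key (dstGrp b))) D) (hD : D ⊆ Finset.range T) :
    WP P.B P.M (commitDisp b) s fun s' t => t ≤ d * (5 * P.lam + 14) + 3 ∧
      Counted P (s'.arr (.cnt (dstGrp b))) (s'.arr (.key (dstGrp b)))
        (D ∪ (Finset.range d).image fun j => sl (o + j)) ∧
      (∀ t, s'.arr (.key (dstGrp b)) t = if t ∈ (Finset.range d).image fun j => sl (o + j) then
        (val t + a) % P.pw else s.arr (.key (dstGrp b)) t) ∧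
      s'.arr (.disp (dstGrp b)) = Function.update (s.arr (.disp (dstGrp b))) x a := by
  have hB := P.M_lt_B
  have hM := P.pw_le_M
  have hsz := P.size_le (k := 1) (by omega)
  simp only [commitDisp, wp_seq, wp_store]
  refine ⟨by simp [hx]; omega, ?_⟩
  obtain ⟨s₁, hs₁⟩ : ∃ s₁, s.setA (.disp (dstGrp b)) x a = s₁ := ⟨_, rfl⟩
  simp only [Exp.eval_r, hx, ha, hs₁]
  have he₁ : Env P s₁ := by
    rw [← hs₁]
    exact ⟨he.1, he.2, he.3, he.4, he.5, he.6, by simpa using he.7, by simpa using he.8, he.9⟩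
  have hcard : ∀ S : Finset ℕ, S ⊆ Finset.range T → S.card ≤ T := fun S hS => by
    simpa using Finset.card_le_card hS
  refine WP.loop d (fun i τ s' => τ ≤ i * (5 * P.lam + 14) ∧
      Counted P (s'.arr (.cnt (dstGrp b))) (s'.arr (.key (dstGrp b)))
        (D ∪ (Finset.range i).image fun j => sl (o + j)) ∧
      (∀ t, s'.arr (.key (dstGrp b)) t = if t ∈ (Finset.range i).image fun j => sl (o + j) then
        (val t + a) % P.pw else s.arr (.key (dstGrp b)) t))
    (by simp [← hs₁, hd]) (by simp) (by omega) ?_ ?_ ?_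
  · refine ⟨by simp, ?_, ?_⟩
    · simpa [← hs₁] using hc
    · simp [← hs₁]
  · rintro i τ s' hi hix hf ⟨h1, h2, h3⟩
    have he' : Env P s' := he₁.frame hf (by cases b <;> rfl)
    have e1 : s'.arr (.slot (srcGrp b)) = sl := by
      rw [hf.arr _ (by cases b <;> rfl), ← hs₁]; simpa using hsl
    have e2 : s'.arr (valArr b) = val := by
      rw [hf.arr _ (by cases b <;> rfl), ← hs₁]
      cases b <;> simpa [valArr, dstGrp] using hval
    have e3 : s'.reg .po = o := by rw [hf.reg _ (by cases b <;> rfl), ← hs₁]; simpa using ho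
    have e4 : s'.reg .pa = a := by rw [hf.reg _ (by cases b <;> rfl), ← hs₁]; simpa using ha
    obtain ⟨t, ht⟩ : ∃ t, sl (o + i) = t := ⟨_, rfl⟩
    obtain ⟨htT, htD, htv⟩ := hslot i hi
    rw [ht] at htT htD htv
    have hm := Nat.mod_lt (val t + a) (show P.pw > 0 by omega)
    simp only [wp_seq, wp_load, wp_set, wp_store]
    simp [hix, e1, e2, e3, e4, ht, he'.pw]
    and_intros <;> try omega
    have hnot : t ∉ D ∪ (Finset.range i).image fun j => sl (o + j) := by
      simp only [Finset.mem_union, Finset.mem_image, Finset.mem_range, not_or, not_exists, not_and]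
      refine ⟨htD, fun j hj e => ?_⟩
      have := hinj j (by omega) i hi (e.trans ht.symm)
      omega
    have hins : insert t (D ∪ (Finset.range i).image fun j => sl (o + j)) =
        D ∪ (Finset.range (i + 1)).image fun j => sl (o + j) := by
      rw [Finset.range_add_one, Finset.image_insert, ht, Finset.union_insert]
    have hsub : insert t (D ∪ (Finset.range i).image fun j => sl (o + j)) ⊆ Finset.range T := by
      refine Finset.insert_subset (by simpa using htT) (Finset.union_subset hD fun x hx => ?_)
      obtain ⟨j, hj, rfl⟩ := Finset.mem_image.1 hx
      have := Finset.mem_range.1 hj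
      simpa using (hslot j (by omega)).1
    have hlt := hcard _ hsub
    rw [Finset.card_insert_of_notMem hnot] at hlt
    refine (wp_countItem (P := P) (b := b) (z := (val t + a) % P.pw) (t := t)
      (s := (((s'.setR .px t).setR .ps (val t)).setR .z ((val t + a) % P.pw)).setA
        (.key (dstGrp b)) t ((val t + a) % P.pw)) (c := s'.arr (.cnt (dstGrp b)))
      ?_ (by simp) hm (by simp) h2 hnot (by omega)).mono ?_
    · exact ⟨he'.1, he'.2, he'.3, he'.4, he'.5, he'.6, by cases b <;> simpa [dstGrp] using he'.7,
        by simpa using he'.8, he'.9⟩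
    · rintro s'' c hf' ⟨g1, g2⟩
      have k1 : s''.arr (.key (dstGrp b)) = Function.update (s'.arr (.key (dstGrp b))) t
          ((val t + a) % P.pw) := by rw [hf'.arr _ rfl]; simp
      rw [hins] at g2
      refine ⟨by rw [add_mul]; omega, ?_, fun x => ?_⟩
      · simpa only [State.setR_arr, k1] using g2
      · simp only [k1, Function.update_apply, h3 x]
        have hex : (∃ j ≤ i, sl (o + j) = x) ↔
            x = t ∨ x ∈ (Finset.range i).image fun j => sl (o + j) := by
          simp only [Finset.mem_image, Finset.mem_range]
          constructor
          · rintro ⟨j, hj, rfl⟩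
            rcases hj.lt_or_eq with h | rfl
            · exact .inr ⟨j, h, rfl⟩
            · exact .inl ht
          · rintro (rfl | ⟨j, hj, rfl⟩)
            · exact ⟨i, le_rfl, ht⟩
            · exact ⟨j, hj.le, rfl⟩
        by_cases hxt : x = t
        · rw [if_pos hxt, if_pos (hex.2 (.inl hxt)), hxt]
        · rw [if_neg hxt]
          exact if_congr (by rw [hex]; simp only [hxt, false_or]) rfl rfl
  · rintro τ s' - hf ⟨h1, h2, h3⟩
    refine ⟨by omega, h2, h3, ?_⟩
    rw [hf.arr _ (by cases b <;> rfl), ← hs₁]; simp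

/-- The items with key `x`. -/
def grpSet (G : ℕ → ℕ) (T x : ℕ) : Finset ℕ := (Finset.range T).filter fun t => G t = x

theorem Grouped.image {G deg off slot : ℕ → ℕ} {nk T x : ℕ} (h : Grouped G deg off slot nk T)
    (hx : x < nk) : ((Finset.range (deg x)).image fun j => slot (off x + j)) = grpSet G T x := by
  ext t
  simp only [grpSet, Finset.mem_image, Finset.mem_range, Finset.mem_filter]
  constructor
  · rintro ⟨j, hj, rfl⟩; exact h.slot_mem hx hj
  · rintro ⟨ht, rfl⟩; exact h.exists_slot ht

theorem Grouped.card {G deg off slot : ℕ → ℕ} {nk T x : ℕ} (h : Grouped G deg off slot nk T)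
    (hx : x < nk) : (grpSet G T x).card = deg x := by
  rw [← h.image hx, Finset.card_image_of_injOn, Finset.card_range]
  intro j hj j' hj' e
  exact h.slot_inj hx (by simpa using hj) (by simpa using hj') e

/-- The last inequality refers to the counters before the placement, so it bounds the collisions of
the group with earlier items. Items of one group are not compared here: they are shifted by the same
amount, and different values below `pw` stay different. -/
theorem wp_place {nk x T : ℕ} {G val dg of sl : ℕ → ℕ} {D : Finset ℕ} (he : Env P s)
    (hx : s.reg .pg = x) (hxn : x < nk) (hnk : nk ≤ P.pw) (ho : s.reg .po = of x)
    (hd : s.reg .pd = dg x) (hg : Grouped G dg of sl nk T)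
    (hsl : s.arr (.slot (srcGrp b)) = sl) (hval : s.arr (valArr b) = val)
    (hT : T < P.pw) (hvl : ∀ t < T, val t < P.pw)
    (hc : Counted P (s.arr (.cnt (dstGrp b))) (s.arr (.key (dstGrp b))) D)
    (hD : D ⊆ Finset.range T) (hDx : ∀ t ∈ D, G t ≠ x) :
    WP P.B P.M (place b) s fun s' t => t ≤ P.lam * (13 * dg x + 10) + 14 * dg x + 7 ∧
      ∃ a < P.pw, Counted P (s'.arr (.cnt (dstGrp b))) (s'.arr (.key (dstGrp b)))
        (D ∪ grpSet G T x) ∧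
      (∀ t, s'.arr (.key (dstGrp b)) t = if t ∈ grpSet G T x then
        (val t + a) % P.pw else s.arr (.key (dstGrp b)) t) ∧
      s'.arr (.disp (dstGrp b)) = Function.update (s.arr (.disp (dstGrp b))) x a ∧
      P.pw * ∑ t ∈ grpSet G T x, s.arr (.cnt (dstGrp b)) (P.pw + (val t + a) % P.pw) ≤
        dg x * D.card := by
  have hod := hg.off_add_deg x hxn
  have hdT := hg.deg_le hxn
  have hDc : D.card ≤ T := by simpa using Finset.card_le_card hD
  simp only [place, wp_seq]
  refine (wp_chooseDisp (P := P) (b := b) (o := of x) (d := dg x)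
    (X := fun j => val (sl (of x + j))) (c := s.arr (.cnt (dstGrp b))) he ho hd (by omega) (by omega)
    (fun j hj => ?_) (fun j hj => hvl _ (hg.slot_mem hxn hj).1) rfl hc.tree
    (by rw [hc.one]; omega)).mono ?_
  · have := (hg.slot_mem hxn hj).1
    rw [hsl, hval]; exact ⟨by omega, rfl⟩
  rintro s₁ t₁ hf₁ ⟨h1, h2, h3⟩
  obtain ⟨a, ha⟩ : ∃ a, s₁.reg .pa = a := ⟨_, rfl⟩
  rw [ha, hc.one] at h3
  rw [ha] at h2
  refine (wp_commitDisp (P := P) (b := b) (o := of x) (d := dg x) (a := a) (x := x) (T := T)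
    (sl := sl) (val := val) (D := D) (he.frame hf₁ (by cases b <;> rfl))
    ((hf₁.reg _ rfl).trans hx) (by omega) ((hf₁.reg _ rfl).trans ho) ((hf₁.reg _ rfl).trans hd)
    (by omega) ha h2 ((hf₁.arr _ rfl).trans hsl) ((hf₁.arr _ rfl).trans hval) hT
    (fun j hj => ?_) (fun j hj j' hj' e => hg.slot_inj hxn hj hj' e) ?_ hD).mono ?_
  · obtain ⟨g1, g2⟩ := hg.slot_mem hxn hj
    exact ⟨g1, fun h => hDx _ h g2, hvl _ g1⟩
  · rw [hf₁.arr (.cnt _) rfl, hf₁.arr (.key _) rfl]; exact hc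
  rintro s₂ t₂ hf₂ ⟨h4, h5, h6, h7⟩
  rw [hg.image hxn] at h5 h6
  refine ⟨?_, a, h2, h5, ?_, ?_, ?_⟩
  · have : P.lam * (13 * dg x + 10) + 14 * dg x + 7 =
      P.lam * (8 * dg x + 10) + 4 + (dg x * (5 * P.lam + 14) + 3) := by ring
    omega
  · rw [hf₁.arr (.key _) rfl] at h6; exact h6
  · rw [hf₁.arr (.disp _) rfl] at h7; exact h7
  · refine le_trans (le_of_eq ?_) h3
    congr 1
    rw [← hg.image hxn, Finset.sum_image]
    · rfl
    · intro j hj j' hj' e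
      exact hg.slot_inj hxn (by simpa using hj) (by simpa using hj') e

/-- The number of pairs of items with equal positions. -/
def coll (pos : ℕ → ℕ) (S S' : Finset ℕ) : ℕ := ∑ t ∈ S, (S'.filter fun t' => pos t' = pos t).card

theorem coll_comm (pos : ℕ → ℕ) (S S' : Finset ℕ) : coll pos S S' = coll pos S' S := by
  simp only [coll, Finset.card_filter]
  rw [Finset.sum_comm]
  exact Finset.sum_congr rfl fun t _ => Finset.sum_congr rfl fun t' _ => by simp only [eq_comm]

/-- `coll` counts ordered pairs, including those of an item with itself; mixed pairs therefore count
twice. -/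
theorem coll_union {pos : ℕ → ℕ} {S S' : Finset ℕ} (h : Disjoint S S') :
    coll pos (S ∪ S') (S ∪ S') = coll pos S S + 2 * coll pos S' S + coll pos S' S' := by
  have h1 : ∀ A, coll pos A (S ∪ S') = coll pos A S + coll pos A S' := fun A => by
    rw [coll, coll, coll, ← Finset.sum_add_distrib]
    refine Finset.sum_congr rfl fun t _ => ?_
    rw [Finset.filter_union, Finset.card_union_of_disjoint (Finset.disjoint_filter_filter h)]
  have h2 : coll pos (S ∪ S') (S ∪ S') = coll pos S (S ∪ S') + coll pos S' (S ∪ S') :=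
    Finset.sum_union h
  rw [h2, h1, h1, coll_comm pos S S']
  ring

theorem coll_self {pos : ℕ → ℕ} {S : Finset ℕ}
    (h : ∀ t ∈ S, ∀ t' ∈ S, pos t = pos t' → t = t') : coll pos S S = S.card := by
  rw [coll, Finset.card_eq_sum_ones]
  refine Finset.sum_congr rfl fun t ht => ?_
  rw [Finset.card_eq_one]
  refine ⟨t, Finset.eq_singleton_iff_unique_mem.2 ⟨by simp [ht], fun t' ht' => ?_⟩⟩
  rw [Finset.mem_filter] at ht'
  exact h _ ht'.1 _ ht ht'.2

theorem coll_congr {pos pos' : ℕ → ℕ} {S S' : Finset ℕ} (h : ∀ t ∈ S, pos t = pos' t)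
    (h' : ∀ t ∈ S', pos t = pos' t) : coll pos S S' = coll pos' S S' := by
  refine Finset.sum_congr rfl fun t ht => ?_
  congr 1
  refine Finset.filter_congr fun t' ht' => ?_
  rw [h t ht, h' t' ht']

theorem add_mod_inj {x y a p : ℕ} (hx : x < p) (hy : y < p) (h : (x + a) % p = (y + a) % p) :
    x = y := by
  have : x ≡ y [MOD p] := Nat.ModEq.add_right_cancel' a h
  rwa [Nat.ModEq, Nat.mod_eq_of_lt hx, Nat.mod_eq_of_lt hy] at this

/-- Distributes the keys to the buckets. -/
def placeKeys : Stmt :=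
  .set .gN ♯.V ;; .set .gL ♯.T ;; csr .col ;;
  .loop .pg ♯.V (.load .po (.off .col) ♯.pg ;; .load .pd (.deg .col) ♯.pg ;; place false)

/-- If `N` keys are placed, then `pw * coll ≤ pw * N + N ^ 2`: a group of `d` keys adds `d` for
itself and at most `2 * d * N / pw` for collisions with earlier keys. With `8 * T ≤ pw` the final
number is at most `9 * T / 8`. -/
theorem wp_placeKeys {T : ℕ} (he : Env P s) (hT : s.reg .T = T) (hTp : 8 * T ≤ P.pw)
    (hlt : ∀ t < T, s.arr .ku t < P.V ∧ s.arr (.key .col) t < P.V)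
    (hinj : ∀ t < T, ∀ t' < T, s.arr .ku t = s.arr .ku t' →
      s.arr (.key .col) t = s.arr (.key .col) t' → t = t')
    (hdeg : ∀ x, s.arr (.deg .col) x = 0) (hfill : ∀ x, s.arr (.fill .col) x = 0)
    (hcnt : ∀ x, s.arr (.cnt .bkt) x = 0) (hdisp : ∀ x, s.arr (.disp .bkt) x = 0) :
    WP P.B P.M placeKeys s fun s' t =>
      t ≤ P.lam * (13 * T + 10 * P.V) + 26 * T + 20 * P.V + 12 ∧
      (∀ t < T, s'.arr (.key .bkt) t < P.pw ∧ s'.arr (.key .bkt) t =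
        (s.arr .ku t + s'.arr (.disp .bkt) (s.arr (.key .col) t)) % P.pw) ∧
      (∀ x, s'.arr (.disp .bkt) x < P.pw) ∧
      8 * coll (s'.arr (.key .bkt)) (Finset.range T) (Finset.range T) ≤ 9 * T := by
  have hB := P.M_lt_B
  have hM := P.pw_le_M
  have hsz := P.size_le (k := 1) (by omega)
  have hV1 := P.V_pos
  have hm1 := P.m_pos
  simp only [placeKeys, wp_seq, wp_set]
  refine ⟨by simp, by simp, ?_⟩
  refine (wp_csr (B := P.B) (M := P.M) (g := .col) (n := T) (N := P.V) (K := s.arr (.key .col))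
    (by simp) (by simp [hT]) (by simp [he.V]) hB (by omega) (by omega) (by simpa using hdeg)
    (by simpa using hfill) fun i hi => (hlt i hi).2).mono ?_
  rintro s₁ t₁ hf₁ ⟨h1, hg⟩
  have he₁ : Env P s₁ := by
    refine Env.frame (s := (s.setR .gN (s.reg .V)).setR .gL (s.reg .T)) ?_ hf₁ rfl
    exact he.congr (by simp) rfl rfl
  have e1 : s₁.arr (.key .col) = s.arr (.key .col) := hf₁.arr _ rfl
  have e2 : s₁.arr .ku = s.arr .ku := hf₁.arr _ rfl
  have e3 : s₁.arr (.cnt .bkt) = s.arr (.cnt .bkt) := hf₁.arr _ rfl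
  have e4 : s₁.arr (.disp .bkt) = s.arr (.disp .bkt) := hf₁.arr _ rfl
  obtain ⟨dg, hdg⟩ : ∃ dg, s₁.arr (.deg .col) = dg := ⟨_, rfl⟩
  obtain ⟨of, hof⟩ : ∃ of, s₁.arr (.off .col) = of := ⟨_, rfl⟩
  obtain ⟨sl, hsl⟩ : ∃ sl, s₁.arr (.slot .col) = sl := ⟨_, rfl⟩
  obtain ⟨G, hG⟩ : ∃ G, s.arr (.key .col) = G := ⟨_, rfl⟩
  obtain ⟨val, hval⟩ : ∃ val, s.arr .ku = val := ⟨_, rfl⟩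
  rw [hdg, hof, hsl, hG] at hg
  simp only [hG, hval] at hlt hinj ⊢
  refine WP.loop P.V (fun i τ s' =>
      τ ≤ P.lam * (13 * ∑ u ∈ Finset.range i, dg u + 10 * i) + 14 * ∑ u ∈ Finset.range i, dg u +
        11 * i ∧
      Counted P (s'.arr (.cnt .bkt)) (s'.arr (.key .bkt))
        ((Finset.range T).filter fun t => G t < i) ∧
      (∀ t < T, G t < i → s'.arr (.key .bkt) t = (val t + s'.arr (.disp .bkt) (G t)) % P.pw) ∧
      (∀ x, s'.arr (.disp .bkt) x < P.pw) ∧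
      P.pw * coll (s'.arr (.key .bkt)) ((Finset.range T).filter fun t => G t < i)
        ((Finset.range T).filter fun t => G t < i) ≤
          P.pw * ((Finset.range T).filter fun t => G t < i).card +
            ((Finset.range T).filter fun t => G t < i).card ^ 2)
    (by simp [he₁.V]) (by simp) (by omega) ?_ ?_ ?_
  · refine ⟨by simp, ⟨?_, ?_⟩, by simp, ?_, ?_⟩
    · simp [e3, hcnt]
    · simp
    · simp [e4, hdisp]; omega
    · simp [coll]
  · rintro i τ s' hi hix hf ⟨g1, g2, g3, g4, g5⟩
    have he' := he₁.frame hf rfl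
    have k1 : s'.arr (.deg .col) = dg := (hf.arr _ rfl).trans hdg
    have k2 : s'.arr (.off .col) = of := (hf.arr _ rfl).trans hof
    have k3 : s'.arr (.slot .col) = sl := (hf.arr _ rfl).trans hsl
    have k4 : s'.arr .ku = val := (hf.arr _ rfl).trans (e2.trans hval)
    simp only [wp_seq, wp_load]
    simp [hix, k1, k2]
    and_intros <;> try omega
    set D := (Finset.range T).filter fun t => G t < i with hD
    refine (wp_place (P := P) (b := false) (nk := P.V) (x := i) (T := T) (G := G) (val := val)
      (dg := dg) (of := of) (sl := sl) (D := D)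
      (s := (s'.setR .po (of i)).setR .pd (dg i)) (he'.congr (by simp) rfl rfl)
      (by simpa using hix) hi (by omega) (by simp) (by simp) hg k3 k4 (by omega) (fun t ht => by have := (hlt t ht).1; omega)
      g2 (Finset.filter_subset _ _) (fun t ht => ?_)).mono ?_
    · have := (Finset.mem_filter.1 ht).2; omega
    rintro s₂ t₂ - ⟨a1, a, ha, a2, a3, a4, a5⟩
    simp only [dstGrp, State.setR_arr] at a2 a3 a4 a5
    obtain ⟨F, hF⟩ : ∃ F, grpSet G T i = F := ⟨_, rfl⟩
    have hmF : ∀ t, t ∈ F ↔ t < T ∧ G t = i := fun t => by simp [← hF, grpSet]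
    have hmD : ∀ t, t ∈ D ↔ t < T ∧ G t < i := fun t => by simp [hD]
    have hFc : F.card = dg i := by rw [← hF, hg.card hi]
    rw [hF] at a2 a3 a5
    have hDF : (Finset.range T).filter (fun t => G t < i + 1) = D ∪ F := by
      ext t
      rw [Finset.mem_union, hmF, hmD, Finset.mem_filter, Finset.mem_range, ← and_or_left]
      refine and_congr_right fun _ => by omega
    have hdis : Disjoint D F := Finset.disjoint_left.2 fun t h h' => by
      have := ((hmD t).1 h).2; have := ((hmF t).1 h').2; omega
    have hDF' : (Finset.range T).filter (fun t => G t ≤ i) = D ∪ F := by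
      rw [← hDF]; exact Finset.filter_congr fun t _ => by omega
    have hkD : ∀ t ∈ D, s₂.arr (.key .bkt) t = s'.arr (.key .bkt) t := fun t ht => by
      rw [a3, if_neg (Finset.disjoint_left.1 hdis ht)]
    have hkF : ∀ t ∈ F, s₂.arr (.key .bkt) t = (val t + a) % P.pw := fun t ht => by
      rw [a3, if_pos ht]
    simp only [hDF']
    refine ⟨?_, a2, fun t ht hti => ?_, fun x => ?_, ?_⟩
    · rw [Finset.sum_range_succ]
      have : P.lam * (13 * (∑ u ∈ Finset.range i, dg u + dg i) + 10 * (i + 1)) =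
        P.lam * (13 * ∑ u ∈ Finset.range i, dg u + 10 * i) + P.lam * (13 * dg i + 10) := by ring
      omega
    · rw [a4, Function.update_apply]
      by_cases h : G t = i
      · rw [if_pos h]; exact hkF t ((hmF t).2 ⟨ht, h⟩)
      · rw [if_neg h, hkD t ((hmD t).2 ⟨ht, by omega⟩)]; exact g3 t ht (by omega)
    · rw [a4, Function.update_apply]; split
      · exact ha
      · exact g4 x
    · rw [coll_union hdis, Finset.card_union_of_disjoint hdis,
        coll_congr (S := D) (S' := D) hkD hkD, coll_self (S := F) fun t ht t' ht' e => ?_]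
      -- The counters on the last level count the earlier keys in a bucket, so the bound of
      -- `wp_place` is one on mixed collisions.
      · have h6 : coll (s₂.arr (.key .bkt)) F D =
            ∑ t ∈ F, s'.arr (.cnt .bkt) (P.pw + (val t + a) % P.pw) := by
          refine Finset.sum_congr rfl fun t ht => ?_
          rw [g2.leaf (Nat.mod_lt _ (by omega)), hkF t ht]
          congr 1
          exact Finset.filter_congr fun t' ht' => by rw [hkD t' ht']
        rw [← h6, ← hFc] at a5
        nlinarith
      -- Keys of one group have the same second vertex, hence different first vertices, and the
      -- common displacement keeps them in different buckets.
      · rw [hkF t ht, hkF t' ht'] at e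
        obtain ⟨b1, b2⟩ := (hmF t).1 ht
        obtain ⟨b3, b4⟩ := (hmF t').1 ht'
        have c1 := (hlt t b1).1
        have c2 := (hlt t' b3).1
        exact hinj t b1 t' b3 (add_mod_inj (by omega) (by omega) e) (b2.trans b4.symm)
  · rintro τ s' - hf ⟨g1, g2, g3, g4, g5⟩
    have hall : (Finset.range T).filter (fun t => G t < P.V) = Finset.range T :=
      Finset.filter_true_of_mem fun t ht => (hlt t (Finset.mem_range.1 ht)).2
    rw [hall] at g2 g5
    rw [hg.sum_deg] at g1
    refine ⟨by omega, fun t ht => ⟨g2.pos_lt t (by simpa using ht), g3 t ht (hlt t ht).2⟩, g4, ?_⟩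
    rw [Finset.card_range] at g5
    have : P.pw * (8 * coll (s'.arr (.key .bkt)) (Finset.range T) (Finset.range T)) ≤
        P.pw * (9 * T) := by nlinarith
    exact Nat.le_of_mul_le_mul_left this (by omega)

end

end DistOracle

/-! ### The second level of the dictionary -/

namespace DistOracle

/-- Places the buckets with at least `th` and less than `2 * th` items. -/
def bucketClass : Stmt :=
  .loop .pg ♯.pw (.load .pd (.deg .bkt) ♯.pg ;;
    .when (.and (.not (.lt ♯.pd ♯.th)) (.lt ♯.pd (2 * ♯.th)))
      (.load .po (.off .bkt) ♯.pg ;; place true))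

/-- Places the buckets, in order of decreasing size class. -/
def placeBuckets : Stmt :=
  .set .gN ♯.pw ;; .set .gL ♯.T ;; csr .bkt ;; .set .th ♯.pw ;;
  .loop .gc (♯.lam + 1) (bucketClass ;; .set .th (♯.th / 2))

/-- Enters the items at their final positions. -/
def fillTable : Stmt := .loop .t ♯.T (.load .x (.key .fin) ♯.t ;; .store .tab ♯.x ♯.t)

section

variable {P : Setup} {s : State}

/-- The items in `D` have been placed without collisions. -/
structure PlacedOK (P : Setup) (G val : ℕ → ℕ) (D : Finset ℕ) (s : State) : Prop where
  counted : Counted P (s.arr (.cnt .fin)) (s.arr (.key .fin)) D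
  inj : ∀ t ∈ D, ∀ t' ∈ D, s.arr (.key .fin) t = s.arr (.key .fin) t' → t = t'
  key : ∀ t ∈ D, s.arr (.key .fin) t = (val t + s.arr (.disp .fin) (G t)) % P.pw
  disp : ∀ x, s.arr (.disp .fin) x < P.pw

theorem PlacedOK.setR {G val : ℕ → ℕ} {D : Finset ℕ} (h : PlacedOK P G val D s) (x : Reg) (v : ℕ) :
    PlacedOK P G val D (s.setR x v) := ⟨h.counted, h.inj, h.key, h.disp⟩

/-- What the second level needs to know about the buckets. -/
structure Buckets (P : Setup) (T : ℕ) (G val dg of sl : ℕ → ℕ) : Prop where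
  grouped : Grouped G dg of sl P.pw T
  T_lt : T < P.pw
  val_lt : ∀ t < T, val t < P.pw
  inj : ∀ t < T, ∀ t' < T, G t = G t' → val t = val t' → t = t'
  coll_lt : 2 * coll G (Finset.range T) (Finset.range T) < P.pw

/-- Both sides are the sum of the squares of the bucket sizes. -/
theorem Buckets.sum_dg {T : ℕ} {G val dg of sl : ℕ → ℕ} (h : Buckets P T G val dg of sl) :
    coll G (Finset.range T) (Finset.range T) = ∑ t ∈ Finset.range T, dg (G t) :=
  Finset.sum_congr rfl fun t ht =>
    h.grouped.card (h.grouped.key_lt t (Finset.mem_range.1 ht))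

/-- All placed items are in buckets of size at least `th`, so `th * |D|` is at most the number of
collisions of the first level, which is below `pw / 2`. As the new bucket has fewer than `2 * th`
items, `dg x * |D| < pw`, and the number of new collisions, being an integer below one, is zero. -/
theorem Buckets.place_free {T x th : ℕ} {G val dg of sl : ℕ → ℕ} (h : Buckets P T G val dg of sl)
    {D : Finset ℕ} {c X : ℕ → ℕ} (hD : ∀ t ∈ D, t < T ∧ th ≤ dg (G t)) (hx : dg x < 2 * th)
    {S : Finset ℕ} (hS : P.pw * ∑ t ∈ S, c (X t) ≤ dg x * D.card) : ∀ t ∈ S, c (X t) = 0 := by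
  have h1 : th * D.card ≤ coll G (Finset.range T) (Finset.range T) := by
    rw [h.sum_dg]
    calc th * D.card = ∑ t ∈ D, th := by simp [mul_comm]
      _ ≤ ∑ t ∈ D, dg (G t) := Finset.sum_le_sum fun t ht => (hD t ht).2
      _ ≤ _ := Finset.sum_le_sum_of_subset fun t ht => Finset.mem_range.2 (hD t ht).1
  have h2 : dg x * D.card ≤ 2 * (th * D.card) := by
    rw [← mul_assoc]; exact Nat.mul_le_mul_right _ hx.le
  have h3 := h.coll_lt
  have h4 : ∑ t ∈ S, c (X t) = 0 := by
    by_contra h5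
    have := Nat.le_mul_of_pos_right P.pw (Nat.pos_of_ne_zero h5)
    omega
  exact Finset.sum_eq_zero_iff.1 h4

/-- Since `th ≥ 1`, a bucket that is placed is not empty, and its fixed cost can be charged to its
items. Together with a scan of all buckets this gives the amortized bound. -/
theorem wp_bucketClass {T th : ℕ} {G val dg of sl : ℕ → ℕ} (h : Buckets P T G val dg of sl)
    (he : Env P s) (hth : s.reg .th = th) (hth1 : 1 ≤ th) (hthp : th ≤ P.pw)
    (hdg : s.arr (.deg .bkt) = dg) (hof : s.arr (.off .bkt) = of) (hsl : s.arr (.slot .bkt) = sl)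
    (hval : s.arr (.key .col) = val)
    (hp : PlacedOK P G val ((Finset.range T).filter fun t => 2 * th ≤ dg (G t)) s) :
    WP P.B P.M bucketClass s fun s' t =>
      t + (23 * P.lam + 21) * ((Finset.range T).filter fun t => 2 * th ≤ dg (G t)).card ≤
        8 * P.pw + 2 + (23 * P.lam + 21) * ((Finset.range T).filter fun t => th ≤ dg (G t)).card ∧
      PlacedOK P G val ((Finset.range T).filter fun t => th ≤ dg (G t)) s' := by
  have hB := P.M_lt_B
  have hM := P.pw_le_M
  have hsz := P.size_le (k := 1) (by omega)
  have hV1 := P.V_pos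
  have hT := h.T_lt
  rw [bucketClass]
  refine WP.loop P.pw (fun i τ s' =>
      τ + (23 * P.lam + 21) * ((Finset.range T).filter fun t => 2 * th ≤ dg (G t)).card ≤
        8 * i + (23 * P.lam + 21) *
          ((Finset.range T).filter fun t => 2 * th ≤ dg (G t) ∨ th ≤ dg (G t) ∧ G t < i).card ∧
      PlacedOK P G val
        ((Finset.range T).filter fun t => 2 * th ≤ dg (G t) ∨ th ≤ dg (G t) ∧ G t < i) s')
    he.pw (by simp) (by omega) (by simpa using hp.setR _ _) ?_ ?_
  · rintro i τ s' hi hix hf ⟨g1, g2⟩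
    have he' := he.frame hf rfl
    have k1 : s'.arr (.deg .bkt) = dg := (hf.arr _ rfl).trans hdg
    have k2 : s'.arr (.off .bkt) = of := (hf.arr _ rfl).trans hof
    have k3 : s'.arr (.slot .bkt) = sl := (hf.arr _ rfl).trans hsl
    have k4 : s'.arr (.key .col) = val := (hf.arr _ rfl).trans hval
    have k5 : s'.reg .th = th := (hf.reg _ rfl).trans hth
    have hsame : ¬ (th ≤ dg i ∧ dg i < 2 * th) →
        ((Finset.range T).filter fun t => 2 * th ≤ dg (G t) ∨ th ≤ dg (G t) ∧ G t < i + 1) =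
        (Finset.range T).filter fun t => 2 * th ≤ dg (G t) ∨ th ≤ dg (G t) ∧ G t < i := fun hn => by
      refine Finset.filter_congr fun t _ => ?_
      by_cases hti : G t = i
      · rw [hti]; omega
      · omega
    have hdT := h.grouped.deg_le hi
    simp only [wp_seq, wp_load, wp_when]
    simp only [Exp.ok_r, Exp.eval_r, hix, k1, State.setR_reg, reduceCtorEq, if_false, if_true,
      Cond.ok_and, Cond.ok_not, Cond.ok_lt, Exp.ok_mul, Exp.ok_two, Exp.eval_two, Exp.eval_mul, k5,
      Cond.holds_and, Cond.holds_not, Cond.holds_lt, not_lt, State.setR_arr, k2, true_and]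
    refine ⟨by omega, by omega, fun hin => ⟨by omega, ?_⟩, fun hn => ?_⟩
    swap
    · rw [hsame (by omega)]
      exact ⟨by omega, (g2.setR _ _).setR _ _⟩
    set D := (Finset.range T).filter fun t => 2 * th ≤ dg (G t) ∨ th ≤ dg (G t) ∧ G t < i with hD
    refine (wp_place (P := P) (b := true) (nk := P.pw) (x := i) (T := T) (G := G) (val := val)
      (dg := dg) (of := of) (sl := sl) (D := D)
      (s := (s'.setR .pd (dg i)).setR .po (of i)) (he'.congr (by simp) rfl rfl)
      (by simpa using hix) hi le_rfl (by simp) (by simp) h.grouped k3 k4 hT h.val_lt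
      g2.counted (Finset.filter_subset _ _) (fun t ht => ?_)).mono ?_
    · rintro rfl
      have := (Finset.mem_filter.1 ht).2; omega
    rintro s₂ t₂ - ⟨a1, a, ha, a2, a3, a4, a5⟩
    simp only [dstGrp, State.setR_arr] at a2 a3 a4 a5
    obtain ⟨F, hF⟩ : ∃ F, grpSet G T i = F := ⟨_, rfl⟩
    have hmF : ∀ t, t ∈ F ↔ t < T ∧ G t = i := fun t => by simp [← hF, grpSet]
    have hmD : ∀ t, t ∈ D ↔ t < T ∧ (2 * th ≤ dg (G t) ∨ th ≤ dg (G t) ∧ G t < i) := fun t => by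
      simp [hD]
    have hFc : F.card = dg i := by rw [← hF, h.grouped.card hi]
    rw [hF] at a2 a3 a5
    have hDF : ((Finset.range T).filter fun t => 2 * th ≤ dg (G t) ∨ th ≤ dg (G t) ∧ G t < i + 1) =
        D ∪ F := by
      ext t
      rw [Finset.mem_union, hmF, hmD, Finset.mem_filter, Finset.mem_range, ← and_or_left]
      refine and_congr_right fun _ => ?_
      by_cases hti : G t = i
      · rw [hti]; omega
      · omega
    have hdis : Disjoint D F := Finset.disjoint_left.2 fun t h h' => by
      have h1 := ((hmD t).1 h).2
      have h2 := ((hmF t).1 h').2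
      rw [h2] at h1; omega
    have hkD : ∀ t ∈ D, s₂.arr (.key .fin) t = s'.arr (.key .fin) t := fun t ht => by
      rw [a3, if_neg (Finset.disjoint_left.1 hdis ht)]
    have hkF : ∀ t ∈ F, s₂.arr (.key .fin) t = (val t + a) % P.pw := fun t ht => by
      rw [a3, if_pos ht]
    have hfree := h.place_free (D := D) (S := F) (c := s'.arr (.cnt .fin))
      (X := fun t => P.pw + (val t + a) % P.pw) (th := th) (x := i)
      (fun t ht => by have := (hmD t).1 ht; exact ⟨this.1, by omega⟩) hin.2 a5
    have hnew : ∀ t ∈ F, ∀ t' ∈ D, s₂.arr (.key .fin) t ≠ s₂.arr (.key .fin) t' :=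
      fun t ht t' ht' e => by
        have h1 := hfree t ht
        simp only [g2.counted.leaf (Nat.mod_lt _ (show P.pw > 0 by omega)),
          Finset.card_eq_zero] at h1
        have : t' ∈ D.filter fun x => s'.arr (.key .fin) x = (val t + a) % P.pw :=
          Finset.mem_filter.2 ⟨ht', by rw [← hkD t' ht', ← e, hkF t ht]⟩
        simp [h1] at this
    rw [hDF]
    refine ⟨?_, PlacedOK.setR ⟨a2, fun t ht t' ht' e => ?_, fun t ht => ?_, fun x => ?_⟩ _ _⟩
    · rw [Finset.card_union_of_disjoint hdis, hFc]
      have h1 : P.lam * (13 * dg i + 10) + 14 * dg i + 7 ≤ (23 * P.lam + 21) * dg i := by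
        have : P.lam ≤ P.lam * dg i := Nat.le_mul_of_pos_right _ (by omega)
        have h3 : P.lam * (13 * dg i + 10) = 13 * (P.lam * dg i) + 10 * P.lam := by ring
        have h4 : (23 * P.lam + 21) * dg i = 23 * (P.lam * dg i) + 21 * dg i := by ring
        omega
      have h2 : ∀ A B, (23 * P.lam + 21) * (A + B) =
          (23 * P.lam + 21) * A + (23 * P.lam + 21) * B := fun A B => mul_add _ _ _
      rw [h2]; omega
    · rcases Finset.mem_union.1 ht with ht | ht <;> rcases Finset.mem_union.1 ht' with ht' | ht'
      · rw [hkD t ht, hkD t' ht'] at e; exact g2.inj t ht t' ht' e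
      · exact absurd e.symm (hnew t' ht' t ht)
      · exact absurd e (hnew t ht t' ht')
      · rw [hkF t ht, hkF t' ht'] at e
        obtain ⟨b1, b2⟩ := (hmF t).1 ht
        obtain ⟨b3, b4⟩ := (hmF t').1 ht'
        exact h.inj t b1 t' b3 (b2.trans b4.symm)
          (add_mod_inj (h.val_lt t b1) (h.val_lt t' b3) e)
    · rw [a4, Function.update_apply]
      rcases Finset.mem_union.1 ht with ht | ht
      · have : G t ≠ i := fun e => Finset.disjoint_left.1 hdis ht ((hmF t).2 ⟨((hmD t).1 ht).1, e⟩)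
        rw [if_neg this, hkD t ht]; exact g2.key t ht
      · rw [if_pos ((hmF t).1 ht).2, hkF t ht]
    · rw [a4, Function.update_apply]; split
      · exact ha
      · exact g2.disp x
  · rintro τ s' - hf ⟨g1, g2⟩
    have : ((Finset.range T).filter fun t => 2 * th ≤ dg (G t) ∨ th ≤ dg (G t) ∧ G t < P.pw) =
        (Finset.range T).filter fun t => th ≤ dg (G t) := Finset.filter_congr fun t ht => by
      have := h.grouped.key_lt t (Finset.mem_range.1 ht); omega
    rw [this] at g1 g2
    exact ⟨by omega, g2⟩

/-- Instead of being sorted by size, the buckets are scanned once for each of the `lam + 1`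
thresholds `pw / 2 ^ i`; `Buckets.place_free` tolerates the factor two within a class. -/
theorem wp_placeBuckets {T : ℕ} {G val : ℕ → ℕ} (he : Env P s) (hT : s.reg .T = T)
    (hTp : T < P.pw) (hG : s.arr (.key .bkt) = G) (hval : s.arr (.key .col) = val)
    (hGlt : ∀ t < T, G t < P.pw) (hvl : ∀ t < T, val t < P.pw)
    (hinj : ∀ t < T, ∀ t' < T, G t = G t' → val t = val t' → t = t')
    (hcoll : 2 * coll G (Finset.range T) (Finset.range T) < P.pw)
    (hdeg : ∀ x, s.arr (.deg .bkt) x = 0) (hfill : ∀ x, s.arr (.fill .bkt) x = 0)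
    (hcnt : ∀ x, s.arr (.cnt .fin) x = 0) (hdisp : ∀ x, s.arr (.disp .fin) x = 0) :
    WP P.B P.M placeBuckets s fun s' t =>
      t ≤ (P.lam + 1) * (8 * P.pw + 5) + (23 * P.lam + 21) * T + 12 * T + 5 * P.pw + 12 ∧
      PlacedOK P G val (Finset.range T) s' := by
  have hB := P.M_lt_B
  have hM := P.pw_le_M
  have hlam := P.lam_lt
  simp only [placeBuckets, wp_seq, wp_set]
  refine ⟨by simp, by simp, ?_⟩
  refine (wp_csr (B := P.B) (M := P.M) (g := .bkt) (n := T) (N := P.pw) (K := G)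
    (by simpa using hG) (by simp [hT]) (by simp [he.pw]) hB (by omega) (by omega)
    (by simpa using hdeg) (by simpa using hfill) hGlt).mono ?_
  rintro s₁ t₁ hf₁ ⟨h1, hg⟩
  refine ⟨by simp, ?_⟩
  have he₁ : Env P s₁ := by
    refine Env.frame (s := (s.setR .gN (s.reg .pw)).setR .gL (s.reg .T)) ?_ hf₁ rfl
    exact he.congr (by simp) rfl rfl
  have e1 : s₁.arr (.key .col) = val := (hf₁.arr _ rfl).trans hval
  have e3 : s₁.arr (.cnt .fin) = s.arr (.cnt .fin) := hf₁.arr _ rfl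
  have e4 : s₁.arr (.disp .fin) = s.arr (.disp .fin) := hf₁.arr _ rfl
  obtain ⟨dg, hdg⟩ : ∃ dg, s₁.arr (.deg .bkt) = dg := ⟨_, rfl⟩
  obtain ⟨of, hof⟩ : ∃ of, s₁.arr (.off .bkt) = of := ⟨_, rfl⟩
  obtain ⟨sl, hsl⟩ : ∃ sl, s₁.arr (.slot .bkt) = sl := ⟨_, rfl⟩
  rw [hdg, hof, hsl] at hg
  have hb : Buckets P T G val dg of sl := ⟨hg, hTp, hvl, hinj, hcoll⟩
  simp only [Exp.eval_r, he₁.pw]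
  have hdT : ∀ t < T, dg (G t) ≤ T := fun t ht => hg.deg_le (hGlt t ht)
  have hd1 : ∀ t < T, 1 ≤ dg (G t) := fun t ht => by
    obtain ⟨j, hj, -⟩ := hg.exists_slot ht; omega
  refine WP.loop (P.lam + 1) (fun i τ s' => τ ≤ i * (8 * P.pw + 5) + (23 * P.lam + 21) *
        ((Finset.range T).filter fun t => 2 * (P.pw / 2 ^ i) ≤ dg (G t)).card ∧
      s'.reg .th = P.pw / 2 ^ i ∧
      PlacedOK P G val ((Finset.range T).filter fun t => 2 * (P.pw / 2 ^ i) ≤ dg (G t)) s')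
    (by simp [he₁.lam]) (by simp [he₁.lam]; omega) (by omega) ?_ ?_ ?_
  · have : ((Finset.range T).filter fun t => 2 * (P.pw / 2 ^ 0) ≤ dg (G t)) = ∅ :=
      Finset.filter_eq_empty_iff.2 fun t ht => by
        have := hdT t (Finset.mem_range.1 ht)
        simp only [pow_zero, Nat.div_one]; omega
    rw [this]
    exact ⟨by simp, by simp, ⟨fun j _ z _ => (congrFun e3 _).trans (hcnt _), by simp⟩, by simp, by simp,
      by simp [e4, hdisp]; omega⟩
  · rintro i τ s' hi hix hf ⟨g1, g2, g3⟩
    have he' : Env P s' := Env.frame (s := s₁.setR .th P.pw) (he₁.congr (by simp) rfl rfl) hf rfl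
    obtain ⟨th, hth⟩ : ∃ th, P.pw / 2 ^ i = th := ⟨_, rfl⟩
    have hth' : 2 ^ (P.lam - i) = th := by
      rw [← hth, P.pw_eq, Nat.pow_div (by omega) (by norm_num)]
    have hth1 : 1 ≤ th := by rw [← hth']; exact Nat.one_le_two_pow
    have hthp : th ≤ P.pw := by rw [← hth]; exact Nat.div_le_self _ _
    have hdiv : P.pw / 2 ^ (i + 1) = th / 2 := by rw [pow_succ, ← Nat.div_div_eq_div_mul, hth]
    rw [hth] at g1 g2 g3
    simp only [wp_seq]
    refine (wp_bucketClass (P := P) hb he' g2 hth1 hthp ((hf.arr _ rfl).trans hdg)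
      ((hf.arr _ rfl).trans hof) ((hf.arr _ rfl).trans hsl) ((hf.arr _ rfl).trans e1) g3).mono ?_
    rintro s₂ t₂ hf₂ ⟨a1, a2⟩
    have k1 : s₂.reg .th = th := (hf₂.reg _ rfl).trans g2
    -- The thresholds are powers of two, so `2 * (th / 2) = th`, except for `th = 1`; there both
    -- conditions hold for every item, because its bucket is not empty.
    have hnext : ((Finset.range T).filter fun t => 2 * (th / 2) ≤ dg (G t)) =
        (Finset.range T).filter fun t => th ≤ dg (G t) := Finset.filter_congr fun t ht => by
      have := hd1 t (Finset.mem_range.1 ht)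
      rcases Nat.eq_zero_or_pos (P.lam - i) with h0 | h0
      · rw [h0] at hth'; omega
      · obtain ⟨e, he⟩ : ∃ e, P.lam - i = e + 1 := ⟨P.lam - i - 1, by omega⟩
        rw [he, pow_succ] at hth'; omega
    simp only [wp_set, Exp.ok_div, Exp.ok_r, Exp.ok_two, Exp.eval_div, Exp.eval_r, Exp.eval_two, k1,
      hdiv, hnext]
    refine ⟨by simp; omega, ?_, by simp, (a2.setR _ _).setR _ _⟩
    rw [add_mul]; omega
  · rintro τ s' - hf ⟨g1, g2, g3⟩
    have hall : ((Finset.range T).filter fun t => 2 * (P.pw / 2 ^ (P.lam + 1)) ≤ dg (G t)) =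
        Finset.range T := Finset.filter_true_of_mem fun t ht => by
      have : P.pw / 2 ^ (P.lam + 1) = 0 :=
        Nat.div_eq_of_lt (by rw [P.pw_eq]; exact Nat.pow_lt_pow_right (by norm_num) (by omega))
      omega
    rw [hall, Finset.card_range] at g1
    rw [hall] at g3
    exact ⟨by omega, g3⟩

/-- Free positions keep the value `0`, which looks like the item `0`. A query therefore compares the
key that it finds with the one it looks for. -/
theorem wp_fillTable {T : ℕ} {pos : ℕ → ℕ} (hT : s.reg .T = T) (hTp : T ≤ P.pw)
    (hpos : s.arr (.key .fin) = pos) (hlt : ∀ t < T, pos t < P.pw)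
    (hinj : ∀ t < T, ∀ t' < T, pos t = pos t' → t = t') (htab : ∀ x, s.arr .tab x = 0) :
    WP P.B P.M fillTable s fun s' t => t ≤ 4 * T + 2 ∧ (∀ t < T, s'.arr .tab (pos t) = t) ∧
      ∀ x, s'.arr .tab x < T ∨ s'.arr .tab x = 0 := by
  have hB := P.M_lt_B
  have hM := P.pw_le_M
  have hsz := P.size_le (k := 1) (by omega)
  have hV1 := P.V_pos
  rw [fillTable]
  refine WP.loop T (fun i τ s' => τ ≤ 4 * i ∧ (∀ t < i, s'.arr .tab (pos t) = t) ∧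
    ∀ x, s'.arr .tab x < T ∨ s'.arr .tab x = 0) (by simp [hT]) (by simp) (by omega) (by simp [htab])
    ?_ ?_
  · rintro i τ s' hi hix hf ⟨h1, h2, h3⟩
    have e1 : s'.arr (.key .fin) = pos := (hf.arr _ rfl).trans hpos
    have := hlt i hi
    simp [hix, e1]
    and_intros <;> try omega
    · intro t ht
      rw [Function.update_apply]
      split
      · next h => exact (hinj t (by omega) i hi h).symm
      · next h => exact h2 t (by
          rcases ht.lt_or_eq with h' | rfl
          · exact h'
          · exact absurd rfl h)
    · intro x
      rw [Function.update_apply]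
      split
      · exact .inl hi
      · exact h3 x
  · rintro τ s' - hf ⟨h1, h2, h3⟩
    exact ⟨by omega, h2, h3⟩

end

end DistOracle

/-! ### The dictionary of walks through clusters -/

namespace DistOracle

/-- Computes the short paths through the clusters, and enters them into a dictionary. -/
def buildDict : Stmt :=
  genPairs ;; dedup ;; placeKeys ;; placeBuckets ;; fillTable ;; .store .par 3 ♯.T

/-- The arrays that have to be zero before the dictionary is built. -/
def dictArrs : List Arr :=
  [.stamp, .deg .dup, .fill .dup, .deg .col, .fill .col, .cnt .bkt, .disp .bkt, .deg .bkt,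
    .fill .bkt, .cnt .fin, .disp .fin, .tab]

/-- The position of a key in the dictionary. -/
def State.slotOf (s : State) (pw u v : ℕ) : ℕ :=
  (v + s.arr (.disp .fin) ((u + s.arr (.disp .bkt) v) % pw)) % pw

/-- The dictionary has the `T` keys `(ku t, key t)` with the values `kw t`. -/
structure Dict (P : Setup) (T : ℕ) (s : State) : Prop where
  T_le : T ≤ P.pw
  len : s.arr .par 3 = T
  bkt_lt : ∀ x, s.arr (.disp .bkt) x < P.pw
  fin_lt : ∀ x, s.arr (.disp .fin) x < P.pw
  tab_le : ∀ x, s.arr .tab x ≤ P.pw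
  tab : ∀ t < T, s.arr .tab (s.slotOf P.pw (s.arr .ku t) (s.arr (.key .col) t)) = t
  sound : ∀ t < T, P.dist (s.arr .ku t) (s.arr (.key .col) t) ≤ s.warr .kw t

section

variable {P : Setup} {s : State}

/-- Each stage is framed against the others: their arrays are disjoint, so those that a stage
expects to be zero are still untouched. -/
theorem wp_buildDict (hc : Clustered P s) (hz : ∀ a ∈ dictArrs, ∀ x, s.arr a x = 0) :
    WP P.B P.M buildDict s fun s' τ => τ ≤ 60 * (P.lam * P.pw) ∧
      (∀ i ≠ 3, s'.arr .par i = s.arr .par i) ∧ ∃ T, Dict P T s' ∧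
      ∀ u v l, (∃ h < 2 * P.m, EdgePair P s h u v l) →
        ∃ t < T, s'.arr .ku t = u ∧ s'.arr (.key .col) t = v ∧ s'.warr .kw t ≤ l := by
  have hB := P.M_lt_B
  have hM := P.pw_le_M
  have hlam := P.lam_lt
  have hlam6 := P.lam_pos
  have hsz := P.size_le (k := 1) (by omega)
  have hN := P.le_pw
  -- At most `8 * m * q ^ 2` pairs are stored. The factor `64` in the choice of `pw` thus makes the
  -- table eight times larger than the number of keys, as `wp_placeKeys` demands.
  have h8 : 64 * (P.m * P.q ^ 2 + P.m) ≤ P.pw := by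
    refine le_trans (Nat.mul_le_mul_left _ ?_) hN
    rw [← Nat.mul_add_one]
    exact Nat.mul_le_mul_left _ (by rw [add_sq]; omega)
  have hm := P.m_pos
  simp only [buildDict, wp_seq]
  refine (wp_genPairs hc).mono ?_
  rintro s₁ t₁ hf₁ ⟨a1, a2, a3⟩
  obtain ⟨len, hlen⟩ : ∃ len, s₁.reg .t = len := ⟨_, rfl⟩
  have z1 : ∀ a ∈ dictArrs, ∀ x, s₁.arr a x = 0 := fun a ha => by
    rw [hf₁.arr a (by revert a; decide)]; exact hz a ha
  have he₁ := hc.env.frame hf₁ rfl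
  have hlen8 : 8 * len ≤ P.pw := by
    rw [hlen, mul_assoc] at a2; omega
  refine (wp_dedup he₁.V a3 hlen (by omega) (fun v _ => z1 _ (by decide) v) (z1 _ (by decide))
    (z1 _ (by decide))).mono ?_
  rintro s₂ t₂ hf₂ ⟨b1, b2, b3⟩
  obtain ⟨T, hT⟩ : ∃ T, s₂.reg .T = T := ⟨_, rfl⟩
  have he₂ := he₁.frame hf₂ rfl
  have k1 := b3.lt
  have k2 := b3.inj
  rw [hT] at b2 k1 k2
  have z2 : ∀ a ∈ dictArrs, a ∉ [Arr.stamp, .deg .dup, .fill .dup] → ∀ x, s₂.arr a x = 0 :=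
    fun a ha hn => by
      rw [hf₂.arr a (by revert a; decide)]; exact z1 a ha
  refine (wp_placeKeys he₂ hT (by omega) k1 k2 (z2 _ (by decide) (by decide))
    (z2 _ (by decide) (by decide)) (z2 _ (by decide) (by decide))
    (z2 _ (by decide) (by decide))).mono ?_
  rintro s₃ t₃ hf₃ ⟨c1, c2, c3, c4⟩
  have he₃ := he₂.frame hf₃ rfl
  have z3 : ∀ a ∈ [Arr.deg .bkt, .fill .bkt, .cnt .fin, .disp .fin, .tab], ∀ x, s₃.arr a x = 0 :=
    fun a ha => by
      rw [hf₃.arr a (by revert a; decide)]; exact z2 a (by revert a; decide) (by revert a; decide)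
  have e1 : s₃.arr (.key .col) = s₂.arr (.key .col) := hf₃.arr _ rfl
  have e2 : s₃.reg .T = T := (hf₃.reg _ rfl).trans hT
  refine (wp_placeBuckets (G := s₃.arr (.key .bkt)) (val := s₂.arr (.key .col)) he₃ e2 (by omega)
    rfl e1 (fun t ht => (c2 t ht).1) (fun t ht => by have := (k1 t ht).2; omega)
    (fun t ht t' ht' hg hv => k2 t ht t' ht' ?_ hv) (by omega) (z3 _ (by decide))
    (z3 _ (by decide)) (z3 _ (by decide)) (z3 _ (by decide))).mono ?_
  -- Equal buckets and equal second vertices force equal first vertices, so within a bucket the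
  -- second vertices are different.
  · rw [(c2 t ht).2, (c2 t' ht').2, hv] at hg
    have h1 := (k1 t ht).1
    have h2 := (k1 t' ht').1
    exact add_mod_inj (by omega) (by omega) hg
  rintro s₄ t₄ hf₄ ⟨d1, d2⟩
  have hpos : ∀ t < T, s₄.arr (.key .fin) t < P.pw := fun t ht => by
    rw [d2.key t (Finset.mem_range.2 ht)]; exact Nat.mod_lt _ (by omega)
  refine (wp_fillTable (P := P) (T := T) (pos := s₄.arr (.key .fin)) ((hf₄.reg _ rfl).trans e2)
    (by omega) rfl hpos (fun t ht t' ht' h => d2.inj t (Finset.mem_range.2 ht) t'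
      (Finset.mem_range.2 ht') h) fun x => by
      rw [hf₄.arr .tab rfl]; exact z3 _ (by decide) x).mono ?_
  rintro s₅ t₅ hf₅ ⟨f1, f2, f3⟩
  have g1 : s₅.arr (.key .col) = s₂.arr (.key .col) :=
    (hf₅.arr _ rfl).trans ((hf₄.arr _ rfl).trans e1)
  have g2 : s₅.arr .ku = s₂.arr .ku := (hf₅.arr _ rfl).trans ((hf₄.arr _ rfl).trans (hf₃.arr _ rfl))
  have g3 : s₅.warr .kw = s₂.warr .kw :=
    (hf₅.warr _ rfl).trans ((hf₄.warr _ rfl).trans (hf₃.warr _ rfl))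
  have g4 : s₅.arr (.disp .bkt) = s₃.arr (.disp .bkt) := (hf₅.arr _ rfl).trans (hf₄.arr _ rfl)
  have g5 : s₅.arr (.disp .fin) = s₄.arr (.disp .fin) := hf₅.arr _ rfl
  have g6 : s₅.reg .T = T := (hf₅.reg _ rfl).trans ((hf₄.reg _ rfl).trans e2)
  rw [wp_store]
  refine ⟨⟨show 3 < _ by omega, show 3 < _ by omega, trivial⟩, ?_, fun i hi => ?_, T, ⟨by omega, ?_, ?_, ?_, ?_, ?_,
    ?_⟩, ?_⟩
  · obtain ⟨A, hA⟩ : ∃ A, P.lam * P.pw = A := ⟨_, rfl⟩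
    have q1 : 6 * P.pw ≤ A := hA ▸ Nat.mul_le_mul_right _ hlam6
    have q2 : 8 * (P.lam * T) ≤ A := by
      rw [← hA, ← mul_assoc, mul_comm 8, mul_assoc]; exact Nat.mul_le_mul_left _ (by omega)
    have q3 : P.lam * P.V ≤ A := hA ▸ Nat.mul_le_mul_left _ (by omega)
    have q4 : P.lam * (13 * T + 10 * P.V) = 13 * (P.lam * T) + 10 * (P.lam * P.V) := by ring
    have q5 : (23 * P.lam + 21) * T = 23 * (P.lam * T) + 21 * T := by ring
    have q6 : (P.lam + 1) * (8 * P.pw + 5) = 8 * (P.lam * P.pw) + 5 * P.lam + 8 * P.pw + 5 := by ring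
    have q7 : 2 * P.m * (48 * P.q ^ 2 + 10) = 96 * (P.m * P.q ^ 2) + 20 * P.m := by ring
    rw [hA] at q6 ⊢
    omega
  · change Function.update (s₅.arr .par) 3 (s₅.reg .T) i = _
    rw [Function.update_of_ne hi, hf₅.arr _ rfl, hf₄.arr _ rfl, hf₃.arr _ rfl, hf₂.arr _ rfl,
      hf₁.arr _ rfl]
  · change Function.update (s₅.arr .par) 3 (s₅.reg .T) 3 = T
    rw [Function.update_self, g6]
  · intro x; change s₅.arr (.disp .bkt) x < _; rw [g4]; exact c3 x
  · intro x; change s₅.arr (.disp .fin) x < _; rw [g5]; exact d2.disp x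
  · intro x; change s₅.arr .tab x ≤ _; have := f3 x; omega
  · intro t ht
    have h1 := d2.key t (Finset.mem_range.2 ht)
    rw [(c2 t ht).2, ← g5, ← g4, ← g2, ← e1, ← (hf₄.arr (.key .col) rfl),
      ← (hf₅.arr (.key .col) rfl)] at h1
    have h2 := f2 t ht
    rw [← hf₅.arr (.key .fin) rfl] at h2
    have h3 : s₅.arr (.key .fin) t = s₅.slotOf P.pw (s₅.arr .ku t) (s₅.arr (.key .col) t) := by
      rw [hf₅.arr (.key .fin) rfl, h1, State.slotOf, g1]
    rw [h3] at h2
    exact h2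
  · intro t ht
    change P.dist (s₅.arr .ku t) (s₅.arr (.key .col) t) ≤ s₅.warr .kw t
    rw [g1, g2, g3]
    obtain ⟨i, hi, h1, h2, h3⟩ := b3.sound t (hT ▸ ht)
    rw [← h1, ← h2, h3]
    exact a3.sound i (by omega)
  · intro u v l h
    obtain ⟨i, hi, h1, h2, h3⟩ := a3.complete u v l h
    obtain ⟨t, ht, k1, k2, k3⟩ := b3.complete i (by omega) trivial
    refine ⟨t, by omega, ?_⟩
    change s₅.arr .ku t = u ∧ s₅.arr (.key .col) t = v ∧ s₅.warr .kw t ≤ l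
    rw [g1, g2, g3, k1, k2, h1, h2, ← h3]
    exact ⟨rfl, rfl, k3⟩

/-- A walk between different vertices has an edge in its middle. -/
theorem Setup.Path.split {u x : ℕ} {l : ℝ≥0∞} (p : P.Path u x l) : ∀ {v : ℕ} {b : ℝ≥0∞},
    P.Path x v b → 2 * b ≤ l + b → 0 < l ∨ x ≠ u → ∃ h < 2 * P.m, ∃ a b', P.Path u (P.src h) a ∧
      P.Path (P.src (twin h)) v b' ∧ l + b = a + P.ew (h / 2) + b' ∧ 2 * a ≤ l + b ∧
      2 * b' ≤ l + b := by
  induction p with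
  | nil => rintro v b - - (h | h); exacts [absurd h (lt_irrefl _), absurd rfl h]
  | @cons y l h p hh hy ih =>
    intro v b p' hb _
    -- If the first part without its last edge is at most half of the walk, this edge is the one.
    -- Otherwise it moves to the second part, which is still shorter than the rest; the rest is then
    -- positive, hence not empty.
    by_cases hl : 2 * l ≤ l + P.ew (h / 2) + b
    · exact ⟨h, hh, l, b, hy ▸ p, p', rfl, hl, hb⟩
    · have h1 : P.ew (h / 2) + b < l := by
        rw [not_le, add_assoc, two_mul] at hl
        exact lt_of_add_lt_add_left hl
      have h2 := ih ((hy ▸ Path.edge hh : P.Path y _ _).trans p')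
        (by rw [two_mul]; exact add_le_add_left h1.le _) (.inl (pos_of_gt h1))
      rwa [← add_assoc] at h2

end

end DistOracle

namespace DistOracle

/-! ### The oracle -/

/-- The memory that the preprocessing leaves. -/
structure Oracle (P : Setup) (s : State) : Prop where
  center : ∀ u < P.V, s.warr .r u = ⊤ ∨ ∃ c, s.warr .r u = P.dist c u ∧
    ∀ v < P.V, s.warr .dA (s.arr .pc u * P.V + v) = P.dist c v
  center_lt : ∀ u < P.V, ∀ v < P.V, s.arr .pc u * P.V + v < P.M
  dict : ∃ T, Dict P T s ∧ ∀ u < P.V, ∀ v < P.V, u ≠ v → ∀ l, P.Path u v l → l < 2 * s.warr .r u →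
    l < 2 * s.warr .r v →
    ∃ t < T, s.arr .ku t = u ∧ s.arr (.key .col) t = v ∧ s.warr .kw t ≤ l

/-- Computes the oracle from the compressed network. -/
def buildOracle : Stmt := buildClusters ;; buildDict

/-- Takes the weight `wa` into account. -/
def relaxRes : Stmt := .when (.wlt (.r .wa) (.r .res)) (.wset .res (.r .wa))

/-- The length of the path through the center of `x`. -/
def viaCenter (x y : Reg) : Stmt :=
  .wload .wa .r ♯x ;; .load .c .pc ♯x ;; .wload .wb .dA (♯.c * ♯.V + ♯y) ;;
  .wset .wa (.add (.r .wa) (.r .wb)) ;; relaxRes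

/-- The value of the key `(iu, iv)` in the dictionary. -/
def viaDict : Stmt :=
  .load .d (.disp .bkt) ♯.iv ;; .load .d (.disp .fin) ((♯.iu + ♯.d) % ♯.pw) ;;
  .load .t .tab ((♯.iv + ♯.d) % ♯.pw) ;; .load .x .ku ♯.t ;; .load .y (.key .col) ♯.t ;;
  .when (.and (.lt ♯.t ♯.T) (.and (.eq ♯.x ♯.iu) (.eq ♯.y ♯.iv))) (.wload .wa .kw ♯.t ;; relaxRes)

/-- The approximate distance of `iu` and `iv`. -/
def queryNet : Stmt :=
  .load .V .par 1 ;; .load .pw .par 2 ;; .load .T .par 3 ;; .wset .res .infty ;;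
  viaCenter .iu .iv ;; viaCenter .iv .iu ;; viaDict

section

variable {P : Setup} {s : State}

@[simp] theorem Exp.eval_three : (3 : Exp).eval s = 3 := rfl
@[simp] theorem Exp.ok_three (B : ℕ) : (3 : Exp).Ok B s ↔ 3 < B := Iff.rfl

/-- The exact case of the query. If the walk is shorter than `2 * r u` and `2 * r v`, the ends of
its middle edge have `u` and `v` in their clusters, and the stored value is at most the length of
the walk. -/
theorem Oracle.of_clusters (hr : Rounds P ∅ s) (hac : (s.reg .ac + 1) * P.V ≤ P.M) {T : ℕ}
    {s' : State} (hd : Dict P T s') (hR : s'.warr .r = s.warr .r) (hdA : s'.warr .dA = s.warr .dA)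
    (hpc : s'.arr .pc = s.arr .pc) (hc : ∀ u v l, (∃ h < 2 * P.m, EdgePair P s h u v l) →
      ∃ t < T, s'.arr .ku t = u ∧ s'.arr (.key .col) t = v ∧ s'.warr .kw t ≤ l) : Oracle P s' := by
  refine ⟨fun u hu => ?_, fun u hu v hv => ?_, T, hd, fun u hu v hv huv l p hlu hlv => ?_⟩
  · rw [hR, hdA, hpc]
    obtain ⟨C, hC⟩ := hr.centers.dist
    refine (hr.centers.pc u hu).imp id fun ⟨h1, h2⟩ => ⟨C (s.arr .pc u), ?_, fun v hv => hC _ h1 v hv⟩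
    rw [h2, hC _ h1 u hu]
  · rw [hpc]
    exact (mul_add_lt (Nat.lt_succ_of_le (hr.centers.pc_le u hu)) hv).trans_le hac
  · rw [hR] at hlu hlv
    -- The second part starts out empty; `u ≠ v` guarantees that there is an edge at all.
    obtain ⟨h, hh, a, b, p1, p2, e, ha, hb⟩ := p.split .nil (by simp) (.inr huv.symm)
    rw [add_zero] at e ha hb
    have half : ∀ {x y : ℝ≥0∞}, 2 * x ≤ l → l < 2 * y → x < y := fun h1 h2 => by
      by_contra h3
      exact absurd (h2.trans_le ((mul_le_mul_right (not_lt.1 h3) 2).trans h1)) (lt_irrefl _)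
    have q1 := Setup.dist_le p1.symm
    have q2 := Setup.dist_le p2
    have c1 := hr.cluster _ (P.src_lt h hh) (Finset.notMem_empty _)
    have c2 := hr.cluster _ (P.src_lt _ (twin_lt hh)) (Finset.notMem_empty _)
    obtain ⟨i, hi, hiu⟩ := c1.exists_mem u hu (q1.trans_lt (half ha hlu))
    obtain ⟨j, hj, hjv⟩ := c2.exists_mem v hv (q2.trans_lt (half hb hlv))
    have d1 := (c1.mem i hi).2
    have d2 := (c2.mem j hj).2
    rw [hiu] at d1
    rw [hjv] at d2
    obtain ⟨t, ht, k1, k2, k3⟩ := hc u v _ ⟨h, hh, i, hi, j, hj, _, _, ⟨hiu, d1⟩, ⟨hjv, d2⟩, rfl⟩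
    exact ⟨t, ht, k1, k2, k3.trans (e ▸ add_le_add (add_le_add q1 le_rfl) q2)⟩

theorem wp_buildOracle (hr : Rounds P (Finset.range P.V) s) (hac : s.reg .ac = 0)
    (hz : ∀ a ∈ dictArrs, ∀ x, s.arr a x = 0) :
    WP P.B P.M buildOracle s fun s' τ =>
      τ ≤ 1600 * (P.m * (P.q + 1) ^ 2 * P.lam ^ 3) + 60 * (P.lam * P.pw) ∧
      (∀ i ≠ 3, s'.arr .par i = s.arr .par i) ∧ Oracle P s' := by
  rw [buildOracle, wp_seq]
  refine (wp_buildClusters hr hac).mono ?_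
  rintro s₁ t₁ hf₁ ⟨h1, h2, h3⟩
  refine (wp_buildDict (P := P) ⟨h2.env, fun w hw => h2.cluster w hw (Finset.notMem_empty _)⟩
    fun a ha => ?_).mono ?_
  · rw [hf₁.arr a (by revert a; decide)]; exact hz a ha
  rintro s₂ t₂ hf₂ ⟨a1, a0, T, a2, a3⟩
  refine ⟨?_, fun i hi => (a0 i hi).trans (congrFun (hf₁.arr _ rfl) i), .of_clusters h2 h3 a2 (hf₂.warr _ rfl) (hf₂.warr _ rfl) (hf₂.arr _ rfl) a3⟩
  have q1 : P.lam * (1500 * (P.m * (P.q + 1) ^ 2 * P.lam ^ 2) + 2) =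
      1500 * (P.m * (P.q + 1) ^ 2 * P.lam ^ 3) + 2 * P.lam := by ring
  have q2 : P.lam * 1 ≤ P.lam ^ 3 := by
    rw [pow_succ']; exact Nat.mul_le_mul_left _ (Nat.one_le_pow _ _ (by have := P.lam_pos; omega))
  have q3 : 1 * P.lam ^ 3 ≤ P.m * (P.q + 1) ^ 2 * P.lam ^ 3 :=
    Nat.mul_le_mul_right _ (Nat.mul_pos P.m_pos (by positivity))
  have := P.lam_pos
  omega

theorem wp_relaxRes {B M : ℕ} : WP B M relaxRes s fun s' τ => τ = 2 ∧
    s'.wreg .res = min (s.wreg .res) (s.wreg .wa) := by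
  simp only [relaxRes, wp_when, wp_wset]
  simp
  exact le_of_lt

theorem wp_viaCenter {x y : Reg} {u v : ℕ} (ho : Oracle P s) (hV : s.reg .V = P.V)
    (hx : s.reg x = u) (hy : s.reg y = v) (hu : u < P.V) (hv : v < P.V) (hyc : y ≠ .c) : WP P.B P.M (viaCenter x y) s fun s' τ => τ = 6 ∧
      s'.wreg .res = min (s.wreg .res) (s.warr .r u + s.warr .dA (s.arr .pc u * P.V + v)) := by
  have hB := P.M_lt_B
  have hM := P.pw_le_M
  have hsz := P.size_le (k := 1) (by omega)
  have h1 := ho.center_lt u hu v hv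
  simp only [viaCenter, wp_seq]
  simp [hx, hy, hV, hyc]
  refine ⟨by omega, ⟨⟨by omega, by omega⟩, h1⟩, wp_relaxRes.mono ?_⟩
  rintro s' t - ⟨a1, a2⟩
  exact ⟨by omega, by simpa using a2⟩

/-- For an absent key the lookup still reads legal cells, and the comparison with `T` and with the
stored key rejects whatever it finds. -/
theorem wp_viaDict {T u v : ℕ} (hd : Dict P T s) (hpw : s.reg .pw = P.pw) (hT : s.reg .T = T)
    (hx : s.reg .iu = u) (hy : s.reg .iv = v) (hu : u < P.V) (hv : v < P.V) :
    WP P.B P.M viaDict s fun s' τ => τ ≤ 9 ∧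
      ((∃ t < T, s.arr .ku t = u ∧ s.arr (.key .col) t = v ∧
        s'.wreg .res = min (s.wreg .res) (s.warr .kw t)) ∨
      ((∀ t < T, s.arr .ku t = u → s.arr (.key .col) t ≠ v) ∧ s'.wreg .res = s.wreg .res)) := by
  have hB := P.M_lt_B
  have hM := P.pw_le_M
  have hsz := P.size_le (k := 1) (by omega)
  have hBB := P.pw_sq_lt_B
  have h1 := hd.bkt_lt v
  have h2 := hd.fin_lt ((u + s.arr (.disp .bkt) v) % P.pw)
  have h3 := hd.tab_le (s.slotOf P.pw u v)
  have hmod : ∀ x, x % P.pw < P.pw := fun x => Nat.mod_lt _ (by omega)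
  have h4 := hmod (u + s.arr (.disp .bkt) v)
  have h5 : s.slotOf P.pw u v < P.pw := hmod _
  have h6 : ∀ t < T, s.arr .ku t = u → s.arr (.key .col) t = v →
      s.arr .tab (s.slotOf P.pw u v) = t := fun t ht e1 e2 => by
    have := hd.tab t ht
    rwa [e1, e2] at this
  simp only [State.slotOf] at h3 h5 h6
  obtain ⟨t, ht⟩ : ∃ t, s.arr .tab ((v + s.arr (.disp .fin)
      ((u + s.arr (.disp .bkt) v) % P.pw)) % P.pw) = t := ⟨_, rfl⟩
  rw [ht] at h3
  simp only [ht] at h6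
  simp only [viaDict, wp_seq]
  simp [hx, hy, hpw, hT, ht]
  and_intros <;> try omega
  · rintro e1 e2 e3
    refine ⟨by omega, wp_relaxRes.mono ?_⟩
    rintro s' τ - ⟨a1, a2⟩
    exact ⟨by omega, .inl ⟨t, e1, e2, e3, by simpa using a2⟩⟩
  · intro hn
    refine .inr fun t' ht' e1 e2 => ?_
    obtain rfl := h6 t' ht' e1 e2
    exact hn ht' e1 e2

/-- For each walk of length `l` one of the three candidates is at most `2 * l`. Equal vertices are
excluded, because a walk between them need not have an edge; the full query treats them separately.
-/
theorem wp_queryNet {u v : ℕ} (ho : Oracle P s) (hV : s.arr .par 1 = P.V)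
    (hpw : s.arr .par 2 = P.pw) (hx : s.reg .iu = u) (hy : s.reg .iv = v) (hu : u < P.V)
    (hv : v < P.V) : WP P.B P.M queryNet s fun s' τ => τ ≤ 30 ∧
      (u ≠ v → P.dist u v ≤ s'.wreg .res ∧ s'.wreg .res ≤ 2 * P.dist u v) := by
  have hB := P.M_lt_B
  have hM := P.pw_le_M
  have hsz := P.size_le (k := 1) (by omega)
  have hm := P.m_pos
  obtain ⟨T, hd, hnear⟩ := ho.dict
  have hsnd : ∀ x < P.V, ∀ y < P.V,
      P.dist x y ≤ s.warr .r x + s.warr .dA (s.arr .pc x * P.V + y) := fun x hx y hy => by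
    rcases ho.center x hx with h | ⟨c, h, h'⟩
    · simp [h]
    · rw [h, h' y hy, P.dist_comm c x]; exact P.dist_triangle x c y
  -- A walk at least twice as long as the way to the center can afford the detour. If `x` has no
  -- center, then `l = ⊤`.
  have hcmp : ∀ x < P.V, ∀ y < P.V, ∀ l, P.Path x y l → 2 * s.warr .r x ≤ l →
      s.warr .r x + s.warr .dA (s.arr .pc x * P.V + y) ≤ 2 * l := fun x hx y hy l p hl => by
    rcases ho.center x hx with h | ⟨c, h, h'⟩
    · rw [h, ENNReal.mul_top (by norm_num), top_le_iff] at hl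
      simp [hl]
    · rw [h' y hy, two_mul l]
      calc s.warr .r x + P.dist c y ≤ s.warr .r x + (s.warr .r x + l) := by
            gcongr; rw [h]
            exact (P.dist_triangle c x y).trans (add_le_add le_rfl (Setup.dist_le p))
        _ = 2 * s.warr .r x + l := by ring
        _ ≤ _ := by gcongr
  simp only [queryNet, wp_seq]
  simp [hV, hpw, hd.len]
  refine ⟨by omega, by omega, by omega, ?_⟩
  refine (wp_viaCenter (P := P) (u := u) (v := v)
    (s := (((s.setR .V P.V).setR .pw P.pw).setR .T T).setW .res ⊤)
    ⟨ho.1, ho.2, T, ⟨hd.1, hd.2, hd.3, hd.4, hd.5, hd.6, hd.7⟩, hnear⟩ (by simp) (x := .iu) (y := .iv)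
    (by simpa) (by simpa) hu hv (by simp)).mono ?_
  rintro s₁ t₁ hf₁ ⟨a1, a2⟩
  have e1 : s₁.arr = s.arr := funext fun a => hf₁.arr a rfl
  have e2 : s₁.warr = s.warr := funext fun a => hf₁.warr a rfl
  have r1 : s₁.reg .V = P.V := hf₁.reg _ rfl
  have r2 : s₁.reg .pw = P.pw := hf₁.reg _ rfl
  have r3 : s₁.reg .T = T := hf₁.reg _ rfl
  have r4 : s₁.reg .iu = u := (hf₁.reg _ rfl).trans (by simpa)
  have r5 : s₁.reg .iv = v := (hf₁.reg _ rfl).trans (by simpa)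
  have hd' : ∀ {s' : State}, s'.arr = s.arr → s'.warr = s.warr → Dict P T s' :=
    fun e e' => ⟨hd.1, e ▸ hd.2, e ▸ hd.3, e ▸ hd.4, e ▸ hd.5, fun t ht => by
      rw [State.slotOf, e]; exact hd.6 t ht, by rw [e, e']; exact hd.7⟩
  refine (wp_viaCenter (P := P) (u := v) (v := u) ⟨e1 ▸ e2 ▸ ho.1, e1 ▸ ho.2, T, hd' e1 e2,
    e1 ▸ e2 ▸ hnear⟩ r1 r5 r4 hv hu (by simp)).mono ?_
  rintro s₂ t₂ hf₂ ⟨b1, b2⟩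
  have e3 : s₂.arr = s.arr := (funext fun a => hf₂.arr a rfl).trans e1
  have e4 : s₂.warr = s.warr := (funext fun a => hf₂.warr a rfl).trans e2
  refine (wp_viaDict (hd' e3 e4) ((hf₂.reg _ rfl).trans r2) ((hf₂.reg _ rfl).trans r3)
    ((hf₂.reg _ rfl).trans r4) ((hf₂.reg _ rfl).trans r5) hu hv).mono ?_
  rintro s₃ t₃ hf₃ ⟨c1, c2⟩
  simp only [State.setW_wreg, if_true, State.setR_warr, State.setW_warr, State.setR_arr,
    State.setW_arr, top_inf_eq] at a2
  rw [e1, e2, a2] at b2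
  rw [e3, e4, b2] at c2
  refine ⟨by omega, fun huv => ⟨?_, ?_⟩⟩
  · have h1 := le_min (hsnd u hu v hv) (P.dist_comm v u ▸ hsnd v hv u hu)
    rcases c2 with ⟨t, ht, k1, k2, k3⟩ | ⟨-, k3⟩
    · rw [k3]; exact le_min h1 (k1 ▸ k2 ▸ hd.sound t ht)
    · rw [k3]; exact h1
  · have hres : s₃.wreg .res ≤ _ := c2.elim (fun ⟨t, ht, k1, k2, k3⟩ => k3.le.trans (min_le_left _ _))
      fun h => h.2.le
    -- Halving the other side leaves the infimum over walks alone on the right, so a single walk can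
    -- be considered.
    rw [mul_comm, ← ENNReal.div_le_iff_le_mul (.inl (by norm_num)) (.inl (by norm_num))]
    refine le_iInf₂ fun l p => ?_
    rw [ENNReal.div_le_iff_le_mul (.inl (by norm_num)) (.inl (by norm_num)), mul_comm l]
    by_cases h1 : 2 * s.warr .r u ≤ l
    · exact hres.trans ((min_le_left _ _).trans (hcmp u hu v hv l p h1))
    by_cases h2 : 2 * s.warr .r v ≤ l
    · exact hres.trans ((min_le_right _ _).trans (hcmp v hv u hu l p.symm h2))
    obtain ⟨t, ht, k1, k2, k3⟩ := hnear u hu v hv huv l p (not_le.1 h1) (not_le.1 h2)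
    rcases c2 with ⟨t', ht', k1', k2', k3'⟩ | ⟨hn, -⟩
    -- Both indices are what the table contains at the position of the same key.
    · have : t' = t := by
        rw [← hd.tab t ht, ← hd.tab t' ht', k1, k2, k1', k2']
      rw [k3', this]
      exact (min_le_right _ _).trans (k3.trans (by rw [two_mul]; exact le_self_add))
    · exact absurd k2 (hn t ht k1)

end

end DistOracle

namespace DistOracle

/-! ### Compression of the vertices

The numbers of the vertices are stored in a tree of depth two. -/

/-- Finds the second level of the tree for the vertex `x`. -/
def internRoot : Stmt :=
  .load .x .inp (2 * ♯.a1 + ♯.h) ;; .load .y .root (♯.x / ♯.sq) ;;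
  .when (.eq ♯.y 0) (.set .blk (♯.blk + 1) ;; .set .y ♯.blk ;; .store .root (♯.x / ♯.sq) ♯.y)

/-- Finds the number of the vertex `x`. -/
def internLeaf : Stmt :=
  .load .z .leaf (♯.y * ♯.sq + ♯.x % ♯.sq) ;;
  .when (.eq ♯.z 0)
    (.set .acc (♯.acc + 1) ;; .set .z ♯.acc ;; .store .leaf (♯.y * ♯.sq + ♯.x % ♯.sq) ♯.z) ;;
  .store (.key .adj) ♯.h ♯.z

/-- Replaces the endpoints of the edges by consecutive numbers. -/
def compress : Stmt := .loop .h (2 * ♯.a1) (internRoot ;; internLeaf)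

/-- The number of the vertex `x`. -/
def ident (root leaf : ℕ → ℕ) (sq x : ℕ) : ℕ := leaf (root (x / sq) * sq + x % sq)

/-- The first `h` vertices in `X` have received the numbers `1, …, acc`. -/
structure Trie (X : ℕ → ℕ) (sq h : ℕ) (root leaf ky : ℕ → ℕ) (blk acc : ℕ) : Prop where
  root_le : ∀ i, root i ≤ blk
  root_inj : ∀ i j, root i = root j → root i ≠ 0 → i = j
  leaf_le : ∀ p, leaf p ≤ acc
  leaf_inj : ∀ p p', leaf p = leaf p' → leaf p ≠ 0 → p = p'
  leaf_low : ∀ p < sq, leaf p = 0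
  key : ∀ g < h, ky g = ident root leaf sq (X g) ∧ ky g ≠ 0
  surj : ∀ z, 0 < z → z ≤ acc → ∃ g < h, ky g = z
  acc_le : acc ≤ h

section

variable {X root leaf ky : ℕ → ℕ} {sq h blk acc : ℕ}

theorem injective_update {f : ℕ → ℕ} {b : ℕ} (hf : ∀ i j, f i = f j → f i ≠ 0 → i = j)
    (hb : ∀ i, f i ≤ b) (x : ℕ) : ∀ i j, Function.update f x (b + 1) i =
      Function.update f x (b + 1) j → Function.update f x (b + 1) i ≠ 0 → i = j := by
  intro i j
  have h1 := hb i
  have h2 := hb j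
  rw [Function.update_apply, Function.update_apply]
  split <;> split
  · intros; omega
  · intros; omega
  · intros; omega
  · exact hf i j

theorem Trie.le_index (h1 : 0 < sq) {y x : ℕ} (hy : y ≠ 0) : sq ≤ y * sq + x % sq :=
  (Nat.le_mul_of_pos_left _ (Nat.pos_of_ne_zero hy)).trans (Nat.le_add_right _ _)

/-- Blocks are numbered from `1`, and the cells of block `0` stay zero. So a vertex whose root entry
is missing receives the number `0` without a special case. -/
theorem Trie.root_ne (t : Trie X sq h root leaf ky blk acc) (h1 : 0 < sq) {x : ℕ}
    (hx : ident root leaf sq x ≠ 0) : root (x / sq) ≠ 0 := fun h0 => hx <| by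
  rw [ident, h0, zero_mul, zero_add]
  exact t.leaf_low _ (Nat.mod_lt _ h1)

theorem Trie.ident_inj (t : Trie X sq h root leaf ky blk acc) (h1 : 0 < sq) {x y : ℕ}
    (he : ident root leaf sq x = ident root leaf sq y) (hx : ident root leaf sq x ≠ 0) : x = y := by
  obtain ⟨h2, h3⟩ := (mul_add_inj (Nat.mod_lt _ h1) (Nat.mod_lt _ h1)).1 (t.leaf_inj _ _ he hx)
  have h4 := t.root_inj _ _ h2 (t.root_ne h1 hx)
  rw [← Nat.div_add_mod x sq, ← Nat.div_add_mod y sq, h4, h3]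

/-- Each number is assigned to some endpoint, and an endpoint has only one number. -/
theorem Trie.acc_le_of_lt (t : Trie X sq h root leaf ky blk acc) {n : ℕ} (hX : ∀ g < h, X g < n) :
    acc ≤ n := by
  choose! g hg he using t.surj
  have := Finset.card_le_card_of_injOn (s := Finset.Icc 1 acc) (t := Finset.range n)
    (fun z => X (g z)) (fun z hz => by
      have := Finset.mem_Icc.1 hz
      exact Finset.mem_coe.2 (Finset.mem_range.2 (hX _ (hg z this.1 this.2))))
    (fun z hz z' hz' e => by
      have h1 := Finset.mem_Icc.1 (Finset.mem_coe.1 hz)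
      have h2 := Finset.mem_Icc.1 (Finset.mem_coe.1 hz')
      rw [← he z h1.1 h1.2, ← he z' h2.1 h2.2, (t.key _ (hg z h1.1 h1.2)).1,
        (t.key _ (hg z' h2.1 h2.2)).1]
      exact congrArg _ e)
  simpa using this

theorem Trie.addRoot (t : Trie X sq h root leaf ky blk acc) (h1 : 0 < sq) {i : ℕ}
    (hi : root i = 0) : Trie X sq h (Function.update root i (blk + 1)) leaf ky (blk + 1) acc := by
  refine ⟨fun j => ?_, injective_update t.root_inj t.root_le i, t.leaf_le, t.leaf_inj, t.leaf_low,
    fun g hg => ?_, t.surj, t.acc_le⟩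
  · rw [Function.update_apply]; have := t.root_le j; split <;> omega
  · obtain ⟨h2, h3⟩ := t.key g hg
    have h4 := t.root_ne h1 (h2 ▸ h3)
    rw [ident, Function.update_of_ne (by rintro rfl; exact h4 hi)]
    exact ⟨h2, h3⟩

theorem Trie.addKey (t : Trie X sq h root leaf ky blk acc) {z : ℕ}
    (hz : ident root leaf sq (X h) = z) (hz0 : z ≠ 0) :
    Trie X sq (h + 1) root leaf (Function.update ky h z) blk acc := by
  refine ⟨t.root_le, t.root_inj, t.leaf_le, t.leaf_inj, t.leaf_low, fun g hg => ?_, fun z h1 h2 => ?_,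
    by have := t.acc_le; omega⟩
  · rw [Function.update_apply]; split
    · next e => rw [e]; exact ⟨hz.symm, hz0⟩
    · exact t.key g (by omega)
  · obtain ⟨g, hg, e⟩ := t.surj z h1 h2
    exact ⟨g, by omega, by rw [Function.update_of_ne (by omega), e]⟩

/-- The changed cell held zero, so no vertex numbered before used it; and it lies outside block `0`,
since its block has a non-zero number. -/
theorem Trie.addLeaf (t : Trie X sq h root leaf ky blk acc) (h1 : 0 < sq) {p : ℕ}
    (hp : root (X h / sq) * sq + X h % sq = p) (hr : root (X h / sq) ≠ 0) (h0 : leaf p = 0) :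
    Trie X sq (h + 1) root (Function.update leaf p (acc + 1)) (Function.update ky h (acc + 1)) blk
      (acc + 1) := by
  refine ⟨t.root_le, t.root_inj, fun j => ?_, injective_update t.leaf_inj t.leaf_le p, fun j hj => ?_,
    fun g hg => ?_, fun z h2 h3 => ?_, by have := t.acc_le; omega⟩
  · rw [Function.update_apply]; have := t.leaf_le j; split <;> omega
  · have := Trie.le_index h1 (x := X h) hr
    rw [Function.update_of_ne (by omega)]
    exact t.leaf_low j hj
  · rw [Function.update_apply, ident]; split
    · next e => rw [e, hp, Function.update_self]; exact ⟨rfl, by omega⟩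
    · obtain ⟨h2, h3⟩ := t.key g (by omega)
      rw [Function.update_of_ne]
      · exact ⟨h2, h3⟩
      · intro e; rw [h2, ident, e] at h3; exact h3 h0
  · rcases h3.lt_or_eq with h3 | rfl
    · obtain ⟨g, hg, e⟩ := t.surj z h2 (by omega)
      exact ⟨g, by omega, by rw [Function.update_of_ne (by omega), e]⟩
    · exact ⟨h, by omega, by rw [Function.update_self]⟩

theorem wp_internRoot {B M m i d : ℕ} {s : State} (hm : s.reg .a1 = m) (hsq : s.reg .sq = sq)
    (hi : s.reg .h = i) (him : i < 2 * m) (hX : s.arr .inp (2 * m + i) = X i) (hd : X i / sq = d)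
    (hdM : d < M) (hmM : 4 * m < M) (hB : M < B) (h1 : 0 < sq) (hblk : s.reg .blk ≤ i)
    (t : Trie X sq i (s.arr .root) (s.arr .leaf) (s.arr (.key .adj)) (s.reg .blk) (s.reg .acc)) :
    WP B M internRoot s fun s' τ => τ ≤ 6 ∧ s'.reg .x = X i ∧ s'.reg .blk ≤ i + 1 ∧
      s'.reg .y = s'.arr .root d ∧ s'.reg .y ≠ 0 ∧
      Trie X sq i (s'.arr .root) (s'.arr .leaf) (s'.arr (.key .adj)) (s'.reg .blk) (s'.reg .acc) := by
  simp only [internRoot, wp_seq]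
  simp [hi, hm, hsq, hX, hd]
  and_intros <;> try omega
  · intro h0
    and_intros <;> try omega
    exact t.addRoot h1 h0
  · intro h0
    exact ⟨by omega, h0, t⟩

theorem wp_internLeaf {B M i d r : ℕ} {s : State} (hsq : s.reg .sq = sq)
    (hi : s.reg .h = i) (hx : s.reg .x = X i) (hy : s.reg .y = s.arr .root d) (hy0 : s.reg .y ≠ 0)
    (hd : X i / sq = d) (hr : X i % sq = r) (hiM : i + 1 < M) (hp : s.reg .y * sq + r < M)
    (hB : M < B) (h1 : 0 < sq)
    (t : Trie X sq i (s.arr .root) (s.arr .leaf) (s.arr (.key .adj)) (s.reg .blk) (s.reg .acc)) :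
    WP B M internLeaf s fun s' τ => τ ≤ 7 ∧ Trie X sq (i + 1) (s'.arr .root) (s'.arr .leaf)
      (s'.arr (.key .adj)) (s'.reg .blk) (s'.reg .acc) := by
  have hacc := t.acc_le
  rw [hy] at hp hy0
  have hp' : s.arr .root d * sq ≤ s.arr .root d * sq + r := Nat.le_add_right _ _
  have hid : ident (s.arr .root) (s.arr .leaf) sq (X i) = s.arr .leaf (s.arr .root d * sq + r) := by
    rw [ident, hd, hr]
  simp only [internLeaf, wp_seq]
  simp [hi, hsq, hx, hy, hr]
  and_intros <;> try omega
  · intro h0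
    and_intros <;> try omega
    exact t.addLeaf h1 (by rw [hd, hr]) (by rwa [hd]) h0
  · intro h0
    exact ⟨by omega, t.addKey hid h0⟩

/-- Every endpoint opens at most one block of `sq` cells, so about `2 * m * sq` cells suffice,
however large `n` is compared with `m`. -/
theorem wp_compress {B M m n : ℕ} {s : State} (hm : s.reg .a1 = m) (hsq : s.reg .sq = sq)
    (hblk : s.reg .blk = 0) (hacc : s.reg .acc = 0) (hX : ∀ g < 2 * m, s.arr .inp (2 * m + g) = X g)
    (hXn : ∀ g < 2 * m, X g < n) (hroot : ∀ x, s.arr .root x = 0) (hleaf : ∀ x, s.arr .leaf x = 0)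
    (hn : n ≤ sq * sq) (h1 : 0 < sq) (hM : (2 * m + 2) * (sq + 2) ≤ M) (hB : M < B) :
    WP B M compress s fun s' τ => τ ≤ 30 * m + 2 ∧ s'.reg .blk ≤ 2 * m ∧
      Trie X sq (2 * m) (s'.arr .root) (s'.arr .leaf) (s'.arr (.key .adj)) (s'.reg .blk)
        (s'.reg .acc) := by
  have hM1 : (2 * m + 1) * sq + 4 * m + 4 + sq ≤ M := by nlinarith
  rw [compress]
  refine WP.loop (2 * m) (fun i τ s' => τ ≤ 15 * i ∧ s'.reg .blk ≤ i ∧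
    Trie X sq i (s'.arr .root) (s'.arr .leaf) (s'.arr (.key .adj)) (s'.reg .blk) (s'.reg .acc))
    (by simp [hm]) (by simp [hm]; omega) (by omega) ?_ ?_ ?_
  · exact ⟨by simp, by simp [hblk], by simp [hblk, hroot], by simp [hroot], by simp [hacc, hleaf],
      by simp [hleaf], by simp [hleaf], by simp, by simp [hacc]; omega, by simp [hacc]⟩
  · rintro i τ s' hi hx hf ⟨g1, g2, t⟩
    have e1 : s'.reg .a1 = m := (hf.reg _ rfl).trans hm
    have e2 : s'.reg .sq = sq := (hf.reg _ rfl).trans hsq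
    have e3 : s'.arr .inp (2 * m + i) = X i := by rw [hf.arr _ rfl]; exact hX i hi
    have hdiv : X i / sq < sq := Nat.div_lt_of_lt_mul ((hXn i hi).trans_le hn)
    have hmod : X i % sq < sq := Nat.mod_lt _ h1
    have hacc := t.acc_le
    obtain ⟨d, hd⟩ : ∃ d, X i / sq = d := ⟨_, rfl⟩
    obtain ⟨r, hr⟩ : ∃ r, X i % sq = r := ⟨_, rfl⟩
    rw [hd] at hdiv
    rw [hr] at hmod
    have hidx : ∀ y ≤ i + 1, y * sq + r < M := fun y hy => by
      have : y * sq ≤ (2 * m + 1) * sq := Nat.mul_le_mul_right _ (by omega)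
      omega
    rw [wp_seq]
    refine (wp_internRoot (X := X) e1 e2 hx hi e3 hd (by omega) (by omega) hB h1 g2 t).mono ?_
    rintro s₁ t₁ hf₁ ⟨a1, a2, a3, a4, a5, a6⟩
    have := a6.root_le d
    refine (wp_internLeaf (X := X) ((hf₁.reg _ rfl).trans e2) ((hf₁.reg _ rfl).trans hx) a2 a4 a5 hd
      hr (by omega) (hidx _ (by omega)) hB h1 a6).mono ?_
    rintro s₂ t₂ hf₂ ⟨b1, b2⟩
    refine ⟨by omega, ?_, b2⟩
    rw [State.setR_reg, if_neg (by decide), hf₂.reg _ rfl]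
    exact a3
  · rintro τ s' - hf ⟨g1, g2, t⟩
    exact ⟨by omega, g2, t⟩

end

end DistOracle

namespace DistOracle

/-! ### The preprocessing of the compressed network -/

/-- Computes the least `q` with `V ≤ q ^ 3`. -/
def findRoot : Stmt :=
  .set .V (♯.acc + 1) ;; .set .q 1 ;;
  .loop .i ♯.V (.when (.lt (♯.q * ♯.q * ♯.q) ♯.V) (.set .q (♯.q + 1))) ;; .set .cap (2 * ♯.q)

/-- Computes the least power of two that is at least `64 * m * (q + 1) ^ 2`. -/
def findPow : Stmt :=
  .set .z (.c 64 * (♯.a1 * ((♯.q + 1) * (♯.q + 1)))) ;; .set .pw 1 ;; .set .lam 0 ;;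
  .loop .i ♯.z (.when (.lt ♯.pw ♯.z) (.set .pw (2 * ♯.pw) ;; .set .lam (♯.lam + 1)))

/-- Initializes the arrays. -/
def initArrays : Stmt :=
  .set .gN ♯.V ;; .set .gL (2 * ♯.a1) ;; csr .adj ;;
  .loop .i (2 * ♯.pw) (.wstore .tree ♯.i .infty) ;;
  .loop .i ♯.V (.wstore .r ♯.i .infty ;; .store .inW ♯.i 1) ;;
  .set .nW ♯.V ;; .store .par 0 ♯.sq ;; .store .par 1 ♯.V ;; .store .par 2 ♯.pw

section

variable {P : Setup} {s : State} {B M : ℕ}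

theorem Grouped.congr {key key' deg off slot : ℕ → ℕ} {nk len : ℕ}
    (h : Grouped key deg off slot nk len) (he : ∀ i < len, key i = key' i) :
    Grouped key' deg off slot nk len := by
  have : ∀ x, group key len x = group key' len x := fun x =>
    List.filter_congr fun i hi => by rw [he i (List.mem_range.1 hi)]
  exact ⟨fun i hi => he i hi ▸ h.key_lt i hi, fun x hx => this x ▸ h.deg_eq x hx, h.off_add_deg,
    fun x hx => this x ▸ h.slot_eq x hx⟩

/-- `V` is one more than the largest number, as `0` is a dummy vertex. `V` rounds are enough: if the
root has not been found, then `q` has grown in every round. -/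
theorem wp_findRoot {V : ℕ} (hV : s.reg .acc + 1 = V) (hB : 16 * V < B) :
    WP B M findRoot s fun s' τ => τ ≤ 6 * V + 5 ∧ s'.reg .V = V ∧ 1 ≤ s'.reg .q ∧
      V ≤ s'.reg .q ^ 3 ∧ (s'.reg .q - 1) ^ 3 < V ∧ s'.reg .cap = 2 * s'.reg .q := by
  have hcube : ∀ q, 1 ≤ q → (q - 1) ^ 3 < V → q * q * q ≤ 8 * V := fun q h1 h2 => by
    obtain ⟨p, rfl⟩ : ∃ p, q = p + 1 := ⟨q - 1, by omega⟩
    simp only [Nat.add_sub_cancel] at h2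
    rcases Nat.eq_zero_or_pos p with rfl | hp
    · omega
    · calc (p + 1) * (p + 1) * (p + 1) ≤ (2 * p) * (2 * p) * (2 * p) := by gcongr <;> omega
        _ = 8 * p ^ 3 := by ring
        _ ≤ _ := by omega
  simp only [findRoot, wp_seq, wp_set]
  refine ⟨by simp; omega, by simp; omega, WP.loop V (fun i τ s' => τ ≤ 5 * i ∧ 1 ≤ s'.reg .q ∧
    (s'.reg .q - 1) ^ 3 < V ∧ (V ≤ s'.reg .q ^ 3 ∨ i + 1 = s'.reg .q)) (by simp [hV]) (by simp)
    (by omega) (by simp; omega) ?_ ?_⟩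
  · rintro i τ s' hi hx hf ⟨h1, h2, h3, h4⟩
    have hV' : s'.reg .V = V := (hf.reg _ rfl).trans (by simp [hV])
    have h5 := hcube _ h2 h3
    have h6 : s'.reg .q * s'.reg .q ≤ s'.reg .q * s'.reg .q * s'.reg .q :=
      Nat.le_mul_of_pos_right _ h2
    have h7 : s'.reg .q ≤ s'.reg .q * s'.reg .q := Nat.le_mul_of_pos_right _ h2
    have h8 : s'.reg .q ^ 3 = s'.reg .q * s'.reg .q * s'.reg .q := by ring
    simp [hV', h8]
    and_intros <;> try omega
  · rintro τ s' - hf ⟨h1, h2, h3, h4⟩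
    have hV' : s'.reg .V = V := (hf.reg _ rfl).trans (by simp [hV])
    have h5 := hcube _ h2 h3
    have h6 : s'.reg .q * s'.reg .q ≤ s'.reg .q * s'.reg .q * s'.reg .q :=
      Nat.le_mul_of_pos_right _ h2
    have h7 : s'.reg .q ≤ s'.reg .q * s'.reg .q := Nat.le_mul_of_pos_right _ h2
    have h8 : s'.reg .q ^ 3 = s'.reg .q * s'.reg .q * s'.reg .q := by ring
    simp [hV']
    and_intros <;> try omega

/-- The loop runs `z` times, more than needed, but `z` is within the time bound anyway. It suffices
because `lam < 2 ^ lam`. -/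
theorem wp_findPow {m q z : ℕ} (hm : s.reg .a1 = m) (hq : s.reg .q = q) (hm1 : 1 ≤ m)
    (hz : 64 * (m * (q + 1) ^ 2) = z) (hB : 4 * z < B) :
    WP B M findPow s fun s' τ => τ ≤ 7 * z + 5 ∧ s'.reg .pw = 2 ^ s'.reg .lam ∧
      z ≤ s'.reg .pw ∧ s'.reg .pw ≤ 2 * z := by
  have h1 : 64 * (m * ((q + 1) * (q + 1))) = z := by rw [← hz]; ring
  have h2 : (q + 1) * (q + 1) ≤ m * ((q + 1) * (q + 1)) := Nat.le_mul_of_pos_left _ hm1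
  have h3 : q + 1 ≤ (q + 1) * (q + 1) := Nat.le_mul_of_pos_left _ (by omega)
  simp only [findPow, wp_seq, wp_set]
  simp [hm, hq, h1]
  refine ⟨⟨by omega, ⟨⟨by omega, by omega⟩, by omega⟩, by omega⟩, by omega, by omega, ?_⟩
  refine WP.loop z (fun i τ s' => τ ≤ 6 * i ∧ s'.reg .pw = 2 ^ s'.reg .lam ∧ s'.reg .pw ≤ 2 * z ∧
    s'.reg .lam < s'.reg .pw ∧ (z ≤ s'.reg .pw ∨ i = s'.reg .lam)) (by simp) (by simp) (by omega)
    (by simp; omega) ?_ ?_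
  · rintro i τ s' hi hx hf ⟨g1, g2, g3, g4, g5⟩
    have hz' : s'.reg .z = z := (hf.reg _ rfl).trans (by simp)
    simp [hz']
    and_intros <;> try omega
  · rintro τ s' - hf ⟨g1, g2, g3, g4, g5⟩
    exact ⟨by omega, g2, by omega, g3⟩

/-- At the start there are no centers, all values `r` are `⊤`, and all vertices still wait for a
cluster. Only what does not start as zero has to be written. -/
theorem wp_initArrays {sq : ℕ} (hV : s.reg .V = P.V) (hm : s.reg .a1 = P.m) (hq : s.reg .q = P.q)
    (hcap : s.reg .cap = 2 * P.q) (hlam : s.reg .lam = P.lam) (hpw : s.reg .pw = P.pw)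
    (hsq : s.reg .sq = sq) (hac : s.reg .ac = 0)
    (hsrc : ∀ h < 2 * P.m, s.arr (.key .adj) h = P.src h)
    (hinp : ∀ e < P.m, s.warr .inp (P.m + e) = P.ew e)
    (hdeg : ∀ x, s.arr (.deg .adj) x = 0) (hfill : ∀ x, s.arr (.fill .adj) x = 0)
    (hpc : ∀ x, s.arr .pc x = 0) :
    WP P.B P.M initArrays s fun s' τ => τ ≤ 60 * P.pw ∧ Rounds P (Finset.range P.V) s' ∧
      s'.reg .ac = 0 ∧ s'.arr .par 0 = sq ∧ s'.arr .par 1 = P.V ∧ s'.arr .par 2 = P.pw := by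
  have hB := P.M_lt_B
  have hM := P.pw_le_M
  have hsz := P.size_le (k := 1) (by omega)
  have hm1 := P.m_pos
  simp only [initArrays, wp_seq, wp_set]
  refine ⟨by simp, by simp; omega, (wp_csr (B := P.B) (M := P.M) (g := .adj) (n := 2 * P.m)
    (N := P.V) (K := s.arr (.key .adj)) (by simp) (by simp [hm]) (by simp [hV]) hB (by omega)
    (by omega) (by simpa using hdeg) (by simpa using hfill)
    fun i hi => hsrc i hi ▸ P.src_lt i hi).mono ?_⟩
  rintro s₁ t₁ hf₁ ⟨a1, a2⟩
  have e1 : ∀ x ∈ [Reg.V, .a1, .q, .cap, .lam, .pw, .sq, .ac], s₁.reg x = s.reg x := fun x hx => by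
    rw [hf₁.reg x (by revert x; decide)]
    simp only [State.setR_reg]
    rw [if_neg (by revert x; decide), if_neg (by revert x; decide)]
  have hgrp : Grouped P.src (s₁.arr (.deg .adj)) (s₁.arr (.off .adj)) (s₁.arr (.slot .adj)) P.V
      (2 * P.m) := a2.congr hsrc
  have he₁ : Env P s₁ := ⟨(e1 _ (by decide)).trans hV, (e1 _ (by decide)).trans hm,
    (e1 _ (by decide)).trans hq, (e1 _ (by decide)).trans hcap, (e1 _ (by decide)).trans hlam,
    (e1 _ (by decide)).trans hpw, fun h hh => by rw [hf₁.arr _ rfl]; exact hsrc h hh, hgrp,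
    fun e he => by rw [hf₁.warr _ rfl]; exact hinp e he⟩
  refine WP.loop (2 * P.pw) (fun i τ s' => τ ≤ 3 * i ∧ ∀ x < i, s'.warr .tree x = ⊤)
    (by simp [he₁.pw]) (by simp [he₁.pw]; omega) (by omega) (by simp) ?_ ?_
  · rintro i τ s' hi hx hf ⟨g1, g2⟩
    simp [hx]
    refine ⟨by omega, by omega, fun x hx => ?_⟩
    rw [Function.update_apply]; split
    · rfl
    · exact g2 x (by omega)
  rintro t₂ s₂ - hf₂ ⟨b1, b2⟩
  have he₂ := he₁.frame hf₂ rfl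
  refine WP.loop P.V (fun i τ s' => τ ≤ 4 * i ∧ ∀ x < i, s'.warr .r x = ⊤ ∧ s'.arr .inW x = 1)
    (by simp [he₂.V]) (by simp) (by omega) (by simp) ?_ ?_
  · rintro i τ s' hi hx hf ⟨g1, g2⟩
    simp [hx]
    and_intros <;> try omega
    intro x hx
    rw [Function.update_apply, Function.update_apply]; split
    · exact ⟨rfl, rfl⟩
    · exact g2 x (by omega)
  rintro t₃ s₃ - hf₃ ⟨c1, c2⟩
  have he₃ := he₂.frame hf₃ rfl
  have e2 : s₃.reg .sq = sq :=
    (hf₃.reg _ rfl).trans ((hf₂.reg _ rfl).trans ((e1 _ (by decide)).trans hsq))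
  have e3 : s₃.reg .ac = 0 :=
    (hf₃.reg _ rfl).trans ((hf₂.reg _ rfl).trans ((e1 _ (by decide)).trans hac))
  have e4 : s₃.arr .pc = s.arr .pc :=
    (hf₃.arr _ rfl).trans ((hf₂.arr _ rfl).trans ((hf₁.arr _ rfl).trans rfl))
  have e5 : s₃.warr .tree = s₂.warr .tree := hf₃.warr _ rfl
  simp [he₃.V, he₃.pw, e2, e3]
  and_intros <;> try omega
  refine ⟨⟨he₃.1, he₃.2, he₃.3, he₃.4, he₃.5, he₃.6, he₃.7, he₃.8, he₃.9⟩, ⟨fun x h1 h2 => ?_,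
    fun p hp => ?_⟩, subset_rfl, fun u hu => ?_, by simp, ⟨⟨id, fun c hc => ?_⟩, fun c hc => ?_,
    fun u hu => .inl (c2 u hu).1, fun u hu => ?_⟩, fun w hw hw' => absurd (Finset.mem_range.2 hw) hw'⟩
  · change s₃.warr .tree x = min (s₃.warr .tree (2 * x)) (s₃.warr .tree (2 * x + 1))
    rw [e5, b2 x (by omega), b2 _ (by omega), b2 _ (by omega), min_self]
  · change s₃.warr .tree (P.pw + p) = ⊤
    rw [e5, b2 _ (by omega)]
  · change 0 < s₃.arr .inW u ↔ _
    simp [(c2 u hu).2, hu]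
  · exact absurd (e3 ▸ hc : c < 0) (by omega)
  · exact absurd (e3 ▸ hc : c < 0) (by omega)
  · change s₃.arr .pc u ≤ s₃.reg .ac
    rw [e4, hpc, e3]

end

end DistOracle

/-! ### The complete preprocessing of the compressed input -/

namespace DistOracle

/-- The preprocessing. -/
def preprocess : Stmt := compress ;; findRoot ;; findPow ;; initArrays ;; buildOracle

/-- The input is in its place: the half-edges start in the vertices `X g` and have the weights `W e`;
moreover `sq` is the rounded square root of the number of vertices. -/
structure Ready (m : ℕ) (X : ℕ → ℕ) (W : ℕ → ℝ≥0∞) (sq : ℕ) (s : State) : Prop where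
  reg_m : s.reg .a1 = m
  reg_sq : s.reg .sq = sq
  reg : ∀ x ∈ [Reg.blk, .acc, .ac], s.reg x = 0
  inp : ∀ g < 2 * m, s.arr .inp (2 * m + g) = X g
  arr : ∀ a ≠ Arr.inp, ∀ x, s.arr a x = 0
  winp : ∀ e < m, s.warr .inp (m + e) = W e

/-- The memory after the preprocessing. -/
structure Stored (P : Setup) (X : ℕ → ℕ) (sq : ℕ) (s : State) : Prop where
  oracle : Oracle P s
  par_sq : s.arr .par 0 = sq
  par_V : s.arr .par 1 = P.V
  par_pw : s.arr .par 2 = P.pw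
  trie : ∃ blk acc, blk ≤ 2 * P.m ∧ P.V = acc + 1 ∧
    Trie X sq (2 * P.m) (s.arr .root) (s.arr .leaf) P.src blk acc
  table : (2 * P.m + 2) * (sq + 2) ≤ P.M

/-- This form keeps the concrete final state of `p`. It is needed where the parameters of the later
stages are read off from that state. -/
theorem WP.seq {B M : ℕ} {p q : Stmt} {s : State} {Q : State → ℕ → Prop} (hp : p.Safe B M s)
    (hq : WP B M q (p.run s) fun s' t => Q s' (p.cost s + t)) : WP B M (p ;; q) s Q :=
  (wp_seq p q).2 ⟨hp, hq⟩

theorem le_of_pred_pow_lt {q V k : ℕ} (hk : k ≠ 0) (h : (q - 1) ^ k < V) : q ≤ V := by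
  have := Nat.le_self_pow hk (q - 1)
  omega

/-- Crude polynomial bounds, used only to see that all addresses and values fit into a word. -/
theorem mem_bound {n m q lam pw V sq : ℕ} (hn : 2 ≤ n) (hm : m ≤ n ^ 2) (hV : V ≤ n + 1)
    (hq : q ≤ n + 1) (hpw : pw ≤ 128 * (m * (q + 1) ^ 2)) (hlam : lam < pw) (hsq : sq ≤ n) :
    pw ≤ 2 ^ 9 * n ^ 4 ∧ pw * pw ≤ 2 ^ 18 * n ^ 8 ∧
      4 * pw + (q ^ 2 * lam ^ 2 + 1) * V + (2 * m + 2) * (sq + 2) ≤ 2 ^ 23 * n ^ 11 := by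
  have h1 : pw ≤ 2 ^ 9 * n ^ 4 := by
    calc pw ≤ 128 * (m * (q + 1) ^ 2) := hpw
      _ ≤ 128 * (n ^ 2 * (2 * n) ^ 2) := by gcongr; omega
      _ = _ := by ring
  have h2 : pw * pw ≤ 2 ^ 18 * n ^ 8 := (Nat.mul_le_mul h1 h1).trans_eq (by ring)
  refine ⟨h1, h2, ?_⟩
  have hp : ∀ k, 1 ≤ n ^ k := fun k => Nat.one_le_pow _ _ (by omega)
  have h3 : (q ^ 2 * lam ^ 2 + 1) * V ≤ 2 ^ 22 * n ^ 11 := by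
    calc (q ^ 2 * lam ^ 2 + 1) * V ≤ ((2 * n) ^ 2 * (2 ^ 9 * n ^ 4) ^ 2 + 2 ^ 20 * n ^ 10) * (2 * n) := by
          gcongr
          · omega
          · omega
          · have := hp 10; omega
          · omega
      _ = _ := by ring
  have h4 : (2 * m + 2) * (sq + 2) ≤ 8 * n ^ 3 := by
    calc (2 * m + 2) * (sq + 2) ≤ (4 * n ^ 2) * (2 * n) := by
          refine Nat.mul_le_mul ?_ (by omega)
          have := hp 2; omega
      _ = _ := by ring
  have h5 : n ^ 4 ≤ n ^ 11 := Nat.pow_le_pow_right (by omega) (by norm_num)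
  have h6 : n ^ 3 ≤ n ^ 11 := Nat.pow_le_pow_right (by omega) (by norm_num)
  omega

/-- The network and its parameters are computed by the first three stages, so `P` can be defined
only from the states that these produce. Effects and costs do not depend on `B` and `M`, whereas
safety does. -/
theorem wp_preprocess {n m B sq : ℕ} {X : ℕ → ℕ} {W : ℕ → ℝ≥0∞} {s : State}
    (hs : Ready m X W sq s) (hn : 2 ≤ n) (hm1 : 1 ≤ m) (hmn : m ≤ n ^ 2) (hX : ∀ g < 2 * m, X g < n)
    (hW : ∀ e < m, W e < ⊤) (hsq : n ≤ sq * sq) (hsqn : (sq - 1) ^ 2 < n)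
    (hB : 2 ^ 40 * n ^ 12 ≤ B) :
    ∃ P : Setup, P.m = m ∧ P.B = B ∧ (∀ e < m, P.ew e = W e) ∧ numArr * P.M < B ∧
      P.pw ≤ 2 ^ 9 * n ^ 4 ∧ (P.q - 1) ^ 3 ≤ n ∧
      numArr * P.M ≤ 200000 * ((m * (P.q + 1) ^ 2 + m * sq) * P.lam ^ 3) ∧
      WP B P.M preprocess s fun s' τ =>
        τ ≤ 20000 * (m * (P.q + 1) ^ 2 * P.lam ^ 3) ∧ Stored P X sq s' := by
  have hsq1 : 0 < sq := Nat.pos_of_ne_zero (by rintro rfl; omega)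
  have hsqn' := le_of_pred_pow_lt (by norm_num) hsqn
  -- The first stages are analysed for arbitrary bounds: once with makeshift ones to obtain their
  -- results, and once more with the final bounds for their safety.
  have hcomp : ∀ M B, (2 * m + 2) * (sq + 2) ≤ M → M < B → WP B M compress s _ := fun M B hM hB =>
    wp_compress hs.reg_m hs.reg_sq (hs.reg _ (by decide)) (hs.reg _ (by decide)) hs.inp hX
      (hs.arr _ (by decide)) (hs.arr _ (by decide)) hsq hsq1 hM hB
  obtain ⟨s₁, hs₁⟩ : ∃ s₁, compress.run s = s₁ := ⟨_, rfl⟩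
  obtain ⟨c1, bk, t1⟩ := (hcomp _ _ le_rfl (Nat.lt_succ_self _)).post
  have f1 := compress.frame s
  rw [hs₁] at bk t1 f1
  obtain ⟨V, hV⟩ : ∃ V, s₁.reg .acc + 1 = V := ⟨_, rfl⟩
  have hroot : ∀ B M, 16 * V < B → WP B M findRoot s₁ _ := fun B M hB => wp_findRoot hV hB
  obtain ⟨s₂, hs₂⟩ : ∃ s₂, findRoot.run s₁ = s₂ := ⟨_, rfl⟩
  obtain ⟨c2, r1, r2, r3, r4, r5⟩ := (hroot _ 0 (Nat.lt_succ_self _)).post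
  have f2 := findRoot.frame s₁
  rw [hs₂] at r1 r2 r3 r4 r5 f2
  obtain ⟨q, hq⟩ : ∃ q, s₂.reg .q = q := ⟨_, rfl⟩
  obtain ⟨z, hz⟩ : ∃ z, 64 * (m * (q + 1) ^ 2) = z := ⟨_, rfl⟩
  rw [hq] at r2 r3 r4 r5
  have m2 : s₂.reg .a1 = m := (f2.reg _ rfl).trans ((f1.reg _ rfl).trans hs.reg_m)
  have hpow : ∀ B M, 4 * z < B → WP B M findPow s₂ _ := fun B M hB => wp_findPow m2 hq hm1 hz hB
  obtain ⟨s₃, hs₃⟩ : ∃ s₃, findPow.run s₂ = s₃ := ⟨_, rfl⟩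
  obtain ⟨c3, p1, p2, p3⟩ := (hpow _ 0 (Nat.lt_succ_self _)).post
  have f3 := findPow.frame s₂
  rw [hs₃] at p1 p2 p3 f3
  obtain ⟨lam, hlam⟩ : ∃ lam, s₃.reg .lam = lam := ⟨_, rfl⟩
  obtain ⟨pw, hpw⟩ : ∃ pw, s₃.reg .pw = pw := ⟨_, rfl⟩
  rw [hlam, hpw] at p1
  rw [hpw] at p2 p3
  have hVn : V ≤ n + 1 := by have := t1.acc_le_of_lt hX; omega
  have hVm : V ≤ 2 * m + 1 := by have := t1.acc_le; omega
  have hqV := le_of_pred_pow_lt (by norm_num) r4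
  have hlp : lam < pw := p1 ▸ Nat.lt_two_pow_self
  obtain ⟨b1, b2, b3⟩ := mem_bound hn hmn hVn (hqV.trans hVn) (pw := pw) (by omega) hlp hsqn'
  -- The three demands for space: queue and dictionary, distances from the centers, and the tree of
  -- the vertex numbers.
  obtain ⟨M, hM⟩ : ∃ M, 4 * pw + (q ^ 2 * lam ^ 2 + 1) * V + (2 * m + 2) * (sq + 2) = M := ⟨_, rfl⟩
  rw [hM] at b3
  have b4 : n ^ 11 ≤ n ^ 12 := Nat.pow_le_pow_right (by omega) (by norm_num)
  have b5 : n ^ 8 ≤ n ^ 12 := Nat.pow_le_pow_right (by omega) (by norm_num)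
  have b6 : 1 ≤ n ^ 11 := Nat.one_le_pow _ _ (by omega)
  let P : Setup :=
    { V := V, m := m, q := q, lam := lam, pw := pw, B := B, M := M, src := s₁.arr (.key .adj), ew := W
      m_pos := hm1
      V_pos := by omega
      q_pos := r2
      src_lt := fun h hh => by
        have := t1.leaf_le (s₁.arr .root (X h / sq) * sq + X h % sq)
        rw [(t1.key h hh).1, ident]; omega
      ew_lt := hW
      pw_eq := p1
      le_pw := by omega
      V_le := hVm
      V_le_q := r3
      pw_le_M := by omega
      table_le_M := by omega
      M_lt_B := by omega
      pw_sq_lt_B := by omega }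
  have hlam6 := P.lam_pos
  obtain ⟨N, hN⟩ : ∃ N, m * (q + 1) ^ 2 = N := ⟨_, rfl⟩
  have l0 : 6 ≤ lam := hlam6
  have hmN : m ≤ N := hN ▸ Nat.le_mul_of_pos_right _ (by positivity)
  have l1 : lam * 1 ≤ lam ^ 3 := by
    rw [pow_succ']; exact Nat.mul_le_mul_left _ (Nat.one_le_pow _ _ (by omega))
  have l2 : N * lam ≤ N * lam ^ 3 := Nat.mul_le_mul_left _ (by omega)
  have l3 : 6 * N ≤ N * lam := by rw [mul_comm 6]; exact Nat.mul_le_mul_left _ l0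
  refine ⟨P, rfl, rfl, fun _ _ => rfl, by change numArr * M < B; unfold numArr; omega, b1, by
    change (q - 1) ^ 3 ≤ n; omega, ?_, ?_⟩
  · change 200 * M ≤ 200000 * ((m * (q + 1) ^ 2 + m * sq) * lam ^ 3)
    have k1 : (q ^ 2 * lam ^ 2 + 1) * V ≤ 6 * (N * lam ^ 3) := by
      have : 1 ≤ (q + 1) ^ 2 * lam ^ 3 := Nat.mul_pos (by positivity) (by positivity)
      calc (q ^ 2 * lam ^ 2 + 1) * V ≤ ((q + 1) ^ 2 * lam ^ 3 + (q + 1) ^ 2 * lam ^ 3) * (3 * m) := by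
            gcongr <;> omega
        _ = 6 * (m * (q + 1) ^ 2 * lam ^ 3) := by ring
        _ = _ := by rw [hN]
    have k2 : (2 * m + 2) * (sq + 2) ≤ 12 * (m * sq) := by
      calc (2 * m + 2) * (sq + 2) ≤ (4 * m) * (3 * sq) := by gcongr <;> omega
        _ = _ := by ring
    have k3 : m * sq ≤ m * sq * lam ^ 3 := Nat.le_mul_of_pos_right _ (by positivity)
    rw [hN, add_mul]
    omega
  rw [preprocess]
  refine WP.seq (hcomp M B (by omega) (by omega)).safe ?_
  rw [hs₁]
  refine WP.seq (hroot B M (by omega)).safe ?_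
  rw [hs₂]
  refine WP.seq (hpow B M (by omega)).safe ?_
  rw [hs₃, wp_seq]
  have a3 : ∀ a ∈ dictArrs ++ [.deg .adj, .fill .adj, .pc], ∀ x, s₃.arr a x = 0 := fun a ha => by
    rw [f3.arr a (by revert a; decide), f2.arr a (by revert a; decide), f1.arr a (by revert a; decide)]
    exact hs.arr a (by revert a; decide)
  refine (wp_initArrays (P := P) (s := s₃) (sq := sq) ((f3.reg _ rfl).trans r1)
    ((f3.reg _ rfl).trans m2) ((f3.reg _ rfl).trans hq) ((f3.reg _ rfl).trans r5) hlam hpw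
    ((f3.reg _ rfl).trans ((f2.reg _ rfl).trans ((f1.reg _ rfl).trans hs.reg_sq)))
    ((f3.reg _ rfl).trans ((f2.reg _ rfl).trans ((f1.reg _ rfl).trans (hs.reg _ (by decide)))))
    (fun h hh => by rw [f3.arr _ rfl, f2.arr _ rfl])
    (fun e he => by rw [f3.warr _ rfl, f2.warr _ rfl, f1.warr _ rfl]; exact hs.winp e he)
    (a3 _ (by decide)) (a3 _ (by decide)) (a3 _ (by decide))).mono ?_
  rintro s₄ t₄ f4 ⟨d1, d2, d3, d4, d5, d6⟩
  refine (wp_buildOracle d2 d3 fun a ha => ?_).mono ?_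
  · rw [f4.arr a (by revert a; decide)]; exact a3 a (by revert a; decide)
  rintro s₅ t₅ f5 ⟨g1, g2, g3⟩
  refine ⟨?_, g3, (g2 0 (by decide)).trans d4, (g2 1 (by decide)).trans d5,
    (g2 2 (by decide)).trans d6, ⟨s₁.reg .blk, s₁.reg .acc, bk, hV.symm, ?_⟩,
    by change (2 * m + 2) * (sq + 2) ≤ M; omega⟩
  · change t₄ ≤ 60 * pw at d1
    change t₅ ≤ 1600 * (m * (q + 1) ^ 2 * lam ^ 3) + 60 * (lam * pw) at g1
    have k1 : lam * pw ≤ 128 * (N * lam) := by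
      calc lam * pw ≤ lam * (128 * N) := Nat.mul_le_mul_left _ (by omega)
        _ = _ := by ring
    change _ ≤ 20000 * (m * (q + 1) ^ 2 * lam ^ 3)
    rw [hN] at g1 ⊢
    omega
  · rw [f5.arr _ rfl, f4.arr _ rfl, f3.arr _ rfl, f2.arr _ rfl, f5.arr .leaf rfl, f4.arr .leaf rfl,
      f3.arr .leaf rfl, f2.arr .leaf rfl]
    exact t1

end DistOracle

/-! ### Queries for the original vertices -/

namespace DistOracle

/-- Finds the number `y` of the vertex `x`. -/
def lookup (x y : Reg) : Stmt :=
  .load .x .root (♯x / ♯.sq) ;; .load y .leaf (♯.x * ♯.sq + ♯x % ♯.sq)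

/-- The query. -/
def query : Stmt :=
  .load .sq .par 0 ;; lookup .a0 .iu ;; lookup .a1 .iv ;; queryNet ;;
  .when (.eq ♯.iu 0) (.wset .res .infty) ;; .when (.eq ♯.iv 0) (.wset .res .infty) ;;
  .when (.eq ♯.a0 ♯.a1) (.wset .res .zero)

section

variable {P : Setup} {s : State} {X : ℕ → ℕ} {sq : ℕ}

theorem Oracle.congr {s' : State} (h : Oracle P s) (e : s'.arr = s.arr) (e' : s'.warr = s.warr) :
    Oracle P s' := by
  obtain ⟨T, hd, hn⟩ := h.dict
  exact ⟨e ▸ e' ▸ h.1, e ▸ h.2, T, ⟨hd.1, e ▸ hd.2, e ▸ hd.3, e ▸ hd.4, e ▸ hd.5, fun t ht => by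
    rw [State.slotOf, e]; exact hd.6 t ht, by rw [e, e']; exact hd.7⟩, e ▸ e' ▸ hn⟩

theorem wp_lookup {x y : Reg} {u blk acc h : ℕ} {ky : ℕ → ℕ} (hsq : s.reg .sq = sq)
    (hx : s.reg x = u) (hxx : x ≠ .x) (hu : u < sq * sq)
    (ht : Trie X sq h (s.arr .root) (s.arr .leaf) ky blk acc)
    (hM : (blk + 2) * (sq + 2) ≤ P.M) :
    WP P.B P.M (lookup x y) s fun s' τ => τ = 2 ∧
      s'.reg y = ident (s.arr .root) (s.arr .leaf) sq u := by
  have hB := P.M_lt_B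
  have hsq0 : 0 < sq := Nat.pos_of_ne_zero (by rintro rfl; simp at hu)
  have h1 : u / sq < sq := Nat.div_lt_of_lt_mul hu
  have h2 : u % sq < sq := Nat.mod_lt _ hsq0
  have h3 : s.arr .root (u / sq) * sq ≤ blk * sq := Nat.mul_le_mul_right _ (ht.root_le _)
  have h4 : (blk + 2) * (sq + 2) = blk * sq + 2 * blk + 2 * sq + 4 := by ring
  obtain ⟨d, hd⟩ : ∃ d, u / sq = d := ⟨_, rfl⟩
  obtain ⟨r, hr⟩ : ∃ r, u % sq = r := ⟨_, rfl⟩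
  rw [hd] at h1 h3
  rw [hr] at h2
  simp only [lookup, wp_seq]
  simp [hx, hsq, hxx, hd, hr, ident]
  omega

/-- The number `0` means that the vertex has no edge. The search in the network runs in any case,
which is legal since `0 < V`, and its result is overwritten afterwards; the test for equal vertices
comes last. -/
theorem wp_query {n u v : ℕ} (hs : Stored P X sq s) (hn : n ≤ sq * sq) (hu : s.reg .a0 = u)
    (hv : s.reg .a1 = v) (hun : u < n) (hvn : v < n) {iu iv : ℕ}
    (hiu : ident (s.arr .root) (s.arr .leaf) sq u = iu)
    (hiv : ident (s.arr .root) (s.arr .leaf) sq v = iv) :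
    WP P.B P.M query s fun s' τ => τ ≤ 60 ∧ (u = v → s'.wreg .res = 0) ∧
      (u ≠ v → iu = 0 ∨ iv = 0 → s'.wreg .res = ⊤) ∧
      (u ≠ v → iu ≠ 0 → iv ≠ 0 → P.dist iu iv ≤ s'.wreg .res ∧ s'.wreg .res ≤ 2 * P.dist iu iv) := by
  have hB := P.M_lt_B
  have hM := P.pw_le_M
  have hsz := P.size_le (k := 1) (by omega)
  have hm := P.m_pos
  obtain ⟨blk, acc, b1, b2, t⟩ := hs.trie
  have hsq0 : 0 < sq := Nat.pos_of_ne_zero (by rintro rfl; omega)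
  have hM' : (blk + 2) * (sq + 2) ≤ P.M := (Nat.mul_le_mul_right _ (by omega)).trans hs.table
  have hlt : ∀ x, ident (s.arr .root) (s.arr .leaf) sq x < P.V := fun x => by
    have := t.leaf_le (s.arr .root (x / sq) * sq + x % sq)
    rw [ident]; omega
  simp only [query, wp_seq, wp_load]
  refine ⟨⟨by simp; omega, by simp; omega⟩, ?_⟩
  simp only [Exp.eval_zero, hs.par_sq]
  refine (wp_lookup (P := P) (s := s.setR .sq sq) (u := u) (by simp) (by simpa using hu) (by simp)
    (by omega) t hM').mono ?_
  rintro s₁ t₁ f₁ ⟨a1, a2⟩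
  have e1 : s₁.arr = s.arr := funext fun a => f₁.arr a rfl
  have e1' : s₁.warr = s.warr := funext fun a => f₁.warr a rfl
  refine (wp_lookup (P := P) (s := s₁) (u := v) (by rw [f₁.reg _ rfl]; simp)
    (by rw [f₁.reg _ rfl]; simpa using hv) (by simp) (by omega) (e1 ▸ t) hM').mono ?_
  rintro s₂ t₂ f₂ ⟨c1, c2⟩
  have e2 : s₂.arr = s.arr := (funext fun a => f₂.arr a rfl).trans e1
  have e2' : s₂.warr = s.warr := (funext fun a => f₂.warr a rfl).trans e1'
  rw [e1, hiv] at c2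
  have a3 : s₂.reg .iu = iu := (f₂.reg _ rfl).trans (a2.trans hiu)
  refine (wp_queryNet (hs.oracle.congr e2 e2') (by rw [e2, hs.par_V]) (by rw [e2, hs.par_pw]) a3 c2
    (hiu ▸ hlt u) (hiv ▸ hlt v)).mono ?_
  rintro s₃ t₃ f₃ ⟨d1, d2⟩
  have g1 : s₃.reg .iu = iu := (f₃.reg _ rfl).trans a3
  have g2 : s₃.reg .iv = iv := (f₃.reg _ rfl).trans c2
  have g3 : s₃.reg .a0 = u := (f₃.reg _ rfl).trans ((f₂.reg _ rfl).trans ((f₁.reg _ rfl).trans hu))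
  have g4 : s₃.reg .a1 = v := (f₃.reg _ rfl).trans ((f₂.reg _ rfl).trans ((f₁.reg _ rfl).trans hv))
  -- Non-zero numbers identify vertices, so different vertices give the network query different
  -- arguments.
  have hne : u ≠ v → iu ≠ 0 → iu ≠ iv := fun h1 h2 h3 =>
    h1 (t.ident_inj hsq0 (hiu.trans (h3.trans hiv.symm)) (by rwa [hiu]))
  by_cases h1 : iu = 0 <;> by_cases h2 : iv = 0 <;> by_cases h3 : u = v <;>
    simp [g1, g2, g3, g4, h1, h2, h3] <;> try omega
  exact ⟨by omega, by omega, d2 (hne h3 h1)⟩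

end

end DistOracle

namespace DistOracle

/-! ### The network of a graph -/

section

variable {n : ℕ} {G : WeightedGraph n} {L : List (Fin n × Fin n)}

theorem WeightedGraph.IsEdgeList.length_eq (h : G.IsEdgeList L) : L.length = G.numEdges := by
  have : G.graph.edgeSet = ((L.map fun e => s(e.1, e.2)).toFinset : Set (Sym2 (Fin n))) := by
    ext e; simpa using (h.2 e).symm
  rw [WeightedGraph.numEdges, this, Set.ncard_coe_finset, List.toFinset_card_of_nodup h.1,
    List.length_map]

theorem WeightedGraph.IsEdgeList.length_le (h : G.IsEdgeList L) : L.length ≤ n ^ 2 := by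
  have := (List.Nodup.of_map _ h.1).length_le_card
  simpa [sq] using this

theorem mem_inputConfig {g : ℕ} {e : Fin n × Fin n} (he : L[g / 2]? = some e) :
    (inputConfig G L).mem g = if g % 2 = 0 then (e.1 : ℕ) else e.2 := by
  simp only [inputConfig, he]

theorem mem_inputConfig_lt {g : ℕ} (hg : g < 2 * L.length) : (inputConfig G L).mem g < n := by
  rw [mem_inputConfig (List.getElem?_eq_getElem (by omega : g / 2 < L.length))]
  split <;> exact Fin.is_lt _

theorem exists_halfEdge_of_adj (h : G.IsEdgeList L) {u v : Fin n} (huv : G.graph.Adj u v) :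
    ∃ g < 2 * L.length, (inputConfig G L).mem g = u ∧ (inputConfig G L).mem (twin g) = v ∧
      (inputConfig G L).weightMem (g / 2) = G.weight s(u, v) := by
  obtain ⟨e, he, heq⟩ := List.mem_map.1 ((h.2 s(u, v)).2 huv)
  obtain ⟨i, hi, rfl⟩ := List.mem_iff_getElem.1 he
  have h1 := List.getElem?_eq_getElem hi
  have hw : (inputConfig G L).weightMem i = G.weight s(u, v) := by
    rw [← heq]; simp only [inputConfig, h1]
  have h2 : (2 * i) / 2 = i := by omega
  have h3 : (2 * i + 1) / 2 = i := by omega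
  have k1 : (inputConfig G L).mem (2 * i) = L[i].1 := by
    rw [mem_inputConfig (e := L[i]) (by rw [h2]; exact h1), if_pos (by omega)]
  have k2 : (inputConfig G L).mem (2 * i + 1) = L[i].2 := by
    rw [mem_inputConfig (e := L[i]) (by rw [h3]; exact h1), if_neg (by omega)]
  have t1 : twin (2 * i) = 2 * i + 1 := by unfold twin; omega
  have t2 : twin (2 * i + 1) = 2 * i := by unfold twin; omega
  rcases Sym2.eq_iff.1 heq with ⟨e1, e2⟩ | ⟨e1, e2⟩
  · exact ⟨2 * i, by omega, by rw [k1, e1], by rw [t1, k2, e2], by rw [h2, hw]⟩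
  · exact ⟨2 * i + 1, by omega, by rw [k2, e2], by rw [t2, k1, e1], by rw [h3, hw]⟩

theorem adj_of_halfEdge (h : G.IsEdgeList L) {g : ℕ} (hg : g < 2 * L.length) :
    ∃ u v : Fin n, (inputConfig G L).mem g = u ∧ (inputConfig G L).mem (twin g) = v ∧
      G.graph.Adj u v ∧ (inputConfig G L).weightMem (g / 2) = G.weight s(u, v) := by
  have hi : g / 2 < L.length := by omega
  have h1 := List.getElem?_eq_getElem hi
  have hw : (inputConfig G L).weightMem (g / 2) = G.weight s(L[g / 2].1, L[g / 2].2) := by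
    simp only [inputConfig, h1]
  have ha : G.graph.Adj L[g / 2].1 L[g / 2].2 :=
    (h.2 _).1 (List.mem_map.2 ⟨_, List.getElem_mem hi, rfl⟩)
  have k1 := mem_inputConfig (G := G) h1
  have k2 := mem_inputConfig (G := G) (g := twin g) (e := L[g / 2]) (by rw [twin_div]; exact h1)
  by_cases hp : g % 2 = 0
  · rw [if_pos hp] at k1
    rw [if_neg (by unfold twin; omega)] at k2
    exact ⟨_, _, k1, k2, ha, hw⟩
  · rw [if_neg hp] at k1
    rw [if_pos (by unfold twin; omega)] at k2
    exact ⟨_, _, k1, k2, ha.symm, by rw [hw, Sym2.eq_swap]⟩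

variable {P : Setup} {root leaf : ℕ → ℕ} {sq blk acc : ℕ}

/-- The vertices of the network `P` are the numbers of the vertices of the graph. -/
structure Represents (P : Setup) (G : WeightedGraph n) (L : List (Fin n × Fin n)) (f : ℕ → ℕ) :
    Prop where
  edges : G.IsEdgeList L
  m : P.m = L.length
  src : ∀ g < 2 * P.m, P.src g = f ((inputConfig G L).mem g)
  ne_zero : ∀ g < 2 * P.m, P.src g ≠ 0
  ew : ∀ e < P.m, P.ew e = (inputConfig G L).weightMem e
  inj : ∀ x y, f x = f y → f x ≠ 0 → x = y

variable {f : ℕ → ℕ}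

theorem Represents.path (hr : Represents P G L f) {u v : Fin n} (p : G.graph.Walk u v) :
    P.Path (f u) (f v) (G.walkLength p) := by
  induction p with
  | nil => simpa [WeightedGraph.walkLength] using Setup.Path.nil
  | @cons u w v h p ih =>
    obtain ⟨g, hg, h1, h2, h3⟩ := exists_halfEdge_of_adj hr.edges h
    rw [← hr.m] at hg
    have := (Setup.Path.edge (P := P) hg).trans (l' := G.walkLength p) (c := f v)
      (by rw [hr.src _ (twin_lt hg), h2]; exact ih)
    rw [hr.src _ hg, h1, hr.ew _ (by omega), h3] at this
    simpa [WeightedGraph.walkLength] using this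

/-- Sources of half-edges have non-zero numbers, on which `f` is injective; so consecutive
half-edges of the network meet in the same vertex of the graph. -/
theorem Represents.walk (hr : Represents P G L f) {u : Fin n} {x : ℕ} {l : ℝ≥0∞}
    (p : P.Path (f u) x l) : ∃ (v : Fin n) (q : G.graph.Walk u v), f v = x ∧ G.walkLength q = l := by
  induction p with
  | nil => exact ⟨u, .nil, rfl, by simp [WeightedGraph.walkLength]⟩
  | @cons y l g p hg hy ih =>
    obtain ⟨v, q, rfl, rfl⟩ := ih
    obtain ⟨a, b, h1, h2, h3, h4⟩ := adj_of_halfEdge hr.edges (hr.m ▸ hg)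
    have h5 := hr.src _ hg
    have h6 := hr.ne_zero _ hg
    rw [h5] at hy h6
    obtain rfl : a = v := Fin.ext (by rw [← h1]; exact hr.inj _ _ hy h6)
    refine ⟨b, q.concat h3, by rw [hr.src _ (twin_lt hg), h2], ?_⟩
    rw [hr.ew _ (by omega), h4]
    simp [WeightedGraph.walkLength, SimpleGraph.Walk.edges_concat]

/-- Walks correspond to each other in both directions. The condition on `v` identifies the end of a
lifted walk, as all isolated vertices share the number `0`. -/
theorem Represents.dist_eq (hr : Represents P G L f) {u v : Fin n} (hv : f v ≠ 0) :
    P.dist (f u) (f v) = G.dist u v := by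
  refine le_antisymm (le_iInf fun p => Setup.dist_le (hr.path p)) (le_iInf₂ fun l p => ?_)
  obtain ⟨w, q, h1, rfl⟩ := hr.walk p
  obtain rfl : w = v := Fin.ext (hr.inj _ _ h1 (h1 ▸ hv))
  exact iInf_le _ q

theorem Represents.ne_zero_of_walk (hr : Represents P G L f) {u v : Fin n} (huv : u ≠ v)
    (p : G.graph.Walk u v) : f u ≠ 0 := by
  cases p with
  | nil => exact absurd rfl huv
  | cons h p =>
    obtain ⟨g, hg, h1, -⟩ := exists_halfEdge_of_adj hr.edges h
    rw [← hr.m] at hg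
    rw [← h1, ← hr.src _ hg]
    exact hr.ne_zero _ hg

theorem Represents.dist_eq_top (hr : Represents P G L f) {u v : Fin n} (huv : u ≠ v)
    (h : f u = 0 ∨ f v = 0) : G.dist u v = ⊤ := by
  have : IsEmpty (G.graph.Walk u v) := ⟨fun p => h.elim (hr.ne_zero_of_walk huv p)
    (hr.ne_zero_of_walk huv.symm p.reverse)⟩
  exact iInf_of_empty _

theorem WeightedGraph.dist_self (u : Fin n) : G.dist u u = 0 :=
  le_antisymm ((iInf_le _ .nil).trans (by simp [walkLength])) bot_le

end

end DistOracle

namespace DistOracle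

/-! ### Moving the input into arrays -/

/-- Moves the words of the input. -/
def moveWords : Program :=
  .seq (.setWord Reg.i.code (.const 0)) (.loop (Cond.lt ♯.i (2 * ♯.a1)).compile
    (.seq (.loadWord Reg.x.code (.reg Reg.i.code))
      (.seq (.storeWord (.c numArr * (2 * ♯.a1 + ♯.i) : Exp).compile (.reg Reg.x.code))
        (.seq (.storeWord (.reg Reg.i.code) (.const 0))
          (.setWord Reg.i.code (♯.i + 1 : Exp).compile)))))

/-- Moves the weights of the input. -/
def moveWeights : Program :=
  .seq (.setWord Reg.i.code (.const 0)) (.loop (Cond.lt ♯.i ♯.a1).compile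
    (.seq (.loadWeight WReg.wa.code (.reg Reg.i.code))
      (.seq (.storeWeight (.c numArr * (♯.a1 + ♯.i) : Exp).compile (.reg WReg.wa.code))
        (.seq (.storeWeight (.reg Reg.i.code) .zero)
          (.setWord Reg.i.code (♯.i + 1 : Exp).compile)))))

/-- Computes the rounded square root of the number of vertices. -/
def findSqrt : Program :=
  .loop (Cond.lt (♯.sq * ♯.sq) ♯.a0).compile (.setWord Reg.sq.code (♯.sq + 1 : Exp).compile)

/-- The first `i` of the `k` cells of the input `f` have been moved. -/
structure Moved {α : Type*} [Zero α] (f : ℕ → α) (k i : ℕ) (mem : ℕ → α) : Prop where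
  low : ∀ j < k, mem j = if j < i then 0 else f j
  high : ∀ j < i, mem (numArr * (k + j)) = f j
  rest : ∀ a, k ≤ a → (∀ j < i, a ≠ numArr * (k + j)) → mem a = 0

theorem Moved.zero {α : Type*} [Zero α] {f : ℕ → α} {k : ℕ} (hf : ∀ a, k ≤ a → f a = 0) :
    Moved f k 0 f :=
  ⟨by simp, by simp, fun a ha _ => hf a ha⟩

/-- The destinations `numArr * (k + i)` lie outside the `k` cells of the input, so nothing unread is
overwritten. Erasing the source makes all other arrays zero. -/
theorem Moved.succ {α : Type*} [Zero α] {f mem : ℕ → α} {k i : ℕ} (h : Moved f k i mem)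
    (hi : i < k) : Moved f k (i + 1)
      (Function.update (Function.update mem (numArr * (k + i)) (mem i)) i 0) := by
  have hi' := h.low i hi
  rw [if_neg (lt_irrefl _)] at hi'
  refine ⟨fun j hj => ?_, fun j hj => ?_, fun a ha hn => ?_⟩
  · rw [Function.update_apply]; split
    · next e => rw [if_pos (by omega)]
    · rw [Function.update_of_ne (by unfold numArr; omega), h.low j hj]
      exact if_congr (by omega) rfl rfl
  · rw [Function.update_of_ne (by unfold numArr; omega), Function.update_apply]; split
    · next e => rw [hi']; congr 1; unfold numArr at e; omega
    · next e => exact h.high j (by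
        rcases Nat.lt_succ_iff_lt_or_eq.1 hj with h | rfl
        · exact h
        · exact absurd rfl e)
  · rw [Function.update_of_ne (by omega), Function.update_of_ne (hn i (by omega))]
    exact h.rest a ha fun j hj => hn j (by omega)

theorem Moved.high_of_eq {α : Type*} [Zero α] {f mem : ℕ → α} {k : ℕ} (h : Moved f k k mem) {j : ℕ}
    (hj : j < k) : mem (numArr * (k + j) + 0) = f j := h.high j hj

theorem Moved.eq_zero {α : Type*} [Zero α] {f mem : ℕ → α} {k : ℕ} (h : Moved f k k mem) {i c : ℕ}
    (hc : c < numArr) (hc0 : c ≠ 0) : mem (numArr * i + c) = 0 := by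
  by_cases hk : numArr * i + c < k
  · rw [h.low _ hk, if_pos hk]
  · exact h.rest _ (not_lt.1 hk) fun j _ => by unfold numArr at *; omega

theorem Exec.loop_inv {w : ℕ} {ω : ℕ → Fin (2 ^ w)} {b : Test} {p : Program} (N t : ℕ)
    (I : ℕ → Config → Prop)
    (hstep : ∀ i < N, ∀ σ, I i σ → b.Holds w σ ∧ ∃ σ', Exec w ω p σ t σ' ∧ I (i + 1) σ')
    (hend : ∀ σ, I N σ → ¬ b.Holds w σ) (σ : Config) (h0 : I 0 σ) :
    ∃ σ', Exec w ω (.loop b p) σ (N * (t + 1) + 1) σ' ∧ I N σ' := by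
  have : ∀ d ≤ N, ∀ σ, I (N - d) σ → ∃ σ', Exec w ω (.loop b p) σ (d * (t + 1) + 1) σ' ∧ I N σ' := by
    intro d
    induction d with
    | zero => exact fun _ σ h => ⟨σ, by simpa using Exec.loopDone (hend σ h), h⟩
    | succ d ih =>
      intro hd σ h
      obtain ⟨hb, σ₁, h1, h2⟩ := hstep _ (by omega) σ h
      rw [show N - (d + 1) + 1 = N - d by omega] at h2
      obtain ⟨σ₂, h3, h4⟩ := ih (by omega) σ₁ h2
      refine ⟨σ₂, ?_, h4⟩
      have := Exec.loopStep hb h1 h3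
      rwa [show t + (d * (t + 1) + 1) + 1 = (d + 1) * (t + 1) + 1 by ring] at this
  exact this N le_rfl σ (by simpa using h0)

/-- The state that a configuration represents. -/
def Config.state (σ : Config) : State where
  reg x := σ.reg x.code
  wreg x := σ.weightReg x.code
  arr a i := σ.mem (numArr * i + a.code)
  warr a i := σ.weightMem (numArr * i + a.code)

theorem Config.sim (σ : Config) : Sim σ.state σ :=
  ⟨fun _ => rfl, fun _ => rfl, fun _ _ => rfl, fun _ _ => rfl⟩

theorem Exp.eval_compile {w : ℕ} (σ : Config) {e : Exp} (h : e.Ok (2 ^ w) σ.state) :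
    e.compile.eval w σ = e.eval σ.state := σ.sim.eval le_rfl h

theorem Cond.holds_compile {w : ℕ} (σ : Config) {b : Cond} (h : b.Ok (2 ^ w) σ.state) :
    b.compile.Holds w σ ↔ b.Holds σ.state := σ.sim.holds le_rfl h

section

variable {w : ℕ} (ω : ℕ → Fin (2 ^ w)) {m : ℕ} {σ₀ : Config}

theorem exec_moveWords (hm : σ₀.reg Reg.a1.code = m) (hw : numArr * (4 * m + 1) < 2 ^ w)
    (h0 : ∀ a, 2 * m ≤ a → σ₀.mem a = 0) : ∃ σ, Exec w ω moveWords σ₀ (10 * m + 2) σ ∧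
      (∀ y, y ≠ Reg.i.code → y ≠ Reg.x.code → σ.reg y = σ₀.reg y) ∧ σ.weightMem = σ₀.weightMem ∧
      σ.weightMemTop = σ₀.weightMemTop ∧ σ.memTop ≤ max σ₀.memTop (numArr * (4 * m + 1)) ∧
      Moved σ₀.mem (2 * m) (2 * m) σ.mem := by
  have hw' : 200 * (4 * m + 1) < 2 ^ w := hw
  have hw0 : w ≠ 0 := by rintro rfl; omega
  have hx : Reg.x.code ≠ Reg.i.code := by decide
  have hax : Reg.a1.code ≠ Reg.x.code := by decide
  have hai : Reg.a1.code ≠ Reg.i.code := by decide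
  have key := Exec.loop_inv (ω := ω) (b := (Cond.lt ♯.i (2 * ♯.a1)).compile) (2 * m) 4 (fun i σ =>
      σ.reg Reg.i.code = i ∧ (∀ y, y ≠ Reg.i.code → y ≠ Reg.x.code → σ.reg y = σ₀.reg y) ∧
      σ.weightMem = σ₀.weightMem ∧ σ.weightMemTop = σ₀.weightMemTop ∧
      σ.memTop ≤ max σ₀.memTop (numArr * (4 * m + 1)) ∧ Moved σ₀.mem (2 * m) i σ.mem)
    (p := .seq (.loadWord Reg.x.code (.reg Reg.i.code))
      (.seq (.storeWord (.c numArr * (2 * ♯.a1 + ♯.i) : Exp).compile (.reg Reg.x.code))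
        (.seq (.storeWord (.reg Reg.i.code) (.const 0))
          (.setWord Reg.i.code (♯.i + 1 : Exp).compile)))) (by
      rintro i hi σ ⟨g1, g2, g3, g4, g5, g6⟩
      have hm' : σ.reg Reg.a1.code = m := (g2 _ hai hax).trans hm
      refine ⟨(Cond.holds_compile σ ?_).2 ?_, _, .seq (.loadWord _ _ _) (.seq (.storeWord _ _ _)
        (.seq (.storeWord _ _ _) (.setWord _ _ _))), ?_⟩
      · simp [Config.state, hm']; omega
      · simp [Config.state, hm', g1]; omega
      · rw [Exp.eval_compile _ (by simp [Config.state, hm', hx.symm, g1, hax, numArr]; omega),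
          Exp.eval_compile _ (by simp [Config.state, hx.symm, g1]; omega)]
        simp [Config.state, hm', hx.symm, g1, hax, WordExpr.eval]
        refine ⟨fun y h1 h2 => ?_, g3, g4, ?_, g6.succ hi⟩
        · rw [Function.update_of_ne h1, Function.update_of_ne h2, g2 y h1 h2]
        · unfold numArr at g5 ⊢; omega)
    (by
      rintro σ ⟨g1, g2, -⟩
      have hm' : σ.reg Reg.a1.code = m := (g2 _ hai hax).trans hm
      rw [Cond.holds_compile σ (by simp [Config.state, hm']; omega)]
      simp [Config.state, hm', g1])
  obtain ⟨σ, h1, h2, h3, h4, h5, h6, h7⟩ := key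
    { σ₀ with reg := Function.update σ₀.reg Reg.i.code 0 }
    ⟨by simp, fun y h _ => by simp [h], rfl, rfl, le_max_left _ _, .zero h0⟩
  refine ⟨σ, ?_, h3, h4, h5, h6, h7⟩
  have := Exec.seq (Exec.setWord (ω := ω) σ₀ Reg.i.code (.const 0)) (by
    simpa [WordExpr.eval] using h1)
  rwa [show 1 + (2 * m * (4 + 1) + 1) = 10 * m + 2 by ring] at this

theorem exec_moveWeights (hm : σ₀.reg Reg.a1.code = m) (hw : numArr * (4 * m + 1) < 2 ^ w)
    (h0 : ∀ a, m ≤ a → σ₀.weightMem a = 0) : ∃ σ, Exec w ω moveWeights σ₀ (5 * m + 2) σ ∧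
      (∀ y, y ≠ Reg.i.code → σ.reg y = σ₀.reg y) ∧ σ.mem = σ₀.mem ∧ σ.memTop = σ₀.memTop ∧
      σ.weightMemTop ≤ max σ₀.weightMemTop (numArr * (4 * m + 1)) ∧
      Moved σ₀.weightMem m m σ.weightMem := by
  have hw' : 200 * (4 * m + 1) < 2 ^ w := hw
  have hw0 : w ≠ 0 := by rintro rfl; omega
  have hai : Reg.a1.code ≠ Reg.i.code := by decide
  have key := Exec.loop_inv (ω := ω) (b := (Cond.lt ♯.i ♯.a1).compile) m 4 (fun i σ =>
      σ.reg Reg.i.code = i ∧ (∀ y, y ≠ Reg.i.code → σ.reg y = σ₀.reg y) ∧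
      σ.mem = σ₀.mem ∧ σ.memTop = σ₀.memTop ∧
      σ.weightMemTop ≤ max σ₀.weightMemTop (numArr * (4 * m + 1)) ∧
      Moved σ₀.weightMem m i σ.weightMem)
    (p := .seq (.loadWeight WReg.wa.code (.reg Reg.i.code))
      (.seq (.storeWeight (.c numArr * (♯.a1 + ♯.i) : Exp).compile (.reg WReg.wa.code))
        (.seq (.storeWeight (.reg Reg.i.code) .zero)
          (.setWord Reg.i.code (♯.i + 1 : Exp).compile)))) (by
      rintro i hi σ ⟨g1, g2, g3, g4, g5, g6⟩
      have hm' : σ.reg Reg.a1.code = m := (g2 _ hai).trans hm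
      refine ⟨(Cond.holds_compile σ ?_).2 ?_, _, .seq (.loadWeight _ _ _) (.seq (.storeWeight _ _ _)
        (.seq (.storeWeight _ _ _) (.setWord _ _ _))), ?_⟩
      · simp
      · simp [Config.state, hm', g1]; omega
      · rw [Exp.eval_compile _ (by simp [Config.state, hm', g1, numArr]; omega),
          Exp.eval_compile _ (by simp [Config.state, g1]; omega)]
        simp [Config.state, hm', g1, WordExpr.eval, WeightExpr.eval]
        refine ⟨fun y h1 => ?_, g3, g4, ?_, g6.succ hi⟩
        · rw [Function.update_of_ne h1, g2 y h1]
        · unfold numArr at g5 ⊢; omega)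
    (by
      rintro σ ⟨g1, g2, -⟩
      have hm' : σ.reg Reg.a1.code = m := (g2 _ hai).trans hm
      rw [Cond.holds_compile σ (by simp)]
      simp [Config.state, hm', g1])
  obtain ⟨σ, h1, h2, h3, h4, h5, h6, h7⟩ := key
    { σ₀ with reg := Function.update σ₀.reg Reg.i.code 0 }
    ⟨by simp, fun y h => by simp [h], rfl, rfl, le_max_left _ _, .zero h0⟩
  refine ⟨σ, ?_, h3, h4, h5, h6, h7⟩
  have := Exec.seq (Exec.setWord (ω := ω) σ₀ Reg.i.code (.const 0)) (by
    simpa [WordExpr.eval] using h1)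
  rwa [show 1 + (m * (4 + 1) + 1) = 5 * m + 2 by ring] at this

/-- This is a proper while loop, outside the structured language: a counting loop with the available
bound `n` would be too slow when there are few edges. -/
theorem exec_findSqrt {n : ℕ} (hn : σ₀.reg Reg.a0.code = n) (hn1 : 1 ≤ n)
    (hsq : σ₀.reg Reg.sq.code = 0) (hw : 4 * n < 2 ^ w) : ∃ r, n ≤ r * r ∧ (r - 1) ^ 2 < n ∧
      Exec w ω findSqrt σ₀ (2 * r + 1) { σ₀ with reg := Function.update σ₀.reg Reg.sq.code r } := by
  have h1 : Nat.sqrt (n - 1) * Nat.sqrt (n - 1) ≤ n - 1 := Nat.sqrt_le _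
  have h2 := Nat.lt_succ_sqrt (n - 1)
  have hne : Reg.a0.code ≠ Reg.sq.code := by decide
  have hw0 : w ≠ 0 := by rintro rfl; omega
  -- The least `r` with `n ≤ r * r`.
  refine ⟨Nat.sqrt (n - 1) + 1, by simp only [Nat.succ_eq_add_one] at h2; omega, by
    rw [Nat.add_sub_cancel, pow_two]; omega, ?_⟩
  have hle : ∀ i ≤ Nat.sqrt (n - 1) + 1, i * i ≤ 4 * n := fun i hi => by
    have := Nat.mul_le_mul hi hi
    have h3 : Nat.sqrt (n - 1) ≤ Nat.sqrt (n - 1) * Nat.sqrt (n - 1) := Nat.le_mul_self _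
    have h4 : (Nat.sqrt (n - 1) + 1) * (Nat.sqrt (n - 1) + 1) =
      Nat.sqrt (n - 1) * Nat.sqrt (n - 1) + 2 * Nat.sqrt (n - 1) + 1 := by ring
    omega
  obtain ⟨σ, e1, rfl⟩ := Exec.loop_inv (ω := ω) (b := (Cond.lt (♯.sq * ♯.sq) ♯.a0).compile)
    (p := .setWord Reg.sq.code (♯.sq + 1 : Exp).compile) (Nat.sqrt (n - 1) + 1) 1
    (fun i σ => σ = { σ₀ with reg := Function.update σ₀.reg Reg.sq.code i }) (by
      rintro i hi _ rfl
      have h3 := hle i hi.le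
      have h4 : i * i ≤ Nat.sqrt (n - 1) * Nat.sqrt (n - 1) :=
        Nat.mul_le_mul (Nat.lt_succ_iff.1 hi) (Nat.lt_succ_iff.1 hi)
      have h5 : i ≤ i * i := Nat.le_mul_self _
      refine ⟨(Cond.holds_compile _ (by simp [Config.state]; omega)).2
        (by simp [Config.state, hne, hn]; omega), _, .setWord _ _ _, ?_⟩
      rw [Exp.eval_compile _ (by simp [Config.state]; omega)]
      simp [Config.state]) (by
      rintro _ rfl
      have h3 := hle _ le_rfl
      rw [Cond.holds_compile _ (by simp [Config.state]; omega)]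
      simp [Config.state, hne, hn]
      simp only [Nat.succ_eq_add_one] at h2
      omega) σ₀ (by rw [← hsq, Function.update_eq_self])
  rwa [show (Nat.sqrt (n - 1) + 1) * (1 + 1) + 1 = 2 * (Nat.sqrt (n - 1) + 1) + 1 by ring] at e1

end

end DistOracle

/-! ### The programs, their resources and the theorem -/

namespace DistOracle

/-- The preprocessing program. -/
def preProgram : Program :=
  .seq (.seq moveWords (.seq moveWeights findSqrt)) preprocess.compile

/-- The query program. -/
def queryProgram : Program := query.compile

/-- With `a = n ^ (1/3)` one has `q + 1 ≤ 3 * a`, `r ≤ 2 * a ^ 2` and `lam ≤ 20 * log n`. The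
constant is `(9 + 2) * 20 ^ 3`. -/
theorem bound_of_parameters {n m q r lam : ℕ} (hn : 2 ≤ n) (hq : (q - 1) ^ 3 ≤ n)
    (hr : (r - 1) ^ 2 < n) (hlam : 2 ^ lam ≤ 2 ^ 9 * n ^ 4) :
    (((m * (q + 1) ^ 2 + m * r) * lam ^ 3 : ℕ) : ℝ) ≤
      88000 * (m * (n : ℝ) ^ ((2 : ℝ) / 3) * Real.log n ^ 3) := by
  have hn' : (2 : ℝ) ≤ n := by exact_mod_cast hn
  obtain ⟨a, ha⟩ : ∃ a : ℝ, (n : ℝ) ^ ((1 : ℝ) / 3) = a := ⟨_, rfl⟩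
  have ha1 : 1 ≤ a := ha ▸ Real.one_le_rpow (by linarith) (by norm_num)
  have ha3 : a ^ 3 = n := by
    rw [← ha, ← Real.rpow_natCast, ← Real.rpow_mul (by linarith)]; norm_num
  have ha2 : (n : ℝ) ^ ((2 : ℝ) / 3) = a ^ 2 := by
    rw [← ha, ← Real.rpow_natCast, ← Real.rpow_mul (by linarith)]; norm_num
  have hq' : (q : ℝ) + 1 ≤ 3 * a := by
    have h1 : (((q - 1 : ℕ) : ℝ)) ≤ a := by
      refine le_of_pow_le_pow_left₀ (n := 3) (by norm_num) (by linarith) ?_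
      rw [ha3]; exact_mod_cast hq
    have h2 : (q : ℝ) ≤ ((q - 1 : ℕ) : ℝ) + 1 := by exact_mod_cast (by omega : q ≤ q - 1 + 1)
    linarith
  have hr' : (r : ℝ) ≤ 2 * a ^ 2 := by
    have h1 : (((r - 1 : ℕ) : ℝ)) ≤ a ^ 2 := by
      refine le_of_pow_le_pow_left₀ (n := 2) (by norm_num) (by positivity) ?_
      have h3 : (((r - 1 : ℕ) : ℝ)) ^ 2 ≤ n := by exact_mod_cast hr.le
      calc _ ≤ (n : ℝ) := h3
        _ = a ^ 3 * 1 := by rw [ha3, mul_one]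
        _ ≤ a ^ 3 * a := by gcongr
        _ = _ := by ring
    have h2 : (r : ℝ) ≤ ((r - 1 : ℕ) : ℝ) + 1 := by exact_mod_cast (by omega : r ≤ r - 1 + 1)
    have h4 : 1 ≤ a ^ 2 := one_le_pow₀ ha1
    linarith
  have hl : (lam : ℝ) ≤ 20 * Real.log n := by
    -- Since `n ≥ 2`, the constant `2 ^ 9` is at most `n ^ 9`; then `13 / log 2 < 20`.
    have h1 : (2 : ℝ) ^ lam ≤ (n : ℝ) ^ 13 := by
      calc (2 : ℝ) ^ lam ≤ 2 ^ 9 * (n : ℝ) ^ 4 := by exact_mod_cast hlam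
        _ ≤ (n : ℝ) ^ 9 * (n : ℝ) ^ 4 := by gcongr
        _ = _ := by ring
    have h2 := Real.log_le_log (by positivity) h1
    rw [Real.log_pow, Real.log_pow] at h2
    have h3 := Real.log_two_gt_d9
    have h4 : (lam : ℝ) * 0.69 ≤ lam * Real.log 2 := by gcongr; linarith
    push_cast at h2
    have h5 : 0 ≤ Real.log n := Real.log_nonneg (by linarith)
    linarith
  push_cast
  rw [ha2]
  calc ((m : ℝ) * (q + 1) ^ 2 + m * r) * lam ^ 3
      ≤ (m * (3 * a) ^ 2 + m * (2 * a ^ 2)) * (20 * Real.log n) ^ 3 := by gcongr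
    _ = _ := by ring

section

variable {n w : ℕ} {G : WeightedGraph n} {L : List (Fin n × Fin n)}

theorem exec_prefix (ω : ℕ → Fin (2 ^ w)) (hm : 1 ≤ L.length)
    (hw : numArr * (4 * L.length + 1) < 2 ^ w) (hn1 : 1 ≤ n) (hnw : 4 * n < 2 ^ w) :
    ∃ r σ, n ≤ r * r ∧ (r - 1) ^ 2 < n ∧
      Exec w ω (.seq moveWords (.seq moveWeights findSqrt)) (inputConfig G L)
        (15 * L.length + 2 * r + 5) σ ∧
      Ready L.length (inputConfig G L).mem (inputConfig G L).weightMem r σ.state ∧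
      (inputConfig G L).Within (numArr * (4 * L.length + 1)) σ := by
  have hout : ∀ i, L.length ≤ i → L[i]? = none := fun i hi => List.getElem?_eq_none hi
  obtain ⟨σ₁, a1, a2, a3, a4, a5, a6⟩ := exec_moveWords ω (σ₀ := inputConfig G L) (m := L.length)
    rfl hw fun a ha => by simp only [inputConfig, hout (a / 2) (by omega)]
  obtain ⟨σ₂, b1, b2, b3, b4, b5, b6⟩ := exec_moveWeights ω (σ₀ := σ₁) (m := L.length)
    (by rw [a2 _ (by decide) (by decide)]; rfl) hw fun a ha => by
      rw [a3]; simp only [inputConfig, hout a ha]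
  have hreg : ∀ y, y ≠ Reg.i.code → y ≠ Reg.x.code → σ₂.reg y = (inputConfig G L).reg y :=
    fun y h1 h2 => (b2 y h1).trans (a2 y h1 h2)
  obtain ⟨r, c1, c2, c3⟩ := exec_findSqrt ω (σ₀ := σ₂) (n := n)
    (by rw [hreg _ (by decide) (by decide)]; rfl) hn1
    (by rw [hreg _ (by decide) (by decide)]; rfl) hnw
  refine ⟨r, { σ₂ with reg := Function.update σ₂.reg Reg.sq.code r }, c1, c2, ?_, ⟨?_, ?_, fun x hx => ?_, fun g hg => ?_, fun a ha x => ?_, fun e he => ?_⟩,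
    by rw [← b4] at a5; exact a5, by rw [a4] at b5; exact b5⟩
  · have := a1.seq (b1.seq c3)
    rwa [show 10 * L.length + 2 + (5 * L.length + 2 + (2 * r + 1)) = 15 * L.length + 2 * r + 5 by
      ring] at this
  · change Function.update σ₂.reg Reg.sq.code r Reg.a1.code = _
    rw [Function.update_of_ne (by decide), hreg _ (by decide) (by decide)]; rfl
  · change Function.update σ₂.reg Reg.sq.code r Reg.sq.code = r
    exact Function.update_self ..
  · change Function.update σ₂.reg Reg.sq.code r x.code = 0
    rw [Function.update_of_ne (by revert x; decide), hreg _ (by revert x; decide)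
      (by revert x; decide)]
    have h1 : x.code ≠ 0 ∧ x.code ≠ 1 := by revert x; decide
    simp only [inputConfig, if_neg h1.1, if_neg h1.2]
  · change σ₂.mem _ = _
    rw [b3]; exact a6.high_of_eq hg
  · change σ₂.mem _ = _
    rw [b3]
    exact a6.eq_zero a.code_lt fun h => ha (Arr.code_injective (h.trans rfl))
  · change σ₂.weightMem _ = _
    rw [← a3]; exact b6.high_of_eq he

theorem Stored.congr {P : Setup} {X : ℕ → ℕ} {sq : ℕ} {s s' : State} (h : Stored P X sq s)
    (e : s'.arr = s.arr) (e' : s'.warr = s.warr) : Stored P X sq s' :=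
  ⟨h.oracle.congr e e', e ▸ h.2, e ▸ h.3, e ▸ h.4, e ▸ h.5, h.6⟩

/-- Only the memory of `σ` enters, through `Stored`; the registers left by the preprocessing play no
role. -/
theorem exec_query {P : Setup} {r : ℕ} {σ : Config} (ω : ℕ → Fin (2 ^ w)) (hB : P.B = 2 ^ w)
    (hM : numArr * P.M < 2 ^ w) (hL : G.IsEdgeList L) (hm : P.m = L.length)
    (hew : ∀ e < P.m, P.ew e = (inputConfig G L).weightMem e) (hn : n ≤ r * r)
    (hs : Stored P (inputConfig G L).mem r σ.state) (u v : Fin n) :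
    ∃ t σ', Exec w ω queryProgram (queryConfig σ u v) t σ' ∧ t ≤ 60 ∧
      (queryConfig σ u v).Within (numArr * P.M) σ' ∧
      G.dist u v ≤ σ'.weightReg 0 ∧ σ'.weightReg 0 ≤ 2 * G.dist u v := by
  obtain ⟨blk, acc, -, -, ht⟩ := hs.trie
  have hr0 : 0 < r := Nat.pos_of_ne_zero (by rintro rfl; have := u.2; omega)
  have hR : Represents P G L (ident (σ.state.arr .root) (σ.state.arr .leaf) r) :=
    ⟨hL, hm, fun g hg => (ht.key g hg).1, fun g hg => (ht.key g hg).2, hew,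
      fun x y h h' => ht.ident_inj hr0 h h'⟩
  obtain ⟨h1, h2, h3, h4, h5⟩ := wp_query (s := (queryConfig σ u v).state) (hs.congr rfl rfl) hn
    (u := u) (v := v) rfl rfl u.2 v.2 rfl rfl
  obtain ⟨σ', g1, g2, g3⟩ := Stmt.sim ω (hB.le) hM query (by decide) _ _ (queryConfig σ u v).sim h1
  refine ⟨_, σ', g1, h2, g3, ?_⟩
  have hres : σ'.weightReg 0 = (query.run (queryConfig σ u v).state).wreg .res := g2.wreg .res
  rw [hres]
  by_cases huv : u = v
  · subst huv
    rw [h3 rfl, WeightedGraph.dist_self]; simp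
  have huv' : (u : ℕ) ≠ v := fun h => huv (Fin.ext h)
  by_cases h0 : ident (σ.state.arr .root) (σ.state.arr .leaf) r u = 0 ∨
      ident (σ.state.arr .root) (σ.state.arr .leaf) r v = 0
  · rw [h4 huv' h0, hR.dist_eq_top huv h0]; simp
  · rw [not_or] at h0
    rw [← hR.dist_eq h0.2]
    exact h5 huv' h0.1 h0.2

/-- One natural number bounds time and space for every sequence of random words. It is the integer
part of the bound, whose constant is `500000 * 88000`. -/
theorem preprocessing_spec (hL : G.IsEdgeList L) (hm : 1 ≤ G.numEdges) (hw : n ^ 52 ≤ 2 ^ w) :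
    ∃ N : ℕ, (N : ℝ) ≤ 44000000000 * (G.numEdges * (n : ℝ) ^ ((2 : ℝ) / 3) * Real.log n ^ 3) ∧
      ∀ ω : ℕ → Fin (2 ^ w), ∃ t σ, Exec w ω preProgram (inputConfig G L) t σ ∧ t ≤ N ∧
        AnswersQueries w queryProgram 60 G σ ∧ SpaceAtMost n w queryProgram σ N := by
  rw [← hL.length_eq] at hm ⊢
  -- An edge has two different ends. This makes `log n` positive, so that additive constants can be
  -- absorbed.
  have hn : 2 ≤ n := by
    obtain ⟨e, he⟩ := List.exists_mem_of_length_pos hm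
    have hadj : G.graph.Adj e.1 e.2 := (hL.2 _).1 (List.mem_map_of_mem he)
    have h1 : (e.1 : ℕ) ≠ e.2 := fun h => hadj.ne (Fin.ext h)
    have h2 := e.1.2
    have h3 := e.2.2
    omega
  -- Here the exponent `52 = 40 + 12` originates: with `n ≥ 2` the constant is absorbed by `n ^ 40`.
  have hB : 2 ^ 40 * n ^ 12 ≤ 2 ^ w := by
    calc 2 ^ 40 * n ^ 12 ≤ n ^ 40 * n ^ 12 := by gcongr
      _ = n ^ 52 := by ring
      _ ≤ _ := hw
  have b1 : n ^ 2 ≤ n ^ 12 := Nat.pow_le_pow_right (by omega) (by norm_num)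
  have b2 : n ≤ n ^ 12 := Nat.le_self_pow (by norm_num) n
  have hmn := hL.length_le
  have hw4 : numArr * (4 * L.length + 1) < 2 ^ w := by unfold numArr; omega
  have hnw : 4 * n < 2 ^ w := by omega
  refine ⟨⌊44000000000 * (L.length * (n : ℝ) ^ ((2 : ℝ) / 3) * Real.log n ^ 3)⌋₊,
    Nat.floor_le (by have := Real.log_natCast_nonneg n; positivity), fun ω => ?_⟩
  obtain ⟨r, σ₁, hr, hr', e₁, hready, hin₁⟩ := exec_prefix (G := G) ω hm hw4 (by omega) hnw
  obtain ⟨P, p1, p2, p3, p4, p5, p6, p7, hwp⟩ := wp_preprocess hready hn hm hmn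
    (fun g hg => mem_inputConfig_lt hg)
    (fun e he => by simp [inputConfig, List.getElem?_eq_getElem he]) hr hr' hB
  obtain ⟨h1, h2, h3⟩ := hwp
  obtain ⟨σ₂, e₂, hsim, hin₂⟩ := Stmt.sim ω le_rfl p4 preprocess (by decide) _ _ σ₁.sim h1
  have hst : Stored P (inputConfig G L).mem r σ₂.state :=
    h3.congr (funext fun a => funext fun i => hsim.mem a i)
      (funext fun a => funext fun i => hsim.wmem a i)
  obtain ⟨S, hS⟩ : ∃ S, (L.length * (P.q + 1) ^ 2 + L.length * r) * P.lam ^ 3 = S := ⟨_, rfl⟩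
  have hbound : 500000 * S ≤
      ⌊44000000000 * (L.length * (n : ℝ) ^ ((2 : ℝ) / 3) * Real.log n ^ 3)⌋₊ := by
    refine Nat.le_floor ?_
    have := bound_of_parameters (m := L.length) hn p6 hr' (P.pw_eq ▸ p5)
    rw [hS] at this
    push_cast
    linarith
  have hr0 : 0 < r := Nat.pos_of_ne_zero (by rintro rfl; omega)
  have htab : 4 * L.length + 1 ≤ P.M := by
    have := hst.table
    rw [p1] at this
    nlinarith
  have hl : 0 < P.lam := by have := P.lam_pos; omega
  have hpre : 15 * L.length + 2 * r + 5 + 20000 * (L.length * (P.q + 1) ^ 2 * P.lam ^ 3) ≤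
      500000 * S := by
    have h4 : 1 ≤ (P.q + 1) ^ 2 := Nat.one_le_pow _ _ (by omega)
    have h5 : 1 ≤ P.lam ^ 3 := Nat.one_le_pow _ _ hl
    have h6 := Nat.le_mul_of_pos_right L.length h4
    have h7 := Nat.le_mul_of_pos_left r hm
    have h8 : L.length * (P.q + 1) ^ 2 + L.length * r ≤ S :=
      hS ▸ Nat.le_mul_of_pos_right _ h5
    have h9 : L.length * (P.q + 1) ^ 2 * P.lam ^ 3 ≤ S :=
      hS ▸ Nat.mul_le_mul_right _ (Nat.le_add_right _ _)
    omega
  rw [hS] at p7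
  obtain ⟨i1, i2⟩ := hin₁
  obtain ⟨j1, j2⟩ := hin₂
  change _ ≤ max (2 * L.length) _ at i1
  change _ ≤ max L.length _ at i2
  have htab' : numArr * (4 * L.length + 1) ≤ numArr * P.M := Nat.mul_le_mul_left _ htab
  have hnum : 4 * L.length ≤ numArr * (4 * L.length + 1) := by unfold numArr; omega
  have top₁ : σ₂.memTop ≤ numArr * P.M := by omega
  have top₂ : σ₂.weightMemTop ≤ numArr * P.M := by omega
  have hq := fun u v ω' => exec_query (σ := σ₂) (u := u) (v := v) ω' p2 p4 hL p1
    (fun e he => p3 e (p1 ▸ he)) hr hst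
  refine ⟨_, σ₂, e₁.seq e₂, ?_, fun u v ω' => ?_, ?_, fun u v ω' t σ₃ he => ?_⟩
  · exact ((Nat.add_le_add_left h2 _).trans hpre).trans hbound
  · obtain ⟨t, σ₃, g1, g2, -, g3⟩ := hq u v ω'
    have hmem := g1.mem_eq (by decide)
    exact ⟨t, σ₃, g1, g2, hmem.1, hmem.2, g3⟩
  · rw [Nat.cast_le]
    unfold Config.space
    omega
  · obtain ⟨t', σ₄, g1, -, ⟨k1, k2⟩, -⟩ := hq u v ω'
    -- The space bound is about every execution of the query; by determinism it is the one already
    -- known.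
    obtain rfl := (he.det g1).2
    change _ ≤ max σ₂.memTop _ at k1
    change _ ≤ max σ₂.weightMemTop _ at k2
    rw [Nat.cast_le]
    unfold Config.space
    omega

end

end DistOracle

theorem mainTheorem3 :
    ∃ (pre query : DistOracle.Program) (κ T k : ℕ), ∀ c : ℕ, ∃ K : ℝ,
      ∀ (n : ℕ) (G : DistOracle.WeightedGraph n) (L : List (Fin n × Fin n)),
        G.IsEdgeList L → 1 ≤ G.numEdges → ∀ w : ℕ, n ^ κ ≤ 2 ^ w →
          (∀ (ω : ℕ → Fin (2 ^ w)) (t : ℕ) (s : DistOracle.Config),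
            DistOracle.Exec w ω pre (DistOracle.inputConfig G L) t s →
              DistOracle.AnswersQueries w query T G s) ∧
          DistOracle.tapeMeasure w
            {ω | ¬ ∃ (t : ℕ) (s : DistOracle.Config),
              DistOracle.Exec w ω pre (DistOracle.inputConfig G L) t s ∧
              (t : ℝ) ≤ K * (G.numEdges * (n : ℝ) ^ ((2 : ℝ) / 3) * Real.log n ^ k) ∧
              DistOracle.SpaceAtMost n w query s
                (K * (G.numEdges * (n : ℝ) ^ ((2 : ℝ) / 3) * Real.log n ^ k))} ≤
            ((n : ℝ≥0∞) ^ c)⁻¹ := by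
  refine ⟨DistOracle.preProgram, DistOracle.queryProgram, 52, 60, 3, fun c => ⟨44000000000,
    fun n G L hL hm w hw => ?_⟩⟩
  obtain ⟨N, hN, h⟩ := DistOracle.preprocessing_spec hL hm hw
  refine ⟨fun ω t s hs => ?_, ?_⟩
  · obtain ⟨t', s', h1, -, h2, -⟩ := h ω
    rwa [(hs.det h1).2]
  -- No random word is ever drawn, so the event of failure is empty and one constant serves for all
  -- `c`.
  · rw [Set.eq_empty_of_forall_notMem (s := {ω | _}), measure_empty]
    · exact bot_le
    · intro ω hω
      obtain ⟨t, s, h1, h2, h3, h4, h5⟩ := h ω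
      exact hω ⟨t, s, h1, (Nat.cast_le.2 h2).trans hN, h4.trans hN, fun u v ω' t' s' he =>
        (h5 u v ω' t' s' he).trans hN⟩
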